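/- **Minimal spectral quantum Fisher information for lossy optical phase waveform estimation.** Let $a(t),b(t)$ be annihilation operators of two one-dimensional bosonic fields on a window $[t_0,t_f]$, $[a(t),a^\dagger(t')]=[b(t),b^\dagger(t')]=\delta(t-t')$, and $I(t)=a^\dagger(t)a(t)$. Only the field $A$ (operators $a$) can be measured. The input is $|\Psi\rangle=|\psi\rangle_A\otimes|0\rangle_B$, and $$U_{AB}=\exp\Big[i\kappa\int dt\,(a^\dagger(t)b(t)+a(t)b^\dagger(t))\Big],\quad U_A=\exp\Big[i\int dt\,\phi(t)I(t)\Big],\quad U_B=\exp\Big[i\int dt\,\theta(t)b^\dagger(t)b(t)\Big],$$ with quantum efficiency $\eta=\cos^2\kappa>0$ and $\theta(t)=\int_{t_0}^{t_f}d\tau\,\lambda(t-\tau)\phi(\tau)$ for a real integrable kernel $\lambda$. Let $F(\phi,\phi')=|\langle\Psi_\phi|\Psi_{\phi'}\rangle|^2$ be the fidelity of the purifications $\Psi_\phi=U_B^\dagger U_AU_{AB}\Psi$, and define the quantum Fisher information kernel $J_\phi^{(Q)}(t,t')$ by $$\iint J^{(Q)}_\phi(t,t')h(t)k(t')\,dt\,dt'=-2\,\partial_\epsilon\partial_\delta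 F(\phi,\phi+\epsilon h+\delta k)\big|_{\epsilon=\delta=0}$$ for bounded measurable compactly supported $h,k$. Let the source be stationary: for every window $\psi$ is a pure state with finite second moment of the photon number, $\langle I(t)\rangle=\langle I\rangle>0$ is constant, and (as distributions) $\langle\Delta I(t)\Delta I(t')\rangle=\int\frac{d\omega}{2\pi}S_{\Delta I}(\omega)e^{i\omega(t-t')}$ with the same measurable $S_{\Delta I}\ge0$ for all windows. Write $f(\omega)=\int f(t)e^{i\omega t}dt$ and $1/0=\infty$. Then: 1. For every real $\lambda\in L^1(\mathbb R)$ the quantum Fisher information exists on every window ($F(\phi,\phi+\epsilon h+\delta k)$ is $C^2$ in $(\epsilon,\delta)$), does not depend on the locally integrable waveform $\phi$, and as $(t_0,t_f)\to(-\infty,\infty)$ its kernel tends, in the sense of pairing with $h,k$, to $\int\frac{d\omega}{2\pi}J_\phi^{(Q)}(\omega)e^{i\omega(t-t')}$, where $$J_\phi^{(Q)}(\omega)=4\big[|\eta-(1-\eta)\lambda(\omega)|^2S_{\Delta I}(\omega)+|1+\lambda(\omega)|^2\eta(1-\eta)\langle I\rangle\big].$$ 2. For every $\omega$ the minimum of $J_\phi^{(Q)}(\omega)$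 over the real $\lambda\in L^1(\mathbb R)$ is attained and equals $$\min_\lambda J_\phi^{(Q)}(\omega)=4\Big[\frac1{S_{\Delta I}(\omega)}+\frac{1-\eta}{\eta\langle I\rangle}\Big]^{-1}.$$ 3. If $\eta<1$, then $\min_\lambda J_\phi^{(Q)}(\omega)\le 4\eta\langle I\rangle/(1-\eta)$ for every $\omega$. 4. (Spectral quantum Cramér–Rao bound.) Let $\phi(t)=\int dt'\,g(t-t')x(t')$ with $g\in L^1(\mathbb R)$ real and $x$ a jointly measurable real random waveform on $\mathbb R$ with uniformly bounded second moments. Suppose that its prior Fisher information has the spectral form $J_x^{(C)}(\omega)\ge0$: for smooth compactly supported $h$ the law of $x$ has a square-integrable logarithmic derivative $\beta_h$ along $h$, in the sense of integration by parts against smooth compactly supported functions of finitely many samples of $x$, and $\mathbb E[\beta_h\beta_k]=\int\frac{d\omega}{2\pi}J_x^{(C)}(\omega)h(\omega)\overline{k(\omega)}$. Then in the limit $(t_0,t_f)\to(-\infty,\infty)$, for every $t$, $$\mathbb E[\tilde x(t)-x(t)]^2\ge\int_{-\infty}^\infty\frac{d\omega}{2\pi}\frac1{|g(\omega)|^2\min_\lambda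 J_\phi^{(Q)}(\omega)+J_x^{(C)}(\omega)},$$ uniformly in the measurement: for every $c$ less than the right-hand side, on all windows with $-t_0$ and $t_f$ sufficiently large, every estimate $\tilde x(t)$ computed from the outcome of any POVM $E_A\otimes1_B$ on the output $U_AU_{AB}|\Psi\rangle$ has mean-square error at least $c$. -/

import Mathlib

open MeasureTheory Filter Set Topology
open scoped ENNReal NNReal ComplexConjugate InnerProductSpace

noncomputable section

namespace LossyWaveform

/-! ### Photon configurations and the one-dimensional optical field

The bosonic Fock space over `L²([t₀, t₁])` is realised as the space of square-integrable functions of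
a finite unordered configuration `σ` of photon arrival times.  Configurations are multisets (hence
bosonic symmetry is built in), and an `n`-photon configuration carries the measure `dt₁ ⋯ dtₙ / n!`.
In this representation `(a(t) ψ)(σ) = ψ(σ ∪ {t})`, `I(t) = a†(t) a(t)`, and `|ψ(σ)|²` is the
probability density of detecting the photons at the times in `σ`. -/

/-- The unordered configuration of the entries of a tuple. -/
def config (n : ℕ) (v : Fin n → ℝ) : Multiset ℝ := (List.ofFn v : Multiset ℝ)

/-- A set of configurations is measurable if its preimage in every `ℝⁿ` is. -/
instance instMeasurableSpaceConfig : MeasurableSpace (Multiset ℝ) :=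
  ⨅ n : ℕ, MeasurableSpace.map (config n) inferInstance

theorem measurable_config (n : ℕ) : Measurable (config n) := by
  intro s hs
  have h := (MeasurableSpace.measurableSet_iInf.1 hs) n
  exact h

/-- The measure `∑ₙ dt₁ ⋯ dtₙ / n!` on configurations of times in the window `[t₀, t₁]`. -/
def configMeasure (t₀ t₁ : ℝ) : Measure (Multiset ℝ) :=
  Measure.sum fun n : ℕ => ((n.factorial : ℝ≥0∞)⁻¹) •
    Measure.map (config n) (Measure.pi fun _ : Fin n => (volume : Measure ℝ).restrict (Icc t₀ t₁))

/-- The Hilbert space `ℋ_A` of the accessible field on the window `[t₀, t₁]`. -/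
abbrev FieldSpace (t₀ t₁ : ℝ) := Lp ℂ 2 (configMeasure t₀ t₁)

/-- Wave functions `Ψ(σ, τ)` of the two fields: `σ` are the times of the photons in the accessible
field `A`, `τ` those in the inaccessible field `B`. -/
abbrev Ket2 := Multiset ℝ × Multiset ℝ → ℂ

/-- The product vector `|ψ⟩_A ⊗ |0⟩_B`. -/
def withVacuum (ψ : Multiset ℝ → ℂ) : Ket2 := fun c => if c.2 = 0 then ψ c.1 else 0

/-- The observable `∫ f(t) I(t) dt`, which is diagonal with value `∑_{t ∈ σ} f(t)`. -/
def flux (f : ℝ → ℝ) (σ : Multiset ℝ) : ℝ := (σ.map f).sum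

/-- The operator `∫ f(t) a†(t) a(t) dt`. -/
def numberA (f : ℝ → ℝ) (Ψ : Ket2) : Ket2 := fun c => (flux f c.1 : ℂ) * Ψ c

/-- The operator `∫ f(t) b†(t) b(t) dt`. -/
def numberB (f : ℝ → ℝ) (Ψ : Ket2) : Ket2 := fun c => (flux f c.2 : ℂ) * Ψ c

/-- The beam-splitter coupling `∫ (a†(t) b(t) + a(t) b†(t)) dt`; the first term moves a photon
from `B` to `A`, the second one from `A` to `B`. -/
def exchange (Ψ : Ket2) : Ket2 := fun c =>
  (c.1.map fun t => Ψ (c.1.erase t, t ::ₘ c.2)).sum +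
    (c.2.map fun t => Ψ (t ::ₘ c.1, c.2.erase t)).sum

/-- The exponential `exp(z G) Ψ = ∑ₖ zᵏ Gᵏ Ψ / k!`.  It is only used for the three generators
above; they preserve the finite set of all photon times, so that the series converges at every
configuration. -/
def opExp (G : Ket2 → Ket2) (z : ℂ) (Ψ : Ket2) : Ket2 := fun c =>
  ∑' k : ℕ, z ^ k / (k.factorial : ℂ) * (G^[k] Ψ) c

/-- `U_A = exp[i ∫ φ(t) I(t) dt]`. -/
def UA (φ : ℝ → ℝ) : Ket2 → Ket2 := opExp (numberA φ) Complex.I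

/-- `U_AB = exp[i κ ∫ (a†(t) b(t) + a(t) b†(t)) dt]`. -/
def UAB (κ : ℝ) : Ket2 → Ket2 := opExp exchange (Complex.I * (κ : ℂ))

/-- `U_B† = exp[-i ∫ θ(t) b†(t) b(t) dt]`. -/
def UBdagger (θ : ℝ → ℝ) : Ket2 → Ket2 := opExp (numberB θ) (-Complex.I)

/-- The output of the sensor: loss with vacuum noise, followed by phase modulation. -/
def outputKet (κ : ℝ) (ψ : Multiset ℝ → ℂ) (φ : ℝ → ℝ) : Ket2 :=
  UA φ (UAB κ (withVacuum ψ))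

/-- `θ(t) = ∫ λ(t - τ) φ(τ) dτ` over the observation window. -/
def auxPhase (t₀ t₁ : ℝ) (lam φ : ℝ → ℝ) (t : ℝ) : ℝ := ∫ τ in Icc t₀ t₁, lam (t - τ) * φ τ

/-- The modified purification `U_B† U_A U_AB (|ψ⟩ ⊗ |0⟩)`. -/
def purifiedKet (t₀ t₁ κ : ℝ) (ψ : Multiset ℝ → ℂ) (lam φ : ℝ → ℝ) : Ket2 :=
  UBdagger (auxPhase t₀ t₁ lam φ) (outputKet κ ψ φ)

/-- The fidelity `|⟨Φ|Φ'⟩|²` of two pure states of the two fields. -/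
def fidelity (t₀ t₁ : ℝ) (Φ Φ' : Ket2) : ℝ :=
  ‖∫ c, conj (Φ c) * Φ' c ∂((configMeasure t₀ t₁).prod (configMeasure t₀ t₁))‖ ^ 2

/-- The fidelity between the purifications for the phases `φ` and `φ + ε h + δ k`, where
`p = (ε, δ)`. -/
def phaseFidelity (t₀ t₁ κ : ℝ) (ψ : Multiset ℝ → ℂ) (lam φ h k : ℝ → ℝ) (p : ℝ × ℝ) : ℝ :=
  fidelity t₀ t₁ (purifiedKet t₀ t₁ κ ψ lam φ)
    (purifiedKet t₀ t₁ κ ψ lam (fun t => φ t + p.1 * h t + p.2 * k t))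

/-- The quantum Fisher information of the phase waveform as a bilinear form,
`-2 ∂²F/∂ε∂δ = ∫∫ J(t, t') h(t) k(t') dt dt'`, at the waveform `φ` and in the directions `h`, `k`. -/
def qfi (t₀ t₁ κ : ℝ) (ψ : Multiset ℝ → ℂ) (lam φ h k : ℝ → ℝ) : ℝ :=
  -2 * deriv (fun ε => deriv (fun δ => phaseFidelity t₀ t₁ κ ψ lam φ h k (ε, δ)) 0) 0

/-! ### Spectra -/

/-- `f(ω) = ∫ f(t) exp(iωt) dt`. -/
def spec (f : ℝ → ℝ) (ω : ℝ) : ℂ := ∫ t, (f t : ℂ) * Complex.exp (Complex.I * ω * t)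

/-- The expectation of a function of the photon times, in particular `⟨∫ f(t) I(t) dt⟩` for
`flux f`. -/
def expect (t₀ t₁ : ℝ) (ψ : Multiset ℝ → ℂ) (X : Multiset ℝ → ℝ) : ℝ :=
  ∫ σ, X σ * ‖ψ σ‖ ^ 2 ∂(configMeasure t₀ t₁)

/-- A pure light source with stationary photon flux: for every observation window `[t₀, t₁]` the
unit vector `ψ t₀ t₁`, with finite second moment of the photon number, constant mean flux
`⟨I(t)⟩ = Imean`, and flux covariance
`⟨ΔI(t) ΔI(t')⟩ = ∫ dω/2π S(ω) exp[iω(t - t')]`.  As the covariance has a delta-function part in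
general, the last two are stated for the smeared fluxes `∫ f(t) I(t) dt`. -/
structure IsStationarySource (ψ : ℝ → ℝ → Multiset ℝ → ℂ) (Imean : ℝ) (S : ℝ → ℝ) : Prop where
  memLp : ∀ t₀ t₁, t₀ < t₁ → MemLp (ψ t₀ t₁) 2 (configMeasure t₀ t₁)
  norm_eq : ∀ t₀ t₁, t₀ < t₁ → expect t₀ t₁ (ψ t₀ t₁) (fun _ => 1) = 1
  second_moment : ∀ t₀ t₁, t₀ < t₁ →
    Integrable (fun σ => (Multiset.card σ : ℝ) ^ 2 * ‖ψ t₀ t₁ σ‖ ^ 2) (configMeasure t₀ t₁)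
  measurable_psd : Measurable S
  psd_nonneg : ∀ ω, 0 ≤ S ω
  mean : ∀ t₀ t₁, t₀ < t₁ → ∀ f : ℝ → ℝ, Measurable f → (∃ C, ∀ t, |f t| ≤ C) →
    expect t₀ t₁ (ψ t₀ t₁) (flux f) = Imean * ∫ t in Icc t₀ t₁, f t
  covariance : ∀ t₀ t₁, t₀ < t₁ → ∀ f g : ℝ → ℝ,
    Measurable f → (∃ C, ∀ t, |f t| ≤ C) → Measurable g → (∃ C, ∀ t, |g t| ≤ C) →
    Integrable (fun ω => (S ω : ℂ) * spec ((Icc t₀ t₁).indicator f) ω *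
      conj (spec ((Icc t₀ t₁).indicator g) ω)) ∧
    ((expect t₀ t₁ (ψ t₀ t₁) (fun σ => flux f σ * flux g σ) -
        expect t₀ t₁ (ψ t₀ t₁) (flux f) * expect t₀ t₁ (ψ t₀ t₁) (flux g) : ℝ) : ℂ) =
      (1 / (2 * Real.pi) : ℂ) * ∫ ω, (S ω : ℂ) * spec ((Icc t₀ t₁).indicator f) ω *
        conj (spec ((Icc t₀ t₁).indicator g) ω)

/-- The test waveforms: bounded, measurable, of compact support. -/
structure IsTestWaveform (h : ℝ → ℝ) : Prop where
  measurable : Measurable h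
  bounded : ∃ C, ∀ t, |h t| ≤ C
  compact : HasCompactSupport h

/-- `J` is the spectral quantum Fisher information of the phase waveform: the quantum Fisher
information exists on every window, does not depend on the waveform `φ` (so that it is also equal
to its average over any prior distribution of `φ`), and in the limit `(t₀, t₁) → (-∞, ∞)` its
kernel is `J(t, t') = ∫ dω/2π J(ω) exp[iω(t - t')]`. -/
structure HasSpectralQFI (κ : ℝ) (ψ : ℝ → ℝ → Multiset ℝ → ℂ) (lam : ℝ → ℝ) (J : ℝ → ℝ) :
    Prop where
  contDiff : ∀ t₀ t₁, t₀ < t₁ → ∀ φ h k : ℝ → ℝ,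
    LocallyIntegrable φ → IsTestWaveform h → IsTestWaveform k →
    ContDiff ℝ 2 (phaseFidelity t₀ t₁ κ (ψ t₀ t₁) lam φ h k)
  indep : ∀ t₀ t₁, t₀ < t₁ → ∀ φ h k : ℝ → ℝ,
    LocallyIntegrable φ → IsTestWaveform h → IsTestWaveform k →
    qfi t₀ t₁ κ (ψ t₀ t₁) lam φ h k = qfi t₀ t₁ κ (ψ t₀ t₁) lam 0 h k
  integrable : ∀ h k : ℝ → ℝ, IsTestWaveform h → IsTestWaveform k →
    Integrable (fun ω => (J ω : ℂ) * spec h ω * conj (spec k ω))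
  tendsto : ∀ φ h k : ℝ → ℝ, LocallyIntegrable φ → IsTestWaveform h → IsTestWaveform k →
    Tendsto (fun w : ℝ × ℝ => (qfi w.1 w.2 κ (ψ w.1 w.2) lam φ h k : ℂ)) (atBot ×ˢ atTop)
      (𝓝 ((1 / (2 * Real.pi) : ℂ) * ∫ ω, (J ω : ℂ) * spec h ω * conj (spec k ω)))

/-- `4 [|η - (1-η) λ(ω)|² S(ω) + |1 + λ(ω)|² η (1-η) ⟨I⟩]`. -/
def spectralQFI (η Imean : ℝ) (S lam : ℝ → ℝ) (ω : ℝ) : ℝ :=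
  4 * (‖(η : ℂ) - (1 - η : ℂ) * spec lam ω‖ ^ 2 * S ω +
    ‖1 + spec lam ω‖ ^ 2 * (η * (1 - η) * Imean))

/-- `4 [1/S(ω) + (1-η)/(η ⟨I⟩)]⁻¹`, where `1/0 = ∞`, so that the value is `0` if `S(ω) = 0`. -/
def minSpectralQFI (η Imean : ℝ) (S : ℝ → ℝ) (ω : ℝ) : ℝ :=
  if S ω = 0 then 0 else 4 * (1 / S ω + (1 - η) / (η * Imean))⁻¹

/-! ### Measurements of the accessible field -/

/-- A positive operator-valued measure on a Hilbert space, with outcomes in `Y`. -/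
structure POVM (Y : Type*) [MeasurableSpace Y] (H : Type*) [NormedAddCommGroup H]
    [InnerProductSpace ℂ H] where
  effect : Set Y → H →L[ℂ] H
  positive : ∀ s, MeasurableSet s → (effect s).IsPositive
  effect_univ : effect univ = 1
  hasSum : ∀ s : ℕ → Set Y, (∀ i, MeasurableSet (s i)) → Pairwise (Function.onFun Disjoint s) →
    ∀ v : H, HasSum (fun i => ⟪v, effect (s i) v⟫_ℂ) ⟪v, effect (⋃ i, s i) v⟫_ℂ

/-- The outcome distribution `s ↦ ⟨v, E(s) v⟩`. -/
def POVM.measureOf {Y : Type*} [MeasurableSpace Y] {H : Type*} [NormedAddCommGroup H]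
    [InnerProductSpace ℂ H] (E : POVM Y H) (v : H) : Measure Y :=
  Measure.ofMeasurable (fun s _ => ENNReal.ofReal (⟪v, E.effect s v⟫_ℂ).re)
    (by
      have h := (E.hasSum (fun _ => ∅) (fun _ => MeasurableSet.empty)
        (fun i j _ => by simp [Function.onFun]) v).summable
      have h0 : ⟪v, E.effect ∅ v⟫_ℂ = 0 :=
        tendsto_nhds_unique tendsto_const_nhds h.tendsto_atTop_zero
      simp [h0])
    (by
      intro s hs hd
      have h := Complex.hasSum_re (E.hasSum s hs hd v)
      rw [← h.tsum_eq]
      refine ENNReal.ofReal_tsum_of_nonneg (fun i => ?_) h.summable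
      exact (E.positive (s i) (hs i)).re_inner_nonneg_right v)

/-- The vector `Ψ(·, τ)` of the accessible field, conditional on the photons of the inaccessible
field being at `τ`; it is square-integrable for almost every `τ`. -/
def slice (t₀ t₁ : ℝ) (Ψ : Ket2) (τ : Multiset ℝ) : FieldSpace t₀ t₁ :=
  open Classical in
  if h : MemLp (fun σ => Ψ (σ, τ)) 2 (configMeasure t₀ t₁) then h.toLp _ else 0

/-- The distribution `tr[(E_A ⊗ 1_B) |Ψ⟩⟨Ψ|] = ∫ dτ ⟨Ψ(·, τ), E_A Ψ(·, τ)⟩` of the outcome of a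
measurement `E_A` of the accessible field. -/
def outcomeMeasure {Y : Type*} [MeasurableSpace Y] (t₀ t₁ : ℝ) (E : POVM Y (FieldSpace t₀ t₁))
    (Ψ : Ket2) : Measure Y :=
  (configMeasure t₀ t₁).bind fun τ => E.measureOf (slice t₀ t₁ Ψ τ)

/-! ### The waveform of interest -/

/-- `φ(t) = ∫ g(t - t') x(t') dt'`. -/
def phaseOf (g x : ℝ → ℝ) (t : ℝ) : ℝ := ∫ s, g (t - s) * x s

/-- `x` is a random waveform on `(Ω, P)` with uniformly bounded second moments and with prior
Fisher information `JC(ω)` in spectral form.  The score `β h` in the direction `h` is the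
logarithmic derivative of the law of `x` along `h`, defined by integration by parts against the
smooth functions of finitely many samples of `x`, and
`E[β h β k] = ∫∫ J(t, t') h(t) k(t') dt dt'` with `J(t, t') = ∫ dω/2π JC(ω) exp[iω(t - t')]`. -/
structure HasPriorInformation {Ω : Type*} [MeasurableSpace Ω] (P : Measure Ω) (x : Ω → ℝ → ℝ)
    (JC : ℝ → ℝ) : Prop where
  measurable : Measurable (fun p : Ω × ℝ => x p.1 p.2)
  second_moment : ∃ C : ℝ≥0, ∀ t, ∫⁻ ω, ENNReal.ofReal (x ω t ^ 2) ∂P ≤ C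
  measurable_info : Measurable JC
  info_nonneg : ∀ ν, 0 ≤ JC ν
  score : ∃ β : (ℝ → ℝ) → Ω → ℝ,
    (∀ h : ℝ → ℝ, ContDiff ℝ (⊤ : ℕ∞) h → HasCompactSupport h →
      Measurable[MeasurableSpace.comap x inferInstance] (β h) ∧ MemLp (β h) 2 P ∧
      ∀ (n : ℕ) (t : Fin n → ℝ) (F : (Fin n → ℝ) → ℝ), ContDiff ℝ (⊤ : ℕ∞) F → HasCompactSupport F →
        ∫ ω, fderiv ℝ F (fun i => x ω (t i)) (fun i => h (t i)) ∂P =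
          -∫ ω, β h ω * F (fun i => x ω (t i)) ∂P) ∧
    ∀ h k : ℝ → ℝ, ContDiff ℝ (⊤ : ℕ∞) h → HasCompactSupport h → ContDiff ℝ (⊤ : ℕ∞) k → HasCompactSupport k →
      Integrable (fun ν => (JC ν : ℂ) * spec h ν * conj (spec k ν)) ∧
      ((∫ ω, β h ω * β k ω ∂P : ℝ) : ℂ) =
        (1 / (2 * Real.pi) : ℂ) * ∫ ν, (JC ν : ℂ) * spec h ν * conj (spec k ν)

/-- The mean-square error `E [x̃ - x(t)]²` of the estimate `est y` of `x(t)` from the outcome `y` of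
the measurement `E` of the accessible output field on the window `[t₀, t₁]`. -/
def meanSquareError {Ω Y : Type*} [MeasurableSpace Ω] [MeasurableSpace Y] (t₀ t₁ κ : ℝ)
    (ψ : Multiset ℝ → ℂ) (P : Measure Ω) (x : Ω → ℝ → ℝ) (g : ℝ → ℝ)
    (E : POVM Y (FieldSpace t₀ t₁)) (est : Y → ℝ) (t : ℝ) : ℝ≥0∞ :=
  ∫⁻ ω, ∫⁻ y, ENNReal.ofReal ((est y - x ω t) ^ 2)
    ∂(outcomeMeasure t₀ t₁ E (outputKet κ ψ (phaseOf g (x ω)))) ∂P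

/-- `∫ dω/2π 1 / (|g(ω)|² J(ω) + JC(ω))`, with `1/0 = ∞`. -/
def spectralBound (g J JC : ℝ → ℝ) : ℝ≥0∞ :=
  ENNReal.ofReal (1 / (2 * Real.pi)) *
    ∫⁻ ω, (ENNReal.ofReal (‖spec g ω‖ ^ 2 * J ω + JC ω))⁻¹

end LossyWaveform

end

noncomputable section

namespace LossyWaveform

/-! ### Measure theory of photon configurations -/

/-! Fidelity. Every operator involved is explicit on photon configurations. The phase modulations
are diagonal. The beam splitter applied to `ψ ⊗ vacuum` gives `cos κ ^ m * (i sin κ) ^ n * ψ (σ +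
τ)` (`UAB_withVacuum`), because the derivative of `cosh ^ m * sinh ^ n` obeys the same recursion as
`exchange`. An integral over pairs of configurations is an integral over one configuration of the
sum over its splittings (`lintegral_prod_configMeasure`), so in the counting statistics loss is
independent thinning with probability `η`. The overlap of two purifications is therefore the
characteristic function of the classical variables `flux h σ - flux (λ∗h) τ` under photon counting
(`phaseFidelity_eq`). The base waveform cancels, and the quantum Fisher information is four times a
covariance (`qfi_eq`). Thinning splits that covariance into a source part, with test function `ηh -
(1-η) λ∗h`, and a partition-noise part `η(1-η)⟨I⟩ ∫ (h + λ∗h)(k + λ∗k)` (`splitAvg_pairFlux_mul`).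

Wide windows. Only the covariances of bounded functions on finite windows are controlled, and `S`
may be neither bounded nor integrable. Stationarity and the second moment of the photon number bound
the `L²(S dω)` norm of the transform of a bounded function on a unit interval, uniformly in the
position of the interval (`IsStationarySource.specBounded`). Summing over unit intervals controls
functions with summable local suprema, and truncation to large windows converges in `L²(S dω)` and
in `L²(dω)` (`IsStationarySource.tendsto_pairCov`).

Minimum. Completing the square (`spectralQFI_eq`) shows that the optimum is `1 + λ = S / ((1-η) S +
η⟨I⟩)`. It is real, and a multiple of a bump convolved with its reflection has this transform at one
given frequency.

Cramér-Rao bound. A phase on `B` is invisible to a measurement of `A`, so outcome probabilities may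
be differentiated along any of the purifications. For an estimator with finitely many values,
positivity of the effects on the vectors `2D + βV - s (r - x) V` gives a quadratic inequality in
`s`. Its discriminant is the van Trees inequality `h(t)² ≤ (4 Cov + E β²) · MSE`
(`sq_le_mul_integral_of_effects`). The score is given only against functions of finitely many
samples. It is extended to linear functionals of the phase on the window by passing to the closed
linear span (`scoreIdentity_of_orthogonal`), and then to nonlinear functions by comparing
characteristic functionals of shifted laws (`map_shift_add_shiftMeasure`).

It remains to choose the direction `h` and the kernel. The optimal transform of `h` is proportional
to `exp(iωt) / (|g|² J_min + J_x)`, and the optimal kernel is the one above. Both are approximated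
in weighted mean square by translates of fixed functions, since real trigonometric sums are dense
among Hermitian functions (`exists_bump_bound`, `exists_kernel_near`). The choices precede the
window and the measurement, which gives the uniformity. -/

theorem measurable_of_config {β : Type*} [MeasurableSpace β] {f : Multiset ℝ → β}
    (h : ∀ n, Measurable fun v => f (config n v)) : Measurable f := by
  intro s hs
  refine MeasurableSpace.measurableSet_iInf.2 fun n => ?_
  exact h n hs

theorem config_succ (n : ℕ) (v : Fin (n + 1) → ℝ) :
    config (n + 1) v = v 0 ::ₘ config n (fun i => v i.succ) := by
  simp [config, List.ofFn_succ]

theorem card_config (n : ℕ) (v : Fin n → ℝ) : Multiset.card (config n v) = n := by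
  simp [config]

theorem config_cons (n : ℕ) (t : ℝ) (v : Fin n → ℝ) :
    config (n + 1) (Fin.cons t v) = t ::ₘ config n v := by
  simp [config_succ]

theorem config_zero (v : Fin 0 → ℝ) : config 0 v = 0 := by
  simp [config]

theorem config_add {m n : ℕ} (v : Fin m → ℝ) (w : Fin n → ℝ) :
    config m v + config n w = config (m + n) (Fin.append v w) := by
  simp [config, List.ofFn_fin_append]

/-- The `i`-th smallest entry of a configuration, `0` if there is none. -/
def orderStat (σ : Multiset ℝ) (i : ℕ) : ℝ := (σ.sort (· ≤ ·)).getD i 0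

/-- The permutations form a countable discrete space, so it suffices to measure the fibres. A fibre
is cut out by finitely many comparisons: the permuted tuple is monotone, and ties keep the order of
their indices. -/
theorem measurable_tuple_sort (n : ℕ) :
    @Measurable _ _ _ ⊤ (fun v : Fin n → ℝ => Tuple.sort v) := by
  let _ : MeasurableSpace (Equiv.Perm (Fin n)) := ⊤
  refine measurable_to_countable' fun π => ?_
  have : (fun v : Fin n → ℝ => Tuple.sort v) ⁻¹' {π} =
      (⋂ i, ⋂ j, {v | i ≤ j → v (π i) ≤ v (π j)}) ∩
        ⋂ i, ⋂ j, {v | i < j → v (π i) = v (π j) → π i < π j} := by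
    ext v
    simp only [mem_preimage, mem_singleton_iff, mem_inter_iff, mem_iInter, mem_ofPred_eq]
    rw [eq_comm, Tuple.eq_sort_iff]
    rfl
  rw [this]
  refine (MeasurableSet.iInter fun i => MeasurableSet.iInter fun j => ?_).inter
    (MeasurableSet.iInter fun i => MeasurableSet.iInter fun j => ?_)
  · by_cases h : i ≤ j
    · simp only [h, true_imp_iff]
      exact measurableSet_le (measurable_pi_apply (π i)) (measurable_pi_apply (π j))
    · simp [h]
  · by_cases h : i < j
    · by_cases h' : π i < π j
      · simp [h']
      · simp only [h, h', true_imp_iff, imp_false]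
        exact (measurableSet_eq_fun (measurable_pi_apply (π i)) (measurable_pi_apply (π j))).compl
    · simp [h]

theorem sort_config (n : ℕ) (v : Fin n → ℝ) :
    (config n v).sort (· ≤ ·) = List.ofFn (v ∘ Tuple.sort v) := by
  refine List.Perm.eq_of_pairwise (le := (· ≤ ·)) (fun a b _ _ h h' => le_antisymm h h')
    (Multiset.pairwise_sort _ _) ?_ ?_
  · rw [List.pairwise_ofFn]
    intro i j hij
    exact Tuple.monotone_sort v hij.le
  · rw [← Multiset.coe_eq_coe, Multiset.sort_eq, config, Multiset.coe_eq_coe]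
    exact (Equiv.Perm.ofFn_comp_perm _ _).symm

theorem measurable_orderStat (i : ℕ) : Measurable fun σ => orderStat σ i := by
  refine measurable_of_config fun n => ?_
  simp only [orderStat, sort_config]
  by_cases hi : i < n
  · have : (fun v : Fin n → ℝ => (List.ofFn (v ∘ Tuple.sort v)).getD i 0) =
        fun v => v (Tuple.sort v ⟨i, hi⟩) := by
      ext v
      simp [List.getD_eq_getElem?_getD, hi]
    rw [this]
    let _ : MeasurableSpace (Equiv.Perm (Fin n)) := ⊤
    have h1 : Measurable fun p : (Fin n → ℝ) × Equiv.Perm (Fin n) => p.1 (p.2 ⟨i, hi⟩) :=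
      measurable_from_prod_countable_left fun π => measurable_pi_apply (π ⟨i, hi⟩)
    exact h1.comp (measurable_id.prodMk (measurable_tuple_sort n))
  · have : (fun v : Fin n → ℝ => (List.ofFn (v ∘ Tuple.sort v)).getD i 0) = fun _ => 0 := by
      ext v
      simp [List.getD_eq_getElem?_getD, hi]
    rw [this]
    exact measurable_const

/-- The order statistics are thus a measurable right inverse of the passage from tuples to
configurations. This is what gives access to joint measurability on pairs of configurations. -/
theorem config_orderStat (σ : Multiset ℝ) :
    config (Multiset.card σ) (fun i => orderStat σ i) = σ := by
  conv_rhs => rw [← Multiset.sort_eq σ (· ≤ ·)]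
  rw [config, Multiset.coe_eq_coe]
  refine List.Perm.of_eq ?_
  apply List.ext_getElem
  · simp
  · intro i h1 h2
    simp [orderStat]

theorem measurable_card : Measurable fun σ : Multiset ℝ => Multiset.card σ :=
  measurable_of_config fun n => by simp [card_config]

/-- The criterion `measurable_of_config` concerns one configuration, not the product σ-algebra.
Instead, on the measurable set where the cardinalities are `m` and `n`, the sum is `config (m + n)`
of a tuple of order statistics. -/
theorem measurable_config_add :
    Measurable fun p : Multiset ℝ × Multiset ℝ => p.1 + p.2 := by
  intro s hs
  have : (fun p : Multiset ℝ × Multiset ℝ => p.1 + p.2) ⁻¹' s =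
      ⋃ m : ℕ, ⋃ n : ℕ, ({p | Multiset.card p.1 = m} ∩ {p | Multiset.card p.2 = n}) ∩
        (fun p : Multiset ℝ × Multiset ℝ => config (m + n) (Fin.append
          (fun i : Fin m => orderStat p.1 i) (fun i : Fin n => orderStat p.2 i))) ⁻¹' s := by
    ext p
    simp only [mem_preimage, mem_iUnion, mem_inter_iff, mem_ofPred_eq]
    constructor
    · intro h
      refine ⟨_, _, ⟨rfl, rfl⟩, ?_⟩
      rwa [← config_add, config_orderStat, config_orderStat]
    · rintro ⟨m, n, ⟨rfl, rfl⟩, h⟩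
      rwa [← config_add, config_orderStat, config_orderStat] at h
  rw [this]
  refine MeasurableSet.iUnion fun m => MeasurableSet.iUnion fun n => ?_
  refine MeasurableSet.inter (MeasurableSet.inter ?_ ?_) ?_
  · exact (measurable_card.comp measurable_fst) (measurableSet_singleton m)
  · exact (measurable_card.comp measurable_snd) (measurableSet_singleton n)
  · refine ((measurable_config (m + n)).comp (measurable_pi_lambda _ fun i => ?_)) hs
    induction i using Fin.addCases with
    | left i => simpa [Function.comp_def] using (measurable_orderStat i).comp measurable_fst
    | right i => simpa [Function.comp_def] using (measurable_orderStat i).comp measurable_snd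

theorem measurable_config_cons :
    Measurable fun p : ℝ × Multiset ℝ => p.1 ::ₘ p.2 := by
  have h : Measurable fun t : ℝ => ({t} : Multiset ℝ) := by
    have : (fun t : ℝ => ({t} : Multiset ℝ)) = fun t => config 1 fun _ => t := by
      ext t; simp [config]
    rw [this]
    exact (measurable_config 1).comp (measurable_pi_lambda _ fun _ => measurable_id)
  simp only [← Multiset.singleton_add]
  exact measurable_config_add.comp ((h.comp measurable_fst).prodMk measurable_snd)

theorem flux_config (f : ℝ → ℝ) (n : ℕ) (v : Fin n → ℝ) :
    flux f (config n v) = ∑ i, f (v i) := by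
  simp [flux, config, List.sum_ofFn, Function.comp_def]

theorem measurable_flux {f : ℝ → ℝ} (hf : Measurable f) : Measurable (flux f) :=
  measurable_of_config fun n => by
    simp only [flux_config]
    exact Finset.measurable_sum _ fun i _ => hf.comp (measurable_pi_apply i)

@[simp] theorem flux_zero (f : ℝ → ℝ) : flux f 0 = 0 := by simp [flux]

@[simp] theorem flux_cons (f : ℝ → ℝ) (t : ℝ) (σ : Multiset ℝ) :
    flux f (t ::ₘ σ) = f t + flux f σ := by simp [flux]

theorem flux_add_fun (f g : ℝ → ℝ) (σ : Multiset ℝ) :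
    flux (fun t => f t + g t) σ = flux f σ + flux g σ := by simp [flux]

theorem flux_const_mul (c : ℝ) (f : ℝ → ℝ) (σ : Multiset ℝ) :
    flux (fun t => c * f t) σ = c * flux f σ := by
  simp [flux, Multiset.sum_map_mul_left]

theorem abs_flux_le {f : ℝ → ℝ} {C : ℝ} (hf : ∀ t, |f t| ≤ C) (σ : Multiset ℝ) :
    |flux f σ| ≤ C * Multiset.card σ := by
  induction σ using Multiset.induction_on with
  | empty => simp
  | cons t σ ih =>
    rw [flux_cons, Multiset.card_cons]
    push_cast
    calc |f t + flux f σ| ≤ |f t| + |flux f σ| := abs_add_le _ _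
      _ ≤ _ := by linarith [hf t]

theorem lintegral_configMeasure (t₀ t₁ : ℝ) {F : Multiset ℝ → ℝ≥0∞} (hF : Measurable F) :
    ∫⁻ σ, F σ ∂(configMeasure t₀ t₁) = ∑' n : ℕ, ((n.factorial : ℝ≥0∞)⁻¹) *
      ∫⁻ v, F (config n v)
        ∂(Measure.pi fun _ : Fin n => (volume : Measure ℝ).restrict (Icc t₀ t₁)) := by
  rw [configMeasure, lintegral_sum_measure]
  refine tsum_congr fun n => ?_
  rw [lintegral_smul_measure, lintegral_map hF (measurable_config n), smul_eq_mul]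

instance isFiniteMeasure_configMeasure (t₀ t₁ : ℝ) : IsFiniteMeasure (configMeasure t₀ t₁) := by
  refine ⟨?_⟩
  have h := lintegral_configMeasure t₀ t₁ (F := fun _ => 1) measurable_const
  simp only [lintegral_one, Measure.pi_univ, Measure.restrict_apply_univ, Finset.prod_const,
    Finset.card_univ, Fintype.card_fin] at h
  rw [h]
  set L := (volume : Measure ℝ) (Icc t₀ t₁)
  have hL : L ≠ ∞ := by simp [L]
  have h2 : ∀ n : ℕ, ((n.factorial : ℝ≥0∞)⁻¹) * L ^ n =
      ENNReal.ofReal (L.toReal ^ n / n.factorial) := by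
    intro n
    rw [ENNReal.ofReal_div_of_pos (by positivity), ENNReal.ofReal_pow ENNReal.toReal_nonneg,
      ENNReal.ofReal_toReal hL, ENNReal.ofReal_natCast, ENNReal.div_eq_inv_mul]
  simp only [h2]
  exact (Real.summable_pow_div_factorial _).tsum_ofReal_lt_top

/-- Each coordinate of a Lebesgue tuple avoids a given null set almost surely, and a configuration
has finitely many entries. This lets waveforms that are defined only almost everywhere be evaluated
at photon times. -/
theorem ae_configMeasure_of_ae {t₀ t₁ : ℝ} {p : ℝ → Prop}
    (hp : ∀ᵐ t ∂((volume : Measure ℝ).restrict (Icc t₀ t₁)), p t) :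
    ∀ᵐ σ ∂(configMeasure t₀ t₁), ∀ t ∈ σ, p t := by
  obtain ⟨N, hN, hNm, hN0⟩ := exists_measurable_superset_of_null hp
  -- The flux of the indicator of `N` counts the photons in `N`. Its vanishing is a measurable
  -- condition, as is needed to pass through the image measures.
  have h2 : ∀ᵐ σ ∂(configMeasure t₀ t₁), flux (N.indicator fun _ => 1) σ = 0 := by
    have hm : Measurable (flux (N.indicator fun _ => 1)) :=
      measurable_flux (measurable_const.indicator hNm)
    rw [configMeasure, Measure.ae_sum_iff' (measurableSet_eq_fun hm measurable_const)]
    intro n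
    refine Measure.ae_smul_measure ?_ _
    rw [ae_map_iff (measurable_config n).aemeasurable (measurableSet_eq_fun hm measurable_const)]
    have : ∀ᵐ v ∂(Measure.pi fun _ : Fin n => (volume : Measure ℝ).restrict (Icc t₀ t₁)),
        ∀ i, v i ∉ N :=
      ae_all_iff.2 fun i => (Measure.tendsto_eval_ae_ae (i := i)).eventually
        (measure_eq_zero_iff_ae_notMem.1 hN0)
    filter_upwards [this] with v hv
    rw [flux_config]
    simp [hv]
  filter_upwards [h2] with σ hσ t ht
  by_contra hpt
  have htN : t ∈ N := hN hpt
  obtain ⟨τ, rfl⟩ := Multiset.exists_cons_of_mem ht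
  rw [flux_cons] at hσ
  have h3 : 0 ≤ flux (N.indicator fun _ => 1) τ := by
    refine Multiset.sum_nonneg fun x hx => ?_
    obtain ⟨y, -, rfl⟩ := Multiset.mem_map.1 hx
    exact indicator_nonneg (fun _ _ => zero_le_one) _
  rw [indicator_of_mem htN] at hσ
  linarith

theorem flux_congr {f g : ℝ → ℝ} {σ : Multiset ℝ} (h : ∀ t ∈ σ, f t = g t) :
    flux f σ = flux g σ := by
  rw [flux, flux, Multiset.map_congr rfl h]

theorem flux_ae_eq {t₀ t₁ : ℝ} {f g : ℝ → ℝ}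
    (h : f =ᵐ[(volume : Measure ℝ).restrict (Icc t₀ t₁)] g) :
    flux f =ᵐ[configMeasure t₀ t₁] flux g := by
  filter_upwards [ae_configMeasure_of_ae h] with σ hσ using flux_congr hσ

/-- Induction on the number of photons: the first one goes to either part, and its time then becomes
a parameter. This is why the parameter space is arbitrary and generalised in the induction. -/
theorem measurable_splitSum_aux {α : Type*} [MeasurableSpace α] (n : ℕ)
    {F : α → Multiset ℝ × Multiset ℝ → ℝ≥0∞} (hF : Measurable (Function.uncurry F)) :
    Measurable fun q : α × (Fin n → ℝ) =>
      ((Multiset.antidiagonal (config n q.2)).map (F q.1)).sum := by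
  induction n generalizing α with
  | zero =>
    simp only [config_zero, Multiset.antidiagonal_zero, Multiset.map_singleton,
      Multiset.sum_singleton]
    exact hF.comp (measurable_fst.prodMk measurable_const)
  | succ n ih =>
    have h1 : Measurable (Function.uncurry fun (a : α × ℝ) (p : Multiset ℝ × Multiset ℝ) =>
        F a.1 (p.1, a.2 ::ₘ p.2)) :=
      hF.comp ((measurable_fst.comp measurable_fst).prodMk ((measurable_fst.comp
        measurable_snd).prodMk (measurable_config_cons.comp ((measurable_snd.comp
          measurable_fst).prodMk (measurable_snd.comp measurable_snd)))))
    have h2 : Measurable (Function.uncurry fun (a : α × ℝ) (p : Multiset ℝ × Multiset ℝ) =>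
        F a.1 (a.2 ::ₘ p.1, p.2)) :=
      hF.comp ((measurable_fst.comp measurable_fst).prodMk ((measurable_config_cons.comp
        ((measurable_snd.comp measurable_fst).prodMk (measurable_fst.comp measurable_snd))).prodMk
          (measurable_snd.comp measurable_snd)))
    have hm : Measurable fun q : α × (Fin (n + 1) → ℝ) =>
        ((q.1, q.2 0), fun i : Fin n => q.2 i.succ) :=
      (measurable_fst.prodMk ((measurable_pi_apply 0).comp measurable_snd)).prodMk
        (measurable_pi_lambda _ fun i => (measurable_pi_apply i.succ).comp measurable_snd)
    have := ((ih h1).comp hm).add ((ih h2).comp hm)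
    simpa [config_succ, Multiset.antidiagonal_cons, Function.comp_def, Prod.map] using! this

theorem measurable_splitSum {F : Multiset ℝ × Multiset ℝ → ℝ≥0∞} (hF : Measurable F) :
    Measurable fun σ => ((Multiset.antidiagonal σ).map F).sum :=
  measurable_of_config fun n => by
    have h := measurable_splitSum_aux (α := Unit) n (F := fun _ => F) (hF.comp measurable_snd)
    exact h.comp (measurable_const.prodMk measurable_id : Measurable fun v => ((), v))

/-! ### Integrals over pairs of configurations as sums over splittings. -/

theorem lintegral_pi_succ (m : Measure ℝ) [SigmaFinite m] (n : ℕ)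
    {g : (Fin (n + 1) → ℝ) → ℝ≥0∞} (hg : Measurable g) :
    ∫⁻ v, g v ∂(Measure.pi fun _ => m) =
      ∫⁻ t, ∫⁻ w, g (Fin.cons t w) ∂(Measure.pi fun _ : Fin n => m) ∂m := by
  have h := measurePreserving_piFinSuccAbove (fun _ : Fin (n + 1) => m) 0
  have hm : Measurable fun p : ℝ × (Fin n → ℝ) => g (Fin.cons p.1 p.2) := by
    refine hg.comp (measurable_pi_lambda _ fun i => ?_)
    induction i using Fin.cases with
    | zero => simpa using measurable_fst
    | succ i => simpa [Function.comp_def] using (measurable_pi_apply i).comp measurable_snd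
  rw [← lintegral_prod (fun p : ℝ × (Fin n → ℝ) => g (Fin.cons p.1 p.2)) hm.aemeasurable,
    ← h.lintegral_comp hm]
  refine lintegral_congr fun v => ?_
  congr 1
  ext i
  induction i using Fin.cases <;> simp [MeasurableEquiv.piFinSuccAbove, Fin.tail]

/-- The integral over `k`-photon and `l`-photon configurations. -/
def tupleIntegral (m : Measure ℝ) (F : Multiset ℝ × Multiset ℝ → ℝ≥0∞) (k l : ℕ) : ℝ≥0∞ :=
  ∫⁻ u, ∫⁻ w, F (config k u, config l w) ∂(Measure.pi fun _ : Fin l => m)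
    ∂(Measure.pi fun _ : Fin k => m)

theorem lintegral_tupleIntegral_snd (m : Measure ℝ) [SigmaFinite m]
    {F : Multiset ℝ × Multiset ℝ → ℝ≥0∞} (hF : Measurable F) (k l : ℕ) :
    ∫⁻ t, tupleIntegral m (fun p => F (p.1, t ::ₘ p.2)) k l ∂m = tupleIntegral m F k (l + 1) := by
  simp only [tupleIntegral]
  rw [lintegral_lintegral_swap]
  · refine lintegral_congr fun u => ?_
    rw [lintegral_pi_succ m l (g := fun w => F (config k u, config (l + 1) w))
      (hF.comp (measurable_const.prodMk (measurable_config _)))]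
    simp only [config_cons]
  · refine Measurable.aemeasurable ?_
    refine Measurable.lintegral_prod_right' (f := fun q : (ℝ × (Fin k → ℝ)) × (Fin l → ℝ) =>
      F (config k q.1.2, q.1.1 ::ₘ config l q.2)) ?_
    refine hF.comp (((measurable_config k).comp (measurable_snd.comp measurable_fst)).prodMk
      (measurable_config_cons.comp ((measurable_fst.comp measurable_fst).prodMk
        ((measurable_config l).comp measurable_snd))))

theorem lintegral_tupleIntegral_fst (m : Measure ℝ) [SigmaFinite m]
    {F : Multiset ℝ × Multiset ℝ → ℝ≥0∞} (hF : Measurable F) (k l : ℕ) :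
    ∫⁻ t, tupleIntegral m (fun p => F (t ::ₘ p.1, p.2)) k l ∂m = tupleIntegral m F (k + 1) l := by
  simp only [tupleIntegral]
  rw [lintegral_pi_succ m k]
  · simp only [config_cons]
  · refine Measurable.lintegral_prod_right' (f := fun q : (Fin (k + 1) → ℝ) × (Fin l → ℝ) =>
      F (config (k + 1) q.1, config l q.2)) ?_
    exact hF.comp (((measurable_config _).comp measurable_fst).prodMk
      ((measurable_config _).comp measurable_snd))

/-- The first of `n + 1` photons goes either to the second or to the first part, and the two
contributions combine by Pascal's rule, here `Finset.sum_antidiagonal_choose_succ_nsmul`. -/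
theorem lintegral_splitSum_config (m : Measure ℝ) [SigmaFinite m] (n : ℕ)
    {F : Multiset ℝ × Multiset ℝ → ℝ≥0∞} (hF : Measurable F) :
    ∫⁻ v, ((Multiset.antidiagonal (config n v)).map F).sum ∂(Measure.pi fun _ => m) =
      ∑ kl ∈ Finset.HasAntidiagonal.antidiagonal n, n.choose kl.1 • tupleIntegral m F kl.1 kl.2 := by
  induction n generalizing F with
  | zero =>
    simp [tupleIntegral, config_zero]
  | succ n ih =>
    have hF1 : ∀ t : ℝ, Measurable fun p : Multiset ℝ × Multiset ℝ => F (p.1, t ::ₘ p.2) :=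
      fun t => hF.comp (measurable_fst.prodMk (measurable_config_cons.comp
        (measurable_const.prodMk measurable_snd)))
    have hF2 : ∀ t : ℝ, Measurable fun p : Multiset ℝ × Multiset ℝ => F (t ::ₘ p.1, p.2) :=
      fun t => hF.comp ((measurable_config_cons.comp
        (measurable_const.prodMk measurable_fst)).prodMk measurable_snd)
    have hm : ∀ k l, Measurable fun t => tupleIntegral m (fun p => F (p.1, t ::ₘ p.2)) k l := by
      intro k l
      refine Measurable.lintegral_prod_right' (f := fun q : ℝ × (Fin k → ℝ) =>
        ∫⁻ w, F (config k q.2, q.1 ::ₘ config l w) ∂(Measure.pi fun _ : Fin l => m)) ?_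
      refine Measurable.lintegral_prod_right' (f := fun q : (ℝ × (Fin k → ℝ)) × (Fin l → ℝ) =>
        F (config k q.1.2, q.1.1 ::ₘ config l q.2)) ?_
      exact hF.comp (((measurable_config k).comp (measurable_snd.comp measurable_fst)).prodMk
        (measurable_config_cons.comp ((measurable_fst.comp measurable_fst).prodMk
          ((measurable_config l).comp measurable_snd))))
    have hm' : ∀ k l, Measurable fun t => tupleIntegral m (fun p => F (t ::ₘ p.1, p.2)) k l := by
      intro k l
      refine Measurable.lintegral_prod_right' (f := fun q : ℝ × (Fin k → ℝ) =>
        ∫⁻ w, F (q.1 ::ₘ config k q.2, config l w) ∂(Measure.pi fun _ : Fin l => m)) ?_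
      refine Measurable.lintegral_prod_right' (f := fun q : (ℝ × (Fin k → ℝ)) × (Fin l → ℝ) =>
        F (q.1.1 ::ₘ config k q.1.2, config l q.2)) ?_
      exact hF.comp ((measurable_config_cons.comp ((measurable_fst.comp measurable_fst).prodMk
          ((measurable_config k).comp (measurable_snd.comp measurable_fst)))).prodMk
            ((measurable_config l).comp measurable_snd))
    rw [lintegral_pi_succ m n
      (g := fun v => ((Multiset.antidiagonal (config (n + 1) v)).map F).sum)
      ((measurable_splitSum hF).comp (measurable_config _))]
    have h1 : ∀ t : ℝ, ∫⁻ w, ((Multiset.antidiagonal (config (n + 1) (Fin.cons t w))).map F).sum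
        ∂(Measure.pi fun _ : Fin n => m) =
        ∑ kl ∈ Finset.HasAntidiagonal.antidiagonal n,
            n.choose kl.1 • tupleIntegral m (fun p => F (p.1, t ::ₘ p.2)) kl.1 kl.2 +
          ∑ kl ∈ Finset.HasAntidiagonal.antidiagonal n,
            n.choose kl.1 • tupleIntegral m (fun p => F (t ::ₘ p.1, p.2)) kl.1 kl.2 := by
      intro t
      have hm1 : Measurable fun v : Fin n → ℝ => ((Multiset.antidiagonal (config n v)).map
          fun p => F (p.1, t ::ₘ p.2)).sum :=
        (measurable_splitSum (hF1 t)).comp (measurable_config n)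
      rw [← ih (hF1 t), ← ih (hF2 t), ← lintegral_add_left hm1]
      refine lintegral_congr fun w => ?_
      simp [config_cons, Multiset.antidiagonal_cons, Prod.map]
    rw [Finset.sum_antidiagonal_choose_succ_nsmul]
    simp only [h1, nsmul_eq_mul]
    rw [lintegral_add_left (Finset.measurable_sum _ fun i _ => (hm _ _).const_mul _),
      lintegral_finsetSum _ (fun i _ => (hm _ _).const_mul _),
      lintegral_finsetSum _ (fun i _ => (hm' _ _).const_mul _)]
    congr 1
    · refine Finset.sum_congr rfl fun kl _ => ?_
      rw [lintegral_const_mul _ (hm _ _), lintegral_tupleIntegral_snd m hF]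
    · refine Finset.sum_congr rfl fun kl hkl => ?_
      rw [lintegral_const_mul _ (hm' _ _), lintegral_tupleIntegral_fst m hF]
      rw [← Finset.HasAntidiagonal.mem_antidiagonal.1 hkl, Nat.choose_symm_add]

/-- Integration over pairs of configurations amounts to integration over one configuration and
summation over its splittings into two parts. -/
theorem lintegral_prod_configMeasure (t₀ t₁ : ℝ) {F : Multiset ℝ × Multiset ℝ → ℝ≥0∞}
    (hF : Measurable F) :
    ∫⁻ p, F p ∂((configMeasure t₀ t₁).prod (configMeasure t₀ t₁)) =
      ∫⁻ σ, ((Multiset.antidiagonal σ).map F).sum ∂(configMeasure t₀ t₁) := by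
  set m := (volume : Measure ℝ).restrict (Icc t₀ t₁) with hmdef
  rw [lintegral_configMeasure _ _ (measurable_splitSum hF), lintegral_prod _ hF.aemeasurable,
    lintegral_configMeasure _ _ hF.lintegral_prod_right']
  have h1 : ∀ k : ℕ, ∫⁻ u, ∫⁻ τ, F (config k u, τ) ∂(configMeasure t₀ t₁)
      ∂(Measure.pi fun _ : Fin k => m) =
      ∑' l : ℕ, ((l.factorial : ℝ≥0∞)⁻¹) * tupleIntegral m F k l := by
    intro k
    have hml : ∀ l, Measurable fun u : Fin k → ℝ =>
        ∫⁻ w, F (config k u, config l w) ∂(Measure.pi fun _ : Fin l => m) := fun l =>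
      Measurable.lintegral_prod_right' (f := fun q : (Fin k → ℝ) × (Fin l → ℝ) =>
        F (config k q.1, config l q.2)) (hF.comp (((measurable_config _).comp
          measurable_fst).prodMk ((measurable_config _).comp measurable_snd)))
    have : ∀ u : Fin k → ℝ, ∫⁻ τ, F (config k u, τ) ∂(configMeasure t₀ t₁) = ∑' l : ℕ,
        ((l.factorial : ℝ≥0∞)⁻¹) * ∫⁻ w, F (config k u, config l w)
          ∂(Measure.pi fun _ : Fin l => m) := fun u =>
      lintegral_configMeasure _ _ (hF.comp (measurable_const.prodMk measurable_id))
    simp only [this]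
    rw [lintegral_tsum fun l => ((hml l).const_mul _).aemeasurable]
    refine tsum_congr fun l => ?_
    rw [lintegral_const_mul _ (hml l), tupleIntegral]
  simp only [← hmdef, h1, lintegral_splitSum_config m _ hF, ← ENNReal.tsum_mul_left]
  -- The double series over `(k, l)` is regrouped by the total photon number `n = k + l`.
  rw [← ENNReal.tsum_prod (f := fun k l : ℕ => ((k.factorial : ℝ≥0∞)⁻¹) *
    (((l.factorial : ℝ≥0∞)⁻¹) * tupleIntegral m F k l)),
    ← (Finset.HasAntidiagonal.sigmaAntidiagonalEquivProd (A := ℕ)).tsum_eq, ENNReal.tsum_sigma']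
  refine tsum_congr fun n => ?_
  rw [tsum_fintype, Finset.mul_sum, ← Finset.sum_coe_sort (Finset.HasAntidiagonal.antidiagonal n)]
  refine Finset.sum_congr rfl fun kl _ => ?_
  obtain ⟨⟨k, l⟩, hkl⟩ := kl
  obtain rfl := Finset.HasAntidiagonal.mem_antidiagonal.1 hkl
  simp only [Finset.HasAntidiagonal.sigmaAntidiagonalEquivProd_apply, nsmul_eq_mul]
  rw [← mul_assoc, ← mul_assoc]
  congr 1
  -- The binomial coefficient counting the splittings turns the weight `1 / n!` into the product
  -- weight `1 / (k! l!)`.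
  have h3 : ((k + l).factorial : ℝ≥0∞) = (k + l).choose k * (k.factorial * l.factorial) := by
    have := Nat.add_choose_mul_factorial_mul_factorial k l
    rw [← this, Nat.choose_symm_add]
    push_cast
    ring
  have hk : (k.factorial : ℝ≥0∞) ≠ 0 := by exact_mod_cast k.factorial_ne_zero
  have hl : (l.factorial : ℝ≥0∞) ≠ 0 := by exact_mod_cast l.factorial_ne_zero
  have hc : ((k + l).choose k : ℝ≥0∞) ≠ 0 := by
    exact_mod_cast (Nat.choose_pos (Nat.le_add_right k l)).ne'
  rw [h3, ENNReal.mul_inv (Or.inl hc) (Or.inl (ENNReal.natCast_ne_top _)),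
    ENNReal.mul_inv (Or.inl hk) (Or.inl (ENNReal.natCast_ne_top _)), mul_comm _
      ((k.factorial : ℝ≥0∞)⁻¹ * _), mul_assoc _ _ ((_ : ℕ) : ℝ≥0∞),
    ENNReal.inv_mul_cancel hc (ENNReal.natCast_ne_top _), mul_one]

/-! ### The beam splitter and the phase modulation -/

theorem opExp_numberA (φ : ℝ → ℝ) (z : ℂ) (Ψ : Ket2) (c : Multiset ℝ × Multiset ℝ) :
    opExp (numberA φ) z Ψ c = Complex.exp (z * (flux φ c.1 : ℂ)) * Ψ c := by
  have h : ∀ k, ((numberA φ)^[k] Ψ) c = (flux φ c.1 : ℂ) ^ k * Ψ c := by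
    intro k
    induction k with
    | zero => simp
    | succ k ih =>
      rw [Function.iterate_succ', Function.comp_apply, numberA, ih]
      ring
  rw [opExp, Complex.exp_eq_exp_ℂ, NormedSpace.exp_eq_tsum_div, ← tsum_mul_right]
  refine tsum_congr fun k => ?_
  rw [h]
  ring

theorem opExp_numberB (φ : ℝ → ℝ) (z : ℂ) (Ψ : Ket2) (c : Multiset ℝ × Multiset ℝ) :
    opExp (numberB φ) z Ψ c = Complex.exp (z * (flux φ c.2 : ℂ)) * Ψ c := by
  have h : ∀ k, ((numberB φ)^[k] Ψ) c = (flux φ c.2 : ℂ) ^ k * Ψ c := by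
    intro k
    induction k with
    | zero => simp
    | succ k ih =>
      rw [Function.iterate_succ', Function.comp_apply, numberB, ih]
      ring
  rw [opExp, Complex.exp_eq_exp_ℂ, NormedSpace.exp_eq_tsum_div, ← tsum_mul_right]
  refine tsum_congr fun k => ?_
  rw [h]
  ring

/-- The amplitude `cosh(z)ᵐ sinh(z)ⁿ` of finding `m` photons in `A` and `n` photons in `B`. -/
def splitAmplitude (m n : ℕ) (z : ℂ) : ℂ := Complex.cosh z ^ m * Complex.sinh z ^ n

theorem differentiable_splitAmplitude (m n : ℕ) : Differentiable ℂ (splitAmplitude m n) := by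
  unfold splitAmplitude
  exact (Complex.differentiable_cosh.pow m).mul (Complex.differentiable_sinh.pow n)

/-- Differentiation exchanges one factor `cosh` for `sinh` or conversely, just as `exchange` moves
one photon. The truncated subtractions are harmless, because their coefficients vanish with `m` or
`n`. -/
theorem deriv_splitAmplitude (m n : ℕ) :
    deriv (splitAmplitude m n) = fun z => (m : ℂ) * splitAmplitude (m - 1) (n + 1) z +
      (n : ℂ) * splitAmplitude (m + 1) (n - 1) z := by
  ext z
  have h1 := (Complex.hasDerivAt_cosh z).pow m
  have h2 := (Complex.hasDerivAt_sinh z).pow n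
  have h := h1.mul h2
  rw [show splitAmplitude m n = (Complex.cosh ^ m) * (Complex.sinh ^ n) from rfl, h.deriv]
  simp only [splitAmplitude, Pi.pow_apply]
  ring

theorem contDiff_splitAmplitude (m n : ℕ) (k : WithTop ℕ∞) :
    ContDiff ℂ k (splitAmplitude m n) :=
  (differentiable_splitAmplitude m n).contDiff

/-- Moving a photon from one field to the other does not change the union of the two configurations.
All summands in `exchange` are therefore equal, and only their number enters. -/
theorem exchange_splitting (ψ : Multiset ℝ → ℂ) (A : ℕ → ℕ → ℂ) (c : Multiset ℝ × Multiset ℝ) :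
    exchange (fun c => A (Multiset.card c.1) (Multiset.card c.2) * ψ (c.1 + c.2)) c =
      ((Multiset.card c.1 : ℂ) * A (Multiset.card c.1 - 1) (Multiset.card c.2 + 1) +
        (Multiset.card c.2 : ℂ) * A (Multiset.card c.1 + 1) (Multiset.card c.2 - 1)) *
        ψ (c.1 + c.2) := by
  obtain ⟨σ, τ⟩ := c
  have h1 : (σ.map fun t => A (Multiset.card (σ.erase t)) (Multiset.card (t ::ₘ τ)) *
      ψ (σ.erase t + t ::ₘ τ)) = σ.map fun _ =>
        A (Multiset.card σ - 1) (Multiset.card τ + 1) * ψ (σ + τ) := by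
    refine Multiset.map_congr rfl fun t ht => ?_
    rw [Multiset.card_erase_of_mem ht, Multiset.card_cons, Multiset.add_cons,
      ← Multiset.cons_add, Multiset.cons_erase ht]
    rfl
  have h2 : (τ.map fun t => A (Multiset.card (t ::ₘ σ)) (Multiset.card (τ.erase t)) *
      ψ (t ::ₘ σ + τ.erase t)) = τ.map fun _ =>
        A (Multiset.card σ + 1) (Multiset.card τ - 1) * ψ (σ + τ) := by
    refine Multiset.map_congr rfl fun t ht => ?_
    rw [Multiset.card_erase_of_mem ht, Multiset.card_cons, Multiset.cons_add,
      ← Multiset.add_cons, Multiset.cons_erase ht]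
    rfl
  simp only [exchange]
  rw [h1, h2]
  simp only [Multiset.map_const', Multiset.sum_replicate, nsmul_eq_mul]
  ring

/-- The recursion of `exchange_splitting` is that of `deriv_splitAmplitude`. Hence the powers of the
generator produce the Taylor coefficients of the amplitude at `0`. -/
theorem iterate_exchange_withVacuum (ψ : Multiset ℝ → ℂ) (k : ℕ) :
    exchange^[k] (withVacuum ψ) = fun c =>
      iteratedDeriv k (splitAmplitude (Multiset.card c.1) (Multiset.card c.2)) 0 *
        ψ (c.1 + c.2) := by
  induction k with
  | zero =>
    -- At `z = 0` the amplitude is `1 ^ m * 0 ^ n`, which is the indicator of the vacuum in `B`.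
    ext ⟨σ, τ⟩
    by_cases h : τ = 0
    · simp [withVacuum, splitAmplitude, h]
    · simp [withVacuum, splitAmplitude, h]
  | succ k ih =>
    rw [Function.iterate_succ', Function.comp_apply, ih]
    ext c
    rw [exchange_splitting ψ (fun m n => iteratedDeriv k (splitAmplitude m n) 0) c,
      iteratedDeriv_succ', deriv_splitAmplitude]
    congr 1
    rw [iteratedDeriv_fun_add, iteratedDeriv_const_mul, iteratedDeriv_const_mul]
    · exact (contDiff_splitAmplitude _ _ _).contDiffAt
    · exact (contDiff_splitAmplitude _ _ _).contDiffAt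
    · exact (contDiff_const.mul (contDiff_splitAmplitude _ _ _)).contDiffAt
    · exact (contDiff_const.mul (contDiff_splitAmplitude _ _ _)).contDiffAt

/-- The lossy, unmodulated state `U_AB (|ψ⟩ ⊗ |0⟩)`. -/
def lossyKet (κ : ℝ) (ψ : Multiset ℝ → ℂ) : Ket2 := fun c =>
  (Real.cos κ : ℂ) ^ Multiset.card c.1 * (Complex.I * (Real.sin κ : ℂ)) ^ Multiset.card c.2 *
    ψ (c.1 + c.2)

/-- The exponential series is the Taylor series of an entire function, evaluated at `iκ`, where
`cosh` and `sinh` become `cos κ` and `i sin κ`. -/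
theorem UAB_withVacuum (κ : ℝ) (ψ : Multiset ℝ → ℂ) : UAB κ (withVacuum ψ) = lossyKet κ ψ := by
  ext c
  rw [UAB, opExp]
  simp only [iterate_exchange_withVacuum]
  have h := Complex.taylorSeries_eq_of_entire
    (differentiable_splitAmplitude (Multiset.card c.1) (Multiset.card c.2)) 0
      (Complex.I * (κ : ℂ))
  have h2 : ∀ k : ℕ, (Complex.I * (κ : ℂ)) ^ k / (k.factorial : ℂ) *
      (iteratedDeriv k (splitAmplitude (Multiset.card c.1) (Multiset.card c.2)) 0 *
        ψ (c.1 + c.2)) = ((k.factorial : ℂ)⁻¹ • (Complex.I * (κ : ℂ) - 0) ^ k •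
          iteratedDeriv k (splitAmplitude (Multiset.card c.1) (Multiset.card c.2)) 0) *
            ψ (c.1 + c.2) := by
    intro k
    simp only [smul_eq_mul, sub_zero]
    ring
  simp only [h2]
  rw [tsum_mul_right, h, splitAmplitude, lossyKet, mul_comm Complex.I (κ : ℂ),
    Complex.cosh_mul_I, Complex.sinh_mul_I]
  push_cast
  ring

theorem outputKet_apply (κ : ℝ) (ψ : Multiset ℝ → ℂ) (φ : ℝ → ℝ) (c : Multiset ℝ × Multiset ℝ) :
    outputKet κ ψ φ c = Complex.exp (Complex.I * (flux φ c.1 : ℂ)) * lossyKet κ ψ c := by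
  rw [outputKet, UA, opExp_numberA, UAB_withVacuum]

theorem purifiedKet_apply (t₀ t₁ κ : ℝ) (ψ : Multiset ℝ → ℂ) (lam φ : ℝ → ℝ)
    (c : Multiset ℝ × Multiset ℝ) :
    purifiedKet t₀ t₁ κ ψ lam φ c =
      Complex.exp (Complex.I * ((flux φ c.1 - flux (auxPhase t₀ t₁ lam φ) c.2 : ℝ) : ℂ)) *
        lossyKet κ ψ c := by
  rw [purifiedKet, UBdagger, opExp_numberB, outputKet_apply, ← mul_assoc, ← Complex.exp_add]
  congr 2
  push_cast
  ring

/-! ### Binomial splitting of configurations -/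

/-- The average of `F` over the independent splittings of `σ`, each photon being transmitted with
probability `η`. -/
def splitAvg (η : ℝ) (F : Multiset ℝ × Multiset ℝ → ℝ) (σ : Multiset ℝ) : ℝ :=
  ((Multiset.antidiagonal σ).map fun p =>
    η ^ Multiset.card p.1 * (1 - η) ^ Multiset.card p.2 * F p).sum

theorem splitAvg_zero (η : ℝ) (F : Multiset ℝ × Multiset ℝ → ℝ) :
    splitAvg η F 0 = F (0, 0) := by simp [splitAvg]

theorem splitAvg_cons (η : ℝ) (F : Multiset ℝ × Multiset ℝ → ℝ) (t : ℝ) (σ : Multiset ℝ) :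
    splitAvg η F (t ::ₘ σ) = (1 - η) * splitAvg η (fun p => F (p.1, t ::ₘ p.2)) σ +
      η * splitAvg η (fun p => F (t ::ₘ p.1, p.2)) σ := by
  simp only [splitAvg, Multiset.antidiagonal_cons, Multiset.map_add, Multiset.sum_add,
    Multiset.map_map, ← Multiset.sum_map_mul_left]
  congr 2
  · refine Multiset.map_congr rfl fun p _ => ?_
    simp [Prod.map]
    ring
  · refine Multiset.map_congr rfl fun p _ => ?_
    simp [Prod.map]
    ring

theorem splitAvg_add (η : ℝ) (F G : Multiset ℝ × Multiset ℝ → ℝ) (σ : Multiset ℝ) :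
    splitAvg η (fun p => F p + G p) σ = splitAvg η F σ + splitAvg η G σ := by
  simp only [splitAvg, mul_add, Multiset.sum_map_add]

theorem splitAvg_const_mul (η c : ℝ) (F : Multiset ℝ × Multiset ℝ → ℝ) (σ : Multiset ℝ) :
    splitAvg η (fun p => c * F p) σ = c * splitAvg η F σ := by
  simp only [splitAvg, ← Multiset.sum_map_mul_left]
  refine congrArg _ (Multiset.map_congr rfl fun p _ => ?_)
  ring

theorem splitAvg_one (η : ℝ) (σ : Multiset ℝ) : splitAvg η (fun _ => 1) σ = 1 := by
  induction σ using Multiset.induction_on with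
  | empty => simp [splitAvg_zero]
  | cons t σ ih => rw [splitAvg_cons, ih]; ring

/-- The observable `∫ f a†a dt + ∫ f' b†b dt`. -/
def pairFlux (f f' : ℝ → ℝ) (p : Multiset ℝ × Multiset ℝ) : ℝ := flux f p.1 + flux f' p.2

theorem splitAvg_pairFlux (η : ℝ) (f f' : ℝ → ℝ) (σ : Multiset ℝ) :
    splitAvg η (pairFlux f f') σ = flux (fun t => η * f t + (1 - η) * f' t) σ := by
  induction σ using Multiset.induction_on with
  | empty => simp [splitAvg_zero, pairFlux]
  | cons t σ ih =>
    have h1 : (fun p : Multiset ℝ × Multiset ℝ => pairFlux f f' (p.1, t ::ₘ p.2)) =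
        fun p => f' t * 1 + pairFlux f f' p := by
      ext p; simp [pairFlux]; ring
    have h2 : (fun p : Multiset ℝ × Multiset ℝ => pairFlux f f' (t ::ₘ p.1, p.2)) =
        fun p => f t * 1 + pairFlux f f' p := by
      ext p; simp [pairFlux]; ring
    rw [splitAvg_cons, h1, h2, splitAvg_add, splitAvg_add, splitAvg_const_mul, splitAvg_const_mul,
      splitAvg_one, ih, flux_cons]
    ring

/-- Given `σ`, each photon contributes `f t` or `f' t` independently with probabilities `η` and `1 -
η`. The means multiply, and the conditional covariance is the sum of the Bernoulli covariances `η (1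
- η) (f - f') (g - g')` of the single photons. This last term is the vacuum noise of the loss. -/
theorem splitAvg_pairFlux_mul (η : ℝ) (f f' g g' : ℝ → ℝ) (σ : Multiset ℝ) :
    splitAvg η (fun p => pairFlux f f' p * pairFlux g g' p) σ =
      flux (fun t => η * f t + (1 - η) * f' t) σ * flux (fun t => η * g t + (1 - η) * g' t) σ +
        flux (fun t => η * (1 - η) * ((f t - f' t) * (g t - g' t))) σ := by
  induction σ using Multiset.induction_on with
  | empty => simp [splitAvg_zero, pairFlux]
  | cons t σ ih =>
    have h1 : (fun p : Multiset ℝ × Multiset ℝ => pairFlux f f' (p.1, t ::ₘ p.2) *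
        pairFlux g g' (p.1, t ::ₘ p.2)) = fun p => (f' t * g' t) * 1 + (f' t * pairFlux g g' p +
          (g' t * pairFlux f f' p + pairFlux f f' p * pairFlux g g' p)) := by
      ext p; simp [pairFlux]; ring
    have h2 : (fun p : Multiset ℝ × Multiset ℝ => pairFlux f f' (t ::ₘ p.1, p.2) *
        pairFlux g g' (t ::ₘ p.1, p.2)) = fun p => (f t * g t) * 1 + (f t * pairFlux g g' p +
          (g t * pairFlux f f' p + pairFlux f f' p * pairFlux g g' p)) := by
      ext p; simp [pairFlux]; ring
    rw [splitAvg_cons, h1, h2]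
    simp only [splitAvg_add, splitAvg_const_mul, splitAvg_one, ih, flux_cons, splitAvg_pairFlux]
    ring

/-! ### Integration over pairs of configurations -/

/-- Applied to the indicator of a null set of pairs, the splitting formula has a vanishing left
side, so almost every configuration has no splitting in that set. -/
theorem ae_antidiagonal {t₀ t₁ : ℝ} {P : Multiset ℝ × Multiset ℝ → Prop}
    (h : ∀ᵐ p ∂((configMeasure t₀ t₁).prod (configMeasure t₀ t₁)), P p) :
    ∀ᵐ σ ∂(configMeasure t₀ t₁), ∀ p ∈ Multiset.antidiagonal σ, P p := by
  obtain ⟨N, hN, hNm, hN0⟩ := exists_measurable_superset_of_null h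
  have hm : Measurable (N.indicator fun _ => (1 : ℝ≥0∞)) := measurable_const.indicator hNm
  have h1 := lintegral_prod_configMeasure t₀ t₁ hm
  rw [lintegral_indicator_const hNm, hN0, mul_zero, eq_comm,
    lintegral_eq_zero_iff (measurable_splitSum hm)] at h1
  filter_upwards [h1] with σ hσ p hp
  by_contra hPp
  have hpN : p ∈ N := hN hPp
  have h2 : N.indicator (fun _ => (1 : ℝ≥0∞)) p ≤
      ((Multiset.antidiagonal σ).map (N.indicator fun _ => (1 : ℝ≥0∞))).sum :=
    Multiset.le_sum_of_mem (Multiset.mem_map_of_mem _ hp)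
  rw [indicator_of_mem hpN] at h2
  simp only [Pi.zero_apply] at hσ
  rw [hσ] at h2
  simp at h2

/-- The converse transfer of null sets. It is needed because `lossyKet` evaluates `ψ`, which is
determined only almost everywhere, at the union of two configurations. -/
theorem ae_config_add {t₀ t₁ : ℝ} {P : Multiset ℝ → Prop}
    (h : ∀ᵐ σ ∂(configMeasure t₀ t₁), P σ) :
    ∀ᵐ p ∂((configMeasure t₀ t₁).prod (configMeasure t₀ t₁)), P (p.1 + p.2) := by
  obtain ⟨N, hN, hNm, hN0⟩ := exists_measurable_superset_of_null h
  have hm : Measurable fun p : Multiset ℝ × Multiset ℝ =>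
      N.indicator (fun _ => (1 : ℝ≥0∞)) (p.1 + p.2) :=
    (measurable_const.indicator hNm).comp measurable_config_add
  have h1 := lintegral_prod_configMeasure t₀ t₁ hm
  have h2 : ∫⁻ σ, ((Multiset.antidiagonal σ).map fun p : Multiset ℝ × Multiset ℝ =>
      N.indicator (fun _ => (1 : ℝ≥0∞)) (p.1 + p.2)).sum ∂(configMeasure t₀ t₁) = 0 := by
    rw [lintegral_eq_zero_iff (measurable_splitSum hm)]
    filter_upwards [measure_eq_zero_iff_ae_notMem.1 hN0] with σ hσ
    refine Multiset.sum_eq_zero fun x hx => ?_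
    obtain ⟨p, hp, rfl⟩ := Multiset.mem_map.1 hx
    rw [Multiset.mem_antidiagonal.1 hp, indicator_of_notMem hσ]
  rw [h2, lintegral_eq_zero_iff hm] at h1
  filter_upwards [h1] with p hp
  by_contra hPp
  have hpN : p.1 + p.2 ∈ N := hN hPp
  simp [indicator_of_mem hpN] at hp

theorem quasiMeasurePreserving_config_add (t₀ t₁ : ℝ) :
    Measure.QuasiMeasurePreserving (fun p : Multiset ℝ × Multiset ℝ => p.1 + p.2)
      ((configMeasure t₀ t₁).prod (configMeasure t₀ t₁)) (configMeasure t₀ t₁) := by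
  refine ⟨measurable_config_add, ?_⟩
  refine Measure.AbsolutelyContinuous.mk fun s hs h0 => ?_
  rw [Measure.map_apply measurable_config_add hs]
  exact measure_eq_zero_iff_ae_notMem.2 (ae_config_add (measure_eq_zero_iff_ae_notMem.1 h0))

theorem lintegral_prod_configMeasure' (t₀ t₁ : ℝ) {F : Multiset ℝ × Multiset ℝ → ℝ≥0∞}
    (hF : AEMeasurable F ((configMeasure t₀ t₁).prod (configMeasure t₀ t₁))) :
    AEMeasurable (fun σ => ((Multiset.antidiagonal σ).map F).sum) (configMeasure t₀ t₁) ∧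
    ∫⁻ p, F p ∂((configMeasure t₀ t₁).prod (configMeasure t₀ t₁)) =
      ∫⁻ σ, ((Multiset.antidiagonal σ).map F).sum ∂(configMeasure t₀ t₁) := by
  have h : ∀ᵐ σ ∂(configMeasure t₀ t₁), ((Multiset.antidiagonal σ).map F).sum =
      ((Multiset.antidiagonal σ).map (hF.mk F)).sum := by
    filter_upwards [ae_antidiagonal hF.ae_eq_mk] with σ hσ
    rw [Multiset.map_congr rfl hσ]
  refine ⟨(measurable_splitSum hF.measurable_mk).aemeasurable.congr (h.mono fun _ h => h.symm), ?_⟩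
  rw [lintegral_congr_ae hF.ae_eq_mk, lintegral_prod_configMeasure _ _ hF.measurable_mk,
    lintegral_congr_ae h]

theorem ofReal_multiset_sum {α : Type*} (s : Multiset α) {F : α → ℝ} (hF : ∀ a, 0 ≤ F a) :
    (s.map fun a => ENNReal.ofReal (F a)).sum = ENNReal.ofReal (s.map F).sum ∧
      0 ≤ (s.map F).sum := by
  induction s using Multiset.induction_on with
  | empty => simp
  | cons a s ih =>
    simp only [Multiset.map_cons, Multiset.sum_cons, ih.1]
    exact ⟨(ENNReal.ofReal_add (hF a) ih.2).symm, add_nonneg (hF a) ih.2⟩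

theorem integral_prod_configMeasure_of_nonneg (t₀ t₁ : ℝ) {F : Multiset ℝ × Multiset ℝ → ℝ}
    (hF : Integrable F ((configMeasure t₀ t₁).prod (configMeasure t₀ t₁))) (h0 : ∀ p, 0 ≤ F p) :
    Integrable (fun σ => ((Multiset.antidiagonal σ).map F).sum) (configMeasure t₀ t₁) ∧
    ∫ p, F p ∂((configMeasure t₀ t₁).prod (configMeasure t₀ t₁)) =
      ∫ σ, ((Multiset.antidiagonal σ).map F).sum ∂(configMeasure t₀ t₁) := by
  have h := lintegral_prod_configMeasure' t₀ t₁ hF.1.aemeasurable.ennreal_ofReal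
  simp only [fun σ => (ofReal_multiset_sum (Multiset.antidiagonal σ) h0).1] at h
  have hn : ∀ σ, 0 ≤ ((Multiset.antidiagonal σ).map F).sum :=
    fun σ => (ofReal_multiset_sum (Multiset.antidiagonal σ) h0).2
  have hm : AEStronglyMeasurable (fun σ => ((Multiset.antidiagonal σ).map F).sum)
      (configMeasure t₀ t₁) := by
    have := h.1.ennreal_toReal
    simp only [fun σ => ENNReal.toReal_ofReal (hn σ)] at this
    exact this.aestronglyMeasurable
  refine ⟨⟨hm, ?_⟩, ?_⟩
  · rw [hasFiniteIntegral_iff_ofReal (ae_of_all _ hn), ← h.2,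
      ← hasFiniteIntegral_iff_ofReal (ae_of_all _ h0)]
    exact hF.2
  · rw [integral_eq_lintegral_of_nonneg_ae (ae_of_all _ h0) hF.1,
      integral_eq_lintegral_of_nonneg_ae (ae_of_all _ hn) hm, h.2]

theorem integral_prod_configMeasure (t₀ t₁ : ℝ) {F : Multiset ℝ × Multiset ℝ → ℝ}
    (hF : Integrable F ((configMeasure t₀ t₁).prod (configMeasure t₀ t₁))) :
    Integrable (fun σ => ((Multiset.antidiagonal σ).map F).sum) (configMeasure t₀ t₁) ∧
    ∫ p, F p ∂((configMeasure t₀ t₁).prod (configMeasure t₀ t₁)) =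
      ∫ σ, ((Multiset.antidiagonal σ).map F).sum ∂(configMeasure t₀ t₁) := by
  have h1 := integral_prod_configMeasure_of_nonneg t₀ t₁ hF.norm (fun p => norm_nonneg _)
  -- A signed integrand is the difference of the nonnegative ones `|F| + F` and `|F|`.
  have h2 := integral_prod_configMeasure_of_nonneg t₀ t₁ (hF.norm.add hF)
    (fun p => by
      have := neg_abs_le (F p)
      simp only [Pi.add_apply, Real.norm_eq_abs]
      linarith)
  have hs : ∀ σ, ((Multiset.antidiagonal σ).map F).sum =
      ((Multiset.antidiagonal σ).map ((fun p => ‖F p‖) + F)).sum -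
        ((Multiset.antidiagonal σ).map fun p => ‖F p‖).sum := by
    intro σ
    simp only [Pi.add_def, Multiset.sum_map_add]
    ring
  simp only [hs]
  refine ⟨h2.1.sub h1.1, ?_⟩
  rw [integral_sub h2.1 h1.1, ← h1.2, ← h2.2, ← integral_sub (hF.norm.add hF) hF.norm]
  simp

/-! ### Moments of the lossy state -/

theorem norm_lossyKet_sq (κ : ℝ) (ψ : Multiset ℝ → ℂ) (p : Multiset ℝ × Multiset ℝ) :
    ‖lossyKet κ ψ p‖ ^ 2 = (Real.cos κ ^ 2) ^ Multiset.card p.1 *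
      (1 - Real.cos κ ^ 2) ^ Multiset.card p.2 * ‖ψ (p.1 + p.2)‖ ^ 2 := by
  rw [lossyKet, ← Real.sin_sq]
  simp only [norm_mul, norm_pow, Complex.norm_real, Complex.norm_I, mul_pow,
    ← pow_mul, mul_comm _ 2]
  simp only [pow_mul, Real.norm_eq_abs, sq_abs, one_pow, one_mul]

theorem aestronglyMeasurable_lossyKet {t₀ t₁ : ℝ} (κ : ℝ) {ψ : Multiset ℝ → ℂ}
    (hψ : AEStronglyMeasurable ψ (configMeasure t₀ t₁)) :
    AEStronglyMeasurable (lossyKet κ ψ) ((configMeasure t₀ t₁).prod (configMeasure t₀ t₁)) := by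
  have h1 : Measurable fun p : Multiset ℝ × Multiset ℝ => (Real.cos κ : ℂ) ^ Multiset.card p.1 :=
    (measurable_of_countable fun n : ℕ => (Real.cos κ : ℂ) ^ n).comp
      (measurable_card.comp measurable_fst)
  have h2 : Measurable fun p : Multiset ℝ × Multiset ℝ =>
      (Complex.I * (Real.sin κ : ℂ)) ^ Multiset.card p.2 :=
    (measurable_of_countable fun n : ℕ => (Complex.I * (Real.sin κ : ℂ)) ^ n).comp
      (measurable_card.comp measurable_snd)
  exact ((h1.mul h2).aestronglyMeasurable).mul
    (hψ.comp_quasiMeasurePreserving (quasiMeasurePreserving_config_add t₀ t₁))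

/-- All splittings of `σ` carry the same factor `‖ψ σ‖ ^ 2`, and the remaining weights are binomial.
In the counting statistics the beam splitter is therefore independent thinning. -/
theorem lossy_sum_antidiagonal (κ : ℝ) (ψ : Multiset ℝ → ℂ) (G : Multiset ℝ × Multiset ℝ → ℝ)
    (σ : Multiset ℝ) :
    ((Multiset.antidiagonal σ).map fun p => G p * ‖lossyKet κ ψ p‖ ^ 2).sum =
      splitAvg (Real.cos κ ^ 2) G σ * ‖ψ σ‖ ^ 2 := by
  rw [splitAvg, ← Multiset.sum_map_mul_right]
  refine congrArg _ (Multiset.map_congr rfl fun p hp => ?_)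
  rw [norm_lossyKet_sq, Multiset.mem_antidiagonal.1 hp]
  ring

/-- A wave function of the accessible field whose photon number has a finite second moment. -/
structure FiniteNumber (t₀ t₁ : ℝ) (ψ : Multiset ℝ → ℂ) : Prop where
  memLp : MemLp ψ 2 (configMeasure t₀ t₁)
  second_moment : Integrable (fun σ => (Multiset.card σ : ℝ) ^ 2 * ‖ψ σ‖ ^ 2) (configMeasure t₀ t₁)

theorem FiniteNumber.integrable_one_add {t₀ t₁ : ℝ} {ψ : Multiset ℝ → ℂ}
    (h : FiniteNumber t₀ t₁ ψ) :
    Integrable (fun σ => (1 + (Multiset.card σ : ℝ) ^ 2) * ‖ψ σ‖ ^ 2) (configMeasure t₀ t₁) := by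
  have := (h.memLp.integrable_norm_pow (by norm_num)).add h.second_moment
  refine this.congr (ae_of_all _ fun σ => ?_)
  simp only [Pi.add_apply, add_mul, one_mul]

theorem FiniteNumber.integrable_mul {t₀ t₁ : ℝ} {ψ : Multiset ℝ → ℂ}
    (h : FiniteNumber t₀ t₁ ψ) {f : Multiset ℝ → ℝ} (hf : AEStronglyMeasurable f (configMeasure t₀ t₁))
    {C : ℝ} (hC : ∀ σ, |f σ| ≤ C * (1 + (Multiset.card σ : ℝ) ^ 2)) :
    Integrable (fun σ => f σ * ‖ψ σ‖ ^ 2) (configMeasure t₀ t₁) := by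
  refine (h.integrable_one_add.const_mul C).mono' (hf.mul (h.memLp.1.norm.pow 2))
    (ae_of_all _ fun σ => ?_)
  rw [norm_mul, Real.norm_eq_abs, Real.norm_eq_abs, abs_of_nonneg (sq_nonneg ‖ψ σ‖), ← mul_assoc]
  exact mul_le_mul_of_nonneg_right (hC σ) (sq_nonneg _)

/-- The beam splitter conserves the total photon number, so the second moment of the input controls
every observable of at most quadratic growth in that number. -/
theorem FiniteNumber.integrable_lossy {t₀ t₁ : ℝ} {ψ : Multiset ℝ → ℂ} (h : FiniteNumber t₀ t₁ ψ)
    (κ : ℝ) {G : Multiset ℝ × Multiset ℝ → ℝ}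
    (hG : AEStronglyMeasurable G ((configMeasure t₀ t₁).prod (configMeasure t₀ t₁))) {C : ℝ}
    (hC : ∀ p, |G p| ≤ C * (1 + (Multiset.card (p.1 + p.2) : ℝ) ^ 2)) :
    Integrable (fun p => G p * ‖lossyKet κ ψ p‖ ^ 2)
      ((configMeasure t₀ t₁).prod (configMeasure t₀ t₁)) := by
  have hm := (aestronglyMeasurable_lossyKet κ h.memLp.1).norm.pow 2
  have hN : Measurable fun p : Multiset ℝ × Multiset ℝ =>
      1 + (Multiset.card (p.1 + p.2) : ℝ) ^ 2 :=
    (measurable_of_countable fun n : ℕ => 1 + (n : ℝ) ^ 2).comp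
      (measurable_card.comp measurable_config_add)
  have h1 : Integrable (fun p => (1 + (Multiset.card (p.1 + p.2) : ℝ) ^ 2) * ‖lossyKet κ ψ p‖ ^ 2)
      ((configMeasure t₀ t₁).prod (configMeasure t₀ t₁)) := by
    have hm1 : AEStronglyMeasurable (fun p : Multiset ℝ × Multiset ℝ =>
        (1 + (Multiset.card (p.1 + p.2) : ℝ) ^ 2) * ‖lossyKet κ ψ p‖ ^ 2)
        ((configMeasure t₀ t₁).prod (configMeasure t₀ t₁)) := hN.aestronglyMeasurable.mul hm
    have hn : ∀ p : Multiset ℝ × Multiset ℝ,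
        0 ≤ (1 + (Multiset.card (p.1 + p.2) : ℝ) ^ 2) * ‖lossyKet κ ψ p‖ ^ 2 := fun p => by
      positivity
    refine ⟨hm1, ?_⟩
    rw [hasFiniteIntegral_iff_ofReal (ae_of_all _ hn),
      (lintegral_prod_configMeasure' t₀ t₁ hm1.aemeasurable.ennreal_ofReal).2]
    have h2 : ∀ σ, ((Multiset.antidiagonal σ).map fun p : Multiset ℝ × Multiset ℝ =>
        ENNReal.ofReal ((1 + (Multiset.card (p.1 + p.2) : ℝ) ^ 2) * ‖lossyKet κ ψ p‖ ^ 2)).sum =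
        ENNReal.ofReal ((1 + (Multiset.card σ : ℝ) ^ 2) * ‖ψ σ‖ ^ 2) := by
      intro σ
      rw [(ofReal_multiset_sum _ hn).1, lossy_sum_antidiagonal κ ψ
        (fun p => 1 + (Multiset.card (p.1 + p.2) : ℝ) ^ 2)]
      -- The total photon number is constant on the splittings of `σ`, so averaging does nothing to
      -- it.
      have : splitAvg (Real.cos κ ^ 2)
          (fun p => 1 + (Multiset.card (p.1 + p.2) : ℝ) ^ 2) σ = 1 + (Multiset.card σ : ℝ) ^ 2 := by
        refine Eq.trans (b := splitAvg (Real.cos κ ^ 2)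
          (fun _ => (1 + (Multiset.card σ : ℝ) ^ 2) * 1) σ) ?_ ?_
        · refine congrArg _ (Multiset.map_congr rfl fun p hp => ?_)
          simp only [Multiset.mem_antidiagonal.1 hp, mul_one]
        · rw [splitAvg_const_mul, splitAvg_one, mul_one]
      rw [this]
    simp only [h2]
    have h3 := h.integrable_one_add.2
    rwa [hasFiniteIntegral_iff_ofReal (ae_of_all _ fun σ => by positivity)] at h3
  refine (h1.const_mul C).mono' (hG.mul hm) (ae_of_all _ fun p => ?_)
  rw [norm_mul, Real.norm_eq_abs, Real.norm_eq_abs, abs_of_nonneg (sq_nonneg ‖_‖), ← mul_assoc]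
  exact mul_le_mul_of_nonneg_right (hC p) (sq_nonneg _)

theorem FiniteNumber.integral_lossy {t₀ t₁ : ℝ} {ψ : Multiset ℝ → ℂ} (h : FiniteNumber t₀ t₁ ψ)
    (κ : ℝ) {G : Multiset ℝ × Multiset ℝ → ℝ}
    (hG : AEStronglyMeasurable G ((configMeasure t₀ t₁).prod (configMeasure t₀ t₁))) {C : ℝ}
    (hC : ∀ p, |G p| ≤ C * (1 + (Multiset.card (p.1 + p.2) : ℝ) ^ 2)) :
    ∫ p, G p * ‖lossyKet κ ψ p‖ ^ 2 ∂((configMeasure t₀ t₁).prod (configMeasure t₀ t₁)) =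
      expect t₀ t₁ ψ (splitAvg (Real.cos κ ^ 2) G) := by
  rw [(integral_prod_configMeasure t₀ t₁ (h.integrable_lossy κ hG hC)).2, expect]
  simp only [lossy_sum_antidiagonal]

theorem abs_pairFlux_le {f f' : ℝ → ℝ} {C : ℝ} (hf : ∀ t, |f t| ≤ C) (hf' : ∀ t, |f' t| ≤ C)
    (p : Multiset ℝ × Multiset ℝ) : |pairFlux f f' p| ≤ C * Multiset.card (p.1 + p.2) := by
  rw [pairFlux, Multiset.card_add]
  push_cast
  calc _ ≤ |flux f p.1| + |flux f' p.2| := abs_add_le _ _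
    _ ≤ _ := by linarith [abs_flux_le hf p.1, abs_flux_le hf' p.2]

theorem measurable_pairFlux {f f' : ℝ → ℝ} (hf : Measurable f) (hf' : Measurable f') :
    Measurable (pairFlux f f') :=
  ((measurable_flux hf).comp measurable_fst).add ((measurable_flux hf').comp measurable_snd)

theorem mul_le_one_add_sq (C : ℝ) (hC : 0 ≤ C) (n : ℕ) : C * n ≤ C * (1 + (n : ℝ) ^ 2) := by
  refine mul_le_mul_of_nonneg_left ?_ hC
  nlinarith [sq_nonneg ((n : ℝ) - 1)]

theorem abs_pairFlux_mul_le {f f' g g' : ℝ → ℝ} {C : ℝ} (hf : ∀ t, |f t| ≤ C)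
    (hf' : ∀ t, |f' t| ≤ C) (hg : ∀ t, |g t| ≤ C) (hg' : ∀ t, |g' t| ≤ C)
    (p : Multiset ℝ × Multiset ℝ) :
    |pairFlux f f' p * pairFlux g g' p| ≤
      C ^ 2 * (1 + (Multiset.card (p.1 + p.2) : ℝ) ^ 2) := by
  rw [abs_mul]
  calc _ ≤ (C * Multiset.card (p.1 + p.2)) * (C * Multiset.card (p.1 + p.2)) :=
        mul_le_mul (abs_pairFlux_le hf hf' p) (abs_pairFlux_le hg hg' p) (abs_nonneg _)
          ((abs_nonneg _).trans (abs_pairFlux_le hf hf' p))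
    _ ≤ _ := by nlinarith [sq_nonneg C]

/-! ### Second-order expansion of characteristic functions -/

section CharFun

variable {α : Type*} [MeasurableSpace α] {P : Measure α}

theorem hasDerivAt_integral_mul_cos {W A B : α → ℝ} (hA : AEStronglyMeasurable A P)
    (hB : AEStronglyMeasurable B P) (hW : Integrable W P)
    (hWB : Integrable (fun a => W a * B a) P) (s₀ : ℝ) :
    HasDerivAt (fun s => ∫ a, W a * Real.cos (A a + s * B a) ∂P)
      (∫ a, W a * (-Real.sin (A a + s₀ * B a) * B a) ∂P) s₀ := by
  have hm : ∀ s : ℝ, AEStronglyMeasurable (fun a => A a + s * B a) P := fun s =>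
    hA.add (hB.const_mul s)
  refine (hasDerivAt_integral_of_dominated_loc_of_deriv_le (𝕜 := ℝ) (s := univ)
    (F := fun s a => W a * Real.cos (A a + s * B a))
    (F' := fun s a => W a * (-Real.sin (A a + s * B a) * B a)) (bound := fun a => |W a * B a|) univ_mem (Eventually.of_forall fun s => ?_) ?_ ?_ ?_
    hWB.abs ?_).2
  · exact hW.1.mul (Real.continuous_cos.comp_aestronglyMeasurable (hm s))
  · refine hW.mono (hW.1.mul (Real.continuous_cos.comp_aestronglyMeasurable (hm s₀)))
      (ae_of_all _ fun a => ?_)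
    rw [norm_mul]
    exact mul_le_of_le_one_right (norm_nonneg _) (Real.abs_cos_le_one _)
  · exact hW.1.mul ((Real.continuous_sin.comp_aestronglyMeasurable (hm s₀)).neg.mul hB)
  · refine ae_of_all _ fun a s _ => ?_
    rw [Real.norm_eq_abs, show W a * (-Real.sin (A a + s * B a) * B a) =
      (W a * B a) * -Real.sin (A a + s * B a) by ring, abs_mul, abs_neg]
    exact mul_le_of_le_one_right (abs_nonneg _) (Real.abs_sin_le_one _)
  · refine ae_of_all _ fun a s _ => ?_
    have h1 : HasDerivAt (fun s : ℝ => A a + s * B a) (B a) s := by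
      simpa using ((hasDerivAt_id s).mul_const (B a)).const_add (A a)
    exact h1.cos.const_mul (W a)

theorem hasDerivAt_integral_mul_sin {W A B : α → ℝ} (hA : AEStronglyMeasurable A P)
    (hB : AEStronglyMeasurable B P) (hW : Integrable W P)
    (hWB : Integrable (fun a => W a * B a) P) (s₀ : ℝ) :
    HasDerivAt (fun s => ∫ a, W a * Real.sin (A a + s * B a) ∂P)
      (∫ a, W a * (Real.cos (A a + s₀ * B a) * B a) ∂P) s₀ := by
  -- The sine is a cosine with the offset `A` lowered by `π / 2`.
  have h := hasDerivAt_integral_mul_cos (hA.sub (aestronglyMeasurable_const (b := Real.pi / 2)))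
    hB hW hWB s₀
  have e : ∀ x y : ℝ, x - Real.pi / 2 + y = (x + y) - Real.pi / 2 := fun x y => by ring
  simp only [Pi.sub_apply, e, Real.cos_sub_pi_div_two, Real.sin_sub_pi_div_two, neg_neg] at h
  exact h

/-- The squared modulus of the characteristic function of `(X, Y)`. -/
def charNormSq (P : Measure α) (X Y : α → ℝ) (p : ℝ × ℝ) : ℝ :=
  ‖∫ a, Complex.exp (Complex.I * ((p.1 * X a + p.2 * Y a : ℝ) : ℂ)) ∂P‖ ^ 2

theorem charNormSq_eq [IsFiniteMeasure P] {X Y : α → ℝ} (hX : AEStronglyMeasurable X P)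
    (hY : AEStronglyMeasurable Y P) (p : ℝ × ℝ) :
    charNormSq P X Y p = (∫ a, Real.cos (p.1 * X a + p.2 * Y a) ∂P) ^ 2 +
      (∫ a, Real.sin (p.1 * X a + p.2 * Y a) ∂P) ^ 2 := by
  have hm : AEStronglyMeasurable (fun a => p.1 * X a + p.2 * Y a) P :=
    (hX.const_mul _).add (hY.const_mul _)
  have hint : Integrable
      (fun a => Complex.exp (Complex.I * ((p.1 * X a + p.2 * Y a : ℝ) : ℂ))) P := by
    refine Integrable.of_bound (C := 1) ?_ (ae_of_all _ fun a => ?_)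
    · exact Complex.continuous_exp.comp_aestronglyMeasurable
        ((Complex.continuous_ofReal.comp_aestronglyMeasurable hm).const_mul _)
    · rw [mul_comm, Complex.norm_exp_ofReal_mul_I]
  rw [charNormSq, Complex.sq_norm, Complex.normSq_apply, ← pow_two, ← pow_two]
  congr 2
  · have := integral_re hint
    simp only [RCLike.re_to_complex] at this
    rw [← this]
    refine integral_congr_ae (ae_of_all _ fun a => ?_)
    simp only
    rw [mul_comm, Complex.exp_ofReal_mul_I_re]
  · have := integral_im hint
    simp only [RCLike.im_to_complex] at this
    rw [← this]
    refine integral_congr_ae (ae_of_all _ fun a => ?_)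
    simp only
    rw [mul_comm, Complex.exp_ofReal_mul_I_im]

/-- The characteristic function of a planar random vector with finite second moments is twice
continuously differentiable. The pair `(X, Y)` is put into Euclidean space so that
`contDiff_charFun` applies to its law. -/
theorem contDiff_charNormSq [IsFiniteMeasure P] {X Y : α → ℝ} (hX : MemLp X 2 P)
    (hY : MemLp Y 2 P) : ContDiff ℝ 2 (charNormSq P X Y) := by
  let Z : α → EuclideanSpace ℝ (Fin 2) := fun a => !₂[X a, Y a]
  have hZm : AEMeasurable Z P := by
    have : AEMeasurable (fun a => ![X a, Y a]) P := by
      refine aemeasurable_pi_lambda _ fun i => ?_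
      fin_cases i
      · exact hX.1.aemeasurable
      · exact hY.1.aemeasurable
    exact (PiLp.continuous_toLp 2 _).measurable.comp_aemeasurable this
  have hZ : MemLp Z 2 P := by
    refine MemLp.mono (g := fun a => |X a| + |Y a|) (hX.abs.add hY.abs)
      hZm.aestronglyMeasurable (ae_of_all _ fun a => ?_)
    rw [Real.norm_eq_abs, abs_of_nonneg (by positivity), EuclideanSpace.norm_eq]
    refine Real.sqrt_le_iff.2 ⟨by positivity, ?_⟩
    simp only [Z, Fin.sum_univ_two, Real.norm_eq_abs, sq_abs]
    simp
    nlinarith [mul_nonneg (abs_nonneg (X a)) (abs_nonneg (Y a)), sq_abs (X a), sq_abs (Y a)]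
  have hQ : MemLp id (2 : ℕ) (P.map Z) := by
    rw [memLp_map_measure_iff aestronglyMeasurable_id hZm]
    exact_mod_cast hZ
  have hc := contDiff_charFun hQ
  let L : ℝ × ℝ →L[ℝ] EuclideanSpace ℝ (Fin 2) :=
    (EuclideanSpace.equiv (Fin 2) ℝ).symm.toContinuousLinearMap.comp
      (ContinuousLinearMap.pi ![ContinuousLinearMap.fst ℝ ℝ ℝ, ContinuousLinearMap.snd ℝ ℝ ℝ])
  have hχ : charNormSq P X Y = fun p => ‖charFun (P.map Z) (L p)‖ ^ 2 := by
    ext p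
    rw [charNormSq, charFun_apply, integral_map hZm]
    · congr 2
      refine integral_congr_ae (ae_of_all _ fun a => ?_)
      simp only
      rw [mul_comm]
      congr 3
      simp [Z, L, PiLp.inner_apply, Fin.sum_univ_two]
    · refine Continuous.aestronglyMeasurable ?_
      fun_prop
  rw [hχ]
  exact ((hc.of_le (by norm_num)).comp L.contDiff).norm_sq ℝ

/-- To second order `|E exp(i(εX + δY))|² = 1 - Var(εX + δY)`, and the mixed derivative of the
variance is twice the covariance. The computation uses the squares of the cosine and sine integrals.
-/
theorem deriv_deriv_charNormSq [IsProbabilityMeasure P] {X Y : α → ℝ} (hX : MemLp X 2 P)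
    (hY : MemLp Y 2 P) :
    deriv (fun ε => deriv (fun δ => charNormSq P X Y (ε, δ)) 0) 0 =
      -2 * (∫ a, X a * Y a ∂P - (∫ a, X a ∂P) * ∫ a, Y a ∂P) := by
  have hX1 : Integrable X P := hX.integrable (by norm_num)
  have hY1 : Integrable Y P := hY.integrable (by norm_num)
  have hYX : Integrable (fun a => Y a * X a) P := hY.integrable_mul hX
  have h0 : AEStronglyMeasurable (fun _ : α => (0 : ℝ)) P := aestronglyMeasurable_const
  have hone : Integrable (fun _ : α => (1 : ℝ)) P := integrable_const _
  have hinner : ∀ ε, deriv (fun δ => charNormSq P X Y (ε, δ)) 0 =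
      2 * (∫ a, 1 * Real.cos (0 + ε * X a) ∂P) * (-∫ a, Y a * Real.sin (0 + ε * X a) ∂P) +
        2 * (∫ a, 1 * Real.sin (0 + ε * X a) ∂P) * (∫ a, Y a * Real.cos (0 + ε * X a) ∂P) := by
    intro ε
    have h1 := hasDerivAt_integral_mul_cos (hX.1.const_mul ε) hY.1 hone (by simpa using hY1) 0
    have h2 := hasDerivAt_integral_mul_sin (hX.1.const_mul ε) hY.1 hone (by simpa using hY1) 0
    have h3 := (h1.pow 2).add (h2.pow 2)
    have hfun : (fun δ => charNormSq P X Y (ε, δ)) =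
        (fun s => ∫ a, 1 * Real.cos (ε * X a + s * Y a) ∂P) ^ 2 +
          (fun s => ∫ a, 1 * Real.sin (ε * X a + s * Y a) ∂P) ^ 2 := by
      ext δ
      rw [charNormSq_eq hX.1 hY.1]
      simp
    rw [hfun, h3.deriv]
    simp only [zero_mul, add_zero, zero_add, one_mul, neg_mul, integral_neg, mul_comm (Y _)]
    ring
  simp only [hinner]
  have d1 := hasDerivAt_integral_mul_cos h0 hX.1 hone (by simpa using hX1) 0
  have d2 := hasDerivAt_integral_mul_sin h0 hX.1 hY1 hYX 0
  have d3 := hasDerivAt_integral_mul_sin h0 hX.1 hone (by simpa using hX1) 0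
  have d4 := hasDerivAt_integral_mul_cos h0 hX.1 hY1 hYX 0
  refine (((d1.const_mul 2).mul d2.neg).add ((d3.const_mul 2).mul d4)).deriv.trans ?_
  simp [mul_comm (Y _)]
  ring

end CharFun

/-! ### The quantum Fisher information of a window -/

/-- The photon-counting distribution of the lossy state. -/
def pairMeasure (t₀ t₁ κ : ℝ) (ψ : Multiset ℝ → ℂ) : Measure (Multiset ℝ × Multiset ℝ) :=
  ((configMeasure t₀ t₁).prod (configMeasure t₀ t₁)).withDensity
    fun p => ENNReal.ofReal (‖lossyKet κ ψ p‖ ^ 2)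

theorem aemeasurable_lossy_sq {t₀ t₁ : ℝ} (κ : ℝ) {ψ : Multiset ℝ → ℂ}
    (hψ : AEStronglyMeasurable ψ (configMeasure t₀ t₁)) :
    AEMeasurable (fun p => ENNReal.ofReal (‖lossyKet κ ψ p‖ ^ 2))
      ((configMeasure t₀ t₁).prod (configMeasure t₀ t₁)) :=
  ((aestronglyMeasurable_lossyKet κ hψ).norm.pow 2).aemeasurable.ennreal_ofReal

theorem integral_pairMeasure {t₀ t₁ κ : ℝ} {ψ : Multiset ℝ → ℂ}
    (hψ : AEStronglyMeasurable ψ (configMeasure t₀ t₁)) {E : Type*} [NormedAddCommGroup E]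
    [NormedSpace ℝ E] (G : Multiset ℝ × Multiset ℝ → E) :
    ∫ p, G p ∂(pairMeasure t₀ t₁ κ ψ) = ∫ p, ‖lossyKet κ ψ p‖ ^ 2 • G p
      ∂((configMeasure t₀ t₁).prod (configMeasure t₀ t₁)) := by
  rw [pairMeasure, integral_withDensity_eq_integral_toReal_smul₀
    (aemeasurable_lossy_sq κ hψ) (ae_of_all _ fun _ => ENNReal.ofReal_lt_top)]
  simp only [ENNReal.toReal_ofReal (sq_nonneg ‖lossyKet κ ψ _‖)]

theorem integrable_pairMeasure {t₀ t₁ κ : ℝ} {ψ : Multiset ℝ → ℂ} (h : FiniteNumber t₀ t₁ ψ)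
    {G : Multiset ℝ × Multiset ℝ → ℝ}
    (hG : AEStronglyMeasurable G ((configMeasure t₀ t₁).prod (configMeasure t₀ t₁))) {C : ℝ}
    (hC : ∀ p, |G p| ≤ C * (1 + (Multiset.card (p.1 + p.2) : ℝ) ^ 2)) :
    Integrable G (pairMeasure t₀ t₁ κ ψ) := by
  rw [pairMeasure, integrable_withDensity_iff_integrable_smul₀'
    (aemeasurable_lossy_sq κ h.memLp.1) (ae_of_all _ fun _ => ENNReal.ofReal_lt_top)]
  refine (h.integrable_lossy κ hG hC).congr (ae_of_all _ fun p => ?_)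
  simp only [ENNReal.toReal_ofReal (sq_nonneg ‖lossyKet κ ψ _‖), smul_eq_mul]
  ring

theorem integral_pairMeasure_eq_expect {t₀ t₁ κ : ℝ} {ψ : Multiset ℝ → ℂ}
    (h : FiniteNumber t₀ t₁ ψ) {G : Multiset ℝ × Multiset ℝ → ℝ}
    (hG : AEStronglyMeasurable G ((configMeasure t₀ t₁).prod (configMeasure t₀ t₁))) {C : ℝ}
    (hC : ∀ p, |G p| ≤ C * (1 + (Multiset.card (p.1 + p.2) : ℝ) ^ 2)) :
    ∫ p, G p ∂(pairMeasure t₀ t₁ κ ψ) = expect t₀ t₁ ψ (splitAvg (Real.cos κ ^ 2) G) := by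
  rw [integral_pairMeasure h.memLp.1, ← h.integral_lossy κ hG hC]
  simp only [smul_eq_mul, mul_comm]

theorem isProbabilityMeasure_pairMeasure {t₀ t₁ κ : ℝ} {ψ : Multiset ℝ → ℂ}
    (h : FiniteNumber t₀ t₁ ψ) (h1 : expect t₀ t₁ ψ (fun _ => 1) = 1) :
    IsProbabilityMeasure (pairMeasure t₀ t₁ κ ψ) := by
  have hC : ∀ p : Multiset ℝ × Multiset ℝ,
      |(1 : ℝ)| ≤ 1 * (1 + (Multiset.card (p.1 + p.2) : ℝ) ^ 2) := fun p => by
    rw [abs_one]; nlinarith [sq_nonneg (Multiset.card (p.1 + p.2) : ℝ)]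
  have hi : Integrable (fun _ => (1 : ℝ)) (pairMeasure t₀ t₁ κ ψ) :=
    integrable_pairMeasure h aestronglyMeasurable_const hC
  have h2 := integral_pairMeasure_eq_expect (κ := κ) h aestronglyMeasurable_const hC
  have hfin : IsFiniteMeasure (pairMeasure t₀ t₁ κ ψ) := by
    rw [integrable_const_iff] at hi
    simpa using hi
  simp only [funext fun σ => splitAvg_one (Real.cos κ ^ 2) σ, h1, integral_const, smul_eq_mul,
    mul_one] at h2
  exact ⟨by rw [← ENNReal.toReal_eq_one_iff]; exact h2⟩

/-- A bounded measurable function. -/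
def BddMeas (f : ℝ → ℝ) : Prop := Measurable f ∧ ∃ C, ∀ t, |f t| ≤ C

theorem BddMeas.add {f g : ℝ → ℝ} (hf : BddMeas f) (hg : BddMeas g) :
    BddMeas fun t => f t + g t := by
  obtain ⟨hf, C, hC⟩ := hf
  obtain ⟨hg, D, hD⟩ := hg
  exact ⟨hf.add hg, C + D, fun t => (abs_add_le _ _).trans (add_le_add (hC t) (hD t))⟩

theorem BddMeas.mul {f g : ℝ → ℝ} (hf : BddMeas f) (hg : BddMeas g) :
    BddMeas fun t => f t * g t := by
  obtain ⟨hf, C, hC⟩ := hf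
  obtain ⟨hg, D, hD⟩ := hg
  refine ⟨hf.mul hg, C * D, fun t => ?_⟩
  rw [abs_mul]
  exact mul_le_mul (hC t) (hD t) (abs_nonneg _) ((abs_nonneg _).trans (hC t))

theorem bddMeas_const (c : ℝ) : BddMeas fun _ => c := ⟨measurable_const, |c|, fun _ => le_rfl⟩

theorem BddMeas.neg {f : ℝ → ℝ} (hf : BddMeas f) : BddMeas fun t => -f t := by
  simpa using (bddMeas_const (-1)).mul hf

theorem BddMeas.sub {f g : ℝ → ℝ} (hf : BddMeas f) (hg : BddMeas g) :
    BddMeas fun t => f t - g t := by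
  simpa [sub_eq_add_neg] using hf.add hg.neg

theorem IsTestWaveform.bddMeas {h : ℝ → ℝ} (hh : IsTestWaveform h) : BddMeas h :=
  ⟨hh.measurable, hh.bounded⟩

theorem exists_common_bound {f g : ℝ → ℝ} (hf : BddMeas f) (hg : BddMeas g) :
    ∃ C, 0 ≤ C ∧ (∀ t, |f t| ≤ C) ∧ ∀ t, |g t| ≤ C := by
  obtain ⟨-, C, hC⟩ := hf
  obtain ⟨-, D, hD⟩ := hg
  exact ⟨max C D, ((abs_nonneg _).trans (hC 0)).trans (le_max_left _ _),
    fun t => (hC t).trans (le_max_left _ _), fun t => (hD t).trans (le_max_right _ _)⟩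

theorem integrable_pairFlux {t₀ t₁ κ : ℝ} {ψ : Multiset ℝ → ℂ} (h : FiniteNumber t₀ t₁ ψ)
    {f f' : ℝ → ℝ} (hf : BddMeas f) (hf' : BddMeas f') :
    Integrable (pairFlux f f') (pairMeasure t₀ t₁ κ ψ) ∧
    ∫ p, pairFlux f f' p ∂(pairMeasure t₀ t₁ κ ψ) =
      expect t₀ t₁ ψ (flux fun t => Real.cos κ ^ 2 * f t + (1 - Real.cos κ ^ 2) * f' t) := by
  obtain ⟨C, hC0, hC, hC'⟩ := exists_common_bound hf hf'
  have hm := (measurable_pairFlux hf.1 hf'.1).aestronglyMeasurable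
    (μ := (configMeasure t₀ t₁).prod (configMeasure t₀ t₁))
  have hb : ∀ p, |pairFlux f f' p| ≤ C * (1 + (Multiset.card (p.1 + p.2) : ℝ) ^ 2) := fun p =>
    (abs_pairFlux_le hC hC' p).trans (mul_le_one_add_sq C hC0 _)
  refine ⟨integrable_pairMeasure h hm hb, ?_⟩
  rw [integral_pairMeasure_eq_expect h hm hb]
  simp only [funext fun σ => splitAvg_pairFlux (Real.cos κ ^ 2) f f' σ]

theorem integrable_pairFlux_mul {t₀ t₁ κ : ℝ} {ψ : Multiset ℝ → ℂ} (h : FiniteNumber t₀ t₁ ψ)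
    {f f' g g' : ℝ → ℝ} (hf : BddMeas f) (hf' : BddMeas f') (hg : BddMeas g) (hg' : BddMeas g') :
    Integrable (fun p => pairFlux f f' p * pairFlux g g' p) (pairMeasure t₀ t₁ κ ψ) ∧
    ∫ p, pairFlux f f' p * pairFlux g g' p ∂(pairMeasure t₀ t₁ κ ψ) =
      expect t₀ t₁ ψ (fun σ =>
        flux (fun t => Real.cos κ ^ 2 * f t + (1 - Real.cos κ ^ 2) * f' t) σ *
          flux (fun t => Real.cos κ ^ 2 * g t + (1 - Real.cos κ ^ 2) * g' t) σ) +
      expect t₀ t₁ ψ (flux fun t =>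
        Real.cos κ ^ 2 * (1 - Real.cos κ ^ 2) * ((f t - f' t) * (g t - g' t))) := by
  obtain ⟨C, hC0, hC, hC'⟩ := exists_common_bound hf hf'
  obtain ⟨D, hD0, hD, hD'⟩ := exists_common_bound hg hg'
  have hm := ((measurable_pairFlux hf.1 hf'.1).mul
    (measurable_pairFlux hg.1 hg'.1)).aestronglyMeasurable
    (μ := (configMeasure t₀ t₁).prod (configMeasure t₀ t₁))
  have hb := abs_pairFlux_mul_le (C := max C D) (fun t => (hC t).trans (le_max_left _ _))
    (fun t => (hC' t).trans (le_max_left _ _)) (fun t => (hD t).trans (le_max_right _ _))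
    (fun t => (hD' t).trans (le_max_right _ _))
  refine ⟨integrable_pairMeasure h hm hb, ?_⟩
  refine (integral_pairMeasure_eq_expect h hm hb).trans ?_
  have hs : (splitAvg (Real.cos κ ^ 2) fun p => pairFlux f f' p * pairFlux g g' p) = _ :=
    funext fun σ => splitAvg_pairFlux_mul (Real.cos κ ^ 2) f f' g g' σ
  have hs' : splitAvg (Real.cos κ ^ 2) (pairFlux f f' * pairFlux g g') = _ := hs
  rw [hs', expect, expect, expect]
  set mf := fun t => Real.cos κ ^ 2 * f t + (1 - Real.cos κ ^ 2) * f' t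
  set mg := fun t => Real.cos κ ^ 2 * g t + (1 - Real.cos κ ^ 2) * g' t
  have hmf : BddMeas mf := ((bddMeas_const _).mul hf).add ((bddMeas_const _).mul hf')
  have hmg : BddMeas mg := ((bddMeas_const _).mul hg).add ((bddMeas_const _).mul hg')
  have hd : BddMeas fun t =>
      Real.cos κ ^ 2 * (1 - Real.cos κ ^ 2) * ((f t - f' t) * (g t - g' t)) :=
    (bddMeas_const _).mul ((hf.sub hf').mul (hg.sub hg'))
  obtain ⟨A, hA0, hA, hA'⟩ := exists_common_bound hmf hmg
  obtain ⟨B, hB0, hB, -⟩ := exists_common_bound hd hd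
  have hi1 : Integrable (fun σ => (flux mf σ * flux mg σ) * ‖ψ σ‖ ^ 2) (configMeasure t₀ t₁) := by
    refine h.integrable_mul (C := A ^ 2) ((measurable_flux hmf.1).mul
      (measurable_flux hmg.1)).aestronglyMeasurable fun σ => ?_
    rw [abs_mul]
    calc _ ≤ (A * Multiset.card σ) * (A * Multiset.card σ) :=
          mul_le_mul (abs_flux_le hA σ) (abs_flux_le hA' σ) (abs_nonneg _)
            ((abs_nonneg _).trans (abs_flux_le hA σ))
      _ ≤ _ := by nlinarith [sq_nonneg A]
  have hi2 := h.integrable_mul (C := B) (measurable_flux hd.1).aestronglyMeasurable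
    fun σ => (abs_flux_le hB σ).trans (mul_le_one_add_sq B hB0 _)
  rw [← integral_add hi1 hi2]
  simp only [add_mul]

theorem memLp_pairFlux {t₀ t₁ κ : ℝ} {ψ : Multiset ℝ → ℂ} (h : FiniteNumber t₀ t₁ ψ)
    {f f' : ℝ → ℝ} (hf : BddMeas f) (hf' : BddMeas f') :
    MemLp (pairFlux f f') 2 (pairMeasure t₀ t₁ κ ψ) := by
  rw [memLp_two_iff_integrable_sq (measurable_pairFlux hf.1 hf'.1).aestronglyMeasurable]
  simpa only [pow_two] using (integrable_pairFlux_mul h hf hf' hf hf').1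

theorem IsStationarySource.finiteNumber {ψ : ℝ → ℝ → Multiset ℝ → ℂ} {Imean : ℝ} {S : ℝ → ℝ}
    (hs : IsStationarySource ψ Imean S) {t₀ t₁ : ℝ} (h : t₀ < t₁) : FiniteNumber t₀ t₁ (ψ t₀ t₁) :=
  ⟨hs.memLp t₀ t₁ h, hs.second_moment t₀ t₁ h⟩

theorem IsStationarySource.isProbabilityMeasure {ψ : ℝ → ℝ → Multiset ℝ → ℂ} {Imean : ℝ}
    {S : ℝ → ℝ} (hs : IsStationarySource ψ Imean S) {t₀ t₁ : ℝ} (h : t₀ < t₁) (κ : ℝ) :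
    IsProbabilityMeasure (pairMeasure t₀ t₁ κ (ψ t₀ t₁)) :=
  isProbabilityMeasure_pairMeasure (hs.finiteNumber h) (hs.norm_eq t₀ t₁ h)

/-- The covariance of two photon-counting observables of the lossy state. -/
def pairCov (t₀ t₁ κ : ℝ) (ψ : Multiset ℝ → ℂ) (X Y : Multiset ℝ × Multiset ℝ → ℝ) : ℝ :=
  ∫ p, X p * Y p ∂(pairMeasure t₀ t₁ κ ψ) -
    (∫ p, X p ∂(pairMeasure t₀ t₁ κ ψ)) * ∫ p, Y p ∂(pairMeasure t₀ t₁ κ ψ)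

/-- The source part of the covariance is spectral, the loss contributes shot noise. -/
theorem IsStationarySource.pairCov_eq {ψ : ℝ → ℝ → Multiset ℝ → ℂ} {Imean : ℝ}
    {S : ℝ → ℝ} (hs : IsStationarySource ψ Imean S) {t₀ t₁ : ℝ} (h : t₀ < t₁) (κ : ℝ)
    {f f' g g' : ℝ → ℝ} (hf : BddMeas f) (hf' : BddMeas f') (hg : BddMeas g) (hg' : BddMeas g') :
    (pairCov t₀ t₁ κ (ψ t₀ t₁) (pairFlux f f') (pairFlux g g') : ℂ) =
      (1 / (2 * Real.pi) : ℂ) * (∫ ω, (S ω : ℂ) *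
        spec ((Icc t₀ t₁).indicator
          fun t => Real.cos κ ^ 2 * f t + (1 - Real.cos κ ^ 2) * f' t) ω *
        conj (spec ((Icc t₀ t₁).indicator
          fun t => Real.cos κ ^ 2 * g t + (1 - Real.cos κ ^ 2) * g' t) ω)) +
      ((Real.cos κ ^ 2 * (1 - Real.cos κ ^ 2) * Imean *
        ∫ t in Icc t₀ t₁, (f t - f' t) * (g t - g' t) : ℝ) : ℂ) := by
  have hfn := hs.finiteNumber h
  have hmf : BddMeas fun t => Real.cos κ ^ 2 * f t + (1 - Real.cos κ ^ 2) * f' t :=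
    ((bddMeas_const _).mul hf).add ((bddMeas_const _).mul hf')
  have hmg : BddMeas fun t => Real.cos κ ^ 2 * g t + (1 - Real.cos κ ^ 2) * g' t :=
    ((bddMeas_const _).mul hg).add ((bddMeas_const _).mul hg')
  have hd : BddMeas fun t =>
      Real.cos κ ^ 2 * (1 - Real.cos κ ^ 2) * ((f t - f' t) * (g t - g' t)) :=
    (bddMeas_const _).mul ((hf.sub hf').mul (hg.sub hg'))
  rw [← (hs.covariance t₀ t₁ h _ _ hmf.1 hmf.2 hmg.1 hmg.2).2, pairCov,
    (integrable_pairFlux_mul hfn hf hf' hg hg').2, (integrable_pairFlux hfn hf hf').2,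
    (integrable_pairFlux hfn hg hg').2, hs.mean t₀ t₁ h _ hd.1 hd.2, ← Complex.ofReal_add]
  congr 1
  rw [integral_const_mul]
  ring

/-! ### The auxiliary phase on a window and the fidelity of the purifications. -/

theorem abs_auxPhase_le (t₀ t₁ : ℝ) {lam f : ℝ → ℝ} (hl : Integrable lam) {C : ℝ}
    (hC : ∀ t, |f t| ≤ C) (t : ℝ) : |auxPhase t₀ t₁ lam f t| ≤ C * ∫ s, |lam s| := by
  have hC0 : 0 ≤ C := (abs_nonneg _).trans (hC 0)
  have hi : Integrable fun τ => C * |lam (t - τ)| := (hl.comp_sub_left t).abs.const_mul C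
  calc |auxPhase t₀ t₁ lam f t| ≤ ∫ τ in Icc t₀ t₁, C * |lam (t - τ)| := by
        rw [← Real.norm_eq_abs]
        refine norm_integral_le_of_norm_le hi.integrableOn (ae_of_all _ fun τ => ?_)
        rw [Real.norm_eq_abs, abs_mul, mul_comm]
        exact mul_le_mul_of_nonneg_right (hC τ) (abs_nonneg _)
    _ ≤ ∫ τ, C * |lam (t - τ)| :=
        setIntegral_le_integral hi (ae_of_all _ fun τ => mul_nonneg hC0 (abs_nonneg _))
    _ = C * ∫ s, |lam s| := by
        rw [integral_const_mul, integral_sub_left_eq_self (fun s => |lam s|) volume t]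

/-- The kernel is measurable only up to a null set. Replacing it by a measurable version changes no
value of the integral, because `τ ↦ t - τ` pulls null sets back to null sets for each `t`. -/
theorem measurable_integral_sub_mul (μ : Measure ℝ) (hμ : μ ≪ volume) [SFinite μ] {k f : ℝ → ℝ}
    (hk : AEStronglyMeasurable k volume) (hf : Measurable f) :
    Measurable fun t => ∫ τ, k (t - τ) * f τ ∂μ := by
  have h1 : ∀ t, ∫ τ, k (t - τ) * f τ ∂μ = ∫ τ, hk.mk k (t - τ) * f τ ∂μ := by
    intro t
    refine integral_congr_ae (hμ.ae_le ?_)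
    filter_upwards [(quasiMeasurePreserving_sub_left volume t).ae_eq_comp hk.ae_eq_mk] with τ hτ
    simp only [Function.comp_apply] at hτ
    rw [hτ]
  simp only [h1]
  refine StronglyMeasurable.measurable ?_
  refine StronglyMeasurable.integral_prod_right'
    (f := fun q : ℝ × ℝ => hk.mk k (q.1 - q.2) * f q.2) ?_
  exact ((hk.stronglyMeasurable_mk.measurable.comp (measurable_fst.sub measurable_snd)).mul
    (hf.comp measurable_snd)).stronglyMeasurable

theorem bddMeas_auxPhase (t₀ t₁ : ℝ) {lam f : ℝ → ℝ} (hl : Integrable lam) (hf : BddMeas f) :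
    BddMeas (auxPhase t₀ t₁ lam f) := by
  obtain ⟨hf, C, hC⟩ := hf
  exact ⟨measurable_integral_sub_mul _ Measure.absolutelyContinuous_restrict hl.1 hf,
    _, abs_auxPhase_le t₀ t₁ hl hC⟩

/-- For a merely locally integrable waveform and an integrable kernel the convolution converges only
for almost every `t`. That is enough, since almost every configuration avoids the exceptional times.
-/
theorem ae_integrable_auxPhase (t₀ t₁ : ℝ) {lam φ : ℝ → ℝ} (hl : Integrable lam)
    (hφ : LocallyIntegrable φ) :
    ∀ᵐ t, IntegrableOn (fun τ => lam (t - τ) * φ τ) (Icc t₀ t₁) := by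
  have h1 : Integrable ((Icc t₀ t₁).indicator φ) :=
    (integrable_indicator_iff measurableSet_Icc).2 (hφ.integrableOn_isCompact isCompact_Icc)
  have h2 := Integrable.ae_convolution_exists (ContinuousLinearMap.mul ℝ ℝ) h1 hl
  filter_upwards [h2] with t ht
  have h3 : Integrable (fun τ => (Icc t₀ t₁).indicator φ τ * lam (t - τ)) := ht
  refine (integrable_indicator_iff measurableSet_Icc).1 ?_
  refine h3.congr (ae_of_all _ fun τ => ?_)
  by_cases hτ : τ ∈ Icc t₀ t₁
  · simp [hτ, mul_comm]
  · simp [hτ]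

theorem integrableOn_auxPhase (t₀ t₁ : ℝ) {lam f : ℝ → ℝ} (hl : Integrable lam) (hf : BddMeas f)
    (t : ℝ) : IntegrableOn (fun τ => lam (t - τ) * f τ) (Icc t₀ t₁) := by
  obtain ⟨hf, C, hC⟩ := hf
  refine (Integrable.mul_bdd (c := C) (hl.comp_sub_left t) hf.aestronglyMeasurable
    (ae_of_all _ hC)).integrableOn

/-- In the basis of photon times both purifications differ from `lossyKet` by a phase factor. In the
overlap the phases due to `φ` cancel, and what remains is the expectation of `exp(i(εX + δY))` under
the photon-counting distribution. -/
theorem phaseFidelity_eq {t₀ t₁ κ : ℝ} {ψ : Multiset ℝ → ℂ} (hψ : FiniteNumber t₀ t₁ ψ)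
    {lam φ h k : ℝ → ℝ} (hl : Integrable lam) (hφ : LocallyIntegrable φ) (hh : BddMeas h)
    (hk : BddMeas k) : phaseFidelity t₀ t₁ κ ψ lam φ h k = charNormSq (pairMeasure t₀ t₁ κ ψ)
      (pairFlux h fun t => -auxPhase t₀ t₁ lam h t)
      (pairFlux k fun t => -auxPhase t₀ t₁ lam k t) := by
  ext p
  rw [phaseFidelity, fidelity, charNormSq, integral_pairMeasure hψ.memLp.1]
  congr 2
  refine integral_congr_ae ?_
  -- The auxiliary phase is additive in the waveform only at times where the integral with `φ`
  -- converges. Almost every configuration of `B` consists of such times.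
  have h1 : ∀ᵐ τ ∂(configMeasure t₀ t₁), ∀ t ∈ τ,
      IntegrableOn (fun τ => lam (t - τ) * φ τ) (Icc t₀ t₁) :=
    ae_configMeasure_of_ae (ae_restrict_of_ae (ae_integrable_auxPhase t₀ t₁ hl hφ))
  have h2 : ∀ᵐ c ∂((configMeasure t₀ t₁).prod (configMeasure t₀ t₁)), ∀ t ∈ c.2,
      IntegrableOn (fun τ => lam (t - τ) * φ τ) (Icc t₀ t₁) :=
    Measure.quasiMeasurePreserving_snd.ae h1
  filter_upwards [h2] with c hc
  have h3 : flux (auxPhase t₀ t₁ lam fun t => φ t + p.1 * h t + p.2 * k t) c.2 =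
      flux (auxPhase t₀ t₁ lam φ) c.2 + p.1 * flux (auxPhase t₀ t₁ lam h) c.2 +
        p.2 * flux (auxPhase t₀ t₁ lam k) c.2 := by
    rw [← flux_const_mul, ← flux_const_mul, ← flux_add_fun, ← flux_add_fun]
    refine flux_congr fun t ht => ?_
    have e : ∀ τ, lam (t - τ) * (φ τ + p.1 * h τ + p.2 * k τ) =
        lam (t - τ) * φ τ + p.1 * (lam (t - τ) * h τ) + p.2 * (lam (t - τ) * k τ) := fun τ => by
      ring
    simp only [auxPhase, e]
    have i1 := integrableOn_auxPhase t₀ t₁ hl hh t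
    have i2 := integrableOn_auxPhase t₀ t₁ hl hk t
    have i3 : Integrable (fun τ => lam (t - τ) * φ τ + p.1 * (lam (t - τ) * h τ))
        (volume.restrict (Icc t₀ t₁)) := Integrable.add (hc t ht) (i1.const_mul _)
    rw [integral_add i3 (i2.const_mul _),
      integral_add (hc t ht) (i1.const_mul _), integral_const_mul, integral_const_mul]
  have h4 : flux (fun t => φ t + p.1 * h t + p.2 * k t) c.1 =
      flux φ c.1 + p.1 * flux h c.1 + p.2 * flux k c.1 := by
    rw [← flux_const_mul, ← flux_const_mul, ← flux_add_fun, ← flux_add_fun]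
  have hneg : ∀ (f : ℝ → ℝ) (σ : Multiset ℝ), flux (fun t => -f t) σ = -flux f σ := fun f σ => by
    simpa using flux_const_mul (-1) f σ
  rw [purifiedKet_apply, purifiedKet_apply, h3, h4, map_mul, ← Complex.exp_conj, map_mul,
    Complex.conj_I, Complex.conj_ofReal, Complex.real_smul, mul_mul_mul_comm, ← Complex.exp_add,
    ← Complex.normSq_eq_conj_mul_self, Complex.normSq_eq_norm_sq, mul_comm]
  congr 2
  simp only [pairFlux, hneg]
  push_cast
  ring

theorem qfi_eq {t₀ t₁ κ : ℝ} {ψ : Multiset ℝ → ℂ} (hψ : FiniteNumber t₀ t₁ ψ)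
    (h1 : expect t₀ t₁ ψ (fun _ => 1) = 1)
    {lam φ h k : ℝ → ℝ} (hl : Integrable lam) (hφ : LocallyIntegrable φ) (hh : BddMeas h)
    (hk : BddMeas k) : qfi t₀ t₁ κ ψ lam φ h k = 4 * pairCov t₀ t₁ κ ψ
      (pairFlux h fun t => -auxPhase t₀ t₁ lam h t)
      (pairFlux k fun t => -auxPhase t₀ t₁ lam k t) := by
  have := isProbabilityMeasure_pairMeasure (κ := κ) hψ h1
  rw [qfi, phaseFidelity_eq hψ hl hφ hh hk,
    deriv_deriv_charNormSq (memLp_pairFlux hψ hh (bddMeas_auxPhase t₀ t₁ hl hh).neg)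
      (memLp_pairFlux hψ hk (bddMeas_auxPhase t₀ t₁ hl hk).neg), pairCov]
  ring

theorem contDiff_phaseFidelity {t₀ t₁ κ : ℝ} {ψ : Multiset ℝ → ℂ} (hψ : FiniteNumber t₀ t₁ ψ)
    (h1 : expect t₀ t₁ ψ (fun _ => 1) = 1)
    {lam φ h k : ℝ → ℝ} (hl : Integrable lam) (hφ : LocallyIntegrable φ) (hh : BddMeas h)
    (hk : BddMeas k) : ContDiff ℝ 2 (phaseFidelity t₀ t₁ κ ψ lam φ h k) := by
  have := isProbabilityMeasure_pairMeasure (κ := κ) hψ h1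
  rw [phaseFidelity_eq hψ hl hφ hh hk]
  exact contDiff_charNormSq (memLp_pairFlux hψ hh (bddMeas_auxPhase t₀ t₁ hl hh).neg)
      (memLp_pairFlux hψ hk (bddMeas_auxPhase t₀ t₁ hl hk).neg)

/-! ### The Fourier transform -/

open FourierTransform

theorem continuous_fourier_of_integrable {f : ℝ → ℂ} (hf : Integrable f) : Continuous (𝓕 f) :=
  VectorFourier.fourierIntegral_continuous (L := innerₗ ℝ) Real.continuous_fourierChar
    continuous_inner hf

/-- The integrable and square-integrable Fourier transforms coincide. -/
theorem fourier_toLp_ae_eq {f : ℝ → ℂ} (hf : Integrable f) (hf2 : MemLp f 2) :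
    (𝓕 (hf2.toLp f) : Lp ℂ 2 (volume : Measure ℝ)) =ᵐ[volume] 𝓕 f := by
  have hc : Continuous (𝓕 f) := continuous_fourier_of_integrable hf
  -- Both transforms are tested against smooth functions of compact support. The square-integrable
  -- one moves onto the test function as a tempered distribution, the integrable one by Fubini.
  refine ae_eq_of_integral_contDiff_smul_eq
    ((Lp.memLp _).locallyIntegrable (by norm_num)) hc.locallyIntegrable fun g hg hgc => ?_
  have hg₁ : HasCompactSupport (Complex.ofRealCLM ∘ g) := hgc.comp_left rfl
  have hg₂ : ContDiff ℝ (⊤ : ℕ∞) (Complex.ofRealCLM ∘ g) := by fun_prop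
  let G := hg₁.toSchwartzMap hg₂
  have h1 := congrArg (fun u => u G) (Lp.fourier_toTemperedDistribution_eq (hf2.toLp f))
  simp only [TemperedDistribution.fourier_apply, Lp.toTemperedDistribution_apply] at h1
  have h2 : ∫ x, 𝓕 G x • f x = ∫ x, G x • 𝓕 f x :=
    (VectorFourier.integral_fourierIntegral_smul_eq_flip (L := innerₗ ℝ)
      Real.continuous_fourierChar continuous_inner G.integrable hf).trans (by
        rw [flip_innerₗ]; rfl)
  have h3 : ∫ x, 𝓕 G x • (hf2.toLp f) x = ∫ x, 𝓕 G x • f x :=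
    integral_congr_ae (by filter_upwards [hf2.coeFn_toLp] with x hx; rw [hx])
  rw [h3, h2] at h1
  exact h1.symm

/-- Passes from the convention `exp(iωt)` to `exp(-2πi w t)`, whence `w = -ω / (2π)`. The Jacobian
of this substitution is the source of the factors `2π` below. -/
theorem spec_eq_fourier (f : ℝ → ℝ) (ω : ℝ) :
    spec f ω = 𝓕 (fun t => (f t : ℂ)) (ω * (-(2 * Real.pi)⁻¹)) := by
  rw [spec, Real.fourier_real_eq_integral_exp_smul]
  refine integral_congr_ae (ae_of_all _ fun t => ?_)
  simp only [smul_eq_mul]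
  rw [mul_comm]
  congr 2
  have hp : (Real.pi : ℂ) ≠ 0 := by exact_mod_cast Real.pi_ne_zero
  push_cast
  field_simp

theorem continuous_spec {f : ℝ → ℝ} (hf : Integrable f) : Continuous (spec f) := by
  have h : Continuous (𝓕 fun t => (f t : ℂ)) := continuous_fourier_of_integrable hf.ofReal
  rw [funext (spec_eq_fourier f)]
  exact h.comp (continuous_id.mul continuous_const)

theorem norm_spec_le (f : ℝ → ℝ) (ω : ℝ) : ‖spec f ω‖ ≤ ∫ t, |f t| := by
  refine (norm_integral_le_integral_norm _).trans (le_of_eq ?_)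
  refine integral_congr_ae (ae_of_all _ fun t => ?_)
  simp only [norm_mul, Complex.norm_real, Real.norm_eq_abs]
  rw [show Complex.I * (ω : ℂ) * (t : ℂ) = ((ω * t : ℝ) : ℂ) * Complex.I by push_cast; ring,
    Complex.norm_exp_ofReal_mul_I, mul_one]

theorem conj_spec (f : ℝ → ℝ) (ω : ℝ) : conj (spec f ω) = spec f (-ω) := by
  rw [spec, spec, ← integral_conj]
  refine integral_congr_ae (ae_of_all _ fun t => ?_)
  simp only [map_mul, Complex.conj_ofReal, ← Complex.exp_conj, Complex.conj_I]
  congr 2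
  push_cast
  ring

theorem integrable_spec_integrand {f : ℝ → ℝ} (hf : Integrable f) (ω : ℝ) :
    Integrable fun t => (f t : ℂ) * Complex.exp (Complex.I * ω * t) := by
  refine Integrable.mul_bdd (c := 1) hf.ofReal ?_ (ae_of_all _ fun t => ?_)
  · exact (by fun_prop : Continuous fun t : ℝ => Complex.exp (Complex.I * ω * t)).aestronglyMeasurable
  · rw [show Complex.I * (ω : ℂ) * (t : ℂ) = ((ω * t : ℝ) : ℂ) * Complex.I by push_cast; ring,
      Complex.norm_exp_ofReal_mul_I]

theorem spec_add {f g : ℝ → ℝ} (hf : Integrable f) (hg : Integrable g) (ω : ℝ) :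
    spec (fun t => f t + g t) ω = spec f ω + spec g ω := by
  rw [spec, spec, spec, ← integral_add (integrable_spec_integrand hf ω)
    (integrable_spec_integrand hg ω)]
  refine integral_congr_ae (ae_of_all _ fun t => ?_)
  simp only
  push_cast
  ring

theorem spec_const_mul (c : ℝ) (f : ℝ → ℝ) (ω : ℝ) :
    spec (fun t => c * f t) ω = c * spec f ω := by
  rw [spec, spec, ← integral_const_mul]
  refine integral_congr_ae (ae_of_all _ fun t => ?_)
  simp only
  push_cast
  ring

theorem spec_sub {f g : ℝ → ℝ} (hf : Integrable f) (hg : Integrable g) (ω : ℝ) :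
    spec (fun t => f t - g t) ω = spec f ω - spec g ω := by
  have h := spec_add hf (hg.const_mul (-1)) ω
  rw [spec_const_mul] at h
  rw [show (fun t => f t - g t) = fun t => f t + -1 * g t by ext t; ring, h]
  push_cast
  ring

theorem spec_comp_sub (f : ℝ → ℝ) (s ω : ℝ) :
    spec (fun t => f (t - s)) ω = Complex.exp (Complex.I * ω * s) * spec f ω := by
  rw [spec, spec, ← integral_const_mul,
    ← integral_sub_right_eq_self
      (fun t => Complex.exp (Complex.I * ω * s) * ((f t : ℂ) * Complex.exp (Complex.I * ω * t))) s]
  refine integral_congr_ae (ae_of_all _ fun t => ?_)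
  simp only
  rw [mul_left_comm, ← Complex.exp_add]
  congr 2
  push_cast
  ring

theorem memLp_spec {f : ℝ → ℝ} (hf : Integrable f) (hf2 : MemLp f 2) : MemLp (spec f) 2 := by
  rw [memLp_two_iff_integrable_sq_norm (continuous_spec hf).aestronglyMeasurable]
  have h1 := fourier_toLp_ae_eq hf.ofReal (hf2.ofReal (K := ℂ))
  have h2 : MemLp (𝓕 fun t => (f t : ℂ)) 2 := (memLp_congr_ae h1).1 (Lp.memLp _)
  have h3 := (memLp_two_iff_integrable_sq_norm h2.1).1 h2
  have h4 := h3.comp_mul_right' (R := -(2 * Real.pi)⁻¹) (by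
    have := Real.pi_pos; exact neg_ne_zero.2 (by positivity))
  simp only [spec_eq_fourier]
  exact h4

theorem integral_spec_mul_conj {f g : ℝ → ℝ} (hf : Integrable f) (hf2 : MemLp f 2)
    (hg : Integrable g) (hg2 : MemLp g 2) :
    ∫ ω, spec f ω * conj (spec g ω) = ((2 * Real.pi * ∫ t, f t * g t : ℝ) : ℂ) := by
  have hF : MemLp (fun t => (f t : ℂ)) 2 := hf2.ofReal
  have hG : MemLp (fun t => (g t : ℂ)) 2 := hg2.ofReal
  have hf' : Integrable fun t => (f t : ℂ) := hf.ofReal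
  have hg' : Integrable fun t => (g t : ℂ) := hg.ofReal
  have h1 := fourier_toLp_ae_eq hf' hF
  have h2 := fourier_toLp_ae_eq hg' hG
  have h3 := Lp.inner_fourier_eq (hG.toLp _) (hF.toLp _)
  rw [L2.inner_def, L2.inner_def] at h3
  have h4 : ∫ w, 𝓕 (fun t => (f t : ℂ)) w * conj (𝓕 (fun t => (g t : ℂ)) w) =
      ((∫ t, f t * g t : ℝ) : ℂ) := by
    rw [← integral_complex_ofReal]
    refine Eq.trans (integral_congr_ae ?_) (h3.trans (integral_congr_ae ?_))
    · filter_upwards [h1, h2] with w hw1 hw2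
      rw [← hw1, ← hw2]
      exact (RCLike.inner_apply _ _).symm
    · filter_upwards [hF.coeFn_toLp, hG.coeFn_toLp] with t h5 h6
      rw [h5, h6, RCLike.inner_apply]
      simp
  simp only [spec_eq_fourier]
  rw [Measure.integral_comp_mul_right
    (fun w => 𝓕 (fun t => (f t : ℂ)) w * conj (𝓕 (fun t => (g t : ℂ)) w)), h4]
  have := Real.pi_pos
  rw [inv_neg, inv_inv, abs_neg, abs_of_pos (by positivity), Complex.real_smul,
    ← Complex.ofReal_mul]

/-- The convolution of two real functions. -/
def conv (f g : ℝ → ℝ) (t : ℝ) : ℝ := ∫ τ, f (t - τ) * g τ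

theorem integrable_conv {f g : ℝ → ℝ} (hf : Integrable f) (hg : Integrable g) :
    Integrable (conv f g) := by
  have := Integrable.integrable_convolution (ContinuousLinearMap.mul ℝ ℝ) hg hf
  refine this.congr (ae_of_all _ fun t => ?_)
  refine integral_congr_ae (ae_of_all _ fun τ => ?_)
  simp [mul_comm]

theorem spec_conv {f g : ℝ → ℝ} (hf : Integrable f) (hg : Integrable g) (ω : ℝ) :
    spec (conv f g) ω = spec f ω * spec g ω := by
  have hf' : Integrable fun t => (f t : ℂ) := hf.ofReal
  have hg' : Integrable fun t => (g t : ℂ) := hg.ofReal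
  simp only [spec_eq_fourier]
  rw [mul_comm (𝓕 (fun t => (f t : ℂ)) _), ← Real.fourier_mul_convolution_eq hg' hf']
  refine congrArg (fun F : ℝ → ℂ => 𝓕 F _) (funext fun t => ?_)
  rw [conv, ← integral_complex_ofReal]
  refine integral_congr_ae (ae_of_all _ fun τ => ?_)
  simp [mul_comm]

/-- A smooth function of compact support. -/
def IsBump (h : ℝ → ℝ) : Prop := ContDiff ℝ (⊤ : ℕ∞) h ∧ HasCompactSupport h

theorem IsBump.integrable {h : ℝ → ℝ} (hh : IsBump h) : Integrable h :=
  hh.1.continuous.integrable_of_hasCompactSupport hh.2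

theorem IsBump.integrable_spec {h : ℝ → ℝ} (hh : IsBump h) : Integrable (spec h) := by
  have hg₁ : HasCompactSupport (Complex.ofRealCLM ∘ h) := hh.2.comp_left rfl
  have hg₂ : ContDiff ℝ (⊤ : ℕ∞) (Complex.ofRealCLM ∘ h) :=
    Complex.ofRealCLM.contDiff.comp hh.1
  have h1 : Integrable (𝓕 fun t => (h t : ℂ)) :=
    (𝓕 (hg₁.toSchwartzMap hg₂)).integrable
  rw [funext (spec_eq_fourier h)]
  exact h1.comp_mul_right' (R := -(2 * Real.pi)⁻¹) (by
    have := Real.pi_pos; exact neg_ne_zero.2 (by positivity))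

theorem IsBump.inversion {h : ℝ → ℝ} (hh : IsBump h) (t : ℝ) :
    ∫ ω, spec h ω * Complex.exp (-(Complex.I * ω * t)) = ((2 * Real.pi * h t : ℝ) : ℂ) := by
  have hg₁ : HasCompactSupport (Complex.ofRealCLM ∘ h) := hh.2.comp_left rfl
  have hg₂ : ContDiff ℝ (⊤ : ℕ∞) (Complex.ofRealCLM ∘ h) :=
    Complex.ofRealCLM.contDiff.comp hh.1
  have h1 : Integrable (𝓕 fun t => (h t : ℂ)) :=
    (𝓕 (hg₁.toSchwartzMap hg₂)).integrable
  have h2 := hh.integrable.ofReal.fourierInv_fourier_eq h1 (v := t)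
    (Complex.continuous_ofReal.comp hh.1.continuous).continuousAt
  rw [Real.fourierInv_eq'] at h2
  have hp := Real.pi_pos
  have h3 : ∀ ω : ℝ, spec h ω * Complex.exp (-(Complex.I * ω * t)) =
      (fun w : ℝ => Complex.exp (((2 * Real.pi * inner ℝ w t : ℝ) : ℂ) * Complex.I) •
        𝓕 (fun t => (h t : ℂ)) w) (ω * (-(2 * Real.pi)⁻¹)) := by
    intro ω
    simp only [spec_eq_fourier, smul_eq_mul]
    rw [mul_comm]
    congr 2
    have hp' : (Real.pi : ℂ) ≠ 0 := by exact_mod_cast Real.pi_ne_zero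
    simp
    field_simp
  simp only [h3]
  refine (Measure.integral_comp_mul_right (fun w : ℝ =>
    Complex.exp (((2 * Real.pi * inner ℝ w t : ℝ) : ℂ) * Complex.I) •
      𝓕 (fun t => (h t : ℂ)) w) _).trans ?_
  rw [h2, inv_neg, inv_inv, abs_neg, abs_of_pos (by positivity), Complex.real_smul,
    ← Complex.ofReal_mul]

theorem IsBump.comp_sub {h : ℝ → ℝ} (hh : IsBump h) (s : ℝ) : IsBump fun t => h (t - s) :=
  ⟨hh.1.comp (contDiff_id.sub contDiff_const), hh.2.comp_homeomorph (Homeomorph.subRight s)⟩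

theorem IsBump.isTestWaveform {h : ℝ → ℝ} (hh : IsBump h) : IsTestWaveform h := by
  refine ⟨hh.1.continuous.measurable, ?_, hh.2⟩
  obtain ⟨C, hC⟩ := hh.2.exists_bound_of_continuous hh.1.continuous
  exact ⟨C, hC⟩

theorem isBump_zero : IsBump fun _ => 0 := ⟨contDiff_const, HasCompactSupport.zero⟩

theorem IsBump.add {h k : ℝ → ℝ} (hh : IsBump h) (hk : IsBump k) : IsBump fun t => h t + k t :=
  ⟨hh.1.add hk.1, hh.2.add hk.2⟩

theorem IsBump.const_mul {h : ℝ → ℝ} (hh : IsBump h) (c : ℝ) : IsBump fun t => c * h t :=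
  ⟨contDiff_const.mul hh.1, hh.2.mul_left⟩

/-- A narrow bump has a flat spectrum. -/
theorem exists_bump_spec_ge (R : ℝ) :
    ∃ h, IsBump h ∧ ∀ ω, |ω| ≤ R → 1 / 2 ≤ ‖spec h ω‖ := by
  -- With this width `|ω t| ≤ 1/2` on the support for all `|ω| ≤ R`. The transform of the normalised
  -- bump is then within `1/2` of `1`.
  set δ : ℝ := 1 / (2 * (|R| + 1)) with hδ
  have hδ0 : 0 < δ := by positivity
  let b : ContDiffBump (0 : ℝ) := ⟨δ / 2, δ, by positivity, by linarith⟩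
  refine ⟨b.normed volume, ⟨b.contDiff_normed, b.hasCompactSupport_normed⟩, fun ω hω => ?_⟩
  have hi : Integrable (b.normed (volume : Measure ℝ)) := b.integrable_normed
  have h1 : spec (b.normed volume) ω - 1 = ∫ t, (b.normed volume t : ℂ) *
      (Complex.exp (Complex.I * ω * t) - 1) := by
    have h2 : (1 : ℂ) = ∫ t, (b.normed volume t : ℂ) := by
      rw [integral_complex_ofReal, b.integral_normed]; simp
    conv_lhs => rw [h2]
    rw [spec, ← integral_sub (integrable_spec_integrand hi ω)
      (hi.ofReal : Integrable fun t => (b.normed volume t : ℂ))]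
    refine integral_congr_ae (ae_of_all _ fun t => ?_)
    simp only
    ring
  have h3 : ‖spec (b.normed volume) ω - 1‖ ≤ ∫ t, b.normed volume t * (1 / 2) := by
    rw [h1]
    refine norm_integral_le_of_norm_le (hi.mul_const _) (ae_of_all _ fun t => ?_)
    rw [norm_mul, Complex.norm_real, Real.norm_eq_abs, abs_of_nonneg (b.nonneg_normed t)]
    by_cases ht : |t| < δ
    · refine mul_le_mul_of_nonneg_left ?_ (b.nonneg_normed t)
      rw [show Complex.I * (ω : ℂ) * (t : ℂ) = Complex.I * ((ω * t : ℝ) : ℂ) by push_cast; ring]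
      refine (Real.norm_exp_I_mul_ofReal_sub_one_le).trans ?_
      rw [Real.norm_eq_abs, abs_mul]
      calc |ω| * |t| ≤ (|R| + 1) * δ :=
            mul_le_mul (by linarith [le_abs_self R]) ht.le (abs_nonneg _) (by positivity)
        _ = 1 / 2 := by rw [hδ]; field_simp
    · have : b.normed volume t = 0 := by
        have hs : t ∉ Function.support (b.normed (volume : Measure ℝ)) := by
          rw [b.support_normed_eq]
          simpa using ht
        simpa using hs
      simp [this]
  rw [integral_mul_const, b.integral_normed, one_mul] at h3
  have h4 := norm_sub_norm_le (1 : ℂ) (1 - spec (b.normed volume) ω)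
  rw [norm_one, norm_sub_rev, sub_sub_cancel] at h4
  linarith

/-! ### Spectral norms of locally bounded, globally summable functions -/

/-- The function `f` is bounded by `a n` on `[n, n + 1)`, with summable `a`. -/
structure Amalgam (f : ℝ → ℝ) (a : ℤ → ℝ) : Prop where
  measurable : Measurable f
  summable : Summable a
  bound : ∀ (n : ℤ) (t : ℝ), t ∈ Ico (n : ℝ) (n + 1) → |f t| ≤ a n

namespace Amalgam

variable {f g : ℝ → ℝ} {a b : ℤ → ℝ}

theorem nonneg (h : Amalgam f a) (n : ℤ) : 0 ≤ a n :=
  (abs_nonneg _).trans (h.bound n n ⟨le_rfl, by linarith⟩)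

theorem bound_floor (h : Amalgam f a) (t : ℝ) : |f t| ≤ a ⌊t⌋ :=
  h.bound _ t ⟨Int.floor_le t, Int.lt_floor_add_one t⟩

theorem bddMeas (h : Amalgam f a) : BddMeas f :=
  ⟨h.measurable, ∑' n, a n, fun t =>
    (h.bound_floor t).trans (h.summable.le_tsum _ fun n _ => h.nonneg n)⟩

theorem integrable (h : Amalgam f a) : Integrable f := by
  refine ⟨h.measurable.aestronglyMeasurable, ?_⟩
  rw [HasFiniteIntegral, ← setLIntegral_univ, ← iUnion_Ico_intCast ℝ,
    lintegral_iUnion (fun n : ℤ => measurableSet_Ico) (pairwise_disjoint_Ico_intCast ℝ)]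
  refine lt_of_le_of_lt (ENNReal.tsum_le_tsum fun n => ?_) h.summable.tsum_ofReal_lt_top
  calc ∫⁻ t in Ico (n : ℝ) (n + 1), ‖f t‖ₑ ≤ ∫⁻ _ in Ico (n : ℝ) (n + 1), ENNReal.ofReal (a n) := by
        refine setLIntegral_mono measurable_const fun t ht => ?_
        rw [← ofReal_norm]
        exact ENNReal.ofReal_le_ofReal (h.bound n t ht)
    _ = ENNReal.ofReal (a n) := by simp

theorem memLp_two (h : Amalgam f a) : MemLp f 2 := by
  rw [memLp_two_iff_integrable_sq h.measurable.aestronglyMeasurable]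
  obtain ⟨-, C, hC⟩ := h.bddMeas
  simpa only [pow_two] using h.integrable.mul_bdd (c := C) h.measurable.aestronglyMeasurable
    (ae_of_all _ hC)

theorem mono (h : Amalgam f a) (hg : Measurable g) (hgf : ∀ t, |g t| ≤ |f t|) : Amalgam g a :=
  ⟨hg, h.summable, fun n t ht => (hgf t).trans (h.bound n t ht)⟩

theorem add (hf : Amalgam f a) (hg : Amalgam g b) :
    Amalgam (fun t => f t + g t) (fun n => a n + b n) :=
  ⟨hf.measurable.add hg.measurable, hf.summable.add hg.summable, fun n t ht =>
    (abs_add_le _ _).trans (add_le_add (hf.bound n t ht) (hg.bound n t ht))⟩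

theorem const_mul (hf : Amalgam f a) (c : ℝ) : Amalgam (fun t => c * f t) (fun n => |c| * a n) :=
  ⟨hf.measurable.const_mul c, hf.summable.mul_left _, fun n t ht => by
    rw [abs_mul]; exact mul_le_mul_of_nonneg_left (hf.bound n t ht) (abs_nonneg _)⟩

theorem indicator (hf : Amalgam f a) {s : Set ℝ} (hs : MeasurableSet s) :
    Amalgam (s.indicator f) a :=
  hf.mono (hf.measurable.indicator hs) fun t => by
    by_cases ht : t ∈ s <;> simp [ht]

end Amalgam

/-- Bounded functions supported in a unit interval have transforms in `L²(ν)`, uniformly in the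
position of the interval. -/
def SpecBounded (ν : Measure ℝ) (B : ℝ) : Prop :=
  0 ≤ B ∧ ∀ (n : ℤ) (f : ℝ → ℝ) (a : ℝ), Measurable f → 0 ≤ a → (∀ t, |f t| ≤ a) →
    (∀ t ∉ Ico (n : ℝ) (n + 1), f t = 0) → eLpNorm (spec f) 2 ν ≤ ENNReal.ofReal (B * a)

theorem eLpNorm_two_le_of_integral {α : Type*} [MeasurableSpace α] {ν : Measure α} {g : α → ℂ}
    (hg : AEStronglyMeasurable g ν) (hi : Integrable (fun x => ‖g x‖ ^ 2) ν) {c : ℝ} (hc : 0 ≤ c)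
    (h : ∫ x, ‖g x‖ ^ 2 ∂ν ≤ c ^ 2) : eLpNorm g 2 ν ≤ ENNReal.ofReal c := by
  have hm : MemLp g 2 ν := (memLp_two_iff_integrable_sq_norm hg).2 hi
  rw [hm.eLpNorm_eq_integral_rpow_norm (by norm_num) (by norm_num)]
  refine ENNReal.ofReal_le_ofReal ?_
  simp only [ENNReal.toReal_ofNat, Real.rpow_ofNat]
  rw [show ((2 : ℝ)⁻¹) = 1 / 2 by norm_num, ← Real.sqrt_eq_rpow]
  exact Real.sqrt_le_iff.2 ⟨hc, h⟩

theorem integrable_of_unit_support {n : ℤ} {f : ℝ → ℝ} {a : ℝ} (hf : Measurable f)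
    (ha : ∀ t, |f t| ≤ a) (hs : ∀ t ∉ Ico (n : ℝ) (n + 1), f t = 0) :
    Integrable f ∧ MemLp f 2 ∧ ∫ t, f t * f t ≤ a ^ 2 := by
  have hA : Amalgam f (Pi.single n a) := by
    refine ⟨hf, (hasSum_pi_single n a).summable, fun m t ht => ?_⟩
    by_cases hmn : m = n
    · subst hmn
      simpa using ha t
    · rw [Pi.single_eq_of_ne hmn, hs t, abs_zero]
      intro ht'
      exact disjoint_left.1 (pairwise_disjoint_Ico_intCast ℝ hmn) ht ht'
  refine ⟨hA.integrable, hA.memLp_two, ?_⟩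
  have h1 : ∀ t, f t * f t ≤ (Ico (n : ℝ) (n + 1)).indicator (fun _ => a ^ 2) t := by
    intro t
    by_cases ht : t ∈ Ico (n : ℝ) (n + 1)
    · rw [indicator_of_mem ht, ← pow_two]
      exact sq_le_sq' (abs_le.1 (ha t)).1 (abs_le.1 (ha t)).2
    · simp [hs t ht, indicator_of_notMem ht]
  have h2 := integral_mono_of_nonneg (ae_of_all volume fun t => mul_self_nonneg (f t))
    ((integrable_indicator_iff measurableSet_Ico).2
      (integrableOn_const (C := a ^ 2) (by simp))) (ae_of_all volume h1)
  refine h2.trans (le_of_eq ?_)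
  rw [integral_indicator measurableSet_Ico]
  simp

/-- By Parseval, the squared norm is `2π ∫ f²`, which is at most `2π a²` on a unit interval. -/
theorem specBounded_volume : SpecBounded volume (Real.sqrt (2 * Real.pi)) := by
  refine ⟨Real.sqrt_nonneg _, fun n f a hf ha hb hs => ?_⟩
  obtain ⟨h1, h2, h3⟩ := integrable_of_unit_support hf hb hs
  have h4 := memLp_spec h1 h2
  have h5 := (memLp_two_iff_integrable_sq_norm h4.1).1 h4
  refine eLpNorm_two_le_of_integral h4.1 h5 (by positivity) ?_
  have h6 := integral_spec_mul_conj h1 h2 h1 h2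
  have h7 : ∀ ω, spec f ω * conj (spec f ω) = ((‖spec f ω‖ ^ 2 : ℝ) : ℂ) := fun ω => by
    rw [Complex.mul_conj, Complex.normSq_eq_norm_sq]
  simp only [h7] at h6
  rw [integral_complex_ofReal] at h6
  rw [Complex.ofReal_injective h6, mul_pow, Real.sq_sqrt (by positivity)]
  exact mul_le_mul_of_nonneg_left h3 (by positivity)

/-- The measure `S(ω) dω`. -/
def psdMeasure (S : ℝ → ℝ) : Measure ℝ := volume.withDensity fun ω => ENNReal.ofReal (S ω)

theorem integral_psdMeasure {S : ℝ → ℝ} (hS : Measurable S) (h0 : ∀ ω, 0 ≤ S ω) {E : Type*}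
    [NormedAddCommGroup E] [NormedSpace ℝ E] (g : ℝ → E) :
    ∫ ω, g ω ∂(psdMeasure S) = ∫ ω, S ω • g ω := by
  rw [psdMeasure, integral_withDensity_eq_integral_toReal_smul hS.ennreal_ofReal
    (ae_of_all _ fun _ => ENNReal.ofReal_lt_top)]
  simp only [ENNReal.toReal_ofReal (h0 _)]

theorem integrable_psdMeasure_iff {S : ℝ → ℝ} (hS : Measurable S) (h0 : ∀ ω, 0 ≤ S ω) {E : Type*}
    [NormedAddCommGroup E] [NormedSpace ℝ E] (g : ℝ → E) :
    Integrable g (psdMeasure S) ↔ Integrable fun ω => S ω • g ω := by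
  rw [psdMeasure, integrable_withDensity_iff_integrable_smul' hS.ennreal_ofReal
    (ae_of_all _ fun _ => ENNReal.ofReal_lt_top)]
  simp only [ENNReal.toReal_ofReal (h0 _)]

/-- The same `S` serves all windows and a translation only multiplies the transform by a phase, so
the interval may be moved to `[0, 1]`. There the spectral integral is `2π` times the variance of a
flux bounded by `a` times the photon number, hence at most `2π a² E[N²]`. -/
theorem IsStationarySource.specBounded {ψ : ℝ → ℝ → Multiset ℝ → ℂ} {Imean : ℝ} {S : ℝ → ℝ}
    (hs : IsStationarySource ψ Imean S) : ∃ B, SpecBounded (psdMeasure S) B := by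
  set N2 : ℝ := expect 0 1 (ψ 0 1) fun σ => (Multiset.card σ : ℝ) ^ 2
  have hN2 : 0 ≤ N2 := integral_nonneg fun σ => by positivity
  refine ⟨Real.sqrt (2 * Real.pi * N2), Real.sqrt_nonneg _, fun n f a hf ha hb hsupp => ?_⟩
  obtain ⟨h1, -, -⟩ := integrable_of_unit_support hf hb hsupp
  -- The translate of `f` that is supported in `[0, 1)`.
  set F : ℝ → ℝ := fun t => f (t - (-n : ℝ)) with hF
  have hFm : Measurable F := hf.comp (measurable_id.sub_const _)
  have hFb : ∀ t, |F t| ≤ a := fun t => hb _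
  have hFi : (Icc (0 : ℝ) 1).indicator F = F := by
    ext t
    by_cases ht : t ∈ Icc (0 : ℝ) 1
    · rw [indicator_of_mem ht]
    · rw [indicator_of_notMem ht, hF]
      refine (hsupp _ fun h => ht ⟨?_, ?_⟩).symm
      · linarith [h.1]
      · linarith [h.2]
  have hnorm : ∀ ω, ‖spec F ω‖ = ‖spec f ω‖ := by
    intro ω
    rw [hF, spec_comp_sub, norm_mul, show Complex.I * (ω : ℂ) * ((-n : ℝ) : ℂ) =
      ((ω * (-n) : ℝ) : ℂ) * Complex.I by push_cast; ring, Complex.norm_exp_ofReal_mul_I, one_mul]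
  obtain ⟨hc1, hc2⟩ := hs.covariance 0 1 one_pos F F hFm ⟨a, hFb⟩ hFm ⟨a, hFb⟩
  rw [hFi] at hc1 hc2
  have h7 : ∀ ω, (S ω : ℂ) * spec F ω * conj (spec F ω) = ((S ω * ‖spec f ω‖ ^ 2 : ℝ) : ℂ) := by
    intro ω
    rw [mul_assoc, Complex.mul_conj, Complex.normSq_eq_norm_sq, hnorm]
    push_cast
    ring
  simp only [h7] at hc1 hc2
  have hi : Integrable fun ω => S ω * ‖spec f ω‖ ^ 2 := by
    refine hc1.re.congr (ae_of_all _ fun ω => Complex.ofReal_re _)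
  rw [integral_complex_ofReal, show (1 / (2 * Real.pi) : ℂ) = ((1 / (2 * Real.pi) : ℝ) : ℂ) by
    push_cast; ring, ← Complex.ofReal_mul] at hc2
  have hc3 := Complex.ofReal_injective hc2
  have hp := Real.pi_pos
  refine eLpNorm_two_le_of_integral (continuous_spec h1).aestronglyMeasurable ?_
    (by positivity) ?_
  · exact (integrable_psdMeasure_iff hs.measurable_psd hs.psd_nonneg _).2 hi
  rw [integral_psdMeasure hs.measurable_psd hs.psd_nonneg, mul_pow,
    Real.sq_sqrt (by positivity)]
  simp only [smul_eq_mul]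
  have h8 : ∫ ω, S ω * ‖spec f ω‖ ^ 2 = 2 * Real.pi *
      (expect 0 1 (ψ 0 1) (fun σ => flux F σ * flux F σ) -
        expect 0 1 (ψ 0 1) (flux F) * expect 0 1 (ψ 0 1) (flux F)) := by
    rw [hc3]
    field_simp
  have h9 : expect 0 1 (ψ 0 1) (fun σ => flux F σ * flux F σ) ≤ a ^ 2 * N2 := by
    simp only [N2, expect]
    rw [← integral_const_mul]
    refine integral_mono_of_nonneg (ae_of_all _ fun σ => mul_nonneg (mul_self_nonneg _)
      (sq_nonneg _)) ((hs.second_moment 0 1 one_pos).const_mul _) (ae_of_all _ fun σ => ?_)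
    simp only
    rw [← mul_assoc]
    refine mul_le_mul_of_nonneg_right ?_ (sq_nonneg _)
    rw [← pow_two, ← mul_pow, ← sq_abs]
    exact pow_le_pow_left₀ (abs_nonneg _) (abs_flux_le hFb σ) 2
  rw [h8, mul_assoc (2 * Real.pi)]
  refine mul_le_mul_of_nonneg_left ?_ (by positivity)
  nlinarith [mul_self_nonneg (expect 0 1 (ψ 0 1) (flux F))]

/-- Cut `f` into its pieces on unit intervals and apply the triangle inequality in `L²(ν)`. No
integrability of `f` against `ν` is used, only the uniform bound for a single piece. -/
theorem SpecBounded.amalgam {ν : Measure ℝ} {B : ℝ} (hB : SpecBounded ν B) {f : ℝ → ℝ}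
    {a : ℤ → ℝ} (hf : Amalgam f a) :
    eLpNorm (spec f) 2 ν ≤ ENNReal.ofReal (B * ∑' n, a n) := by
  set fn : ℤ → ℝ → ℝ := fun n => (Ico (n : ℝ) (n + 1)).indicator f
  have hfn : ∀ n, Integrable (fn n) := fun n => hf.integrable.indicator measurableSet_Ico
  have hsum : ∀ ω, HasSum (fun n => spec (fn n) ω) (spec f ω) := by
    intro ω
    have h1 := hasSum_integral_iUnion (μ := volume) (fun n : ℤ => measurableSet_Ico)
      (pairwise_disjoint_Ico_intCast ℝ) (integrable_spec_integrand hf.integrable ω).integrableOn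
    rw [iUnion_Ico_intCast ℝ, setIntegral_univ] at h1
    have h2 : ∀ n : ℤ, ∫ t in Ico (n : ℝ) (n + 1), (f t : ℂ) * Complex.exp (Complex.I * ω * t) =
        spec (fn n) ω := by
      intro n
      rw [spec, ← integral_indicator measurableSet_Ico]
      refine integral_congr_ae (ae_of_all _ fun t => ?_)
      by_cases ht : t ∈ Ico (n : ℝ) (n + 1) <;> simp [fn, ht]
    simp only [h2] at h1
    exact h1
  have hb : ∀ n, eLpNorm (spec (fn n)) 2 ν ≤ ENNReal.ofReal (B * a n) := by
    intro n
    refine hB.2 n (fn n) (a n) (hf.measurable.indicator measurableSet_Ico) (hf.nonneg n)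
      (fun t => ?_) (fun t ht => indicator_of_notMem ht _)
    by_cases ht : t ∈ Ico (n : ℝ) (n + 1)
    · simpa [fn, ht] using hf.bound n t ht
    · simpa [fn, ht] using hf.nonneg n
  -- The symmetric partial sums converge pointwise in `ω`, and by Fatou the norm of the limit is at
  -- most the limit inferior of the norms.
  have hlim := Lp.eLpNorm_lim_le_liminf_eLpNorm (p := 2) (μ := ν)
    (f := fun N : ℕ => fun ω => ∑ n ∈ Finset.Icc (-(N : ℤ)) N, spec (fn n) ω)
    (fun N => (continuous_finsetSum _ fun n _ => continuous_spec (hfn n)).aestronglyMeasurable)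
    (spec f) (ae_of_all _ fun ω => (hsum ω).comp Finset.tendsto_Icc_neg)
  refine hlim.trans (liminf_le_of_frequently_le' (Frequently.of_forall fun N => ?_))
  calc eLpNorm (fun ω => ∑ n ∈ Finset.Icc (-(N : ℤ)) N, spec (fn n) ω) 2 ν
      ≤ ∑ n ∈ Finset.Icc (-(N : ℤ)) N, eLpNorm (spec (fn n)) 2 ν := by
        have := eLpNorm_sum_le (p := 2) (μ := ν) (s := Finset.Icc (-(N : ℤ)) N)
          (f := fun n => spec (fn n))
          (fun n _ => (continuous_spec (hfn n)).aestronglyMeasurable) (by norm_num)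
        convert this using 2
        ext ω
        simp
    _ ≤ ∑ n ∈ Finset.Icc (-(N : ℤ)) N, ENNReal.ofReal (B * a n) :=
        Finset.sum_le_sum fun n _ => hb n
    _ = ENNReal.ofReal (∑ n ∈ Finset.Icc (-(N : ℤ)) N, B * a n) :=
        (ENNReal.ofReal_sum_of_nonneg fun n _ => mul_nonneg hB.1 (hf.nonneg n)).symm
    _ ≤ ENNReal.ofReal (B * ∑' n, a n) := by
        refine ENNReal.ofReal_le_ofReal ?_
        rw [← Finset.mul_sum]
        exact mul_le_mul_of_nonneg_left (hf.summable.sum_le_tsum _ fun n _ => hf.nonneg n) hB.1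

theorem SpecBounded.memLp {ν : Measure ℝ} {B : ℝ} (hB : SpecBounded ν B) {f : ℝ → ℝ}
    {a : ℤ → ℝ} (hf : Amalgam f a) : MemLp (spec f) 2 ν :=
  ⟨(continuous_spec hf.integrable).aestronglyMeasurable,
    (hB.amalgam hf).trans_lt ENNReal.ofReal_lt_top⟩

/-- Functions `F w` that are uniformly in an amalgam class and eventually equal to `f` on every
unit interval. -/
structure LocallyEventually {ι : Type*} (l : Filter ι) (F : ι → ℝ → ℝ) (f : ℝ → ℝ) (a : ℤ → ℝ) :
    Prop where
  left : ∀ w, Amalgam (F w) a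
  right : Amalgam f a
  eventually_eq : ∀ n : ℤ, ∀ᶠ w in l, ∀ t ∈ Ico (n : ℝ) (n + 1), F w t = f t

/-- The difference `F w - f` vanishes on every fixed unit interval eventually and is dominated by `2
a n` on the `n`-th one. Dominated convergence of the series of local bounds then gives convergence
in `L²(ν)`. -/
theorem SpecBounded.tendsto_eLpNorm {ν : Measure ℝ} {B : ℝ} (hB : SpecBounded ν B) {ι : Type*}
    {l : Filter ι} {F : ι → ℝ → ℝ} {f : ℝ → ℝ} {a : ℤ → ℝ} (h : LocallyEventually l F f a) :
    Tendsto (fun w => eLpNorm (spec (F w) - spec f) 2 ν) l (𝓝 0) := by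
  classical
  -- The local bound of the difference: zero on the intervals where the functions already agree.
  let c : ι → ℤ → ℝ := fun w n =>
    if ∀ t ∈ Ico (n : ℝ) (n + 1), F w t = f t then 0 else 2 * a n
  have hcb : ∀ w n, ‖c w n‖ ≤ 2 * a n := by
    intro w n
    have := h.right.nonneg n
    simp only [c]
    split_ifs
    · simpa using this
    · rw [Real.norm_eq_abs, abs_of_nonneg (by positivity)]
  have hsum : Summable fun n => 2 * a n := h.right.summable.mul_left 2
  have hA : ∀ w, Amalgam (fun t => F w t - f t) (c w) := by
    intro w
    refine ⟨(h.left w).measurable.sub h.right.measurable,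
      Summable.of_norm_bounded hsum (hcb w), fun n t ht => ?_⟩
    simp only [c]
    split_ifs with hn
    · simp [hn t ht]
    · linarith [abs_sub (F w t) (f t), (h.left w).bound n t ht, h.right.bound n t ht]
  have hlim : Tendsto (fun w => ∑' n, c w n) l (𝓝 (∑' _ : ℤ, (0 : ℝ))) := by
    refine tendsto_tsum_of_dominated_convergence hsum (fun n => ?_) (Eventually.of_forall hcb)
    refine tendsto_const_nhds.congr' ?_
    filter_upwards [h.eventually_eq n] with w hw
    simp only [c, if_pos hw]
  rw [tsum_zero] at hlim
  have hlim2 : Tendsto (fun w => ENNReal.ofReal (B * ∑' n, c w n)) l (𝓝 0) := by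
    have := ENNReal.tendsto_ofReal (hlim.const_mul B)
    simpa using this
  refine tendsto_of_tendsto_of_tendsto_of_le_of_le tendsto_const_nhds hlim2 (fun _ => zero_le)
    fun w => ?_
  refine le_trans (le_of_eq ?_) (hB.amalgam (hA w))
  congr 1
  ext ω
  rw [Pi.sub_apply, spec_sub (h.left w).integrable h.right.integrable]

/-- Both transforms converge in `L²(ν)`, and the integral is their inner product. -/
theorem SpecBounded.tendsto_integral {ν : Measure ℝ} {B : ℝ} (hB : SpecBounded ν B) {ι : Type*}
    {l : Filter ι} {F G : ι → ℝ → ℝ} {f g : ℝ → ℝ} {a b : ℤ → ℝ} (h : LocallyEventually l F f a)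
    (h' : LocallyEventually l G g b) :
    Tendsto (fun w => ∫ ω, spec (F w) ω * conj (spec (G w) ω) ∂ν) l
      (𝓝 (∫ ω, spec f ω * conj (spec g ω) ∂ν)) := by
  have h1 := (Lp.tendsto_Lp_iff_tendsto_eLpNorm'' _ (fun w => hB.memLp (h.left w)) _
    (hB.memLp h.right)).2 (hB.tendsto_eLpNorm h)
  have h2 := (Lp.tendsto_Lp_iff_tendsto_eLpNorm'' _ (fun w => hB.memLp (h'.left w)) _
    (hB.memLp h'.right)).2 (hB.tendsto_eLpNorm h')
  have e : ∀ {u v : ℝ → ℂ} (hu : MemLp u 2 ν) (hv : MemLp v 2 ν),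
      ∫ ω, u ω * conj (v ω) ∂ν = ⟪hv.toLp v, hu.toLp u⟫_ℂ := by
    intro u v hu hv
    rw [L2.inner_def]
    refine integral_congr_ae ?_
    filter_upwards [hu.coeFn_toLp, hv.coeFn_toLp] with ω h3 h4
    rw [h3, h4, RCLike.inner_apply]
  simp only [fun w => e (hB.memLp (h.left w)) (hB.memLp (h'.left w)),
    e (hB.memLp h.right) (hB.memLp h'.right)]
  exact h2.inner h1

/-! ### Wide windows -/

theorem summable_sum_shift {a : ℤ → ℝ} (ha : Summable a) (L : ℕ) :
    Summable fun n : ℤ => ∑ j ∈ Finset.Icc (-(L : ℤ)) L, a (n + j) :=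
  summable_sum fun j _ => ha.comp_injective (add_left_injective j)

/-- The unit interval of `τ` is near the one of `t`. -/
theorem floor_mem_shift {L : ℕ} {n : ℤ} {t τ : ℝ} (ht : t ∈ Ico (n : ℝ) (n + 1))
    (h : |t - τ| ≤ L) : ∃ j ∈ Finset.Icc (-((L + 1 : ℕ) : ℤ)) (L + 1 : ℕ), ⌊τ⌋ = n + j := by
  refine ⟨⌊τ⌋ - n, ?_, by ring⟩
  have h1 := Int.floor_le τ
  have h2 := Int.lt_floor_add_one τ
  obtain ⟨h3, h4⟩ := abs_le.1 h
  obtain ⟨h5, h6⟩ := ht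
  rw [Finset.mem_Icc]
  constructor
  · have : ((-((L + 1 : ℕ) : ℤ) : ℤ) : ℝ) < ((⌊τ⌋ - n + 1 : ℤ) : ℝ) := by push_cast; linarith
    have := Int.cast_lt.1 this
    lia
  · have : ((⌊τ⌋ - n : ℤ) : ℝ) < (((L + 1 : ℕ) : ℤ) + 1 : ℤ) := by push_cast; linarith
    have := Int.cast_lt.1 this
    lia

theorem summable_integral_abs {lam : ℝ → ℝ} (hl : Integrable lam) :
    Summable fun n : ℤ => ∫ t, (Ico (n : ℝ) (n + 1)).indicator (fun t => |lam t|) t := by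
  have h1 := hasSum_integral_iUnion (μ := volume) (fun n : ℤ => measurableSet_Ico)
    (pairwise_disjoint_Ico_intCast ℝ) (hl.abs.integrableOn)
  simpa only [integral_indicator measurableSet_Ico] using h1.summable

/-- Convolution of an integrable kernel and a test waveform. -/
theorem amalgam_conv_of_support {lam h : ℝ → ℝ} (hl : Integrable lam) (hm : Measurable h) {C : ℝ}
    (hC : ∀ t, |h t| ≤ C) {R : ℕ} (hR : ∀ t, (R : ℝ) < |t| → h t = 0) (s : Set ℝ) :
    Amalgam (fun t => ∫ τ in s, lam (t - τ) * h τ) fun n => C *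
      ∑ j ∈ Finset.Icc (-((R + 1 : ℕ) : ℤ)) (R + 1 : ℕ),
        ∫ t, (Ico ((n + j : ℤ) : ℝ) ((n + j : ℤ) + 1)).indicator (fun t => |lam t|) t := by
  have hC0 : 0 ≤ C := (abs_nonneg _).trans (hC 0)
  refine ⟨measurable_integral_sub_mul _ Measure.absolutelyContinuous_restrict hl.1 hm,
    (summable_sum_shift (summable_integral_abs hl) (R + 1)).mul_left C, fun n t ht => ?_⟩
  have hi : ∀ m : ℤ, Integrable fun τ =>
      (Ico (m : ℝ) (m + 1)).indicator (fun t => |lam t|) (t - τ) := fun m =>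
    (hl.abs.indicator measurableSet_Ico).comp_sub_left t
  have hi2 : Integrable fun τ => C * ∑ j ∈ Finset.Icc (-((R + 1 : ℕ) : ℤ)) (R + 1 : ℕ),
      (Ico ((n + j : ℤ) : ℝ) ((n + j : ℤ) + 1)).indicator (fun t => |lam t|) (t - τ) :=
    (integrable_finsetSum _ fun j _ => hi (n + j)).const_mul C
  have hnn : ∀ m : ℤ, ∀ x, 0 ≤ (Ico (m : ℝ) (m + 1)).indicator (fun t => |lam t|) x :=
    fun m x => indicator_nonneg (fun _ _ => abs_nonneg _) _
  calc |∫ τ in s, lam (t - τ) * h τ|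
      ≤ ∫ τ in s, C * ∑ j ∈ Finset.Icc (-((R + 1 : ℕ) : ℤ)) (R + 1 : ℕ),
        (Ico ((n + j : ℤ) : ℝ) ((n + j : ℤ) + 1)).indicator (fun t => |lam t|) (t - τ) := by
        rw [← Real.norm_eq_abs]
        refine norm_integral_le_of_norm_le hi2.integrableOn (ae_of_all _ fun τ => ?_)
        rw [Real.norm_eq_abs, abs_mul]
        by_cases hτ : (R : ℝ) < |τ|
        · rw [hR τ hτ, abs_zero, mul_zero]
          exact mul_nonneg hC0 (Finset.sum_nonneg fun j _ => hnn _ _)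
        · obtain ⟨j, hj, hj'⟩ := floor_mem_shift (τ := t - τ) ht
            (by rw [sub_sub_cancel]; exact not_lt.1 hτ)
          rw [mul_comm]
          refine mul_le_mul (hC τ) ?_ (abs_nonneg _) hC0
          refine le_trans (le_of_eq ?_) (Finset.single_le_sum (fun j _ => hnn (n + j) (t - τ)) hj)
          have hm : t - τ ∈ Ico ((⌊t - τ⌋ : ℤ) : ℝ) ((⌊t - τ⌋ : ℤ) + 1) :=
            ⟨Int.floor_le _, Int.lt_floor_add_one _⟩
          rw [← hj', indicator_of_mem hm]
    _ ≤ ∫ τ, C * ∑ j ∈ Finset.Icc (-((R + 1 : ℕ) : ℤ)) (R + 1 : ℕ),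
        (Ico ((n + j : ℤ) : ℝ) ((n + j : ℤ) + 1)).indicator (fun t => |lam t|) (t - τ) :=
        setIntegral_le_integral hi2 (ae_of_all _ fun τ =>
          mul_nonneg hC0 (Finset.sum_nonneg fun j _ => hnn _ _))
    _ = _ := by
        rw [integral_const_mul, integral_finsetSum _ fun j _ => hi (n + j)]
        congr 1
        refine Finset.sum_congr rfl fun j _ => ?_
        exact integral_sub_left_eq_self
          (fun x => (Ico ((n + j : ℤ) : ℝ) ((n + j : ℤ) + 1)).indicator (fun t => |lam t|) x)
          volume t

/-- Convolution with an integrable kernel of compact support. -/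
theorem Amalgam.conv_of_support {lam h : ℝ → ℝ} {b : ℤ → ℝ} (hh : Amalgam h b)
    (hl : Integrable lam) {L : ℕ} (hL : ∀ t, (L : ℝ) < |t| → lam t = 0) (s : Set ℝ) :
    Amalgam (fun t => ∫ τ in s, lam (t - τ) * h τ) fun n => (∫ t, |lam t|) *
      ∑ j ∈ Finset.Icc (-((L + 1 : ℕ) : ℤ)) (L + 1 : ℕ), b (n + j) := by
  refine ⟨measurable_integral_sub_mul _ Measure.absolutelyContinuous_restrict hl.1 hh.measurable,
    (summable_sum_shift hh.summable (L + 1)).mul_left _, fun n t ht => ?_⟩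
  set B := ∑ j ∈ Finset.Icc (-((L + 1 : ℕ) : ℤ)) (L + 1 : ℕ), b (n + j)
  have hB : 0 ≤ B := Finset.sum_nonneg fun j _ => hh.nonneg _
  have hi2 : Integrable fun τ => |lam (t - τ)| * B := (hl.comp_sub_left t).abs.mul_const B
  calc |∫ τ in s, lam (t - τ) * h τ| ≤ ∫ τ in s, |lam (t - τ)| * B := by
        rw [← Real.norm_eq_abs]
        refine norm_integral_le_of_norm_le hi2.integrableOn (ae_of_all _ fun τ => ?_)
        rw [Real.norm_eq_abs, abs_mul]
        by_cases hτ : (L : ℝ) < |t - τ|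
        · rw [hL _ hτ, abs_zero, zero_mul, zero_mul]
        · obtain ⟨j, hj, hj'⟩ := floor_mem_shift ht (not_lt.1 hτ)
          refine mul_le_mul_of_nonneg_left ((hh.bound_floor τ).trans ?_) (abs_nonneg _)
          rw [hj']
          exact Finset.single_le_sum (f := fun j => b (n + j)) (fun j _ => hh.nonneg (n + j)) hj
    _ ≤ ∫ τ, |lam (t - τ)| * B :=
        setIntegral_le_integral hi2 (ae_of_all _ fun τ => mul_nonneg (abs_nonneg _) hB)
    _ = _ := by
        rw [integral_mul_const, integral_sub_left_eq_self (fun x => |lam x|) volume t]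

/-- A kernel and a waveform whose convolution over a window approaches the one over the line. -/
structure WindowPair (lam h : ℝ → ℝ) (a : ℤ → ℝ) : Prop where
  wave : Amalgam h a
  limit : Amalgam (conv lam h) a
  aux : ∀ w : ℝ × ℝ, Amalgam (auxPhase w.1 w.2 lam h) a
  eventually_eq : ∀ n : ℤ, ∀ᶠ w : ℝ × ℝ in atBot ×ˢ atTop, ∀ t ∈ Ico (n : ℝ) (n + 1),
    auxPhase w.1 w.2 lam h t = conv lam h t

theorem Amalgam.mono_seq {f : ℝ → ℝ} {a b : ℤ → ℝ} (h : Amalgam f a) (hb : Summable b)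
    (hab : ∀ n, a n ≤ b n) : Amalgam f b :=
  ⟨h.measurable, hb, fun n t ht => (h.bound n t ht).trans (hab n)⟩

/-- For `t` in a fixed unit interval the integrand vanishes for `|τ| > T`, so any window containing
`[-T, T]` already gives the convolution over the line. The sum `a + b` is used so that one sequence
dominates the waveform and its convolutions. -/
theorem WindowPair.of_amalgam {lam h : ℝ → ℝ} {a b : ℤ → ℝ} (hh : Amalgam h a)
    (hc : ∀ s : Set ℝ, Amalgam (fun t => ∫ τ in s, lam (t - τ) * h τ) b)
    (he : ∀ n : ℤ, ∃ T : ℝ, ∀ t ∈ Ico (n : ℝ) (n + 1), ∀ τ, T < |τ| → lam (t - τ) * h τ = 0) :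
    WindowPair lam h fun n => a n + b n := by
  have hs : Summable fun n => a n + b n := hh.summable.add (hc univ).summable
  have hle : ∀ n, b n ≤ a n + b n := fun n => by linarith [hh.nonneg n]
  refine ⟨hh.mono_seq hs fun n => by linarith [(hc univ).nonneg n], ?_,
    fun w => (hc _).mono_seq hs hle, fun n => ?_⟩
  · have := (hc univ).mono_seq hs hle
    simp only [setIntegral_univ] at this
    exact this
  · obtain ⟨T, hT⟩ := he n
    filter_upwards [(eventually_le_atBot (-T)).prod_mk (eventually_ge_atTop T)] with w hw t ht
    refine setIntegral_eq_integral_of_forall_compl_eq_zero fun τ hτ => hT t ht τ ?_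
    by_contra! hlt
    obtain ⟨h1, h2⟩ := abs_le.1 hlt
    exact hτ ⟨hw.1.trans h1, h2.trans hw.2⟩

theorem exists_support_bound {h : ℝ → ℝ} (hh : HasCompactSupport h) :
    ∃ R : ℕ, ∀ t, (R : ℝ) < |t| → h t = 0 := by
  obtain ⟨r, hr⟩ := hh.isCompact.isBounded.subset_closedBall 0
  refine ⟨⌈r⌉₊, fun t ht => ?_⟩
  by_contra hne
  have := hr (subset_tsupport h hne)
  rw [mem_closedBall_zero_iff, Real.norm_eq_abs] at this
  linarith [Nat.le_ceil r]

theorem amalgam_of_support {h : ℝ → ℝ} (hm : Measurable h) {C : ℝ}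
    (hC : ∀ t, |h t| ≤ C) {R : ℕ} (hR : ∀ t, (R : ℝ) < |t| → h t = 0) :
    ∃ a, Amalgam h a := by
  classical
  have hC0 : 0 ≤ C := (abs_nonneg _).trans (hC 0)
  refine ⟨fun n => if n ∈ Finset.Icc (-((R + 1 : ℕ) : ℤ)) (R + 1 : ℕ) then C else 0, hm,
    summable_of_ne_finset_zero (s := Finset.Icc (-((R + 1 : ℕ) : ℤ)) (R + 1 : ℕ))
      fun n hn => if_neg hn, fun n t ht => ?_⟩
  split_ifs with hn
  · exact hC t
  · rw [hR t, abs_zero]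
    by_contra! hlt
    obtain ⟨j, hj, hj'⟩ := floor_mem_shift (n := 0) (t := 0) (τ := t) (L := R) (by simp)
      (by simpa using hlt)
    rw [Int.floor_eq_iff.2 ht, zero_add] at hj'
    exact hn (hj' ▸ hj)

/-- Here the compact support of the waveform makes the convolution local, and the kernel is any
integrable function. -/
theorem IsTestWaveform.windowPair {lam h : ℝ → ℝ} (hl : Integrable lam) (hh : IsTestWaveform h) :
    ∃ a, WindowPair lam h a := by
  obtain ⟨C, hC⟩ := hh.bounded
  obtain ⟨R, hR⟩ := exists_support_bound hh.compact
  obtain ⟨a, ha⟩ := amalgam_of_support hh.measurable hC hR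
  exact ⟨_, WindowPair.of_amalgam ha (amalgam_conv_of_support hl hh.measurable hC hR)
    fun n => ⟨R, fun t _ τ hτ => by rw [hR τ hτ, mul_zero]⟩⟩

theorem IsTestWaveform.exists_amalgam_conv {g h : ℝ → ℝ} (hg : Integrable g)
    (hh : IsTestWaveform h) : ∃ a, Amalgam (conv g h) a := by
  obtain ⟨a, ha⟩ := hh.windowPair hg
  exact ⟨a, ha.limit⟩

/-- In the Cramér-Rao bound the direction is a convolution with `g` and need not have compact
support. The compact support of the kernel provides the locality instead. -/
theorem Amalgam.windowPair {lam h : ℝ → ℝ} {b : ℤ → ℝ} (hh : Amalgam h b) (hl : Integrable lam)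
    (hc : HasCompactSupport lam) : ∃ a, WindowPair lam h a := by
  obtain ⟨L, hL⟩ := exists_support_bound hc
  refine ⟨_, WindowPair.of_amalgam hh (hh.conv_of_support hl hL)
    fun n => ⟨|(n : ℝ)| + 1 + L, fun t ht τ hτ => ?_⟩⟩
  rw [hL (t - τ), zero_mul]
  have h1 : |t| ≤ |(n : ℝ)| + 1 := by
    have := abs_add_le (n : ℝ) (t - n)
    rw [add_sub_cancel, abs_of_nonneg (sub_nonneg.2 ht.1)] at this
    linarith [ht.2]
  have h2 := abs_sub_abs_le_abs_sub τ t
  rw [abs_sub_comm]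
  linarith

/-- The covariance on a window involves two combinations of a waveform and its auxiliary phase: `(c,
d) = (η, 1 - η)` for the mean transmitted signal and `(1, -1)` for the partition noise. The general
form covers both. -/
theorem WindowPair.locallyEventually {lam h : ℝ → ℝ} {a : ℤ → ℝ} (hp : WindowPair lam h a)
    (c d : ℝ) : LocallyEventually (atBot ×ˢ atTop)
      (fun w : ℝ × ℝ => (Icc w.1 w.2).indicator
        fun t => c * h t + d * -auxPhase w.1 w.2 lam h t)
      (fun t => c * h t + d * -conv lam h t) fun n => |c| * a n + |d| * a n := by
  have hneg : ∀ {f : ℝ → ℝ}, Amalgam f a → Amalgam (fun t => -f t) a := fun hf =>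
    hf.mono hf.measurable.neg fun t => (abs_neg _).le
  refine ⟨fun w => ((hp.wave.const_mul c).add ((hneg (hp.aux w)).const_mul d)).indicator
    measurableSet_Icc, (hp.wave.const_mul c).add ((hneg hp.limit).const_mul d), fun n => ?_⟩
  filter_upwards [hp.eventually_eq n,
    (eventually_le_atBot (n : ℝ)).prod_mk (eventually_ge_atTop ((n : ℝ) + 1))] with w hw hw' t ht
  have hm : t ∈ Icc w.1 w.2 := ⟨hw'.1.trans ht.1, ht.2.le.trans hw'.2⟩
  rw [indicator_of_mem hm, hw t ht]

theorem WindowPair.spec_eq {lam h : ℝ → ℝ} {a : ℤ → ℝ} (hp : WindowPair lam h a)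
    (hl : Integrable lam) (c d ω : ℝ) : spec (fun t => c * h t + d * -conv lam h t) ω =
      (c - d * spec lam ω) * spec h ω := by
  have h1 : (fun t => c * h t + d * -conv lam h t) = fun t => c * h t - d * conv lam h t := by
    ext t; ring
  rw [h1, spec_sub (hp.wave.integrable.const_mul c) (hp.limit.integrable.const_mul d),
    spec_const_mul, spec_const_mul, spec_conv hl hp.wave.integrable]
  ring

/-- The Fisher information of wide windows. -/
theorem IsStationarySource.tendsto_pairCov {ψ : ℝ → ℝ → Multiset ℝ → ℂ} {Imean : ℝ}
    {S : ℝ → ℝ} (hs : IsStationarySource ψ Imean S) (κ : ℝ) {lam h k : ℝ → ℝ} {a b : ℤ → ℝ}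
    (hl : Integrable lam) (hh : WindowPair lam h a) (hk : WindowPair lam k b) :
    Integrable (fun ω => (spectralQFI (Real.cos κ ^ 2) Imean S lam ω : ℂ) * spec h ω *
      conj (spec k ω)) ∧
    Tendsto (fun w : ℝ × ℝ => ((4 * pairCov w.1 w.2 κ (ψ w.1 w.2)
        (pairFlux h fun t => -auxPhase w.1 w.2 lam h t)
        (pairFlux k fun t => -auxPhase w.1 w.2 lam k t) : ℝ) : ℂ)) (atBot ×ˢ atTop)
      (𝓝 ((1 / (2 * Real.pi) : ℂ) * ∫ ω, (spectralQFI (Real.cos κ ^ 2) Imean S lam ω : ℂ) *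
        spec h ω * conj (spec k ω))) := by
  set η := Real.cos κ ^ 2 with hη
  obtain ⟨B, hB⟩ := hs.specBounded
  have hS := hs.measurable_psd
  have hS0 := hs.psd_nonneg
  -- The pair `(η, 1 - η)` goes with the measure `S dω`, and `(1, -1)` with Lebesgue measure.
  have lh := hh.locallyEventually η (1 - η)
  have lk := hk.locallyEventually η (1 - η)
  have dh := hh.locallyEventually 1 (-1)
  have dk := hk.locallyEventually 1 (-1)
  have t1 := hB.tendsto_integral lh lk
  have t2 := specBounded_volume.tendsto_integral dh dk
  have i1 := (hB.memLp lh.right).integrable_mul (hB.memLp lk.right).star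
  have i2 := (specBounded_volume.memLp dh.right).integrable_mul
    (specBounded_volume.memLp dk.right).star
  -- By `WindowPair.spec_eq` the two combinations have transforms `(η - (1-η) λ) ĥ` and `(1 + λ) ĥ`.
  -- Their sesquilinear products give the two squared moduli in `spectralQFI`.
  have hpt : ∀ ω, (spectralQFI η Imean S lam ω : ℂ) * spec h ω * conj (spec k ω) =
      4 * ((S ω : ℂ) * (spec (fun t => η * h t + (1 - η) * -conv lam h t) ω *
        conj (spec (fun t => η * k t + (1 - η) * -conv lam k t) ω)) +
      (η * (1 - η) * Imean : ℝ) * (spec (fun t => 1 * h t + -1 * -conv lam h t) ω *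
        conj (spec (fun t => 1 * k t + -1 * -conv lam k t) ω))) := by
    intro ω
    rw [hh.spec_eq hl, hk.spec_eq hl, hh.spec_eq hl, hk.spec_eq hl, spectralQFI]
    simp only [map_mul, map_sub, Complex.conj_ofReal, ← Complex.normSq_eq_norm_sq]
    push_cast
    rw [Complex.normSq_eq_conj_mul_self, Complex.normSq_eq_conj_mul_self]
    simp only [map_sub, map_add, map_mul, map_one, Complex.conj_ofReal]
    ring
  have i1' : Integrable fun ω => (S ω : ℂ) *
      (spec (fun t => η * h t + (1 - η) * -conv lam h t) ω *
        conj (spec (fun t => η * k t + (1 - η) * -conv lam k t) ω)) := by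
    have := (integrable_psdMeasure_iff hS hS0 _).1 i1
    simp only [Complex.real_smul] at this
    exact this
  have i2' : Integrable fun ω => (spec (fun t => 1 * h t + -1 * -conv lam h t) ω *
        conj (spec (fun t => 1 * k t + -1 * -conv lam k t) ω)) := i2
  refine ⟨?_, ?_⟩
  · simp only [hpt]
    exact (i1'.add (i2'.const_mul _)).const_mul 4
  simp only [hpt]
  rw [integral_const_mul, integral_add i1' (i2'.const_mul _), integral_const_mul]
  simp only [integral_psdMeasure hS hS0, Complex.real_smul] at t1
  have t3 := ((t1.const_mul (1 / (2 * Real.pi) : ℂ)).add ((t2.const_mul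
    (1 / (2 * Real.pi) : ℂ)).const_mul ((η * (1 - η) * Imean : ℝ) : ℂ))).const_mul 4
  refine (t3.congr' ?_).trans (le_of_eq ?_)
  · filter_upwards [(eventually_lt_atBot (0 : ℝ)).prod_mk (eventually_gt_atTop (0 : ℝ))] with w hw
    have hw' : w.1 < w.2 := hw.1.trans hw.2
    have ea := fun {f : ℝ → ℝ} {a : ℤ → ℝ} (hf : WindowPair lam f a) => (hf.aux w).bddMeas.neg
    rw [Complex.ofReal_mul 4, hs.pairCov_eq hw' κ hh.wave.bddMeas (ea hh) hk.wave.bddMeas (ea hk)]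
    -- Parseval turns the partition noise, an integral over the window, into a frequency integral of
    -- truncated functions, to which the limit `t2` applies.
    have e1 := integral_spec_mul_conj (dh.left w).integrable (dh.left w).memLp_two
      (dk.left w).integrable (dk.left w).memLp_two
    have e2 : ∫ t, (Icc w.1 w.2).indicator
          (fun t => 1 * h t + -1 * -auxPhase w.1 w.2 lam h t) t *
        (Icc w.1 w.2).indicator (fun t => 1 * k t + -1 * -auxPhase w.1 w.2 lam k t) t =
        ∫ t in Icc w.1 w.2, (h t - -auxPhase w.1 w.2 lam h t) *
          (k t - -auxPhase w.1 w.2 lam k t) := by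
      rw [← integral_indicator measurableSet_Icc]
      refine integral_congr_ae (ae_of_all _ fun t => ?_)
      by_cases ht : t ∈ Icc w.1 w.2
      · simp only [indicator_of_mem ht]; ring
      · simp only [indicator_of_notMem ht, mul_zero]
    rw [e2] at e1
    rw [e1]
    have hp : (Real.pi : ℂ) ≠ 0 := by exact_mod_cast Real.pi_ne_zero
    simp only [← hη, mul_assoc]
    push_cast
    field_simp
  · congr 1
    ring

theorem IsStationarySource.hasSpectralQFI {ψ : ℝ → ℝ → Multiset ℝ → ℂ} {Imean : ℝ}
    {S : ℝ → ℝ} (hs : IsStationarySource ψ Imean S) (κ : ℝ) {lam : ℝ → ℝ} (hl : Integrable lam) :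
    HasSpectralQFI κ ψ lam (spectralQFI (Real.cos κ ^ 2) Imean S lam) where
  contDiff t₀ t₁ h φ f k hφ hf hk := contDiff_phaseFidelity (hs.finiteNumber h)
    (hs.norm_eq t₀ t₁ h) hl hφ hf.bddMeas hk.bddMeas
  indep t₀ t₁ h φ f k hφ hf hk := by
    rw [qfi_eq (hs.finiteNumber h) (hs.norm_eq t₀ t₁ h) hl hφ hf.bddMeas hk.bddMeas,
      qfi_eq (hs.finiteNumber h) (hs.norm_eq t₀ t₁ h) hl (φ := 0) (continuous_zero.locallyIntegrable) hf.bddMeas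
        hk.bddMeas]
  integrable f k hf hk := by
    obtain ⟨a, ha⟩ := hf.windowPair hl
    obtain ⟨b, hb⟩ := hk.windowPair hl
    exact (hs.tendsto_pairCov κ hl ha hb).1
  tendsto φ f k hφ hf hk := by
    obtain ⟨a, ha⟩ := hf.windowPair hl
    obtain ⟨b, hb⟩ := hk.windowPair hl
    refine (hs.tendsto_pairCov κ hl ha hb).2.congr' ?_
    filter_upwards [(eventually_lt_atBot (0 : ℝ)).prod_mk (eventually_gt_atTop (0 : ℝ))] with w hw
    have h := hw.1.trans hw.2
    rw [qfi_eq (hs.finiteNumber h) (hs.norm_eq _ _ h) hl hφ hf.bddMeas hk.bddMeas]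

/-! ### The optimal purification -/

/-- The optimal value of `1 + λ(ω)`. -/
def optimalGain (η Imean : ℝ) (S : ℝ → ℝ) (ω : ℝ) : ℝ := S ω / ((1 - η) * S ω + η * Imean)

section Minimum

variable {η Imean : ℝ} {S : ℝ → ℝ} {ω : ℝ}

theorem gain_denom_pos (hη0 : 0 < η) (hη1 : η ≤ 1) (hI : 0 < Imean) (hS : 0 ≤ S ω) :
    0 < (1 - η) * S ω + η * Imean :=
  add_pos_of_nonneg_of_pos (mul_nonneg (by linarith) hS) (mul_pos hη0 hI)

theorem minSpectralQFI_eq (hη0 : 0 < η) (hη1 : η ≤ 1) (hI : 0 < Imean) (hS : 0 ≤ S ω) :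
    minSpectralQFI η Imean S ω = 4 * (S ω * (η * Imean) / ((1 - η) * S ω + η * Imean)) := by
  have hD := gain_denom_pos hη0 hη1 hI hS
  rw [minSpectralQFI]
  split_ifs with h0
  · simp [h0]
  · congr 1
    rw [inv_eq_iff_eq_inv, inv_div]
    field_simp
    ring

theorem minSpectralQFI_nonneg (hη0 : 0 < η) (hη1 : η ≤ 1) (hI : 0 < Imean) (hS : 0 ≤ S ω) :
    0 ≤ minSpectralQFI η Imean S ω := by
  have hD := gain_denom_pos hη0 hη1 hI hS
  rw [minSpectralQFI_eq hη0 hη1 hI hS]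
  positivity

/-- Completing the square. -/
theorem spectralQFI_eq (hη0 : 0 < η) (hη1 : η ≤ 1) (hI : 0 < Imean) (hS : 0 ≤ S ω)
    (lam : ℝ → ℝ) : spectralQFI η Imean S lam ω = minSpectralQFI η Imean S ω +
      4 * ((1 - η) * ((1 - η) * S ω + η * Imean)) *
        ‖1 + spec lam ω - (optimalGain η Imean S ω : ℂ)‖ ^ 2 := by
  have hD := gain_denom_pos hη0 hη1 hI hS
  rw [minSpectralQFI_eq hη0 hη1 hI hS, spectralQFI, optimalGain]
  simp only [← Complex.normSq_eq_norm_sq, Complex.normSq_apply, Complex.sub_re, Complex.sub_im,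
    Complex.add_re, Complex.add_im, Complex.mul_re, Complex.mul_im, Complex.one_re,
    Complex.one_im, Complex.ofReal_re, Complex.ofReal_im]
  field_simp
  ring

theorem spec_comp_neg (f : ℝ → ℝ) (ω : ℝ) : spec (fun t => f (-t)) ω = conj (spec f ω) := by
  rw [conj_spec, spec, spec,
    ← integral_neg_eq_self (fun t : ℝ => (f t : ℂ) * Complex.exp (Complex.I * (-ω : ℝ) * t))]
  refine integral_congr_ae (ae_of_all _ fun t => ?_)
  simp only
  congr 2
  push_cast
  ring

/-- A bump convolved with its reflection has transform `|ĥ|²`, which is real and nonzero at `ω` if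
the bump is narrow. Rescaling reaches any real value, and the optimal value of `λ(ω)` is real. -/
theorem exists_kernel_spec_eq (ω c : ℝ) : ∃ lam : ℝ → ℝ, Integrable lam ∧ spec lam ω = c := by
  obtain ⟨h, hh, hω⟩ := exists_bump_spec_ge |ω|
  have hi := hh.integrable
  have hi' : Integrable fun t => h (-t) := hi.comp_neg
  have h0 : ‖spec h ω‖ ^ 2 ≠ 0 := by
    have := hω ω le_rfl
    positivity
  refine ⟨fun t => (c / ‖spec h ω‖ ^ 2) * conv h (fun t => h (-t)) t,
    (integrable_conv hi hi').const_mul _, ?_⟩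
  rw [spec_const_mul, spec_conv hi hi', spec_comp_neg, Complex.mul_conj,
    Complex.normSq_eq_norm_sq, ← Complex.ofReal_mul, div_mul_cancel₀ _ h0]

theorem isLeast_minSpectralQFI (hη0 : 0 < η) (hη1 : η ≤ 1) (hI : 0 < Imean) (hS : 0 ≤ S ω) :
    IsLeast {J : ℝ | ∃ lam : ℝ → ℝ, Integrable lam ∧ J = spectralQFI η Imean S lam ω}
      (minSpectralQFI η Imean S ω) := by
  have hD := gain_denom_pos hη0 hη1 hI hS
  constructor
  · obtain ⟨lam, hl, hω⟩ := exists_kernel_spec_eq ω (optimalGain η Imean S ω - 1)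
    refine ⟨lam, hl, ?_⟩
    rw [spectralQFI_eq hη0 hη1 hI hS, hω]
    simp
  · rintro J ⟨lam, -, rfl⟩
    rw [spectralQFI_eq hη0 hη1 hI hS]
    have : 0 ≤ 1 - η := by linarith
    have : 0 ≤ 4 * ((1 - η) * ((1 - η) * S ω + η * Imean)) *
        ‖1 + spec lam ω - (optimalGain η Imean S ω : ℂ)‖ ^ 2 := by positivity
    linarith

theorem minSpectralQFI_le (hη0 : 0 < η) (hη1 : η < 1) (hI : 0 < Imean) (hS : 0 ≤ S ω) :
    minSpectralQFI η Imean S ω ≤ 4 * η * Imean / (1 - η) := by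
  have hD := gain_denom_pos hη0 hη1.le hI hS
  have h1 : 0 < 1 - η := by linarith
  rw [minSpectralQFI_eq hη0 hη1.le hI hS, ← mul_div_assoc, div_le_div_iff₀ hD h1]
  have : 0 ≤ η * Imean * (η * Imean) := mul_self_nonneg _
  nlinarith

end Minimum

/-! ### Density of trigonometric polynomials -/

/-- The positive and negative parts of `f` are densities of finite measures with equal
characteristic functions. The measures coincide, so the parts agree almost everywhere, which forces
`f = 0`. -/
theorem ae_eq_zero_of_integral_exp {ν : Measure ℝ} [SigmaFinite ν] {f : ℝ → ℝ}
    (hf : Integrable f ν)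
    (h : ∀ s : ℝ, ∫ ω, (f ω : ℂ) * Complex.exp (Complex.I * ω * s) ∂ν = 0) : f =ᵐ[ν] 0 := by
  have hp : ∀ {u : ℝ → ℝ}, Integrable u ν →
      IsFiniteMeasure (ν.withDensity fun ω => ENNReal.ofReal (u ω)) := fun hu =>
    isFiniteMeasure_withDensity_ofReal hu.2
  have hm := hf.1.aemeasurable
  have := hp hf
  have := hp hf.neg
  have hc : ∀ {u : ℝ → ℝ}, Integrable u ν → ∀ s : ℝ,
      charFun (ν.withDensity fun ω => ENNReal.ofReal (u ω)) s =
        ∫ ω, (max (u ω) 0 : ℝ) • Complex.exp (Complex.I * ω * s) ∂ν := by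
    intro u hu s
    rw [charFun_apply_real, integral_withDensity_eq_integral_toReal_smul₀
      hu.1.aemeasurable.ennreal_ofReal (ae_of_all _ fun _ => ENNReal.ofReal_lt_top)]
    refine integral_congr_ae (ae_of_all _ fun ω => ?_)
    simp only [ENNReal.toReal_ofReal']
    congr 2
    ring
  have hbd : ∀ {u : ℝ → ℝ}, Integrable u ν → ∀ s : ℝ,
      Integrable (fun ω => (max (u ω) 0 : ℝ) • Complex.exp (Complex.I * ω * s)) ν := by
    intro u hu s
    have hu' : Integrable (fun ω => ((max (u ω) 0 : ℝ) : ℂ)) ν := hu.pos_part.ofReal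
    refine hu'.mul_bdd (c := 1) (by fun_prop) (ae_of_all _ fun ω => ?_)
    rw [show Complex.I * (ω : ℂ) * (s : ℂ) = ((ω * s : ℝ) : ℂ) * Complex.I by push_cast; ring,
      Complex.norm_exp_ofReal_mul_I]
  have heq : ν.withDensity (fun ω => ENNReal.ofReal (f ω)) =
      ν.withDensity (fun ω => ENNReal.ofReal ((-f) ω)) := by
    refine Measure.ext_of_charFun (funext fun s => ?_)
    rw [hc hf, hc hf.neg, ← sub_eq_zero, ← integral_sub (hbd hf s) (hbd hf.neg s), ← h s]
    refine integral_congr_ae (ae_of_all _ fun ω => ?_)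
    simp only [Complex.real_smul, ← sub_mul, ← Complex.ofReal_sub, Pi.neg_apply]
    congr 2
    rcases le_total (f ω) 0 with h0 | h0
    · rw [max_eq_right h0, max_eq_left (by linarith)]; ring
    · rw [max_eq_left h0, max_eq_right (by linarith)]; ring
  rw [withDensity_eq_iff hm.ennreal_ofReal hm.neg.ennreal_ofReal
    (hf.lintegral_lt_top.ne)] at heq
  filter_upwards [heq] with ω hω
  rw [Pi.neg_apply] at hω
  rcases le_total (f ω) 0 with h0 | h0
  · rw [ENNReal.ofReal_of_nonpos h0, eq_comm, ENNReal.ofReal_eq_zero] at hω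
    exact le_antisymm h0 (neg_nonpos.1 hω)
  · rw [ENNReal.ofReal_of_nonpos (p := -f ω) (by linarith), ENNReal.ofReal_eq_zero] at hω
    exact le_antisymm hω h0

theorem norm_exp_I_mul_mul (ω s : ℝ) : ‖Complex.exp (Complex.I * ω * s)‖ = 1 := by
  rw [show Complex.I * (ω : ℂ) * (s : ℂ) = ((ω * s : ℝ) : ℂ) * Complex.I by push_cast; ring,
      Complex.norm_exp_ofReal_mul_I]

/-- The transform of `conj f` at `s` is the conjugate of that of `f` at `-s`, so it vanishes as
well. Hence the transforms of the real and imaginary parts of `f` vanish separately. -/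
theorem ae_eq_zero_of_integral_exp_complex {ν : Measure ℝ} [SigmaFinite ν] {f : ℝ → ℂ}
    (hf : Integrable f ν)
    (h : ∀ s : ℝ, ∫ ω, f ω * Complex.exp (Complex.I * ω * s) ∂ν = 0) : f =ᵐ[ν] 0 := by
  have hi : ∀ s : ℝ, Integrable (fun ω => f ω * Complex.exp (Complex.I * ω * s)) ν := fun s =>
    hf.mul_bdd (c := 1) (by fun_prop) (ae_of_all _ fun ω => (norm_exp_I_mul_mul ω s).le)
  have hf' : Integrable (fun ω => conj (f ω)) ν := by
    simpa using (LinearIsometryEquiv.integrable_comp_iff Complex.conjLIE).2 hf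
  have hi' : ∀ s : ℝ, Integrable (fun ω => conj (f ω) * Complex.exp (Complex.I * ω * s)) ν :=
    fun s => hf'.mul_bdd (c := 1) (by fun_prop) (ae_of_all _ fun ω => (norm_exp_I_mul_mul ω s).le)
  have h' : ∀ s : ℝ, ∫ ω, conj (f ω) * Complex.exp (Complex.I * ω * s) ∂ν = 0 := by
    intro s
    have := congrArg conj (h (-s))
    rw [← integral_conj, map_zero] at this
    rw [← this]
    refine integral_congr_ae (ae_of_all _ fun ω => ?_)
    simp only [map_mul, ← Complex.exp_conj, Complex.conj_ofReal, Complex.conj_I]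
    congr 2
    push_cast
    ring
  have hre := ae_eq_zero_of_integral_exp hf.re fun s => by
    have := congrArg (fun z => z / 2) (congrArg₂ (· + ·) (h s) (h' s))
    simp only [← integral_add (hi s) (hi' s), ← integral_div] at this
    simp only [add_zero, zero_div] at this
    rw [← this]
    refine integral_congr_ae (ae_of_all _ fun ω => ?_)
    simp only [← add_mul, Complex.add_conj, RCLike.re_to_complex]
    push_cast
    ring
  have him := ae_eq_zero_of_integral_exp hf.im fun s => by
    have := congrArg (fun z => z / (2 * Complex.I)) (congrArg₂ (· - ·) (h s) (h' s))
    simp only [← integral_sub (hi s) (hi' s), ← integral_div] at this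
    simp only [sub_zero, zero_div] at this
    rw [← this]
    refine integral_congr_ae (ae_of_all _ fun ω => ?_)
    simp only [← sub_mul, Complex.sub_conj, RCLike.im_to_complex]
    field_simp
    push_cast
    ring
  filter_upwards [hre, him] with ω h1 h2
  exact Complex.ext h1 h2

/-- The trigonometric polynomial with coefficients `c` and frequencies `s`. -/
def trigSum {n : ℕ} (c s : Fin n → ℝ) (ω : ℝ) : ℂ :=
  ∑ j, (c j : ℂ) * Complex.exp (Complex.I * ω * s j)

theorem continuous_trigSum {n : ℕ} (c s : Fin n → ℝ) : Continuous (trigSum c s) := by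
  unfold trigSum
  fun_prop

theorem norm_trigSum_le {n : ℕ} (c s : Fin n → ℝ) (ω : ℝ) : ‖trigSum c s ω‖ ≤ ∑ j, |c j| := by
  refine (norm_sum_le _ _).trans (Finset.sum_le_sum fun j _ => ?_)
  rw [norm_mul, norm_exp_I_mul_mul, mul_one, Complex.norm_real, Real.norm_eq_abs]

theorem memLp_trigSum {ν : Measure ℝ} [IsFiniteMeasure ν] {n : ℕ} (c s : Fin n → ℝ) :
    MemLp (trigSum c s) 2 ν :=
  MemLp.of_bound (continuous_trigSum c s).aestronglyMeasurable _
    (ae_of_all _ (norm_trigSum_le c s))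

theorem memLp_exp {ν : Measure ℝ} [IsFiniteMeasure ν] (s : ℝ) :
    MemLp (fun ω : ℝ => Complex.exp (Complex.I * ω * s)) 2 ν :=
  MemLp.of_bound (by fun_prop) 1 (ae_of_all _ fun ω => (norm_exp_I_mul_mul ω s).le)

/-- An element orthogonal to all exponentials has vanishing transform. It is integrable since `ν` is
finite, hence it is zero by uniqueness. -/
theorem span_exp_dense (ν : Measure ℝ) [IsFiniteMeasure ν] :
    (Submodule.span ℂ (range fun s : ℝ => (memLp_exp (ν := ν) s).toLp _)).topologicalClosure =
      ⊤ := by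
  rw [Submodule.topologicalClosure_eq_top_iff, Submodule.eq_bot_iff]
  intro F hF
  have hFi : Integrable F ν := (Lp.memLp F).integrable (by norm_num)
  refine Lp.ext ?_
  refine (ae_eq_zero_of_integral_exp_complex hFi fun s => ?_).trans (Lp.coeFn_zero _ _ _).symm
  have h1 := (Submodule.mem_orthogonal _ _).1 hF _
    (Submodule.subset_span (mem_range_self (-s)))
  rw [L2.inner_def] at h1
  rw [← h1]
  refine integral_congr_ae ?_
  filter_upwards [(memLp_exp (ν := ν) (-s)).coeFn_toLp] with ω hω
  rw [hω, RCLike.inner_apply, ← Complex.exp_conj]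
  simp only [map_mul, Complex.conj_ofReal, Complex.conj_I]
  congr 2
  push_cast
  ring

theorem exists_expSum_near {ν : Measure ℝ} [IsFiniteMeasure ν] {v : ℝ → ℂ} (hv : MemLp v 2 ν)
    {ε : ℝ} (hε : 0 < ε) : ∃ (n : ℕ) (z : Fin n → ℂ) (s : Fin n → ℝ),
      eLpNorm (fun ω => v ω - ∑ j, z j * Complex.exp (Complex.I * ω * s j)) 2 ν <
        ENNReal.ofReal ε := by
  have h1 : hv.toLp v ∈ (Submodule.span ℂ
      (range fun s : ℝ => (memLp_exp (ν := ν) s).toLp _)).topologicalClosure := by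
    rw [span_exp_dense]; trivial
  rw [← SetLike.mem_coe, Submodule.topologicalClosure_coe, Metric.mem_closure_iff] at h1
  obtain ⟨p, hp, hpd⟩ := h1 ε hε
  rw [SetLike.mem_coe, Submodule.mem_span_set'] at hp
  obtain ⟨n, z, e, rfl⟩ := hp
  choose s hs using fun j => (e j).2
  refine ⟨n, z, s, ?_⟩
  have hQ : (∑ j, z j • (e j : Lp ℂ 2 ν) : Lp ℂ 2 ν) =ᵐ[ν]
      fun ω => ∑ j, z j * Complex.exp (Complex.I * ω * s j) := by
    refine (Lp.coeFn_finsetSum _ _).trans ?_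
    have : ∀ j, (z j • (e j : Lp ℂ 2 ν) : Lp ℂ 2 ν) =ᵐ[ν]
        fun ω => z j * Complex.exp (Complex.I * ω * s j) := by
      intro j
      refine (Lp.coeFn_smul _ _).trans ?_
      rw [← hs j]
      filter_upwards [(memLp_exp (ν := ν) (s j)).coeFn_toLp] with ω hω
      rw [Pi.smul_apply, hω, smul_eq_mul]
    filter_upwards [ae_all_iff.2 this] with ω hω
    rw [Finset.sum_apply]
    exact Finset.sum_congr rfl fun j _ => hω j
  rw [← edist_lt_ofReal, Lp.edist_def] at hpd
  refine lt_of_eq_of_lt (eLpNorm_congr_ae ?_) hpd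
  filter_upwards [hv.coeFn_toLp, hQ] with ω h2 h3
  rw [Pi.sub_apply, h2, h3]

/-- Real trigonometric polynomials are dense in the Hermitian part of `L²(ν)`, for symmetric `ν`. -/
theorem exists_trigSum_near {ν : Measure ℝ} [IsFiniteMeasure ν] (hν : ν.map (fun ω => -ω) = ν)
    {v : ℝ → ℂ} (hv : MemLp v 2 ν) (hsymm : ∀ᵐ ω ∂ν, v (-ω) = conj (v ω)) {ε : ℝ} (hε : 0 < ε) :
    ∃ (n : ℕ) (c s : Fin n → ℝ), eLpNorm (fun ω => v ω - trigSum c s ω) 2 ν <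
      ENNReal.ofReal ε := by
  obtain ⟨n, z, s, hd1⟩ := exists_expSum_near hv hε
  set Q : ℝ → ℂ := fun ω => ∑ j, z j * Complex.exp (Complex.I * ω * s j)
  have hQc : Continuous Q := by fun_prop
  replace hd1 : eLpNorm (fun ω => v ω - Q ω) 2 ν < ENNReal.ofReal ε := hd1
  -- By the symmetry of `ν` and of `v`, the reflected conjugate of `Q` is an equally good
  -- approximation. The mean of the two has the real parts of the coefficients as its coefficients.
  have hd2 : eLpNorm (fun ω => v ω - conj (Q (-ω))) 2 ν < ENNReal.ofReal ε := by
    refine lt_of_eq_of_lt ?_ hd1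
    have hm : AEStronglyMeasurable (fun ω => v ω - Q ω) (ν.map fun ω => -ω) := by
      rw [hν]; exact hv.1.sub hQc.aestronglyMeasurable
    have h4 := eLpNorm_map_measure (p := 2) hm measurable_neg.aemeasurable
    rw [hν] at h4
    rw [h4]
    refine eLpNorm_congr_norm_ae ?_
    filter_upwards [hsymm] with ω hω
    rw [Function.comp_apply, hω, ← Complex.norm_conj, map_sub, Complex.conj_conj]
  refine ⟨n, fun j => (z j).re, s, ?_⟩
  have hm1 : AEStronglyMeasurable (fun ω => v ω - Q ω) ν := hv.1.sub hQc.aestronglyMeasurable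
  have hm2 : AEStronglyMeasurable (fun ω => v ω - conj (Q (-ω))) ν :=
    hv.1.sub (Complex.continuous_conj.comp (hQc.comp continuous_neg)).aestronglyMeasurable
  have hsplit : (fun ω => v ω - trigSum (fun j => (z j).re) s ω) =
      fun ω => (2⁻¹ : ℂ) • ((v ω - Q ω) + (v ω - conj (Q (-ω)))) := by
    ext ω
    have h5 : conj (Q (-ω)) = ∑ j, conj (z j) * Complex.exp (Complex.I * ω * s j) := by
      simp only [Q, map_sum, map_mul, ← Complex.exp_conj, Complex.conj_ofReal, Complex.conj_I]
      refine Finset.sum_congr rfl fun j _ => ?_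
      congr 2
      push_cast
      ring
    have h6 : trigSum (fun j => (z j).re) s ω = 2⁻¹ * (Q ω + conj (Q (-ω))) := by
      rw [h5, trigSum, ← Finset.sum_add_distrib, Finset.mul_sum]
      refine Finset.sum_congr rfl fun j _ => ?_
      rw [← add_mul, Complex.add_conj]
      push_cast
      ring
    rw [h6, smul_eq_mul]
    ring
  have h7 : ‖(2⁻¹ : ℂ)‖ₑ = 2⁻¹ := by
    rw [enorm_inv two_ne_zero, ← ofReal_norm]
    norm_num
  rw [hsplit]
  calc eLpNorm (fun ω => (2⁻¹ : ℂ) • ((v ω - Q ω) + (v ω - conj (Q (-ω))))) 2 ν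
      = ‖(2⁻¹ : ℂ)‖ₑ * eLpNorm (fun ω => (v ω - Q ω) + (v ω - conj (Q (-ω)))) 2 ν :=
        eLpNorm_const_smul (2⁻¹ : ℂ) _ 2 ν
    _ ≤ 2⁻¹ * (eLpNorm (fun ω => v ω - Q ω) 2 ν + eLpNorm (fun ω => v ω - conj (Q (-ω))) 2 ν) := by
        rw [h7]
        gcongr
        exact eLpNorm_add_le hm1 hm2 (by norm_num)
    _ < 2⁻¹ * (ENNReal.ofReal ε + ENNReal.ofReal ε) :=
        ENNReal.mul_lt_mul_right (by norm_num) (by norm_num) (ENNReal.add_lt_add hd1 hd2)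
    _ = ENNReal.ofReal ε := by
        rw [← two_mul, ← mul_assoc, ENNReal.inv_mul_cancel (by norm_num) (by norm_num), one_mul]

/-- A spectral density with real covariances is even. -/
theorem ae_even_of_integral_real {M : ℝ → ℝ}
    (hi : ∀ h, IsBump h → Integrable fun ω => (M ω : ℂ) * spec h ω * conj (spec h ω))
    (hr : ∀ h k, IsBump h → IsBump k →
      (∫ ω, (M ω : ℂ) * spec h ω * conj (spec k ω)).im = 0) :
    ∀ᵐ ω, M (-ω) = M ω := by
  have key : ∀ R : ℕ, ∀ᵐ ω : ℝ, |ω| ≤ R → M (-ω) = M ω := by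
    intro R
    -- `M` itself need not be integrable. The weight `‖ĥ‖²` makes it so, is even, and does not
    -- vanish on `[-R, R]`.
    obtain ⟨h, hh, hR⟩ := exists_bump_spec_ge R
    have e1 : ∀ ω, (M ω : ℂ) * spec h ω * conj (spec h ω) = ((M ω * ‖spec h ω‖ ^ 2 : ℝ) : ℂ) := by
      intro ω
      rw [mul_assoc, Complex.mul_conj, Complex.normSq_eq_norm_sq]
      push_cast
      ring
    have hf : Integrable fun ω => M ω * ‖spec h ω‖ ^ 2 := by
      have := hi h hh
      simp only [e1] at this
      exact this.re.congr (ae_of_all _ fun ω => Complex.ofReal_re _)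
    have hn : ∀ ω, ‖spec h (-ω)‖ = ‖spec h ω‖ := fun ω => by
      rw [← conj_spec, Complex.norm_conj]
    have hf' : Integrable fun ω => M (-ω) * ‖spec h ω‖ ^ 2 := by
      have := hf.comp_neg
      simpa only [hn] using this
    have hz := ae_eq_zero_of_integral_exp (f := fun ω => M (-ω) * ‖spec h ω‖ ^ 2 -
        M ω * ‖spec h ω‖ ^ 2) (hf'.sub hf) fun s => by
      set u : ℝ → ℝ := fun ω => M ω * ‖spec h ω‖ ^ 2
      have hu : (fun ω => M (-ω) * ‖spec h ω‖ ^ 2 - M ω * ‖spec h ω‖ ^ 2) =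
          fun ω => u (-ω) - u ω := by
        ext ω
        simp only [u, hn]
      have h3 : spec (fun ω => M (-ω) * ‖spec h ω‖ ^ 2 - M ω * ‖spec h ω‖ ^ 2) s = 0 := by
        rw [hu, spec_sub (hf.comp_neg) hf, spec_comp_neg, sub_eq_zero, Complex.conj_eq_iff_im,
          ← neg_eq_zero, ← Complex.conj_im, conj_spec]
        -- Pairing `h` with its translate by `s` gives the transform of `u` at `-s`, so that
        -- transform is real. Since reflection of `u` conjugates its transform, `u` and its
        -- reflection have the same transform.
        have h4 := hr h (fun t => h (t - s)) hh (hh.comp_sub s)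
        rw [← h4, spec]
        congr 1
        refine integral_congr_ae (ae_of_all _ fun ω => ?_)
        simp only [spec_comp_sub, map_mul, ← Complex.exp_conj, Complex.conj_ofReal,
          Complex.conj_I, u]
        rw [mul_left_comm, e1, mul_comm]
        congr 2
        push_cast
        ring
      rw [← h3, spec]
      refine integral_congr_ae (ae_of_all _ fun ω => ?_)
      simp only
      congr 2
      ring
    filter_upwards [hz] with ω hω hωR
    have h0 : ‖spec h ω‖ ^ 2 ≠ 0 := by
      have := hR ω hωR
      positivity
    have : (M (-ω) - M ω) * ‖spec h ω‖ ^ 2 = 0 := by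
      rw [sub_mul]; exact hω
    rcases mul_eq_zero.1 this with h1 | h1
    · linarith
    · exact absurd h1 h0
  filter_upwards [ae_all_iff.2 key] with ω hω
  exact hω ⌈|ω|⌉₊ (Nat.le_ceil _)

/-! ### Slices of square-integrable functions of two variables -/

theorem eLpNorm_two_pow {α E : Type*} [MeasurableSpace α] [NormedAddCommGroup E] (μ : Measure α)
    (f : α → E) : eLpNorm f 2 μ ^ 2 = ∫⁻ a, ‖f a‖ₑ ^ 2 ∂μ := by
  rw [eLpNorm_eq_lintegral_rpow_enorm_toReal (by norm_num) (by norm_num), ← ENNReal.rpow_natCast,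
    ← ENNReal.rpow_mul]
  norm_num

theorem tendsto_eLpNorm_two_of_dominated {ι α E : Type*} [MeasurableSpace α]
    [NormedAddCommGroup E] {μ : Measure α} {l : Filter ι} [l.IsCountablyGenerated]
    {F : ι → α → E} {f : α → E} {G : α → ℝ} (hF : ∀ i, AEStronglyMeasurable (F i) μ)
    (hf : AEStronglyMeasurable f μ) (hG : MemLp G 2 μ)
    (hb : ∀ᶠ i in l, ∀ᵐ a ∂μ, ‖F i a - f a‖ ≤ G a)
    (hl : ∀ᵐ a ∂μ, Tendsto (fun i => F i a) l (𝓝 (f a))) :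
    Tendsto (fun i => eLpNorm (F i - f) 2 μ) l (𝓝 0) := by
  have h1 : Tendsto (fun i => ∫⁻ a, ‖F i a - f a‖ₑ ^ 2 ∂μ) l (𝓝 (∫⁻ _, 0 ∂μ)) := by
    refine tendsto_lintegral_filter_of_dominated_convergence' (fun a => ‖G a‖ₑ ^ 2)
      (Eventually.of_forall fun i => ((hF i).sub hf).enorm.pow_const 2) ?_ ?_ ?_
    · filter_upwards [hb] with i hi
      filter_upwards [hi] with a ha
      refine ENNReal.pow_le_pow_left ?_
      rw [← ofReal_norm, ← ofReal_norm]
      exact ENNReal.ofReal_le_ofReal (ha.trans (Real.le_norm_self _))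
    · rw [← eLpNorm_two_pow]
      exact (ENNReal.pow_lt_top hG.2).ne
    · filter_upwards [hl] with a ha
      have h2 : Tendsto (fun i => F i a - f a) l (𝓝 0) := by
        simpa using ha.sub_const (f a)
      have h3 := (ENNReal.continuous_pow 2).continuousAt.tendsto.comp h2.enorm
      simpa [Function.comp_def] using h3
  rw [lintegral_zero] at h1
  have h4 := (ENNReal.continuous_rpow_const (y := 1 / 2)).continuousAt.tendsto.comp h1
  have e : ∀ i, (∫⁻ a, ‖F i a - f a‖ₑ ^ 2 ∂μ) ^ (1 / 2 : ℝ) = eLpNorm (F i - f) 2 μ := by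
    intro i
    have := eLpNorm_two_pow μ (F i - f)
    simp only [Pi.sub_apply] at this
    rw [← this, ← ENNReal.rpow_natCast, ← ENNReal.rpow_mul]
    norm_num
  simp only [Function.comp_def, e] at h4
  simpa using h4

section Slices

variable {α β 𝕜 : Type*} [MeasurableSpace α] [MeasurableSpace β] [RCLike 𝕜] {μ : Measure α}
  {ν : Measure β}

open Classical in
/-- The class of a square-integrable function, and `0` for other functions. -/
def lpSlice (μ : Measure α) (F : α → 𝕜) : Lp 𝕜 2 μ := if h : MemLp F 2 μ then h.toLp F else 0

theorem lpSlice_of_memLp {F : α → 𝕜} (h : MemLp F 2 μ) : lpSlice μ F = h.toLp F := dif_pos h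

theorem lpSlice_coeFn {F : α → 𝕜} (h : MemLp F 2 μ) : lpSlice μ F =ᵐ[μ] F := by
  rw [lpSlice_of_memLp h]; exact h.coeFn_toLp

theorem lpSlice_congr {F G : α → 𝕜} (h : F =ᵐ[μ] G) : lpSlice μ F = lpSlice μ G := by
  by_cases hF : MemLp F 2 μ
  · rw [lpSlice_of_memLp hF, lpSlice_of_memLp (hF.ae_eq h), MemLp.toLp_eq_toLp_iff]
    exact h
  · rw [lpSlice, lpSlice, dif_neg hF, dif_neg fun hG => hF (hG.ae_eq h.symm)]

theorem lpSlice_add {F G : α → 𝕜} (hF : MemLp F 2 μ) (hG : MemLp G 2 μ) :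
    lpSlice μ (fun a => F a + G a) = lpSlice μ F + lpSlice μ G := by
  rw [lpSlice_of_memLp hF, lpSlice_of_memLp hG]
  exact lpSlice_of_memLp (hF.add hG)

theorem lpSlice_zero : lpSlice μ (fun _ : α => (0 : 𝕜)) = 0 := by
  have h : MemLp (fun _ : α => (0 : 𝕜)) 2 μ := MemLp.zero'
  rw [lpSlice_of_memLp h]
  exact MemLp.toLp_zero h

theorem lpSlice_const_mul (c : 𝕜) {F : α → 𝕜} (hF : MemLp F 2 μ) :
    lpSlice μ (fun a => c * F a) = c • lpSlice μ F := by
  rw [lpSlice_of_memLp hF, lpSlice_of_memLp (hF.const_mul c)]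
  rfl

theorem enorm_lpSlice {F : α → 𝕜} (hF : MemLp F 2 μ) : ‖lpSlice μ F‖ₑ = eLpNorm F 2 μ := by
  rw [lpSlice_of_memLp hF, Lp.enorm_toLp]

theorem tendsto_lpSlice {ι : Type*} {l : Filter ι} {F : ι → α → 𝕜} {f : α → 𝕜}
    (hF : ∀ i, MemLp (F i) 2 μ) (hf : MemLp f 2 μ)
    (h : Tendsto (fun i => eLpNorm (F i - f) 2 μ) l (𝓝 0)) :
    Tendsto (fun i => lpSlice μ (F i)) l (𝓝 (lpSlice μ f)) := by
  simp only [fun i => lpSlice_of_memLp (hF i), lpSlice_of_memLp hf]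
  exact (Lp.tendsto_Lp_iff_tendsto_eLpNorm'' _ hF _ hf).2 h

/-- No separability of `L²(μ)` is assumed, so strong measurability of an `L²`-valued map is not a
matter of scalar tests. It is built up from rectangles, where the map is a constant times an
indicator, by complements and disjoint unions. The latter are limits in `L²(μ)` by dominated
convergence. -/
theorem stronglyMeasurable_lpSlice_indicator [IsFiniteMeasure μ] (c : 𝕜) {A : Set (α × β)}
    (hA : MeasurableSet A) :
    StronglyMeasurable fun b => lpSlice μ fun a => A.indicator (fun _ => c) (a, b) := by
  have hmem : ∀ {A : Set (α × β)}, MeasurableSet A → ∀ b,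
      MemLp (fun a => A.indicator (fun _ => c) (a, b)) 2 μ := by
    intro A hA b
    refine MemLp.of_bound (C := ‖c‖) ?_ (ae_of_all _ fun a => norm_indicator_le_norm_self _ _)
    exact ((measurable_const.indicator hA).comp measurable_prodMk_right).aestronglyMeasurable
  induction A, hA using MeasurableSpace.induction_on_inter generateFrom_prod.symm isPiSystem_prod with
  | empty => simpa using stronglyMeasurable_const
  | basic A hA =>
    obtain ⟨s, hs, t, ht, rfl⟩ := hA
    have : (fun b => lpSlice μ fun a => (s ×ˢ t).indicator (fun _ => c) (a, b)) =
        t.indicator fun _ => lpSlice μ (s.indicator fun _ => c) := by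
      ext1 b
      by_cases hb : b ∈ t
      · rw [indicator_of_mem hb]
        congr 1
        ext1 a
        by_cases ha : a ∈ s <;> simp [ha, hb]
      · rw [indicator_of_notMem hb]
        have : (fun a => (s ×ˢ t).indicator (fun _ => c) (a, b)) = fun _ => 0 := by
          ext1 a
          simp [hb]
        rw [this, lpSlice_zero]
    rw [this]
    exact stronglyMeasurable_const.indicator ht
  | compl A hA ih =>
    have : (fun b => lpSlice μ fun a => Aᶜ.indicator (fun _ => c) (a, b)) =
        fun b => (lpSlice μ fun _ => c) + (-1 : 𝕜) •
          lpSlice μ fun a => A.indicator (fun _ => c) (a, b) := by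
      ext1 b
      rw [← lpSlice_const_mul _ (hmem hA b),
        ← lpSlice_add (memLp_const c) ((hmem hA b).const_mul (-1))]
      congr 1
      ext1 a
      by_cases ha : (a, b) ∈ A <;> simp [ha]
    rw [this]
    exact stronglyMeasurable_const.add (ih.const_smul (-1 : 𝕜))
  | iUnion A hd hA ih =>
    have hsum : ∀ n : ℕ, StronglyMeasurable fun b =>
        lpSlice μ fun a => (⋃ i ∈ Finset.range n, A i).indicator (fun _ => c) (a, b) := by
      intro n
      have : (fun b => lpSlice μ fun a =>
          (⋃ i ∈ Finset.range n, A i).indicator (fun _ => c) (a, b)) =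
          fun b => ∑ i ∈ Finset.range n,
            lpSlice μ fun a => (A i).indicator (fun _ => c) (a, b) := by
        ext1 b
        induction n with
        | zero =>
          simp only [Finset.range_zero, Finset.notMem_empty, iUnion_of_empty, iUnion_empty,
            indicator_empty, Finset.sum_empty]
          exact lpSlice_zero
        | succ n ihn =>
          rw [Finset.sum_range_succ, ← ihn, ← lpSlice_add
            (hmem (Finset.measurableSet_biUnion _ fun i _ => hA i) b) (hmem (hA n) b)]
          congr 1
          ext1 a
          rw [Finset.range_add_one, Finset.set_biUnion_insert, union_comm,
            indicator_union_of_disjoint]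
          refine disjoint_left.2 fun x hx hx' => ?_
          simp only [mem_iUnion] at hx
          obtain ⟨i, hi, hxi⟩ := hx
          exact disjoint_left.1 (hd (Finset.mem_range.1 hi).ne) hxi hx'
      rw [this]
      exact Finset.stronglyMeasurable_fun_sum _ fun i _ => ih i
    refine stronglyMeasurable_of_tendsto atTop hsum (tendsto_pi_nhds.2 fun b => ?_)
    refine tendsto_lpSlice (fun n => hmem (Finset.measurableSet_biUnion _ fun i _ => hA i) b)
      (hmem (MeasurableSet.iUnion hA) b) ?_
    refine tendsto_eLpNorm_two_of_dominated (G := fun _ => ‖c‖ + ‖c‖)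
      (fun n => (hmem (Finset.measurableSet_biUnion _ fun i _ => hA i) b).1)
      (hmem (MeasurableSet.iUnion hA) b).1 (memLp_const _)
      (Eventually.of_forall fun n => ae_of_all _ fun a => (norm_sub_le _ _).trans
        (add_le_add (norm_indicator_le_norm_self _ _) (norm_indicator_le_norm_self _ _)))
      (ae_of_all _ fun a => ?_)
    refine tendsto_const_nhds.congr' ?_
    by_cases ha : (a, b) ∈ ⋃ i, A i
    · obtain ⟨i, hi⟩ := mem_iUnion.1 ha
      filter_upwards [eventually_gt_atTop i] with n hn
      rw [indicator_of_mem ha, indicator_of_mem]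
      exact mem_biUnion (Finset.mem_coe.2 (Finset.mem_range.2 hn)) hi
    · refine Eventually.of_forall fun n => ?_
      have h : (a, b) ∉ ⋃ i ∈ Finset.range n, A i := fun h => ha (iUnion₂_subset_iUnion _ _ h)
      simp only [indicator_of_notMem ha, indicator_of_notMem h]

theorem memLp_simpleFunc_slice [IsFiniteMeasure μ] (φ : SimpleFunc (α × β) 𝕜) (b : β) :
    MemLp (fun a => φ (a, b)) 2 μ := by
  obtain ⟨C, hC⟩ := φ.exists_forall_norm_le
  exact MemLp.of_bound (C := C) (φ.measurable.comp measurable_prodMk_right).aestronglyMeasurable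
    (ae_of_all _ fun a => hC _)

theorem stronglyMeasurable_lpSlice_simpleFunc [IsFiniteMeasure μ] (φ : SimpleFunc (α × β) 𝕜) :
    StronglyMeasurable fun b => lpSlice μ fun a => φ (a, b) := by
  induction φ using SimpleFunc.induction with
  | @const c A hA =>
    classical
    have h := stronglyMeasurable_lpSlice_indicator (μ := μ) c hA
    convert h using 1
    ext1 b
    congr 1
  | @add f g hd hf hg =>
    have : (fun b => lpSlice μ fun a => (f + g) (a, b)) =
        fun b => lpSlice μ (fun a => f (a, b)) + lpSlice μ fun a => g (a, b) := by
      ext1 b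
      rw [← lpSlice_add (memLp_simpleFunc_slice f b) (memLp_simpleFunc_slice g b)]
      rfl
    rw [this]
    exact hf.add hg

theorem stronglyMeasurable_lpSlice [IsFiniteMeasure μ] {F : α × β → 𝕜} (hF : Measurable F)
    (hm : ∀ b, MemLp (fun a => F (a, b)) 2 μ) :
    StronglyMeasurable fun b => lpSlice μ fun a => F (a, b) := by
  refine stronglyMeasurable_of_tendsto atTop (fun n => stronglyMeasurable_lpSlice_simpleFunc
    (SimpleFunc.approxOn F hF univ 0 (mem_univ _) n)) (tendsto_pi_nhds.2 fun b => ?_)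
  refine tendsto_lpSlice (fun n => memLp_simpleFunc_slice _ b) (hm b) ?_
  refine tendsto_eLpNorm_two_of_dominated (G := fun a => ‖F (a, b)‖ + ‖F (a, b)‖ + ‖F (a, b)‖)
    (fun n => (memLp_simpleFunc_slice _ b).1) (hm b).1
    (((hm b).norm.add (hm b).norm).add (hm b).norm)
    (Eventually.of_forall fun n => ae_of_all _ fun a => (norm_sub_le _ _).trans ?_)
    (ae_of_all _ fun a => ?_)
  · exact add_le_add (SimpleFunc.norm_approxOn_zero_le hF (mem_univ _) (a, b) n) le_rfl
  · exact SimpleFunc.tendsto_approxOn hF (mem_univ _) (by simp)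

theorem aestronglyMeasurable_lpSlice [IsFiniteMeasure μ] [SFinite ν] {F : α × β → 𝕜}
    (hF : AEStronglyMeasurable F (μ.prod ν)) (hm : ∀ᵐ b ∂ν, MemLp (fun a => F (a, b)) 2 μ) :
    AEStronglyMeasurable (fun b => lpSlice μ fun a => F (a, b)) ν := by
  have hG : Measurable (hF.mk F) := hF.stronglyMeasurable_mk.measurable
  have hFG : ∀ᵐ b ∂ν, (fun a => F (a, b)) =ᵐ[μ] fun a => hF.mk F (a, b) := by
    have h1 : ∀ᵐ p ∂(ν.prod μ), F p.swap = hF.mk F p.swap :=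
      Measure.measurePreserving_swap.quasiMeasurePreserving.ae hF.ae_eq_mk
    exact Measure.ae_ae_of_ae_prod h1
  -- Setting the function to zero outside `B` makes every slice square-integrable, as
  -- `stronglyMeasurable_lpSlice` requires. Almost every slice is unchanged.
  set B : Set β := {b | ∫⁻ a, ‖hF.mk F (a, b)‖ₑ ^ 2 ∂μ < ∞}
  have hB : MeasurableSet B := measurableSet_lt
    (Measurable.lintegral_prod_left' (f := fun p : α × β => ‖hF.mk F p‖ₑ ^ 2)
      (hG.enorm.pow_const 2)) measurable_const
  have hmem : ∀ b, MemLp (fun a => hF.mk F (a, b)) 2 μ ↔ b ∈ B := by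
    intro b
    have hm : AEStronglyMeasurable (fun a => hF.mk F (a, b)) μ :=
      (hG.comp measurable_prodMk_right).aestronglyMeasurable
    rw [MemLp, and_iff_right hm, mem_ofPred_eq, ← eLpNorm_two_pow]
    simp [ENNReal.pow_lt_top_iff]
  refine ⟨fun b => lpSlice μ fun a => (univ ×ˢ B).indicator (hF.mk F) (a, b),
    stronglyMeasurable_lpSlice (hG.indicator (MeasurableSet.univ.prod hB)) fun b => ?_, ?_⟩
  · by_cases hb : b ∈ B
    · simpa [hb] using (hmem b).2 hb
    · simp [hb]
  · filter_upwards [hm, hFG] with b h1 h2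
    rw [lpSlice_congr h2]
    have hb := (hmem b).1 (h1.ae_eq h2)
    simp [hb]

end Slices

/-! ### Measurements of one of two fields -/

section Slices

variable {α β : Type*} [MeasurableSpace α] [MeasurableSpace β] {μ : Measure α} {ν : Measure β}
  [IsFiniteMeasure μ] [IsFiniteMeasure ν]

theorem ae_ae_of_ae_prod_swap {p : α × β → Prop} (h : ∀ᵐ z ∂(μ.prod ν), p z) :
    ∀ᵐ b ∂ν, ∀ᵐ a ∂μ, p (a, b) :=
  Measure.ae_ae_of_ae_prod (Measure.measurePreserving_swap.quasiMeasurePreserving.ae h)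

theorem ae_memLp_slice {F : α × β → ℂ} (hF : MemLp F 2 (μ.prod ν)) :
    ∀ᵐ b ∂ν, MemLp (fun a => F (a, b)) 2 μ := by
  have h1 := ((memLp_two_iff_integrable_sq_norm hF.1).1 hF).prod_left_ae
  have h2 : ∀ᵐ b ∂ν, AEStronglyMeasurable (fun a => F (a, b)) μ := hF.1.prod_swap.prodMk_left
  filter_upwards [h1, h2] with b h3 h4
  exact (memLp_two_iff_integrable_sq_norm h4).2 h3

theorem eLpNorm_lpSlice {F : α × β → ℂ} (hF : MemLp F 2 (μ.prod ν)) :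
    eLpNorm (fun b => lpSlice μ fun a => F (a, b)) 2 ν = eLpNorm F 2 (μ.prod ν) := by
  have h1 : eLpNorm (fun b => lpSlice μ fun a => F (a, b)) 2 ν ^ 2 =
      eLpNorm F 2 (μ.prod ν) ^ 2 := by
    rw [eLpNorm_two_pow, eLpNorm_two_pow, lintegral_prod_symm _ (hF.1.enorm.pow_const 2)]
    refine lintegral_congr_ae ?_
    filter_upwards [ae_memLp_slice hF] with b hb
    rw [enorm_lpSlice hb, eLpNorm_two_pow]
  exact (ENNReal.pow_right_strictMono two_ne_zero).injective h1

theorem memLp_lpSlice {F : α × β → ℂ} (hF : MemLp F 2 (μ.prod ν)) :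
    MemLp (fun b => lpSlice μ fun a => F (a, b)) 2 ν :=
  ⟨aestronglyMeasurable_lpSlice hF.1 (ae_memLp_slice hF), by
    rw [eLpNorm_lpSlice hF]; exact hF.2⟩

theorem ae_lpSlice_congr {F G : α × β → ℂ} (h : F =ᵐ[μ.prod ν] G) :
    (fun b => lpSlice μ fun a => F (a, b)) =ᵐ[ν] fun b => lpSlice μ fun a => G (a, b) := by
  filter_upwards [ae_ae_of_ae_prod_swap h] with b hb
  exact lpSlice_congr hb

/-- Square-integrable functions of two variables as `L²`-valued functions of the second one. -/
def sliceLp (μ : Measure α) (ν : Measure β) [IsFiniteMeasure μ] [IsFiniteMeasure ν] :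
    Lp ℂ 2 (μ.prod ν) →ₗᵢ[ℂ] Lp (Lp ℂ 2 μ) 2 ν where
  toFun F := (memLp_lpSlice (Lp.memLp F)).toLp _
  map_add' F G := by
    rw [← MemLp.toLp_add, MemLp.toLp_eq_toLp_iff]
    refine (ae_lpSlice_congr (Lp.coeFn_add F G)).trans ?_
    filter_upwards [ae_memLp_slice (Lp.memLp F), ae_memLp_slice (Lp.memLp G)] with b h1 h2
    exact lpSlice_add h1 h2
  map_smul' c F := by
    rw [RingHom.id_apply, ← MemLp.toLp_const_smul, MemLp.toLp_eq_toLp_iff]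
    refine (ae_lpSlice_congr (Lp.coeFn_smul c F)).trans ?_
    filter_upwards [ae_memLp_slice (Lp.memLp F)] with b h1
    exact lpSlice_const_mul c h1
  norm_map' F := by
    change ‖(memLp_lpSlice (Lp.memLp F)).toLp _‖ = ‖F‖
    rw [Lp.norm_toLp, eLpNorm_lpSlice (Lp.memLp F), Lp.norm_def]

theorem sliceLp_toLp {F : α × β → ℂ} (hF : MemLp F 2 (μ.prod ν)) :
    sliceLp μ ν (hF.toLp F) =ᵐ[ν] fun b => lpSlice μ fun a => F (a, b) :=
  (MemLp.coeFn_toLp (memLp_lpSlice (Lp.memLp (hF.toLp F)))).trans (ae_lpSlice_congr hF.coeFn_toLp)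

/-- The operator `T ⊗ 1`. -/
def liftOp (μ : Measure α) (ν : Measure β) [IsFiniteMeasure μ] [IsFiniteMeasure ν]
    (T : Lp ℂ 2 μ →L[ℂ] Lp ℂ 2 μ) : Lp ℂ 2 (μ.prod ν) →L[ℂ] Lp ℂ 2 (μ.prod ν) :=
  ContinuousLinearMap.adjoint (sliceLp μ ν).toContinuousLinearMap ∘L
    T.compLpL 2 ν ∘L (sliceLp μ ν).toContinuousLinearMap

theorem inner_liftOp (T : Lp ℂ 2 μ →L[ℂ] Lp ℂ 2 μ) (F G : Lp ℂ 2 (μ.prod ν)) :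
    ⟪F, liftOp μ ν T G⟫_ℂ = ⟪sliceLp μ ν F, T.compLpL 2 ν (sliceLp μ ν G)⟫_ℂ := by
  simp only [liftOp, ContinuousLinearMap.comp_apply, ContinuousLinearMap.adjoint_inner_right]
  rfl

/-- The expectation of `T ⊗ 1` is the integral of the expectations of `T` in the conditional
vectors. This links the operator on the two fields with the slicewise definition of
`outcomeMeasure`. -/
theorem inner_liftOp_toLp (T : Lp ℂ 2 μ →L[ℂ] Lp ℂ 2 μ) {F : α × β → ℂ}
    (hF : MemLp F 2 (μ.prod ν)) :
    Integrable (fun b => (⟪lpSlice μ fun a => F (a, b), T (lpSlice μ fun a => F (a, b))⟫_ℂ).re) ν ∧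
    (⟪hF.toLp F, liftOp μ ν T (hF.toLp F)⟫_ℂ).re =
      ∫ b, (⟪lpSlice μ fun a => F (a, b), T (lpSlice μ fun a => F (a, b))⟫_ℂ).re ∂ν := by
  have h1 : (fun b => ⟪sliceLp μ ν (hF.toLp F) b,
      T.compLpL 2 ν (sliceLp μ ν (hF.toLp F)) b⟫_ℂ) =ᵐ[ν]
      fun b => ⟪lpSlice μ fun a => F (a, b), T (lpSlice μ fun a => F (a, b))⟫_ℂ := by
    filter_upwards [T.coeFn_compLpL (p := 2) (μ := ν) (sliceLp μ ν (hF.toLp F)),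
      sliceLp_toLp hF] with b h2 h3
    rw [h2, h3]
  have h2 := (L2.integrable_inner (𝕜 := ℂ) (sliceLp μ ν (hF.toLp F))
    (T.compLpL 2 ν (sliceLp μ ν (hF.toLp F)))).congr h1
  refine ⟨h2.re, ?_⟩
  rw [inner_liftOp, L2.inner_def, integral_congr_ae h1]
  exact (integral_re h2).symm

theorem isPositive_liftOp {T : Lp ℂ 2 μ →L[ℂ] Lp ℂ 2 μ} (hT : T.IsPositive) :
    (liftOp μ ν T).IsPositive := by
  refine ⟨fun F G => ?_, fun F => ?_⟩
  · change ⟪liftOp μ ν T F, G⟫_ℂ = ⟪F, liftOp μ ν T G⟫_ℂ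
    rw [← inner_conj_symm, inner_liftOp, inner_liftOp, inner_conj_symm, L2.inner_def, L2.inner_def]
    refine integral_congr_ae ?_
    filter_upwards [T.coeFn_compLpL (p := 2) (μ := ν) (sliceLp μ ν F),
      T.coeFn_compLpL (p := 2) (μ := ν) (sliceLp μ ν G)] with b h1 h2
    rw [h1, h2]
    exact hT.1 _ _
  · change 0 ≤ (⟪liftOp μ ν T F, F⟫_ℂ).re
    rw [← inner_conj_symm, Complex.conj_re, ← Lp.toLp_coeFn F (Lp.memLp F),
      (inner_liftOp_toLp T (Lp.memLp F)).2]
    exact integral_nonneg fun b => hT.re_inner_nonneg_right _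

end Slices

/-! ### Outcome probabilities as quadratic forms in the state of the two fields. -/

section Outcomes

variable {t₀ t₁ : ℝ} {Y : Type*} [MeasurableSpace Y]

/-- The kets of the two fields. -/
abbrev PairSpace (t₀ t₁ : ℝ) := Lp ℂ 2 ((configMeasure t₀ t₁).prod (configMeasure t₀ t₁))

/-- The effect `E(s) ⊗ 1`. -/
def POVM.pairEffect (E : POVM Y (FieldSpace t₀ t₁)) (s : Set Y) :
    PairSpace t₀ t₁ →L[ℂ] PairSpace t₀ t₁ :=
  liftOp (configMeasure t₀ t₁) (configMeasure t₀ t₁) (E.effect s)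

theorem POVM.measureOf_apply {H : Type*} [NormedAddCommGroup H] [InnerProductSpace ℂ H]
    (E : POVM Y H) (v : H) {s : Set Y} (hs : MeasurableSet s) :
    E.measureOf v s = ENNReal.ofReal (⟪v, E.effect s v⟫_ℂ).re := by
  rw [POVM.measureOf, Measure.ofMeasurable_apply _ hs]

theorem POVM.measurable_measureOf {H : Type*} [NormedAddCommGroup H] [InnerProductSpace ℂ H]
    (E : POVM Y H) {β : Type*} [MeasurableSpace β] {v : β → H} (hv : StronglyMeasurable v) :
    Measurable fun b => E.measureOf (v b) := by
  refine Measure.measurable_of_measurable_coe _ fun s hs => ?_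
  simp only [E.measureOf_apply _ hs]
  refine Measurable.ennreal_ofReal ?_
  have : Continuous fun x : H => (⟪x, E.effect s x⟫_ℂ).re := by fun_prop
  exact (this.comp_stronglyMeasurable hv).measurable

theorem slice_eq (Ψ : Ket2) (τ : Multiset ℝ) :
    slice t₀ t₁ Ψ τ = lpSlice (configMeasure t₀ t₁) fun σ => Ψ (σ, τ) := rfl

theorem aemeasurable_measureOf_slice (E : POVM Y (FieldSpace t₀ t₁)) {Ψ : Ket2}
    (hΨ : MemLp Ψ 2 ((configMeasure t₀ t₁).prod (configMeasure t₀ t₁))) :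
    AEMeasurable (fun τ => E.measureOf (slice t₀ t₁ Ψ τ)) (configMeasure t₀ t₁) := by
  have h := (memLp_lpSlice hΨ).1
  refine ⟨fun τ => E.measureOf (h.mk _ τ), E.measurable_measureOf h.stronglyMeasurable_mk, ?_⟩
  filter_upwards [h.ae_eq_mk] with τ hτ
  rw [slice_eq, hτ]

/-- In this form a probability is a quadratic form of a bounded operator in the global state, which
can be differentiated along curves of states. -/
theorem outcomeMeasure_apply (E : POVM Y (FieldSpace t₀ t₁)) {Ψ : Ket2}
    (hΨ : MemLp Ψ 2 ((configMeasure t₀ t₁).prod (configMeasure t₀ t₁))) {s : Set Y}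
    (hs : MeasurableSet s) : outcomeMeasure t₀ t₁ E Ψ s =
      ENNReal.ofReal (⟪hΨ.toLp Ψ, E.pairEffect s (hΨ.toLp Ψ)⟫_ℂ).re := by
  obtain ⟨h1, h2⟩ := inner_liftOp_toLp (E.effect s) hΨ
  rw [outcomeMeasure, Measure.bind_apply hs (aemeasurable_measureOf_slice E hΨ), POVM.pairEffect,
    h2, ofReal_integral_eq_lintegral_ofReal h1
      (ae_of_all _ fun τ => (E.positive s hs).re_inner_nonneg_right _)]
  refine lintegral_congr fun τ => ?_
  rw [E.measureOf_apply _ hs, slice_eq]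

theorem outcomeMeasure_univ (E : POVM Y (FieldSpace t₀ t₁)) {Ψ : Ket2}
    (hΨ : MemLp Ψ 2 ((configMeasure t₀ t₁).prod (configMeasure t₀ t₁))) :
    outcomeMeasure t₀ t₁ E Ψ univ = ENNReal.ofReal (‖hΨ.toLp Ψ‖ ^ 2) := by
  rw [outcomeMeasure_apply E hΨ MeasurableSet.univ, POVM.pairEffect, inner_liftOp, E.effect_univ]
  have h1 : (1 : FieldSpace t₀ t₁ →L[ℂ] FieldSpace t₀ t₁).compLpL 2 (configMeasure t₀ t₁)
      (sliceLp _ _ (hΨ.toLp Ψ)) = sliceLp _ _ (hΨ.toLp Ψ) := by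
    refine Lp.ext ?_
    filter_upwards [(1 : FieldSpace t₀ t₁ →L[ℂ] FieldSpace t₀ t₁).coeFn_compLpL (p := 2)
      (μ := configMeasure t₀ t₁) (sliceLp _ _ (hΨ.toLp Ψ))] with τ hτ
    rw [hτ]; rfl
  rw [h1, LinearIsometry.inner_map_map, inner_self_eq_norm_sq_to_K]
  norm_cast

/-- Phases of the inaccessible field cannot be observed. -/
theorem inner_pairEffect_phase (E : POVM Y (FieldSpace t₀ t₁)) (s : Set Y) {Ψ Φ : Ket2}
    (hΨ : MemLp Ψ 2 ((configMeasure t₀ t₁).prod (configMeasure t₀ t₁)))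
    (hΦ : MemLp Φ 2 ((configMeasure t₀ t₁).prod (configMeasure t₀ t₁)))
    {χ : Multiset ℝ → ℝ} (h : ∀ c, Φ c = Complex.exp (Complex.I * χ c.2) * Ψ c) :
    (⟪hΦ.toLp Φ, E.pairEffect s (hΦ.toLp Φ)⟫_ℂ).re =
      (⟪hΨ.toLp Ψ, E.pairEffect s (hΨ.toLp Ψ)⟫_ℂ).re := by
  rw [POVM.pairEffect, (inner_liftOp_toLp _ hΨ).2, (inner_liftOp_toLp _ hΦ).2]
  refine integral_congr_ae ?_
  filter_upwards [ae_memLp_slice hΨ] with τ hτ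
  have h1 : (fun σ => Φ (σ, τ)) = fun σ => Complex.exp (Complex.I * χ τ) * Ψ (σ, τ) :=
    funext fun σ => h (σ, τ)
  rw [h1, lpSlice_const_mul _ hτ, map_smul, inner_smul_left, inner_smul_right, ← mul_assoc,
    ← Complex.normSq_eq_conj_mul_self, Complex.normSq_eq_norm_sq, mul_comm Complex.I,
    Complex.norm_exp_ofReal_mul_I]
  simp

/-- The effects of the level sets of `f` resolve the identity. This is read off from the total mass
of the outcome distribution, split along the finitely many level sets. -/
theorem sum_inner_pairEffect (E : POVM Y (FieldSpace t₀ t₁)) (f : SimpleFunc Y ℝ)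
    (v : PairSpace t₀ t₁) : ∑ r ∈ f.range, (⟪v, E.pairEffect (f ⁻¹' {r}) v⟫_ℂ).re = ‖v‖ ^ 2 := by
  have h0 : ∀ r, 0 ≤ (⟪v, E.pairEffect (f ⁻¹' {r}) v⟫_ℂ).re := fun r =>
    (isPositive_liftOp (E.positive _ (f.measurableSet_preimage {r}))).re_inner_nonneg_right _
  have h1 := outcomeMeasure_univ E (Lp.memLp v)
  rw [← SimpleFunc.sum_range_measure_preimage_singleton f,
    Finset.sum_congr rfl fun r _ => outcomeMeasure_apply E (Lp.memLp v)
      (f.measurableSet_preimage {r}), Lp.toLp_coeFn, ← ENNReal.ofReal_sum_of_nonneg fun r _ => h0 r,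
    ENNReal.ofReal_eq_ofReal_iff (Finset.sum_nonneg fun r _ => h0 r) (sq_nonneg _)] at h1
  exact h1

end Outcomes

/-! ### Shifts of a random vector with a score -/

set_option linter.unusedSectionVars false

section Shift

variable {Ω E : Type*} [MeasurableSpace Ω] {P : Measure Ω} [IsProbabilityMeasure P]
  [NormedAddCommGroup E] [NormedSpace ℝ E] [CompleteSpace E] [MeasurableSpace E] [BorelSpace E]
  [SecondCountableTopology E]

/-- The positive part of a signed density on the shifted random vectors. -/
def shiftMeasure (P : Measure Ω) (X : Ω → E) (v : E) (ε : ℝ) (β : Ω → ℝ) : Measure E :=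
  ((P.prod (volume.restrict (Icc 0 ε))).withDensity
    fun p => ENNReal.ofReal (β p.1)).map fun p => X p.1 + p.2 • v

theorem aemeasurable_shift {X : Ω → E} (hX : AEMeasurable X P) (v : E) (ε : ℝ) :
    AEMeasurable (fun p : Ω × ℝ => X p.1 + p.2 • v) (P.prod (volume.restrict (Icc 0 ε))) := by
  refine (hX.comp_quasiMeasurePreserving Measure.quasiMeasurePreserving_fst).add ?_
  exact (by fun_prop : Continuous fun s : ℝ => s • v).measurable.comp_aemeasurable
    measurable_snd.aemeasurable

theorem aemeasurable_fst_density {β : Ω → ℝ} (hβ : AEMeasurable β P) (ε : ℝ) :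
    AEMeasurable (fun p : Ω × ℝ => ENNReal.ofReal (β p.1))
      (P.prod (volume.restrict (Icc 0 ε))) :=
  (hβ.comp_quasiMeasurePreserving Measure.quasiMeasurePreserving_fst).ennreal_ofReal

theorem isFiniteMeasure_shiftMeasure (X : Ω → E) (v : E) (ε : ℝ) {β : Ω → ℝ}
    (hβ : Integrable β P) : IsFiniteMeasure (shiftMeasure P X v ε β) := by
  have : IsFiniteMeasure ((P.prod (volume.restrict (Icc 0 ε))).withDensity
      fun p => ENNReal.ofReal (β p.1)) :=
    isFiniteMeasure_withDensity_ofReal (hβ.comp_fst _).2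
  exact Measure.isFiniteMeasure_map _ _

theorem integral_shiftMeasure {X : Ω → E} (hX : AEMeasurable X P) (v : E) (ε : ℝ) {β : Ω → ℝ}
    (hβ : AEMeasurable β P) {F : Type*} [NormedAddCommGroup F] [NormedSpace ℝ F] {G : E → F}
    (hG : StronglyMeasurable G) : ∫ e, G e ∂(shiftMeasure P X v ε β) =
      ∫ p, max (β p.1) 0 • G (X p.1 + p.2 • v) ∂(P.prod (volume.restrict (Icc 0 ε))) := by
  rw [shiftMeasure, integral_map ((aemeasurable_shift hX v ε).mono_ac
    (withDensity_absolutelyContinuous _ _)) hG.aestronglyMeasurable,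
    integral_withDensity_eq_integral_toReal_smul₀ (aemeasurable_fst_density hβ ε)
      (ae_of_all _ fun _ => ENNReal.ofReal_lt_top)]
  simp only [ENNReal.toReal_ofReal']

theorem integrable_shiftMeasure {X : Ω → E} (hX : AEMeasurable X P) (v : E) (ε : ℝ) {β : Ω → ℝ}
    (hβ : AEMeasurable β P) {F : Type*} [NormedAddCommGroup F] [NormedSpace ℝ F] {G : E → F}
    (hG : StronglyMeasurable G)
    (hi : Integrable (fun p : Ω × ℝ => β p.1 • G (X p.1 + p.2 • v))
      (P.prod (volume.restrict (Icc 0 ε)))) :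
    Integrable G (shiftMeasure P X v ε β) ∧
    Integrable (fun p : Ω × ℝ => max (β p.1) 0 • G (X p.1 + p.2 • v))
      (P.prod (volume.restrict (Icc 0 ε))) := by
  have hX' := aemeasurable_shift hX v ε
  have hβ' := hβ.comp_quasiMeasurePreserving
    (Measure.quasiMeasurePreserving_fst (ν := volume.restrict (Icc 0 ε)))
  have h1 : Integrable (fun p : Ω × ℝ => max (β p.1) 0 • G (X p.1 + p.2 • v))
      (P.prod (volume.restrict (Icc 0 ε))) := by
    refine hi.mono ?_ (ae_of_all _ fun p => ?_)
    · exact (hβ'.max aemeasurable_const).aestronglyMeasurable.smul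
        (hG.aestronglyMeasurable.comp_aemeasurable hX')
    · rw [norm_smul, norm_smul]
      refine mul_le_mul_of_nonneg_right ?_ (norm_nonneg _)
      rw [Real.norm_eq_abs, Real.norm_eq_abs, abs_of_nonneg (le_max_right _ _)]
      exact max_le (le_abs_self _) (abs_nonneg _)
  refine ⟨?_, h1⟩
  rw [shiftMeasure, integrable_map_measure hG.aestronglyMeasurable (hX'.mono_ac
    (withDensity_absolutelyContinuous _ _)),
    integrable_withDensity_iff_integrable_smul₀' (aemeasurable_fst_density hβ ε)
      (ae_of_all _ fun _ => ENNReal.ofReal_lt_top)]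
  simpa only [ENNReal.toReal_ofReal', Function.comp_apply] using h1

theorem integral_exp_Icc (z : ℝ) {ε : ℝ} (hε : 0 ≤ ε) :
    (∫ s in Icc 0 ε, Complex.exp (s * z * Complex.I)) * (-(Complex.I * z)) =
      1 - Complex.exp (ε * z * Complex.I) := by
  have h1 : ∀ s ∈ uIcc 0 ε, HasDerivAt (fun s : ℝ => Complex.exp (s * z * Complex.I))
      (Complex.exp (s * z * Complex.I) * (z * Complex.I)) s := by
    intro s _
    have h2 : HasDerivAt (fun s : ℝ => (s : ℂ) * z * Complex.I) (z * Complex.I) s := by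
      have := ((hasDerivAt_id s).ofReal_comp.mul_const (z : ℂ)).mul_const Complex.I
      simpa using this
    exact h2.cexp
  have h3 := intervalIntegral.integral_eq_sub_of_hasDerivAt h1
    (Continuous.intervalIntegrable (by fun_prop) _ _)
  rw [intervalIntegral.integral_of_le hε, ← integral_Icc_eq_integral_Ioc, integral_mul_const] at h3
  simp only [Complex.ofReal_zero, zero_mul, Complex.exp_zero] at h3
  linear_combination -h3

/-- An integrated form of the score equation: the law shifted by `εv` minus the original one is
minus the integral over `s ∈ [0, ε]` of the `β`-weighted laws shifted by `sv`. The positive and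
negative parts of `β` are put on different sides, so that all measures are positive and finite and
may be compared by characteristic functionals, also in infinite dimension. -/
theorem map_shift_add_shiftMeasure {X : Ω → E} (hX : AEMeasurable X P) (v : E) {ε : ℝ}
    (hε : 0 ≤ ε) {β : Ω → ℝ} (hβ : Integrable β P)
    (h : ∀ L : StrongDual ℝ E, ∫ ω, (β ω : ℂ) * Complex.exp (L (X ω) * Complex.I) ∂P =
      -(Complex.I * L v) * ∫ ω, Complex.exp (L (X ω) * Complex.I) ∂P) :
    P.map (fun ω => X ω + ε • v) + shiftMeasure P X v ε β =
      P.map X + shiftMeasure P X v ε (fun ω => -β ω) := by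
  have hXε : AEMeasurable (fun ω => X ω + ε • v) P := hX.add_const _
  have := Measure.isFiniteMeasure_map P X
  have := Measure.isFiniteMeasure_map P fun ω => X ω + ε • v
  have := isFiniteMeasure_shiftMeasure X v ε hβ
  have := isFiniteMeasure_shiftMeasure X v ε hβ.fun_neg
  refine Measure.ext_of_charFunDual (funext fun L => ?_)
  have hc : Continuous fun e : E => Complex.exp (L e * Complex.I) := by fun_prop
  have hb : ∀ e : E, ‖Complex.exp (L e * Complex.I)‖ ≤ 1 := fun e =>
    (Complex.norm_exp_ofReal_mul_I _).le
  have hint : ∀ (m : Measure E) [IsFiniteMeasure m],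
      Integrable (fun e => Complex.exp (L e * Complex.I)) m := fun m _ =>
    Integrable.of_bound hc.aestronglyMeasurable 1 (ae_of_all _ hb)
  rw [charFunDual_apply, charFunDual_apply, integral_add_measure (hint _) (hint _),
    integral_add_measure (hint _) (hint _), integral_map hXε hc.aestronglyMeasurable,
    integral_map hX hc.aestronglyMeasurable]
  have hβi : ∀ {b : Ω → ℝ}, Integrable b P → Integrable
      (fun p : Ω × ℝ => b p.1 • Complex.exp (L (X p.1 + p.2 • v) * Complex.I))
      (P.prod (volume.restrict (Icc 0 ε))) := by
    intro b hb'
    have h1 : Integrable (fun p : Ω × ℝ => b p.1) (P.prod (volume.restrict (Icc 0 ε))) :=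
      hb'.comp_fst _
    refine h1.mono (h1.1.smul (hc.stronglyMeasurable.aestronglyMeasurable.comp_aemeasurable
      (aemeasurable_shift hX v ε))) (ae_of_all _ fun p => ?_)
    rw [norm_smul]
    exact mul_le_of_le_one_right (norm_nonneg _) (hb _)
  rw [integral_shiftMeasure hX v ε hβ.1.aemeasurable hc.stronglyMeasurable,
    integral_shiftMeasure (β := fun ω => -β ω) hX v ε hβ.1.aemeasurable.fun_neg hc.stronglyMeasurable]
  have i1 := (integrable_shiftMeasure hX v ε hβ.1.aemeasurable hc.stronglyMeasurable
    (hβi hβ)).2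
  have i2 := (integrable_shiftMeasure (β := fun ω => -β ω) hX v ε hβ.1.aemeasurable.fun_neg hc.stronglyMeasurable
    (hβi hβ.fun_neg)).2
  rw [← sub_eq_zero, add_sub_add_comm, ← integral_sub i1 i2]
  have e1 : ∀ p : Ω × ℝ, max (β p.1) 0 • Complex.exp (L (X p.1 + p.2 • v) * Complex.I) -
      max (-β p.1) 0 • Complex.exp (L (X p.1 + p.2 • v) * Complex.I) =
      ((β p.1 : ℂ) * Complex.exp (L (X p.1) * Complex.I)) *
        Complex.exp (p.2 * L v * Complex.I) := by
    intro p
    have : max (β p.1) 0 - max (-β p.1) 0 = β p.1 := by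
      rcases le_total (β p.1) 0 with h0 | h0
      · rw [max_eq_right h0, max_eq_left (by linarith)]; ring
      · rw [max_eq_left h0, max_eq_right (by linarith)]; ring
    rw [← sub_smul, this, Complex.real_smul, mul_assoc, ← Complex.exp_add]
    congr 2
    simp only [map_add, map_smul, smul_eq_mul]
    push_cast
    ring
  have e2 : ∀ ω, Complex.exp (L (X ω + ε • v) * Complex.I) =
      Complex.exp (L (X ω) * Complex.I) * Complex.exp (ε * L v * Complex.I) := by
    intro ω
    rw [← Complex.exp_add]
    congr 1
    simp only [map_add, map_smul, smul_eq_mul]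
    push_cast
    ring
  simp only [e1, e2]
  rw [integral_prod_mul (fun ω => (β ω : ℂ) * Complex.exp (L (X ω) * Complex.I))
    (fun s : ℝ => Complex.exp (s * L v * Complex.I)), h L, integral_mul_const]
  linear_combination (∫ ω, Complex.exp (L (X ω) * Complex.I) ∂P) * integral_exp_Icc (L v) hε

/-- Integrating the identity of measures against `G` requires measurability and integrability only.
No differentiability of `G` on the possibly infinite-dimensional space enters. -/
theorem integral_shift_sub {X : Ω → E} (hX : AEMeasurable X P) (v : E) {ε : ℝ}
    (hε : 0 ≤ ε) {β : Ω → ℝ} (hβ : Integrable β P)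
    (h : ∀ L : StrongDual ℝ E, ∫ ω, (β ω : ℂ) * Complex.exp (L (X ω) * Complex.I) ∂P =
      -(Complex.I * L v) * ∫ ω, Complex.exp (L (X ω) * Complex.I) ∂P)
    {G : E → ℝ} (hG : Measurable G) (i0 : Integrable (fun ω => G (X ω)) P)
    (i1 : Integrable (fun ω => G (X ω + ε • v)) P)
    (i2 : Integrable (fun p : Ω × ℝ => β p.1 * G (X p.1 + p.2 • v))
      (P.prod (volume.restrict (Icc 0 ε)))) :
    ∫ ω, G (X ω + ε • v) ∂P - ∫ ω, G (X ω) ∂P =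
      -∫ p, β p.1 * G (X p.1 + p.2 • v) ∂(P.prod (volume.restrict (Icc 0 ε))) := by
  have hXε : AEMeasurable (fun ω => X ω + ε • v) P := hX.add_const _
  have hGs := hG.stronglyMeasurable
  have i2' : Integrable (fun p : Ω × ℝ => -β p.1 • G (X p.1 + p.2 • v))
      (P.prod (volume.restrict (Icc 0 ε))) :=
    i2.neg.congr (ae_of_all _ fun p => by simp)
  obtain ⟨j1, j2⟩ := integrable_shiftMeasure hX v ε hβ.1.aemeasurable hGs i2
  obtain ⟨j3, j4⟩ := integrable_shiftMeasure (β := fun ω => -β ω) hX v ε hβ.1.aemeasurable.fun_neg hGs i2'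
  have h1 := congrArg (fun m => ∫ e, G e ∂m) (map_shift_add_shiftMeasure hX v hε hβ h)
  rw [integral_add_measure
      ((integrable_map_measure hGs.aestronglyMeasurable hXε).2 i1) j1,
    integral_add_measure ((integrable_map_measure hGs.aestronglyMeasurable hX).2 i0) j3,
    integral_map hXε hGs.aestronglyMeasurable, integral_map hX hGs.aestronglyMeasurable,
    integral_shiftMeasure hX v ε hβ.1.aemeasurable hGs,
    integral_shiftMeasure (β := fun ω => -β ω) hX v ε hβ.1.aemeasurable.fun_neg hGs] at h1
  have h2 : ∫ p, β p.1 * G (X p.1 + p.2 • v) ∂(P.prod (volume.restrict (Icc 0 ε))) =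
      (∫ p, max (β p.1) 0 • G (X p.1 + p.2 • v) ∂(P.prod (volume.restrict (Icc 0 ε)))) -
        ∫ p, max (-β p.1) 0 • G (X p.1 + p.2 • v) ∂(P.prod (volume.restrict (Icc 0 ε))) := by
    rw [← integral_sub j2 j4]
    refine integral_congr_ae (ae_of_all _ fun p => ?_)
    simp only [smul_eq_mul, ← sub_mul]
    congr 1
    rcases le_total (β p.1) 0 with h0 | h0
    · rw [max_eq_right h0, max_eq_left (by linarith)]; ring
    · rw [max_eq_left h0, max_eq_right (by linarith)]; ring
  rw [h2]
  linarith

end Shift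

/-! ### Integration by parts for random waveforms -/

section Score

variable {Ω : Type*} [MeasurableSpace Ω] {P : Measure Ω} [IsProbabilityMeasure P]

/-- Integration by parts against compactly supported functions extends to bounded functions of one
linear combination. -/
theorem score_comp_linear {n : ℕ} {X : Ω → Fin n → ℝ} (hX : AEMeasurable X P) {v : Fin n → ℝ}
    {β : Ω → ℝ} (hβ : Integrable β P)
    (hF : ∀ F : (Fin n → ℝ) → ℝ, ContDiff ℝ (⊤ : ℕ∞) F → HasCompactSupport F →
      ∫ ω, fderiv ℝ F (X ω) v ∂P = -∫ ω, β ω * F (X ω) ∂P)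
    (ℓ : (Fin n → ℝ) →L[ℝ] ℝ) {f f' : ℝ → ℝ} (hf : ContDiff ℝ (⊤ : ℕ∞) f)
    (hf' : ∀ s, HasDerivAt f (f' s) s) (hb : ∀ s, |f s| ≤ 1)
    (hb' : ∀ s, |f' s| ≤ 1) :
    ℓ v * ∫ ω, f' (ℓ (X ω)) ∂P = -∫ ω, β ω * f (ℓ (X ω)) ∂P := by
  let χ : ContDiffBump (0 : Fin n → ℝ) := ⟨1, 2, one_pos, one_lt_two⟩
  have hχ1 : ∀ y, |χ y| ≤ 1 := fun y => by rw [abs_of_nonneg χ.nonneg]; exact χ.le_one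
  have hχs : ContDiff ℝ (⊤ : ℕ∞) (χ : (Fin n → ℝ) → ℝ) := χ.contDiff
  have hχd : Continuous (fderiv ℝ (χ : (Fin n → ℝ) → ℝ)) := hχs.continuous_fderiv (by simp)
  obtain ⟨D, hD⟩ := (χ.hasCompactSupport.fderiv (𝕜 := ℝ)).exists_bound_of_continuous hχd
  set r : ℕ → ℝ := fun N => ((N : ℝ) + 1)⁻¹
  have hr0 : ∀ N, 0 < r N := fun N => by positivity
  have hr1 : ∀ N, r N ≤ 1 := fun N => inv_le_one_of_one_le₀ (by
    have := N.cast_nonneg (α := ℝ); linarith)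
  have hrl : Tendsto r atTop (𝓝 0) := by
    simpa [r] using tendsto_one_div_add_atTop_nhds_zero_nat (𝕜 := ℝ)
  -- Cut-offs on balls of growing radius. The derivative that falls on the cut-off carries a factor
  -- `r N` and disappears in the limit.
  set F : ℕ → (Fin n → ℝ) → ℝ := fun N y => χ (r N • y) * f (ℓ y)
  have hFs : ∀ N, ContDiff ℝ (⊤ : ℕ∞) (F N) := fun N =>
    (hχs.comp (contDiff_const_smul (r N))).mul (hf.comp ℓ.contDiff)
  have hFc : ∀ N, HasCompactSupport (F N) := fun N =>
    (χ.hasCompactSupport.comp_homeomorph (Homeomorph.smulOfNeZero (r N) (hr0 N).ne')).mul_right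
  have hFd : ∀ N y, fderiv ℝ (F N) y v = χ (r N • y) * (f' (ℓ y) * ℓ v) +
      r N * fderiv ℝ χ (r N • y) v * f (ℓ y) := by
    intro N y
    have h1 : HasFDerivAt (fun y => χ (r N • y))
        ((fderiv ℝ χ (r N • y)).comp (r N • ContinuousLinearMap.id ℝ (Fin n → ℝ))) y :=
      ((hχs.differentiable (by simp) _).hasFDerivAt).comp y
        ((ContinuousLinearMap.id ℝ (Fin n → ℝ)).hasFDerivAt.const_smul (r N))
    have h2 : HasFDerivAt (fun y => f (ℓ y)) (f' (ℓ y) • ℓ) y :=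
      (hf' (ℓ y)).comp_hasFDerivAt y ℓ.hasFDerivAt
    have h3 : HasFDerivAt (F N) _ y := h1.mul h2
    rw [h3.fderiv]
    simp
    ring
  have hXr : ∀ {g : (Fin n → ℝ) → ℝ}, Continuous g → AEStronglyMeasurable (fun ω => g (X ω)) P :=
    fun hg => (hg.measurable.comp_aemeasurable hX).aestronglyMeasurable
  have hχl : ∀ y, Tendsto (fun N => χ (r N • y)) atTop (𝓝 1) := by
    intro y
    have h1 : Tendsto (fun N => r N • y) atTop (𝓝 0) := by simpa using hrl.smul_const y
    have h2 := (χ.continuous.tendsto 0).comp h1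
    rwa [χ.one_of_mem_closedBall (by simp [χ.rIn_pos.le])] at h2
  have hl1 : Tendsto (fun N => ∫ ω, fderiv ℝ (F N) (X ω) v ∂P) atTop
      (𝓝 (∫ ω, f' (ℓ (X ω)) * ℓ v ∂P)) := by
    refine tendsto_integral_of_dominated_convergence (fun _ => |ℓ v| + D * ‖v‖)
      (fun N => hXr (((hFs N).continuous_fderiv (by simp)).clm_apply continuous_const))
      (integrable_const _) (fun N => ae_of_all _ fun ω => ?_) (ae_of_all _ fun ω => ?_)
    · rw [hFd, Real.norm_eq_abs]
      refine (abs_add_le _ _).trans (add_le_add ?_ ?_)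
      · rw [abs_mul, abs_mul]
        calc |χ (r N • X ω)| * (|f' (ℓ (X ω))| * |ℓ v|) ≤ 1 * (1 * |ℓ v|) := by
              gcongr
              · exact hχ1 _
              · exact hb' _
          _ = |ℓ v| := by ring
      · rw [abs_mul, abs_mul, abs_of_pos (hr0 N)]
        have h3 : |fderiv ℝ χ (r N • X ω) v| ≤ D * ‖v‖ :=
          ((fderiv ℝ χ (r N • X ω)).le_opNorm v).trans
            (mul_le_mul_of_nonneg_right (hD _) (norm_nonneg _))
        have h4 : 0 ≤ D * ‖v‖ := (abs_nonneg _).trans h3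
        calc r N * |fderiv ℝ χ (r N • X ω) v| * |f (ℓ (X ω))| ≤ 1 * (D * ‖v‖) * 1 := by
              gcongr
              · exact hr1 N
              · exact hb _
          _ = D * ‖v‖ := by ring
    · simp only [hFd]
      have h5 : Tendsto (fun N => r N * fderiv ℝ χ (r N • X ω) v * f (ℓ (X ω))) atTop (𝓝 0) := by
        have h6 : Tendsto (fun N => r N • X ω) atTop (𝓝 0) := by simpa using hrl.smul_const (X ω)
        have h7 := ((hχd.clm_apply (continuous_const (y := v))).tendsto 0).comp h6
        simpa [Function.comp_def] using (hrl.mul h7).mul_const (f (ℓ (X ω)))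
      simpa using ((hχl (X ω)).mul_const (f' (ℓ (X ω)) * ℓ v)).add h5
  have hl2 : Tendsto (fun N => ∫ ω, β ω * F N (X ω) ∂P) atTop
      (𝓝 (∫ ω, β ω * f (ℓ (X ω)) ∂P)) := by
    refine tendsto_integral_of_dominated_convergence (fun ω => ‖β ω‖)
      (fun N => hβ.1.mul (hXr (hFs N).continuous)) hβ.norm
      (fun N => ae_of_all _ fun ω => ?_) (ae_of_all _ fun ω => ?_)
    · rw [norm_mul]
      refine mul_le_of_le_one_right (norm_nonneg _) ?_
      rw [norm_mul]
      exact mul_le_one₀ (hχ1 _) (norm_nonneg _) (hb _)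
    · simpa using ((hχl (X ω)).mul_const (f (ℓ (X ω)))).const_mul (β ω)
  simp only [hF _ (hFs _) (hFc _)] at hl1
  have := tendsto_nhds_unique hl1 hl2.neg
  rw [← this, integral_mul_const, mul_comm]

/-- The identity `E [β exp(iZ)] = -i z E [exp(iZ)]`. -/
def ScoreIdentity (P : Measure Ω) (β Z : Ω → ℝ) (z : ℝ) : Prop :=
  ∫ ω, (β ω : ℂ) * Complex.exp (Z ω * Complex.I) ∂P =
    -(Complex.I * z) * ∫ ω, Complex.exp (Z ω * Complex.I) ∂P

theorem ScoreIdentity.congr {β Z Z' : Ω → ℝ} {z : ℝ} (h : ScoreIdentity P β Z z)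
    (hZ : Z =ᵐ[P] Z') : ScoreIdentity P β Z' z := by
  have h1 : ∫ ω, (β ω : ℂ) * Complex.exp (Z ω * Complex.I) ∂P =
      ∫ ω, (β ω : ℂ) * Complex.exp (Z' ω * Complex.I) ∂P :=
    integral_congr_ae (by filter_upwards [hZ] with ω hω; rw [hω])
  have h2 : ∫ ω, Complex.exp (Z ω * Complex.I) ∂P = ∫ ω, Complex.exp (Z' ω * Complex.I) ∂P :=
    integral_congr_ae (by filter_upwards [hZ] with ω hω; rw [hω])
  rwa [ScoreIdentity, h1, h2] at h

/-- Integration by parts for the cosine and the sine of a linear combination gives the real and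
imaginary parts. -/
theorem scoreIdentity_finite {n : ℕ} {X : Ω → Fin n → ℝ} (hX : AEMeasurable X P) {v : Fin n → ℝ}
    {β : Ω → ℝ} (hβ : Integrable β P)
    (hF : ∀ F : (Fin n → ℝ) → ℝ, ContDiff ℝ (⊤ : ℕ∞) F → HasCompactSupport F →
      ∫ ω, fderiv ℝ F (X ω) v ∂P = -∫ ω, β ω * F (X ω) ∂P)
    (ℓ : (Fin n → ℝ) →L[ℝ] ℝ) : ScoreIdentity P β (fun ω => ℓ (X ω)) (ℓ v) := by
  have h1 := score_comp_linear hX hβ hF ℓ Real.contDiff_cos (f' := fun s => -Real.sin s)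
    Real.hasDerivAt_cos Real.abs_cos_le_one
    fun s => by rw [abs_neg]; exact Real.abs_sin_le_one s
  have h2 := score_comp_linear hX hβ hF ℓ Real.contDiff_sin
    Real.hasDerivAt_sin Real.abs_sin_le_one Real.abs_cos_le_one
  have hm : ∀ {g : ℝ → ℝ}, Continuous g → AEStronglyMeasurable (fun ω => g (ℓ (X ω))) P :=
    fun hg => ((hg.comp ℓ.continuous).measurable.comp_aemeasurable hX).aestronglyMeasurable
  have ic : Integrable (fun ω => Real.cos (ℓ (X ω))) P :=
    Integrable.of_bound (hm Real.continuous_cos) 1 (ae_of_all _ fun ω => Real.abs_cos_le_one _)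
  have is : Integrable (fun ω => Real.sin (ℓ (X ω))) P :=
    Integrable.of_bound (hm Real.continuous_sin) 1 (ae_of_all _ fun ω => Real.abs_sin_le_one _)
  have ibc : Integrable (fun ω => β ω * Real.cos (ℓ (X ω))) P :=
    hβ.mul_bdd (c := 1) (hm Real.continuous_cos) (ae_of_all _ fun ω => Real.abs_cos_le_one _)
  have ibs : Integrable (fun ω => β ω * Real.sin (ℓ (X ω))) P :=
    hβ.mul_bdd (c := 1) (hm Real.continuous_sin) (ae_of_all _ fun ω => Real.abs_sin_le_one _)
  have key : ∀ {p q : Ω → ℝ}, Integrable p P → Integrable q P →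
      ∫ ω, ((p ω : ℂ) + (q ω : ℂ) * Complex.I) ∂P =
        ((∫ ω, p ω ∂P : ℝ) : ℂ) + ((∫ ω, q ω ∂P : ℝ) : ℂ) * Complex.I := by
    intro p q hp hq
    have hp' : Integrable (fun ω => (p ω : ℂ)) P := hp.ofReal
    have hq' : Integrable (fun ω => (q ω : ℂ)) P := hq.ofReal
    rw [integral_add hp' (hq'.mul_const _), integral_mul_const, integral_complex_ofReal,
      integral_complex_ofReal]
  have e1 : ∀ ω, (β ω : ℂ) * Complex.exp (ℓ (X ω) * Complex.I) =
      ((β ω * Real.cos (ℓ (X ω)) : ℝ) : ℂ) + ((β ω * Real.sin (ℓ (X ω)) : ℝ) : ℂ) * Complex.I := by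
    intro ω
    rw [Complex.exp_mul_I]
    push_cast
    ring
  have e2 : ∀ ω, Complex.exp (ℓ (X ω) * Complex.I) =
      (Real.cos (ℓ (X ω)) : ℂ) + (Real.sin (ℓ (X ω)) : ℂ) * Complex.I := by
    intro ω
    rw [Complex.exp_mul_I]
    push_cast
    ring
  rw [ScoreIdentity]
  rw [integral_congr_ae (ae_of_all _ e1), integral_congr_ae (ae_of_all _ e2), key ibc ibs,
    key ic is]
  rw [integral_neg] at h1
  have h1' : ((∫ ω, β ω * Real.cos (ℓ (X ω)) ∂P : ℝ) : ℂ) =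
      ((ℓ v * ∫ ω, Real.sin (ℓ (X ω)) ∂P : ℝ) : ℂ) := by congr 1; linarith
  have h2' : ((∫ ω, β ω * Real.sin (ℓ (X ω)) ∂P : ℝ) : ℂ) =
      ((-(ℓ v * ∫ ω, Real.cos (ℓ (X ω)) ∂P) : ℝ) : ℂ) := by congr 1; linarith
  rw [h1', h2']
  push_cast
  linear_combination ((ℓ v : ℂ) * (∫ ω, Real.sin (ℓ (X ω)) ∂P : ℝ)) * Complex.I_mul_I

/-- Convergence in `L²` gives almost sure convergence along a subsequence. The exponentials are
bounded and `β` is integrable, so both sides pass to the limit. -/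
theorem isClosed_scoreIdentity {β : Ω → ℝ} (hβ : Integrable β P) :
    IsClosed {u : WithLp 2 (Lp ℝ 2 P × ℝ) | ScoreIdentity P β u.fst u.snd} := by
  refine IsSeqClosed.isClosed fun u a hu ha => ?_
  have h1 : Tendsto (fun n => (u n).fst) atTop (𝓝 a.fst) :=
    ((continuous_fst.comp (WithLp.prod_continuous_ofLp 2 _ _)).tendsto a).comp ha
  have h2 : Tendsto (fun n => (u n).snd) atTop (𝓝 a.snd) :=
    ((continuous_snd.comp (WithLp.prod_continuous_ofLp 2 _ _)).tendsto a).comp ha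
  obtain ⟨ns, hns, hae⟩ := (tendstoInMeasure_of_tendsto_Lp h1).exists_seq_tendsto_ae
  have h3 : ∀ᵐ ω ∂P, Tendsto (fun i => Complex.exp ((u (ns i)).fst ω * Complex.I)) atTop
      (𝓝 (Complex.exp (a.fst ω * Complex.I))) := by
    filter_upwards [hae] with ω hω
    have hc : Continuous fun s : ℝ => Complex.exp (s * Complex.I) := by fun_prop
    exact (hc.tendsto _).comp hω
  have hm : ∀ Z : Lp ℝ 2 P, AEStronglyMeasurable (fun ω => Complex.exp (Z ω * Complex.I)) P :=
    fun Z => (by fun_prop : Continuous fun s : ℝ => Complex.exp (s * Complex.I)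
      ).comp_aestronglyMeasurable (Lp.aestronglyMeasurable Z)
  have hβ' : Integrable (fun ω => (β ω : ℂ)) P := hβ.ofReal
  have t1 : Tendsto (fun i => ∫ ω, (β ω : ℂ) * Complex.exp ((u (ns i)).fst ω * Complex.I) ∂P) atTop
      (𝓝 (∫ ω, (β ω : ℂ) * Complex.exp (a.fst ω * Complex.I) ∂P)) := by
    refine tendsto_integral_of_dominated_convergence (fun ω => ‖β ω‖)
      (fun i => hβ'.1.mul (hm _)) hβ.norm (fun i => ae_of_all _ fun ω => ?_) ?_
    · rw [norm_mul, Complex.norm_exp_ofReal_mul_I, mul_one, Complex.norm_real]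
    · filter_upwards [h3] with ω hω
      exact hω.const_mul _
  have t2 : Tendsto (fun i => ∫ ω, Complex.exp ((u (ns i)).fst ω * Complex.I) ∂P) atTop
      (𝓝 (∫ ω, Complex.exp (a.fst ω * Complex.I) ∂P)) := by
    refine tendsto_integral_of_dominated_convergence (fun _ => 1) (fun i => hm _)
      (integrable_const _) (fun i => ae_of_all _ fun ω => ?_) h3
    rw [Complex.norm_exp_ofReal_mul_I]
  have t3 : Tendsto (fun i => -(Complex.I * (u (ns i)).snd)) atTop (𝓝 (-(Complex.I * a.snd))) := by
    have hc : Continuous fun s : ℝ => -(Complex.I * s) := by fun_prop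
    exact (hc.tendsto _).comp (h2.comp hns.tendsto_atTop)
  have h4 : ∀ i, ScoreIdentity P β (u (ns i)).fst (u (ns i)).snd := fun i => hu (ns i)
  simp only [ScoreIdentity] at h4
  simp only [h4] at t1
  exact tendsto_nhds_unique t1 (t3.mul t2)

/-- The identity holds in the closed linear span of the samples. -/
theorem scoreIdentity_of_orthogonal {ι : Type*} {x : Ω → ι → ℝ} (hx : ∀ s, MemLp (x · s) 2 P)
    {h : ι → ℝ} {β : Ω → ℝ} (hβ : Integrable β P)
    (hF : ∀ (n : ℕ) (t : Fin n → ι) (F : (Fin n → ℝ) → ℝ), ContDiff ℝ (⊤ : ℕ∞) F →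
      HasCompactSupport F → ∫ ω, fderiv ℝ F (fun i => x ω (t i)) (fun i => h (t i)) ∂P =
        -∫ ω, β ω * F (fun i => x ω (t i)) ∂P)
    {Z : Ω → ℝ} (hZ : MemLp Z 2 P) {z : ℝ}
    (ho : ∀ (Y : Ω → ℝ) (y : ℝ), MemLp Y 2 P → (∀ s, ∫ ω, Y ω * x ω s ∂P + y * h s = 0) →
      ∫ ω, Y ω * Z ω ∂P + y * z = 0) : ScoreIdentity P β Z z := by
  -- A random variable is paired with its derivative along `h` as one vector of a Hilbert space. The
  -- hypothesis `ho` says that `q` is orthogonal to the orthogonal complement of all the sample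
  -- vectors, so `q` lies in their closed span.
  let p : ι → WithLp 2 (Lp ℝ 2 P × ℝ) := fun s => WithLp.toLp 2 ((hx s).toLp _, h s)
  let q : WithLp 2 (Lp ℝ 2 P × ℝ) := WithLp.toLp 2 (hZ.toLp _, z)
  have hinner : ∀ (u : WithLp 2 (Lp ℝ 2 P × ℝ)) {W : Ω → ℝ} (hW : MemLp W 2 P) (w : ℝ),
      ⟪WithLp.toLp 2 (hW.toLp W, w), u⟫_ℝ = ∫ ω, u.fst ω * W ω ∂P + u.snd * w := by
    intro u W hW w
    rw [WithLp.prod_inner_apply]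
    congr 1
    change ⟪hW.toLp W, u.fst⟫_ℝ = _
    rw [L2.inner_def]
    refine integral_congr_ae ?_
    filter_upwards [hW.coeFn_toLp] with ω hω
    rw [hω]
    rfl
  have hq : q ∈ (Submodule.span ℝ (range p)).topologicalClosure := by
    rw [← Submodule.orthogonal_orthogonal_eq_closure, Submodule.mem_orthogonal]
    intro u hu
    rw [real_inner_comm, hinner u hZ z]
    refine ho _ _ (Lp.memLp u.fst) fun s => ?_
    rw [← hinner u (hx s)]
    exact (Submodule.mem_orthogonal _ _).1 hu _ (Submodule.subset_span (mem_range_self s))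
  have hsub : ((Submodule.span ℝ (range p) : Submodule ℝ _) : Set (WithLp 2 (Lp ℝ 2 P × ℝ))) ⊆
      {u | ScoreIdentity P β u.fst u.snd} := by
    intro u hu
    rw [SetLike.mem_coe, Submodule.mem_span_set'] at hu
    obtain ⟨n, c, e, rfl⟩ := hu
    choose t ht using fun j => (e j).2
    let ℓ : (Fin n → ℝ) →L[ℝ] ℝ := ∑ j, c j • ContinuousLinearMap.proj j
    have hℓ : ∀ y, ℓ y = ∑ j, c j * y j := fun y => by simp [ℓ]
    have h1 := scoreIdentity_finite (X := fun ω i => x ω (t i)) (v := fun i => h (t i))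
      (aemeasurable_pi_lambda _ fun i => (hx (t i)).1.aemeasurable) hβ (hF n t) ℓ
    have e1 : (∑ j, c j • (e j : WithLp 2 (Lp ℝ 2 P × ℝ))).fst =ᵐ[P]
        fun ω => ℓ fun i => x ω (t i) := by
      have e2 : (∑ j, c j • (e j : WithLp 2 (Lp ℝ 2 P × ℝ))).fst =
          ∑ j, c j • ((hx (t j)).toLp _ : Lp ℝ 2 P) := by
        have := map_sum (WithLp.fstₗ 2 ℝ (Lp ℝ 2 P) ℝ)
          (fun j => c j • (e j : WithLp 2 (Lp ℝ 2 P × ℝ))) Finset.univ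
        refine this.trans (Finset.sum_congr rfl fun j _ => ?_)
        rw [← ht j]
        rfl
      rw [e2]
      refine (Lp.coeFn_finsetSum _ _).trans ?_
      have e3 : ∀ j, (c j • ((hx (t j)).toLp _ : Lp ℝ 2 P) : Lp ℝ 2 P) =ᵐ[P]
          fun ω => c j * x ω (t j) := by
        intro j
        filter_upwards [Lp.coeFn_smul (c j) ((hx (t j)).toLp _), (hx (t j)).coeFn_toLp]
          with ω h2 h3
        rw [h2, Pi.smul_apply, h3, smul_eq_mul]
      filter_upwards [ae_all_iff.2 e3] with ω hω
      rw [Finset.sum_apply, hℓ]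
      exact Finset.sum_congr rfl fun j _ => hω j
    have e2 : (∑ j, c j • (e j : WithLp 2 (Lp ℝ 2 P × ℝ))).snd = ℓ fun i => h (t i) := by
      rw [hℓ]
      have := map_sum (WithLp.sndₗ 2 ℝ (Lp ℝ 2 P) ℝ)
        (fun j => c j • (e j : WithLp 2 (Lp ℝ 2 P × ℝ))) Finset.univ
      refine this.trans (Finset.sum_congr rfl fun j _ => ?_)
      rw [← ht j]
      rfl
    rw [mem_ofPred_eq, e2]
    exact h1.congr e1.symm
  have h1 : ScoreIdentity P β q.fst q.snd :=
    closure_minimal hsub (isClosed_scoreIdentity hβ) hq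
  exact h1.congr hZ.coeFn_toLp

end Score

/-! ### The random phase waveform -/

section Mixture

variable {Ω T : Type*} [MeasurableSpace Ω] [MeasurableSpace T] {P : Measure Ω}
  [IsProbabilityMeasure P] {ρ : Measure T} [SFinite ρ]

/-- Cauchy-Schwarz for the measure with density `k`, obtained by splitting `k` into two square
roots. -/
theorem sq_lintegral_mul_le {k Z : T → ℝ≥0∞} (hk : AEMeasurable k ρ) (hZ : AEMeasurable Z ρ) :
    (∫⁻ τ, k τ * Z τ ∂ρ) ^ 2 ≤ (∫⁻ τ, k τ ∂ρ) * ∫⁻ τ, k τ * Z τ ^ 2 ∂ρ := by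
  have hr : ∀ a : ℝ≥0∞, (a ^ (1 / 2 : ℝ)) ^ (2 : ℝ) = a := fun a => by
    rw [← ENNReal.rpow_mul]; norm_num
  have h1 := ENNReal.lintegral_mul_le_Lp_mul_Lq ρ Real.HolderConjugate.two_two
    (hk.pow_const (1 / 2 : ℝ)) ((hk.pow_const (1 / 2 : ℝ)).mul hZ)
  have e1 : ∀ τ, ((fun τ => k τ ^ (1 / 2 : ℝ)) * ((fun τ => k τ ^ (1 / 2 : ℝ)) * Z)) τ =
      k τ * Z τ := by
    intro τ
    simp only [Pi.mul_apply]
    rw [← mul_assoc, ← ENNReal.rpow_add_of_nonneg _ _ (by norm_num) (by norm_num)]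
    norm_num
  have e2 : ∀ τ, ((fun τ => k τ ^ (1 / 2 : ℝ)) * Z) τ ^ (2 : ℝ) = k τ * Z τ ^ 2 := by
    intro τ
    simp only [Pi.mul_apply]
    rw [ENNReal.mul_rpow_of_nonneg _ _ (by norm_num), hr]
    norm_num
  simp only [e1, e2, hr] at h1
  calc (∫⁻ τ, k τ * Z τ ∂ρ) ^ 2 ≤ _ := ENNReal.pow_le_pow_left h1
    _ = _ := by
      rw [mul_pow, ← ENNReal.rpow_natCast, ← ENNReal.rpow_natCast, Nat.cast_ofNat, hr, hr]

/-- Mixtures of random variables with bounded second moments. -/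
theorem lintegral_mixture_le {Z : Ω × T → ℝ} (hZ : Measurable Z) {C : ℝ≥0∞}
    (hC : ∀ τ, ∫⁻ ω, ‖Z (ω, τ)‖ₑ ^ 2 ∂P ≤ C) {k : T → ℝ} (hk : AEStronglyMeasurable k ρ) :
    ∫⁻ ω, ‖∫ τ, k τ * Z (ω, τ) ∂ρ‖ₑ ^ 2 ∂P ≤ (∫⁻ τ, ‖k τ‖ₑ ∂ρ) ^ 2 * C := by
  have hZ1 : ∀ ω, Measurable fun τ => Z (ω, τ) := fun ω => hZ.comp measurable_prodMk_left
  calc ∫⁻ ω, ‖∫ τ, k τ * Z (ω, τ) ∂ρ‖ₑ ^ 2 ∂P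
      ≤ ∫⁻ ω, (∫⁻ τ, ‖k τ‖ₑ ∂ρ) * ∫⁻ τ, ‖k τ‖ₑ * ‖Z (ω, τ)‖ₑ ^ 2 ∂ρ ∂P := by
        refine lintegral_mono fun ω => ?_
        refine le_trans (ENNReal.pow_le_pow_left (enorm_integral_le_lintegral_enorm _)) ?_
        simp only [enorm_mul]
        exact sq_lintegral_mul_le hk.enorm (hZ1 ω).enorm.aemeasurable
    _ = (∫⁻ τ, ‖k τ‖ₑ ∂ρ) * ∫⁻ τ, ∫⁻ ω, ‖k τ‖ₑ * ‖Z (ω, τ)‖ₑ ^ 2 ∂P ∂ρ := by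
        have hm : AEMeasurable (fun p : Ω × T => ‖k p.2‖ₑ * ‖Z p‖ₑ ^ 2) (P.prod ρ) :=
          (hk.enorm.comp_quasiMeasurePreserving Measure.quasiMeasurePreserving_snd).mul
            (hZ.enorm.pow_const 2).aemeasurable
        rw [lintegral_const_mul'' _ hm.lintegral_prod_right', lintegral_lintegral_swap hm]
    _ ≤ (∫⁻ τ, ‖k τ‖ₑ ∂ρ) * ∫⁻ τ, ‖k τ‖ₑ * C ∂ρ := by
        gcongr with τ
        have hZ2 : Measurable fun ω => Z (ω, τ) := hZ.comp measurable_prodMk_right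
        rw [lintegral_const_mul _ (hZ2.enorm.pow_const 2)]
        gcongr
        exact hC τ
    _ = _ := by rw [lintegral_mul_const'' _ hk.enorm]; ring

theorem memLp_two_of_lintegral_le {Z : Ω → ℝ} (hZ : AEStronglyMeasurable Z P) {C : ℝ≥0∞}
    (hC : C < ∞) (h : ∫⁻ ω, ‖Z ω‖ₑ ^ 2 ∂P ≤ C) : MemLp Z 2 P := by
  refine ⟨hZ, ?_⟩
  have h1 := eLpNorm_two_pow P Z
  have h2 : eLpNorm Z 2 P ^ 2 < ∞ := by rw [h1]; exact h.trans_lt hC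
  simpa [ENNReal.pow_lt_top_iff] using h2

theorem memLp_mixture {Z : Ω × T → ℝ} (hZ : Measurable Z) {C : ℝ≥0∞} (hC' : C < ∞)
    (hC : ∀ τ, ∫⁻ ω, ‖Z (ω, τ)‖ₑ ^ 2 ∂P ≤ C) {k : T → ℝ} (hk : Integrable k ρ) :
    MemLp (fun ω => ∫ τ, k τ * Z (ω, τ) ∂ρ) 2 P := by
  refine memLp_two_of_lintegral_le ?_ ?_ (lintegral_mixture_le hZ hC hk.1)
  · refine AEStronglyMeasurable.integral_prod_right' (f := fun p : Ω × T => k p.2 * Z p) ?_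
    exact (hk.1.comp_quasiMeasurePreserving Measure.quasiMeasurePreserving_snd).mul
      hZ.aestronglyMeasurable
  · exact ENNReal.mul_lt_top (ENNReal.pow_lt_top hk.2) hC'

/-- Fubini applies because `|Y Z| ≤ Y² + Z²` bounds the inner integral uniformly in `τ`, while `k`
is integrable. -/
theorem integral_mul_mixture {Z : Ω × T → ℝ} (hZ : Measurable Z) {C : ℝ≥0∞} (hC' : C < ∞)
    (hC : ∀ τ, ∫⁻ ω, ‖Z (ω, τ)‖ₑ ^ 2 ∂P ≤ C) {k : T → ℝ} (hk : Integrable k ρ) {Y : Ω → ℝ}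
    (hY : MemLp Y 2 P) : ∫ ω, Y ω * ∫ τ, k τ * Z (ω, τ) ∂ρ ∂P =
      ∫ τ, k τ * ∫ ω, Y ω * Z (ω, τ) ∂P ∂ρ := by
  have hZ2 : ∀ τ, MemLp (fun ω => Z (ω, τ)) 2 P := fun τ =>
    memLp_two_of_lintegral_le (hZ.comp measurable_prodMk_right).aestronglyMeasurable hC' (hC τ)
  have hZi : ∀ τ, ∫ ω, Z (ω, τ) ^ 2 ∂P ≤ C.toReal := by
    intro τ
    rw [integral_eq_lintegral_of_nonneg_ae (ae_of_all _ fun ω => sq_nonneg _)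
      ((hZ2 τ).1.pow 2)]
    refine ENNReal.toReal_mono hC'.ne (le_trans (le_of_eq ?_) (hC τ))
    refine lintegral_congr fun ω => ?_
    rw [← sq_abs, ENNReal.ofReal_pow (abs_nonneg _), Real.enorm_eq_ofReal_abs]
  have hint : Integrable (fun p : Ω × T => Y p.1 * (k p.2 * Z p)) (P.prod ρ) := by
    have hm : AEStronglyMeasurable (fun p : Ω × T => Y p.1 * (k p.2 * Z p)) (P.prod ρ) :=
      (hY.1.comp_quasiMeasurePreserving Measure.quasiMeasurePreserving_fst).mul
        ((hk.1.comp_quasiMeasurePreserving Measure.quasiMeasurePreserving_snd).mul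
          hZ.aestronglyMeasurable)
    rw [integrable_prod_iff' hm]
    have e1 : ∀ τ ω, Y ω * (k τ * Z (ω, τ)) = k τ * (Y ω * Z (ω, τ)) := fun τ ω => by ring
    refine ⟨ae_of_all _ fun τ => ?_, ?_⟩
    · simp only [e1]
      exact (hY.integrable_mul (hZ2 τ)).const_mul _
    · refine Integrable.mono' (hk.norm.mul_const (∫ ω, Y ω ^ 2 ∂P + C.toReal))
        (hm.norm.prod_swap.integral_prod_right') (ae_of_all _ fun τ => ?_)
      rw [Real.norm_of_nonneg (integral_nonneg fun ω => norm_nonneg _)]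
      simp only [e1, norm_mul]
      rw [integral_const_mul]
      refine mul_le_mul_of_nonneg_left ?_ (norm_nonneg _)
      have i1 := hY.integrable_sq
      have i2 := (hZ2 τ).integrable_sq
      calc ∫ ω, ‖Y ω‖ * ‖Z (ω, τ)‖ ∂P ≤ ∫ ω, (Y ω ^ 2 + Z (ω, τ) ^ 2) ∂P := by
            refine integral_mono_of_nonneg (ae_of_all _ fun ω => by positivity) (i1.add i2)
              (ae_of_all _ fun ω => ?_)
            simp only [Real.norm_eq_abs]
            nlinarith [sq_nonneg (|Y ω| - |Z (ω, τ)|), sq_abs (Y ω), sq_abs (Z (ω, τ)),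
              sq_nonneg (Y ω), sq_nonneg (Z (ω, τ))]
        _ ≤ _ := by
            rw [integral_add i1 i2]
            linarith [hZi τ]
  calc ∫ ω, Y ω * ∫ τ, k τ * Z (ω, τ) ∂ρ ∂P = ∫ ω, ∫ τ, Y ω * (k τ * Z (ω, τ)) ∂ρ ∂P := by
        simp only [integral_const_mul]
    _ = ∫ τ, ∫ ω, Y ω * (k τ * Z (ω, τ)) ∂P ∂ρ := integral_integral_swap hint
    _ = _ := by
        refine integral_congr_ae (ae_of_all _ fun τ => ?_)
        simp only
        rw [← integral_const_mul]
        refine integral_congr_ae (ae_of_all _ fun ω => ?_)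
        simp only
        ring

/-- Riesz representation on the first component. It exhibits every continuous functional of the
phase and the sample as a mixture of samples plus a multiple of the one at time `t`. -/
theorem exists_dual_eq {W : Measure T} (L : StrongDual ℝ (Lp ℝ 2 W × ℝ)) :
    ∃ (k : Lp ℝ 2 W) (c : ℝ), ∀ {u : T → ℝ} (hu : MemLp u 2 W) (r : ℝ),
      L (hu.toLp u, r) = (∫ τ, k τ * u τ ∂W) + c * r := by
  set k : Lp ℝ 2 W := (InnerProductSpace.toDual ℝ (Lp ℝ 2 W)).symm
    (L.comp (ContinuousLinearMap.inl ℝ (Lp ℝ 2 W) ℝ)) with hk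
  refine ⟨k, L (0, 1), fun {u} hu r => ?_⟩
  have h1 : L (hu.toLp u, r) = L (hu.toLp u, 0) + r * L (0, 1) := by
    rw [← smul_eq_mul, ← map_smul, ← map_add]
    simp
  have h2 : L (hu.toLp u, 0) = ⟪k, hu.toLp u⟫_ℝ := by
    rw [hk, InnerProductSpace.toDual_symm_apply]
    simp
  rw [h1, h2, L2.inner_def, mul_comm r]
  congr 1
  refine integral_congr_ae ?_
  filter_upwards [hu.coeFn_toLp] with τ hτ
  rw [hτ]
  simp [mul_comm]

end Mixture

/-! ### The filtered phase as a random element of `L²` and its score. -/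

section Wave

variable {Ω : Type*} [MeasurableSpace Ω] {P : Measure Ω} [IsProbabilityMeasure P]
  {x : Ω → ℝ → ℝ} {g : ℝ → ℝ}

theorem phaseOf_eq_mk (hg : Integrable g) (y : ℝ → ℝ) (t : ℝ) :
    phaseOf g y t = phaseOf (hg.1.mk g) y t := by
  refine integral_congr_ae ?_
  filter_upwards [(quasiMeasurePreserving_sub_left volume t).ae_eq_comp hg.1.ae_eq_mk] with s hs
  simp only [Function.comp_apply] at hs
  rw [hs]

theorem measurable_phaseOf (hx : Measurable fun p : Ω × ℝ => x p.1 p.2) (hg : Integrable g) :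
    Measurable fun p : Ω × ℝ => phaseOf g (x p.1) p.2 := by
  simp only [phaseOf_eq_mk hg]
  refine StronglyMeasurable.measurable ?_
  refine StronglyMeasurable.integral_prod_right'
    (f := fun q : (Ω × ℝ) × ℝ => hg.1.mk g (q.1.2 - q.2) * x q.1.1 q.2) ?_
  refine ((hg.1.stronglyMeasurable_mk.measurable.comp
    ((measurable_snd.comp measurable_fst).sub measurable_snd)).mul ?_).stronglyMeasurable
  exact hx.comp ((measurable_fst.comp measurable_fst).prodMk measurable_snd)

theorem lintegral_phaseOf_le (hx : Measurable fun p : Ω × ℝ => x p.1 p.2) {C : ℝ≥0∞}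
    (hC : ∀ s, ∫⁻ ω, ‖x ω s‖ₑ ^ 2 ∂P ≤ C) (hg : Integrable g) (t : ℝ) :
    ∫⁻ ω, ‖phaseOf g (x ω) t‖ₑ ^ 2 ∂P ≤ (∫⁻ s, ‖g s‖ₑ) ^ 2 * C := by
  have h1 := lintegral_mixture_le hx hC (hg.comp_sub_left t).1
  rwa [lintegral_sub_left_eq_self (fun s => ‖g s‖ₑ) t] at h1

/-- The phase on the window and the sample at time `t`. -/
def wavePoint (t₀ t₁ : ℝ) (g : ℝ → ℝ) (t : ℝ) (y : ℝ → ℝ) :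
    Lp ℝ 2 ((volume : Measure ℝ).restrict (Icc t₀ t₁)) × ℝ :=
  (lpSlice (volume.restrict (Icc t₀ t₁)) (phaseOf g y), y t)

variable (t₀ t₁ : ℝ)

/-- By Tonelli, since the second moments of the phase are bounded uniformly in time and the window
has finite length. -/
theorem ae_memLp_phaseOf (hx : Measurable fun p : Ω × ℝ => x p.1 p.2) {C : ℝ≥0∞} (hC' : C < ∞)
    (hC : ∀ s, ∫⁻ ω, ‖x ω s‖ₑ ^ 2 ∂P ≤ C) (hg : Integrable g) :
    ∀ᵐ ω ∂P, MemLp (phaseOf g (x ω)) 2 (volume.restrict (Icc t₀ t₁)) := by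
  have hm := measurable_phaseOf hx hg
  have h1 : ∫⁻ ω, (∫⁻ t in Icc t₀ t₁, ‖phaseOf g (x ω) t‖ₑ ^ 2) ∂P < ∞ := by
    rw [lintegral_lintegral_swap (hm.enorm.pow_const 2).aemeasurable]
    refine (lintegral_mono fun t => lintegral_phaseOf_le hx hC hg t).trans_lt ?_
    rw [lintegral_const]
    exact ENNReal.mul_lt_top (ENNReal.mul_lt_top (ENNReal.pow_lt_top hg.2) hC')
      (measure_lt_top _ _)
  filter_upwards [ae_lt_top (hm.enorm.pow_const 2).lintegral_prod_right' h1.ne] with ω hω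
  refine ⟨(hm.comp measurable_prodMk_left).aestronglyMeasurable, ?_⟩
  rw [← eLpNorm_two_pow] at hω
  simpa [ENNReal.pow_lt_top_iff] using hω

theorem aestronglyMeasurable_wavePoint (hx : Measurable fun p : Ω × ℝ => x p.1 p.2) {C : ℝ≥0∞}
    (hC' : C < ∞) (hC : ∀ s, ∫⁻ ω, ‖x ω s‖ₑ ^ 2 ∂P ≤ C) (hg : Integrable g) (t : ℝ) :
    AEStronglyMeasurable (fun ω => wavePoint t₀ t₁ g t (x ω)) P := by
  refine AEStronglyMeasurable.prodMk ?_ (hx.comp measurable_prodMk_right).aestronglyMeasurable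
  exact aestronglyMeasurable_lpSlice (F := fun p : ℝ × Ω => phaseOf g (x p.2) p.1)
    ((measurable_phaseOf hx hg).comp measurable_swap).aestronglyMeasurable
    (ae_memLp_phaseOf t₀ t₁ hx hC' hC hg)

/-- A functional of the phase on the window is a double integral of samples of `x`. It is in the
closed span required by `scoreIdentity_of_orthogonal`, because a pair `(Y, y)` orthogonal to all
samples stays orthogonal under both integrations. -/
theorem scoreIdentity_wavePoint (hx : Measurable fun p : Ω × ℝ => x p.1 p.2) {C : ℝ≥0∞}
    (hC' : C < ∞) (hC : ∀ s, ∫⁻ ω, ‖x ω s‖ₑ ^ 2 ∂P ≤ C) (hg : Integrable g) (t : ℝ)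
    {h : ℝ → ℝ} (hh : MemLp (conv g h) 2 (volume.restrict (Icc t₀ t₁))) {β : Ω → ℝ}
    (hβ : Integrable β P)
    (hF : ∀ (n : ℕ) (t : Fin n → ℝ) (F : (Fin n → ℝ) → ℝ), ContDiff ℝ (⊤ : ℕ∞) F →
      HasCompactSupport F → ∫ ω, fderiv ℝ F (fun i => x ω (t i)) (fun i => h (t i)) ∂P =
        -∫ ω, β ω * F (fun i => x ω (t i)) ∂P)
    (L : StrongDual ℝ (Lp ℝ 2 ((volume : Measure ℝ).restrict (Icc t₀ t₁)) × ℝ)) :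
    ScoreIdentity P β (fun ω => L (wavePoint t₀ t₁ g t (x ω))) (L (hh.toLp _, h t)) := by
  have hm := measurable_phaseOf hx hg
  have hx2 : ∀ s, MemLp (x · s) 2 P := fun s =>
    memLp_two_of_lintegral_le (hx.comp measurable_prodMk_right).aestronglyMeasurable hC' (hC s)
  obtain ⟨k, c, hL⟩ := exists_dual_eq L
  have hki : Integrable k (volume.restrict (Icc t₀ t₁)) := (Lp.memLp k).integrable (by norm_num)
  set C₁ : ℝ≥0∞ := (∫⁻ s, ‖g s‖ₑ) ^ 2 * C
  have hC₁ : C₁ < ∞ := ENNReal.mul_lt_top (ENNReal.pow_lt_top hg.2) hC'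
  have hC₁' := lintegral_phaseOf_le (P := P) hx hC hg
  have hZ1 := memLp_mixture hm hC₁ hC₁' hki
  have hZ : MemLp (fun ω => (∫ τ, k τ * phaseOf g (x ω) τ ∂(volume.restrict (Icc t₀ t₁))) + c * x ω t) 2 P :=
    hZ1.add ((hx2 t).const_mul c)
  rw [hL hh]
  refine (scoreIdentity_of_orthogonal hx2 hβ hF hZ (z := (∫ τ, k τ * conv g h τ ∂(volume.restrict (Icc t₀ t₁))) + c * h t)
    fun Y y hY hYs => ?_).congr ?_
  -- Orthogonality is propagated from the samples to the filter output by one application of Fubini,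
  -- and from there to the functional by a second one.
  · have h1 : ∀ s, ∫ ω, Y ω * x ω s ∂P = -(y * h s) := fun s => by linarith [hYs s]
    have h2 : ∀ τ, ∫ ω, Y ω * phaseOf g (x ω) τ ∂P = -(y * conv g h τ) := by
      intro τ
      have h3 := integral_mul_mixture (Z := fun p : Ω × ℝ => x p.1 p.2) hx hC' hC
        (hg.comp_sub_left τ) hY
      refine Eq.trans h3 ?_
      simp only [h1]
      rw [conv, ← integral_const_mul, ← integral_neg]
      refine integral_congr_ae (ae_of_all _ fun s => ?_)
      simp only
      ring
    have h4 := integral_mul_mixture (Z := fun p : Ω × ℝ => phaseOf g (x p.1) p.2) hm hC₁ hC₁' hki hY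
    simp only [h2] at h4
    have i1 : Integrable (fun ω => Y ω * ∫ τ, k τ * phaseOf g (x ω) τ ∂(volume.restrict (Icc t₀ t₁))) P :=
      hY.integrable_mul hZ1
    have i2 : Integrable (fun ω => Y ω * x ω t) P := hY.integrable_mul (hx2 t)
    have e1 : ∀ ω, Y ω * ((∫ τ, k τ * phaseOf g (x ω) τ ∂(volume.restrict (Icc t₀ t₁))) + c * x ω t) =
        Y ω * (∫ τ, k τ * phaseOf g (x ω) τ ∂(volume.restrict (Icc t₀ t₁))) + c * (Y ω * x ω t) := fun ω => by ring
    simp only [e1]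
    rw [integral_add i1 (i2.const_mul c), integral_const_mul, h1 t, h4]
    have e2 : ∀ τ, k τ * -(y * conv g h τ) = -y * (k τ * conv g h τ) := fun τ => by ring
    simp only [e2]
    rw [integral_const_mul]
    ring
  · filter_upwards [ae_memLp_phaseOf t₀ t₁ hx hC' hC hg] with ω hω
    rw [wavePoint, lpSlice_of_memLp hω, hL hω]

end Wave

/-! ### The weighted score identity for measurement outcomes -/

section ShiftDeriv

variable {Ω E : Type*} [MeasurableSpace Ω] {P : Measure Ω} [IsProbabilityMeasure P]
  [NormedAddCommGroup E] [NormedSpace ℝ E] [CompleteSpace E] [MeasurableSpace E] [BorelSpace E]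
  [SecondCountableTopology E]

/-- Integration by parts along `v` for functions with square-integrable Lipschitz constants. -/
theorem integral_deriv_shift {X : Ω → E} (hX : AEMeasurable X P) (v : E) {β : Ω → ℝ}
    (hβ : MemLp β 2 P)
    (h : ∀ L : StrongDual ℝ E, ScoreIdentity P β (fun ω => L (X ω)) (L v))
    {G : E → ℝ} (hG : Measurable G) (hG2 : MemLp (fun ω => G (X ω)) 2 P) {b : Ω → ℝ}
    (hb : MemLp b 2 P)
    (hlip : ∀ ω, ∀ s ∈ Icc (-1 : ℝ) 1, ∀ s' ∈ Icc (-1 : ℝ) 1,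
      |G (X ω + s • v) - G (X ω + s' • v)| ≤ b ω * |s - s'|)
    {G' : Ω → ℝ} (hG' : ∀ ω, HasDerivAt (fun s : ℝ => G (X ω + s • v)) (G' ω) 0) :
    Integrable G' P ∧ ∫ ω, G' ω ∂P = -∫ ω, β ω * G (X ω) ∂P := by
  have hb0 : ∀ ω, 0 ≤ b ω := fun ω => by
    have := (abs_nonneg _).trans (hlip ω 1 (by norm_num) 0 (by norm_num))
    simpa using this
  have hm : ∀ s : ℝ, AEMeasurable (fun ω => G (X ω + s • v)) P := fun s =>
    hG.comp_aemeasurable (hX.add_const _)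
  have h0 : ∀ ω, G (X ω + (0 : ℝ) • v) = G (X ω) := fun ω => by rw [zero_smul, add_zero]
  have hl0 : ∀ ω, ∀ s ∈ Icc (-1 : ℝ) 1, |G (X ω + s • v) - G (X ω)| ≤ b ω * |s| := by
    intro ω s hs
    have := hlip ω s hs 0 (by norm_num)
    rwa [h0, sub_zero] at this
  have hGi : Integrable (fun ω => G (X ω)) P := hG2.integrable (by norm_num)
  have hbi : Integrable b P := hb.integrable (by norm_num)
  -- The derivative is a pointwise limit of difference quotients along `1 / (n + 1)`.
  have hG'm : AEStronglyMeasurable G' P := by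
    have hu : Tendsto (fun n : ℕ => (1 / ((n : ℝ) + 1))) atTop (𝓝[>] 0) :=
      tendsto_nhdsWithin_iff.2 ⟨tendsto_one_div_add_atTop_nhds_zero_nat,
        Eventually.of_forall fun n => by simp only [mem_Ioi]; positivity⟩
    refine (aemeasurable_of_tendsto_metrizable_ae (u := atTop)
      (f := fun (n : ℕ) ω => (1 / ((n : ℝ) + 1))⁻¹ •
        (G (X ω + (1 / ((n : ℝ) + 1)) • v) - G (X ω))) (fun n => ?_)
      (ae_of_all _ fun ω => ?_)).aestronglyMeasurable
    · have : AEMeasurable (fun ω => G (X ω + (1 / ((n : ℝ) + 1)) • v) - G (X ω)) P :=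
        (hm _).sub hGi.1.aemeasurable
      simpa only [smul_eq_mul] using this.const_mul (1 / ((n : ℝ) + 1))⁻¹
    · have h1 := (hG' ω).tendsto_slope_zero_right.comp hu
      simpa [Function.comp_def, h0] using h1
  have hfin : Integrable G' P ∧
      HasDerivAt (fun s : ℝ => ∫ ω, G (X ω + s • v) ∂P) (∫ ω, G' ω ∂P) 0 := by
    refine hasDerivAt_integral_of_dominated_loc_of_lip (bound := b)
      (Icc_mem_nhds (a := (-1 : ℝ)) (b := 1) (by norm_num) (by norm_num))
      (Eventually.of_forall fun s => (hm s).aestronglyMeasurable) (by simpa [h0] using hGi) hG'm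
      (ae_of_all _ fun ω => ?_) hbi (ae_of_all _ hG')
    refine LipschitzOnWith.of_dist_le_mul fun s hs s' hs' => ?_
    rw [Real.dist_eq, Real.dist_eq, Real.coe_nnabs, abs_of_nonneg (hb0 ω)]
    exact hlip ω s hs s' hs'
  refine ⟨hfin.1, ?_⟩
  have iβ : Integrable β P := hβ.integrable (by norm_num)
  have iβb : Integrable (fun ω => |β ω| * b ω) P := hβ.abs.integrable_mul hb
  have iβG : Integrable (fun ω => β ω * G (X ω)) P := hβ.integrable_mul hG2
  set M := ∫ ω, |β ω| * b ω ∂P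
  -- In the shift formula `G (X + s v)` is replaced by `G (X)`. The Lipschitz bound makes the error
  -- at most `ε |β| b` over an interval of length `ε`. The derivative at zero from the right is
  -- thereby identified, and it is also `∫ G'`.
  have key : ∀ ε ∈ Ioc (0 : ℝ) 1, |(∫ ω, G (X ω + ε • v) ∂P - ∫ ω, G (X ω) ∂P) +
      ε * ∫ ω, β ω * G (X ω) ∂P| ≤ ε ^ 2 * M := by
    intro ε hε
    have hsm : ∀ s ∈ Icc (0 : ℝ) ε, s ∈ Icc (-1 : ℝ) 1 := fun s hs =>
      ⟨by linarith [hs.1], hs.2.trans hε.2⟩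
    have hs : ∀ᵐ p ∂(P.prod ((volume : Measure ℝ).restrict (Icc 0 ε))), p.2 ∈ Icc 0 ε :=
      Measure.quasiMeasurePreserving_snd.ae (ae_restrict_mem measurableSet_Icc)
    have j1 : Integrable (fun p : Ω × ℝ => β p.1 * G (X p.1))
      (P.prod ((volume : Measure ℝ).restrict (Icc 0 ε))) := iβG.comp_fst _
    have j2 : Integrable (fun p : Ω × ℝ => |β p.1| * b p.1)
      (P.prod ((volume : Measure ℝ).restrict (Icc 0 ε))) := iβb.comp_fst _
    have hGm : AEMeasurable (fun p : Ω × ℝ => G (X p.1 + p.2 • v))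
        (P.prod ((volume : Measure ℝ).restrict (Icc 0 ε))) :=
      hG.comp_aemeasurable (aemeasurable_shift hX v ε)
    have hβm : AEMeasurable (fun p : Ω × ℝ => β p.1)
        (P.prod ((volume : Measure ℝ).restrict (Icc 0 ε))) :=
      hβ.1.aemeasurable.comp_quasiMeasurePreserving Measure.quasiMeasurePreserving_fst
    have hd : ∀ᵐ p ∂(P.prod ((volume : Measure ℝ).restrict (Icc 0 ε))),
        ‖β p.1 * G (X p.1 + p.2 • v) - β p.1 * G (X p.1)‖ ≤ ε * (|β p.1| * b p.1) := by
      filter_upwards [hs] with p hp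
      rw [← mul_sub, norm_mul, Real.norm_eq_abs, Real.norm_eq_abs]
      have h1 := hl0 p.1 p.2 (hsm _ hp)
      rw [abs_of_nonneg hp.1] at h1
      calc |β p.1| * |G (X p.1 + p.2 • v) - G (X p.1)| ≤ |β p.1| * (b p.1 * ε) := by
            gcongr
            exact h1.trans (mul_le_mul_of_nonneg_left hp.2 (hb0 _))
        _ = _ := by ring
    have j3 : Integrable (fun p : Ω × ℝ => β p.1 * G (X p.1 + p.2 • v) - β p.1 * G (X p.1))
        (P.prod ((volume : Measure ℝ).restrict (Icc 0 ε))) :=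
      Integrable.mono' (j2.const_mul ε)
        ((hβm.mul hGm).aestronglyMeasurable.sub j1.1) hd
    have j4 : Integrable (fun p : Ω × ℝ => β p.1 * G (X p.1 + p.2 • v))
        (P.prod ((volume : Measure ℝ).restrict (Icc 0 ε))) := by
      refine (j3.add j1).congr (ae_of_all _ fun p => ?_)
      simp
    have i1 : Integrable (fun ω => G (X ω + ε • v)) P := by
      have i2 : Integrable (fun ω => G (X ω + ε • v) - G (X ω)) P := by
        refine Integrable.mono' (hbi.mul_const |ε|)
          ((hm ε).aestronglyMeasurable.sub hGi.1) (ae_of_all _ fun ω => ?_)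
        exact hl0 ω ε ⟨by linarith [hε.1], hε.2⟩
      refine (i2.add hGi).congr (ae_of_all _ fun p => ?_)
      simp
    have hv : (volume.restrict (Icc 0 ε) : Measure ℝ).real univ = ε := by
      simp [hε.1.le]
    have e1 := integral_shift_sub hX v hε.1.le iβ h hG hGi i1 j4
    have e2 : ∫ p, β p.1 * G (X p.1) ∂(P.prod ((volume : Measure ℝ).restrict (Icc 0 ε))) =
        ε * ∫ ω, β ω * G (X ω) ∂P := by
      rw [integral_fun_fst (fun ω => β ω * G (X ω)), hv, smul_eq_mul]
    have e3 : ∫ p, ε * (|β p.1| * b p.1) ∂(P.prod ((volume : Measure ℝ).restrict (Icc 0 ε))) =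
        ε ^ 2 * M := by
      rw [integral_const_mul, integral_fun_fst (fun ω => |β ω| * b ω), hv, smul_eq_mul]
      ring
    rw [e1, ← e2, ← e3, neg_add_eq_sub, abs_sub_comm, ← integral_sub j4 j1]
    exact norm_integral_le_of_norm_le (j2.const_mul ε) hd
  have t1 := hfin.2.tendsto_slope_zero_right
  simp only [zero_add, h0, smul_eq_mul] at t1
  have t2 : Tendsto (fun ε : ℝ => ε⁻¹ * (∫ ω, G (X ω + ε • v) ∂P - ∫ ω, G (X ω) ∂P))
      (𝓝[>] 0) (𝓝 (-∫ ω, β ω * G (X ω) ∂P)) := by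
    have t3 : Tendsto (fun ε : ℝ => ε * M) (𝓝[>] 0) (𝓝 0) := by
      have : Tendsto (fun ε : ℝ => ε * M) (𝓝 0) (𝓝 (0 * M)) := tendsto_id.mul_const M
      rw [zero_mul] at this
      exact this.mono_left nhdsWithin_le_nhds
    rw [tendsto_iff_dist_tendsto_zero]
    refine squeeze_zero' (Eventually.of_forall fun _ => dist_nonneg) ?_ t3
    filter_upwards [Ioc_mem_nhdsGT (zero_lt_one' ℝ)] with ε hε
    have h1 := key ε hε
    have hε0 := hε.1
    rw [Real.dist_eq, sub_neg_eq_add]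
    have e : ε⁻¹ * (∫ ω, G (X ω + ε • v) ∂P - ∫ ω, G (X ω) ∂P) + ∫ ω, β ω * G (X ω) ∂P =
        ε⁻¹ * ((∫ ω, G (X ω + ε • v) ∂P - ∫ ω, G (X ω) ∂P) + ε * ∫ ω, β ω * G (X ω) ∂P) := by
      field_simp
    rw [e, abs_mul, abs_of_pos (inv_pos.2 hε0)]
    calc ε⁻¹ * _ ≤ ε⁻¹ * (ε ^ 2 * M) := by gcongr
      _ = ε * M := by field_simp
  exact tendsto_nhds_unique t1 t2

end ShiftDeriv

/-! ### The van Trees identity and inequality for quantum measurements. -/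

section VanTrees

variable {Ω F : Type*} [MeasurableSpace Ω] {P : Measure Ω} [IsProbabilityMeasure P]
  [NormedAddCommGroup F] [NormedSpace ℝ F] [CompleteSpace F] [MeasurableSpace F] [BorelSpace F]
  [SecondCountableTopology F]

/-- The van Trees identity for outcome probabilities `p r u`, the estimate `r`, and the parameter
to be estimated in the second component. -/
theorem integral_score_eq {Z : Ω → F × ℝ} (hZ : AEMeasurable Z P)
    (hZ2 : MemLp (fun ω => (Z ω).2) 2 P) (v : F × ℝ) {β : Ω → ℝ} (hβ : MemLp β 2 P)
    (h : ∀ L : StrongDual ℝ (F × ℝ), ScoreIdentity P β (fun ω => L (Z ω)) (L v))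
    (R : Finset ℝ) {p d : ℝ → F → ℝ} (hp : ∀ r, Continuous (p r)) {a c : ℝ → ℝ}
    (ha : ∀ r u, |p r u| ≤ a r) (hc : ∀ r u (s : ℝ), |p r (u + s • v.1) - p r u| ≤ c r * |s|)
    (hd : ∀ r u, HasDerivAt (fun s : ℝ => p r (u + s • v.1)) (d r u) 0)
    (h1 : ∀ u, ∑ r ∈ R, p r u = 1) :
    Integrable (fun ω => ∑ r ∈ R, (r - (Z ω).2) * (d r (Z ω).1 + β ω * p r (Z ω).1)) P ∧
    ∫ ω, ∑ r ∈ R, (r - (Z ω).2) * (d r (Z ω).1 + β ω * p r (Z ω).1) ∂P = v.2 := by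
  have ha0 : ∀ r, 0 ≤ a r := fun r => (abs_nonneg _).trans (ha r 0)
  have hc0 : ∀ r, 0 ≤ c r := fun r => by
    have := (abs_nonneg _).trans (hc r 0 1); simpa using this
  set G : F × ℝ → ℝ := fun z => ∑ r ∈ R, (r - z.2) * p r z.1 with hG
  have hGc : Continuous G := by
    refine continuous_finsetSum _ fun r _ => ?_
    exact (continuous_const.sub continuous_snd).mul ((hp r).comp continuous_fst)
  -- The probabilities sum to one, so the parameter separates. This makes the Lipschitz constant of
  -- `G` along `v` independent of the unbounded component `z.2`.
  have hGe : ∀ z : F × ℝ, G z = (∑ r ∈ R, r * p r z.1) - z.2 := by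
    intro z
    simp only [hG, sub_mul, Finset.sum_sub_distrib, ← Finset.mul_sum, h1, mul_one]
  set A : ℝ := ∑ r ∈ R, |r| * a r
  set B : ℝ := ∑ r ∈ R, |r| * c r
  have hGb : ∀ z : F × ℝ, |G z| ≤ A + |z.2| := by
    intro z
    rw [hGe]
    refine (abs_sub _ _).trans (add_le_add_left ?_ _)
    refine (Finset.abs_sum_le_sum_abs _ _).trans (Finset.sum_le_sum fun r _ => ?_)
    rw [abs_mul]
    exact mul_le_mul_of_nonneg_left (ha r _) (abs_nonneg _)
  have hG2 : MemLp (fun ω => G (Z ω)) 2 P := by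
    have h2 : MemLp (fun ω => A + |(Z ω).2|) 2 P := (memLp_const A).add hZ2.abs
    exact h2.mono' (hGc.measurable.comp_aemeasurable hZ).aestronglyMeasurable
      (ae_of_all _ fun ω => hGb _)
  have hlip0 : ∀ (z : F × ℝ) (s : ℝ), |G (z + s • v) - G z| ≤ (B + |v.2|) * |s| := by
    intro z s
    have e : G (z + s • v) - G z =
        (∑ r ∈ R, r * (p r (z.1 + s • v.1) - p r z.1)) - s * v.2 := by
      simp only [hGe, Prod.fst_add, Prod.snd_add, Prod.smul_fst, Prod.smul_snd, smul_eq_mul,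
        mul_sub, Finset.sum_sub_distrib]
      ring
    rw [e, add_mul]
    refine (abs_sub _ _).trans (add_le_add ?_ (by rw [abs_mul, mul_comm]))
    refine (Finset.abs_sum_le_sum_abs _ _).trans ?_
    rw [Finset.sum_mul]
    refine Finset.sum_le_sum fun r _ => ?_
    rw [abs_mul, mul_assoc]
    exact mul_le_mul_of_nonneg_left (hc r _ _) (abs_nonneg _)
  have hder : ∀ ω, HasDerivAt (fun s : ℝ => G (Z ω + s • v))
      ((∑ r ∈ R, r * d r (Z ω).1) - v.2) 0 := by
    intro ω
    simp only [hGe, Prod.fst_add, Prod.snd_add, Prod.smul_fst, Prod.smul_snd, smul_eq_mul]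
    refine HasDerivAt.sub (HasDerivAt.fun_sum fun r _ => (hd r (Z ω).1).const_mul r) ?_
    simpa using ((hasDerivAt_id (0 : ℝ)).mul_const v.2).const_add (Z ω).2
  -- Derivatives of probabilities sum to zero, so the centring by `(Z ω).2` can be inserted in the
  -- derivative term at no cost.
  have hsum0 : ∀ u, ∑ r ∈ R, d r u = 0 := by
    intro u
    have h2 : HasDerivAt (fun s : ℝ => ∑ r ∈ R, p r (u + s • v.1)) (∑ r ∈ R, d r u) 0 :=
      HasDerivAt.fun_sum fun r _ => hd r u
    simp only [h1] at h2
    exact h2.unique (hasDerivAt_const _ _)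
  obtain ⟨i1, e1⟩ := integral_deriv_shift hZ v hβ h hGc.measurable hG2
    (b := fun _ => B + |v.2|) (memLp_const _) (fun ω s _ s' _ => by
      have := hlip0 (Z ω + s' • v) (s - s')
      rwa [add_assoc, ← add_smul, add_sub_cancel] at this) hder
  have i2 : Integrable (fun ω => β ω * G (Z ω)) P := hβ.integrable_mul hG2
  have e2 : ∀ ω, ∑ r ∈ R, (r - (Z ω).2) * (d r (Z ω).1 + β ω * p r (Z ω).1) =
      ((∑ r ∈ R, r * d r (Z ω).1) - v.2) + β ω * G (Z ω) + v.2 := by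
    intro ω
    have e3 : ∑ r ∈ R, (r - (Z ω).2) * d r (Z ω).1 = ∑ r ∈ R, r * d r (Z ω).1 := by
      simp only [sub_mul, Finset.sum_sub_distrib, ← Finset.mul_sum, hsum0, mul_zero, sub_zero]
    have e4 : ∑ r ∈ R, (r - (Z ω).2) * (β ω * p r (Z ω).1) = β ω * G (Z ω) := by
      rw [hG, Finset.mul_sum]
      exact Finset.sum_congr rfl fun r _ => by ring
    simp only [mul_add, Finset.sum_add_distrib]
    rw [e3, e4]
    ring
  simp only [e2]
  have i3 : Integrable (fun ω => ((∑ r ∈ R, r * d r (Z ω).1) - v.2) + β ω * G (Z ω)) P := i1.add i2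
  refine ⟨i3.add (integrable_const _), ?_⟩
  rw [integral_add i3 (integrable_const _), integral_add i1 i2, e1]
  simp

/-- The van Trees inequality for measurements of a pure state `V u`, whose dependence on `u` along
`v` has the tangent vector `D u` in some purification. -/
theorem sq_le_mul_integral_of_effects {𝓗 : Type*} [NormedAddCommGroup 𝓗] [InnerProductSpace ℂ 𝓗]
    {Z : Ω → F × ℝ} (hZ : AEMeasurable Z P) (hZ2 : MemLp (fun ω => (Z ω).2) 2 P) (v : F × ℝ)
    {β : Ω → ℝ} (hβ : MemLp β 2 P)
    (h : ∀ L : StrongDual ℝ (F × ℝ), ScoreIdentity P β (fun ω => L (Z ω)) (L v))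
    (R : Finset ℝ) {T : ℝ → 𝓗 →L[ℂ] 𝓗} (hT : ∀ r (x y : 𝓗), ⟪T r x, y⟫_ℂ = ⟪x, T r y⟫_ℂ)
    (hT0 : ∀ r (x : 𝓗), 0 ≤ (⟪x, T r x⟫_ℂ).re)
    (hT1 : ∀ x : 𝓗, ∑ r ∈ R, (⟪x, T r x⟫_ℂ).re = ‖x‖ ^ 2)
    {V : F → 𝓗} (hV : Continuous V) (hV1 : ∀ u, ‖V u‖ = 1) {W : ℝ → F → 𝓗}
    (hW0 : ∀ u, W 0 u = V u)
    (hW : ∀ r u (s : ℝ), (⟪V (u + s • v.1), T r (V (u + s • v.1))⟫_ℂ).re =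
      (⟪W s u, T r (W s u)⟫_ℂ).re) {D : F → 𝓗} (hD : ∀ u, HasDerivAt (fun s => W s u) (D u) 0)
    (hWl : ∀ u (s : ℝ), ‖W s u - V u‖ ≤ ‖D u‖ * |s|) (hW1 : ∀ u s, ‖W s u‖ = 1) {q : ℝ}
    (hq : ∀ u, ‖D u‖ ^ 2 = q)
    (hDV : ∀ u, (⟪D u, V u⟫_ℂ).re = 0) :
    Integrable (fun ω => ∑ r ∈ R, (r - (Z ω).2) ^ 2 * (⟪V (Z ω).1, T r (V (Z ω).1)⟫_ℂ).re) P ∧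
    v.2 ^ 2 ≤ (4 * q + ∫ ω, β ω ^ 2 ∂P) *
      ∫ ω, ∑ r ∈ R, (r - (Z ω).2) ^ 2 * (⟪V (Z ω).1, T r (V (Z ω).1)⟫_ℂ).re ∂P := by
  have hre : ∀ r x y, (⟪x, T r y⟫_ℂ).re = (⟪y, T r x⟫_ℂ).re := fun r x y => by
    rw [← hT, ← inner_conj_symm, Complex.conj_re]
  have hq0 : 0 ≤ q := (hq 0) ▸ sq_nonneg _
  have hDn : ∀ u, ‖D u‖ = Real.sqrt q := fun u => by
    rw [← hq u, Real.sqrt_sq (norm_nonneg _)]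
  set p : ℝ → F → ℝ := fun r u => (⟪V u, T r (V u)⟫_ℂ).re with hp
  have hpc : ∀ r, Continuous (p r) := fun r => by
    simp only [hp]
    fun_prop
  have ha : ∀ r u, |p r u| ≤ ‖T r‖ := fun r u => by
    refine (Complex.abs_re_le_norm _).trans ((norm_inner_le_norm _ _).trans ?_)
    rw [hV1, one_mul]
    exact ((T r).le_opNorm _).trans (by rw [hV1, mul_one])
  -- The probabilities along the shifted states equal those along the purified curve `W`, so the
  -- tangent vector `D` of the latter determines the derivative.
  have hder : ∀ r u, HasDerivAt (fun s : ℝ => p r (u + s • v.1))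
      (2 * (⟪D u, T r (V u)⟫_ℂ).re) 0 := by
    intro r u
    simp only [hp, hW]
    have h1 := ((hD u).inner ℂ (((T r).restrictScalars ℝ).hasFDerivAt.comp_hasDerivAt 0 (hD u)))
    have h2 := (Complex.reCLM.hasFDerivAt.comp_hasDerivAt 0 h1)
    refine (h2.congr_deriv ?_)
    simp only [Complex.reCLM_apply, Function.comp_apply, hW0, ContinuousLinearMap.coe_restrictScalars',
      Complex.add_re]
    rw [hre r (V u) (D u)]
    ring
  have hc : ∀ r u (s : ℝ), |p r (u + s • v.1) - p r u| ≤ 2 * ‖T r‖ * Real.sqrt q * |s| := by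
    intro r u s
    simp only [hp, hW]
    have e : (⟪W s u, T r (W s u)⟫_ℂ).re - (⟪V u, T r (V u)⟫_ℂ).re =
        (⟪W s u - V u, T r (W s u)⟫_ℂ).re + (⟪V u, T r (W s u - V u)⟫_ℂ).re := by
      simp only [map_sub, inner_sub_left, inner_sub_right, Complex.sub_re]
      ring
    have hl := hWl u s
    rw [hDn] at hl
    rw [e]
    refine (abs_add_le _ _).trans ?_
    have b1 : |(⟪W s u - V u, T r (W s u)⟫_ℂ).re| ≤ (Real.sqrt q * |s|) * ‖T r‖ := by
      refine (Complex.abs_re_le_norm _).trans ((norm_inner_le_norm _ _).trans ?_)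
      refine mul_le_mul hl ?_ (norm_nonneg _) (by positivity)
      exact ((T r).le_opNorm _).trans (by rw [hW1, mul_one])
    have b2 : |(⟪V u, T r (W s u - V u)⟫_ℂ).re| ≤ 1 * (‖T r‖ * (Real.sqrt q * |s|)) := by
      refine (Complex.abs_re_le_norm _).trans ((norm_inner_le_norm _ _).trans ?_)
      refine mul_le_mul (hV1 u).le ?_ (norm_nonneg _) (by positivity)
      exact ((T r).le_opNorm _).trans (by gcongr)
    linarith
  have h1 : ∀ u, ∑ r ∈ R, p r u = 1 := fun u => by simp only [hp, hT1, hV1, one_pow]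
  obtain ⟨i1, e1⟩ := integral_score_eq hZ hZ2 v hβ h R hpc ha hc hder h1
  have i2 : Integrable (fun ω => ∑ r ∈ R, (r - (Z ω).2) ^ 2 * p r (Z ω).1) P := by
    refine integrable_finsetSum _ fun r _ => ?_
    have h2 : Integrable (fun ω => (r - (Z ω).2) ^ 2) P := by
      have h3 : MemLp (fun ω => r - (Z ω).2) 2 P := (memLp_const r).sub hZ2
      exact h3.integrable_sq
    refine h2.mul_bdd (c := ‖T r‖) ?_ (ae_of_all _ fun ω => ha r _)
    exact ((hpc r).measurable.comp_aemeasurable hZ.fst).aestronglyMeasurable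
  refine ⟨i2, ?_⟩
  set M := ∫ ω, ∑ r ∈ R, (r - (Z ω).2) ^ 2 * p r (Z ω).1 ∂P
  -- Instead of a Cauchy-Schwarz inequality for the sum over outcomes and the expectation together,
  -- nonnegativity for every real `s` is proved and the discriminant is used.
  have hquad : ∀ s : ℝ, 0 ≤ M * (s * s) + (-(2 * v.2)) * s + (4 * q + ∫ ω, β ω ^ 2 ∂P) := by
    intro s
    have hpt : ∀ ω, 0 ≤ s ^ 2 * (∑ r ∈ R, (r - (Z ω).2) ^ 2 * p r (Z ω).1) -
        2 * s * (∑ r ∈ R, (r - (Z ω).2) * (2 * (⟪D (Z ω).1, T r (V (Z ω).1)⟫_ℂ).re +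
          β ω * p r (Z ω).1)) + (4 * q + β ω ^ 2) := by
      intro ω
      set u := (Z ω).1
      -- The joint score vector of data and prior. Its squared norm is `4q + β²`, since the real
      -- part of `⟪D, V⟫` vanishes. The quadratic polynomial is the sum over `r` of the effects in
      -- the vectors `K - s (r - x) V`.
      set K : 𝓗 := (2 : ℝ) • D u + β ω • V u with hK
      have hKn : ‖K‖ ^ 2 = 4 * q + β ω ^ 2 := by
        have h3 := @norm_add_sq ℂ 𝓗 _ _ _ ((2 : ℝ) • D u) (β ω • V u)
        rw [hK, h3, norm_smul, norm_smul, mul_pow, mul_pow, hq, hV1, inner_smul_left_eq_smul,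
          inner_smul_right_eq_smul]
        simp only [RCLike.re_eq_complex_re, Complex.smul_re, hDV]
        simp
        norm_num
      have hKV : ∀ r, (⟪K, T r (V u)⟫_ℂ).re = 2 * (⟪D u, T r (V u)⟫_ℂ).re + β ω * p r u := by
        intro r
        rw [hK, inner_add_left, inner_smul_left_eq_smul, inner_smul_left_eq_smul]
        simp only [Complex.add_re, Complex.smul_re, smul_eq_mul, hp]
      have hterm : ∀ r, (⟪K - (s * (r - (Z ω).2)) • V u, T r (K - (s * (r - (Z ω).2)) • V u)⟫_ℂ).re
          = (⟪K, T r K⟫_ℂ).re - 2 * s * ((r - (Z ω).2) *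
            (2 * (⟪D u, T r (V u)⟫_ℂ).re + β ω * p r u)) +
            s ^ 2 * ((r - (Z ω).2) ^ 2 * p r u) := by
        intro r
        set y := s * (r - (Z ω).2) with hy
        have hTs : T r (y • V u) = y • T r (V u) := (T r).map_smul_of_tower y (V u)
        rw [map_sub, hTs, inner_sub_left, inner_sub_right, inner_sub_right,
          inner_smul_left_eq_smul, inner_smul_right_eq_smul, inner_smul_left_eq_smul,
          inner_smul_right_eq_smul]
        simp only [Complex.sub_re, Complex.smul_re, smul_eq_mul]
        rw [hre r (V u) K, hKV]
        simp only [hy, hp]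
        ring
      have hsum := Finset.sum_nonneg fun r (_ : r ∈ R) =>
        hT0 r (K - (s * (r - (Z ω).2)) • V u)
      simp only [hterm, Finset.sum_add_distrib, Finset.sum_sub_distrib, hT1, hKn,
        ← Finset.mul_sum] at hsum
      linarith
    have i3 : Integrable (fun ω => β ω ^ 2) P := hβ.integrable_sq
    have j1 := i2.const_mul (s ^ 2)
    have j2 := i1.const_mul (2 * s)
    have j3 : Integrable (fun ω => 4 * q + β ω ^ 2) P := (integrable_const _).add i3
    have h4 := integral_nonneg_of_ae (ae_of_all P hpt)
    rw [integral_add (f := fun ω => s ^ 2 * (∑ r ∈ R, (r - (Z ω).2) ^ 2 * p r (Z ω).1) -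
        2 * s * (∑ r ∈ R, (r - (Z ω).2) * (2 * (⟪D (Z ω).1, T r (V (Z ω).1)⟫_ℂ).re +
          β ω * p r (Z ω).1))) (j1.sub j2) j3, integral_sub j1 j2, integral_const_mul, integral_const_mul,
      e1, integral_add (integrable_const _) i3] at h4
    simp only [integral_const, probReal_univ, one_smul] at h4
    linarith
  have h5 := discrim_le_zero hquad
  rw [discrim] at h5
  linarith

end VanTrees

/-! ### Phase shifts of square-integrable functions -/

section Phase

variable {α : Type*} [MeasurableSpace α] {μ : Measure α}

theorem memLp_phase {Ψ : α → ℂ} (hΨ : MemLp Ψ 2 μ) {χ : α → ℝ} (hχ : AEStronglyMeasurable χ μ) :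
    MemLp (fun a => Complex.exp (Complex.I * χ a) * Ψ a) 2 μ := by
  have h1 : AEStronglyMeasurable (fun a => Complex.exp (Complex.I * χ a)) μ :=
    (by fun_prop : Continuous fun r : ℝ => Complex.exp (Complex.I * r)).comp_aestronglyMeasurable hχ
  refine hΨ.of_le (h1.mul hΨ.1) (ae_of_all _ fun a => ?_)
  rw [norm_mul, mul_comm Complex.I, Complex.norm_exp_ofReal_mul_I, one_mul]

theorem norm_lpSlice_congr {Ψ Φ : α → ℂ} (hΨ : MemLp Ψ 2 μ) (hΦ : MemLp Φ 2 μ)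
    (h : ∀ a, ‖Ψ a‖ = ‖Φ a‖) : ‖lpSlice μ Ψ‖ = ‖lpSlice μ Φ‖ := by
  rw [lpSlice_of_memLp hΨ, lpSlice_of_memLp hΦ, Lp.norm_toLp, Lp.norm_toLp,
    eLpNorm_congr_norm_ae (ae_of_all _ h)]

theorem norm_lpSlice_sq {Ψ : α → ℂ} (hΨ : MemLp Ψ 2 μ) : ‖lpSlice μ Ψ‖ ^ 2 = ∫ a, ‖Ψ a‖ ^ 2 ∂μ := by
  rw [← RCLike.ofReal_inj (K := ℂ), RCLike.ofReal_pow, ← inner_self_eq_norm_sq_to_K, L2.inner_def]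
  refine Eq.trans ?_ (integral_ofReal (𝕜 := ℂ) (f := fun a => ‖Ψ a‖ ^ 2))
  refine integral_congr_ae ?_
  filter_upwards [lpSlice_coeFn hΨ] with a ha
  rw [ha, inner_self_eq_norm_sq_to_K]
  norm_cast

theorem norm_lpSlice_phase_sub_le {Ψ : α → ℂ} (hΨ : MemLp Ψ 2 μ) {X : α → ℝ}
    (hX : AEStronglyMeasurable X μ) (hXΨ : MemLp (fun a => Complex.I * X a * Ψ a) 2 μ) (s : ℝ) :
    ‖lpSlice μ (fun a => Complex.exp (Complex.I * (s * X a : ℝ)) * Ψ a) - lpSlice μ Ψ‖ ≤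
      ‖lpSlice μ fun a => Complex.I * X a * Ψ a‖ * |s| := by
  have h1 := memLp_phase hΨ (hX.const_mul s)
  rw [lpSlice_of_memLp h1, lpSlice_of_memLp hΨ, ← MemLp.toLp_sub, lpSlice_of_memLp hXΨ, mul_comm]
  refine Lp.norm_le_mul_norm_of_ae_le_mul ?_
  filter_upwards [(h1.sub hΨ).coeFn_toLp, hXΨ.coeFn_toLp] with a h2 h3
  rw [h2, h3]
  simp only [Pi.sub_apply]
  rw [← sub_one_mul, norm_mul, norm_mul, norm_mul, Complex.norm_I, Complex.norm_real, one_mul,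
    ← mul_assoc]
  refine mul_le_mul_of_nonneg_right ?_ (norm_nonneg _)
  refine (Real.norm_exp_I_mul_ofReal_sub_one_le).trans ?_
  rw [norm_mul, Real.norm_eq_abs, Real.norm_eq_abs]

/-- The difference quotients converge pointwise and are dominated by `|X Ψ|`, since `|exp(isX) - 1|
≤ |sX|`. Square-integrability of `X Ψ` thus suffices for norm differentiability. -/
theorem hasDerivAt_lpSlice_phase {Ψ : α → ℂ} (hΨ : MemLp Ψ 2 μ) {X : α → ℝ}
    (hX : AEStronglyMeasurable X μ) (hXΨ : MemLp (fun a => Complex.I * X a * Ψ a) 2 μ) :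
    HasDerivAt (fun s : ℝ => lpSlice μ fun a => Complex.exp (Complex.I * (s * X a : ℝ)) * Ψ a)
      (lpSlice μ fun a => Complex.I * X a * Ψ a) 0 := by
  rw [hasDerivAt_iff_tendsto_slope_zero]
  have hm : ∀ s : ℝ, MemLp (fun a => Complex.exp (Complex.I * (s * X a : ℝ)) * Ψ a) 2 μ := fun s =>
    memLp_phase hΨ (hX.const_mul s)
  have hF : ∀ s : ℝ, MemLp (fun a => (s⁻¹ : ℂ) *
      (Complex.exp (Complex.I * (s * X a : ℝ)) * Ψ a - Ψ a)) 2 μ := fun s =>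
    ((hm s).sub hΨ).const_mul _
  have e : ∀ s : ℝ, s⁻¹ • (lpSlice μ (fun a => Complex.exp (Complex.I * ((0 + s) * X a : ℝ)) * Ψ a) -
      lpSlice μ fun a => Complex.exp (Complex.I * ((0 : ℝ) * X a : ℝ)) * Ψ a) =
      lpSlice μ fun a => (s⁻¹ : ℂ) *
        (Complex.exp (Complex.I * (s * X a : ℝ)) * Ψ a - Ψ a) := by
    intro s
    simp only [zero_add, zero_mul, Complex.ofReal_zero, mul_zero, Complex.exp_zero, one_mul]
    rw [lpSlice_of_memLp (hm s), lpSlice_of_memLp hΨ, lpSlice_of_memLp (hF s), ← MemLp.toLp_sub,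
      ← MemLp.toLp_const_smul, MemLp.toLp_eq_toLp_iff]
    refine ae_of_all _ fun a => ?_
    simp [Complex.real_smul]
  simp only [e]
  refine tendsto_lpSlice hF hXΨ ?_
  refine tendsto_eLpNorm_two_of_dominated (fun s => (hF s).1) hXΨ.1
    (G := fun a => 2 * ‖Complex.I * X a * Ψ a‖) (hXΨ.norm.const_mul 2) ?_ ?_
  · filter_upwards [self_mem_nhdsWithin] with s hs
    refine ae_of_all _ fun a => (norm_sub_le _ _).trans ?_
    have hs0 : 0 < |s| := abs_pos.2 hs
    have h1 : ‖(s⁻¹ : ℂ) * (Complex.exp (Complex.I * (s * X a : ℝ)) * Ψ a - Ψ a)‖ ≤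
        ‖Complex.I * X a * Ψ a‖ := by
      rw [← sub_one_mul, norm_mul, norm_mul, norm_mul, norm_mul, Complex.norm_I, Complex.norm_real,
        one_mul, ← mul_assoc, norm_inv, Complex.norm_real]
      refine mul_le_mul_of_nonneg_right ?_ (norm_nonneg _)
      rw [Real.norm_eq_abs, inv_mul_le_iff₀ hs0]
      refine (Real.norm_exp_I_mul_ofReal_sub_one_le).trans ?_
      rw [norm_mul, Real.norm_eq_abs]
    linarith
  · refine ae_of_all _ fun a => ?_
    have h1 : HasDerivAt (fun s : ℝ => Complex.exp (Complex.I * (s * X a : ℝ)) * Ψ a)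
        (Complex.I * X a * Ψ a) 0 := by
      have h2 : HasDerivAt (fun s : ℝ => Complex.I * ((s * X a : ℝ) : ℂ)) (Complex.I * X a) 0 := by
        have h3 : HasDerivAt (fun s : ℝ => s * X a) (X a) 0 := by
          simpa using (hasDerivAt_id (0 : ℝ)).mul_const (X a)
        exact h3.ofReal_comp.const_mul Complex.I
      have h4 := (h2.cexp).mul_const (Ψ a)
      simpa using h4
    have h5 := (hasDerivAt_iff_tendsto_slope_zero.1 h1)
    simpa [Complex.real_smul] using h5

end Phase

/-! ### The output state as a function of the phase -/

section Output

variable {t₀ t₁ κ : ℝ} {ψ : Multiset ℝ → ℂ}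

theorem memLp_mul_lossyKet (h : FiniteNumber t₀ t₁ ψ) {X : Multiset ℝ × Multiset ℝ → ℝ}
    (hX : AEStronglyMeasurable X ((configMeasure t₀ t₁).prod (configMeasure t₀ t₁)))
    (hX2 : MemLp X 2 (pairMeasure t₀ t₁ κ ψ)) :
    MemLp (fun c => (X c : ℂ) * lossyKet κ ψ c) 2
      ((configMeasure t₀ t₁).prod (configMeasure t₀ t₁)) := by
  have hm : AEStronglyMeasurable (fun c => (X c : ℂ) * lossyKet κ ψ c)
      ((configMeasure t₀ t₁).prod (configMeasure t₀ t₁)) :=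
    (Complex.continuous_ofReal.comp_aestronglyMeasurable hX).mul
      (aestronglyMeasurable_lossyKet κ h.memLp.1)
  rw [memLp_two_iff_integrable_sq_norm hm]
  have h1 := hX2.integrable_sq
  rw [pairMeasure, integrable_withDensity_iff_integrable_smul₀'
    (aemeasurable_lossy_sq κ h.memLp.1) (ae_of_all _ fun _ => ENNReal.ofReal_lt_top)] at h1
  refine h1.congr (ae_of_all _ fun c => ?_)
  simp only [ENNReal.toReal_ofReal (sq_nonneg ‖lossyKet κ ψ _‖), smul_eq_mul, norm_mul, mul_pow,
    Complex.norm_real, Real.norm_eq_abs, sq_abs]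
  ring

theorem memLp_lossyKet (h : FiniteNumber t₀ t₁ ψ) : MemLp (lossyKet κ ψ) 2
    ((configMeasure t₀ t₁).prod (configMeasure t₀ t₁)) := by
  have hm := aestronglyMeasurable_lossyKet κ h.memLp.1
  rw [memLp_two_iff_integrable_sq_norm hm]
  have := h.integrable_lossy κ (G := fun _ => 1) aestronglyMeasurable_const (C := 1) fun p => by
    rw [abs_one]; nlinarith [sq_nonneg (Multiset.card (p.1 + p.2) : ℝ)]
  simpa using this

theorem outputKet_eq (φ : ℝ → ℝ) : outputKet κ ψ φ = fun c =>
    Complex.exp (Complex.I * (flux φ c.1 : ℝ)) * lossyKet κ ψ c :=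
  funext fun c => outputKet_apply κ ψ φ c

theorem norm_outputKet (φ : ℝ → ℝ) (c : Multiset ℝ × Multiset ℝ) :
    ‖outputKet κ ψ φ c‖ = ‖lossyKet κ ψ c‖ := by
  rw [outputKet_apply, norm_mul, mul_comm Complex.I, Complex.norm_exp_ofReal_mul_I, one_mul]

theorem memLp_outputKet (h : FiniteNumber t₀ t₁ ψ) {φ : ℝ → ℝ} (hφ : Measurable φ) :
    MemLp (outputKet κ ψ φ) 2 ((configMeasure t₀ t₁).prod (configMeasure t₀ t₁)) := by
  rw [outputKet_eq]
  exact memLp_phase (χ := fun c => flux φ c.1) (memLp_lossyKet h)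
    ((measurable_flux hφ).comp measurable_fst).aestronglyMeasurable

theorem outputKet_ae_eq {φ φ' : ℝ → ℝ}
    (h : φ =ᵐ[(volume : Measure ℝ).restrict (Icc t₀ t₁)] φ') :
    outputKet κ ψ φ =ᵐ[(configMeasure t₀ t₁).prod (configMeasure t₀ t₁)] outputKet κ ψ φ' := by
  filter_upwards [Measure.quasiMeasurePreserving_fst.ae (flux_ae_eq h)] with c hc
  rw [outputKet_apply, outputKet_apply, hc]

/-- The output state as a function of the square-integrable phase. -/
def outputState (t₀ t₁ κ : ℝ) (ψ : Multiset ℝ → ℂ)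
    (u : Lp ℝ 2 ((volume : Measure ℝ).restrict (Icc t₀ t₁))) : PairSpace t₀ t₁ :=
  lpSlice _ (outputKet κ ψ u)

theorem norm_outputState (h : FiniteNumber t₀ t₁ ψ) [IsProbabilityMeasure (pairMeasure t₀ t₁ κ ψ)]
    (u : Lp ℝ 2 ((volume : Measure ℝ).restrict (Icc t₀ t₁))) :
    ‖outputState t₀ t₁ κ ψ u‖ = 1 := by
  have h1 := norm_lpSlice_sq (memLp_outputKet (κ := κ) h (Lp.stronglyMeasurable u).measurable)
  simp only [norm_outputKet] at h1
  have h2 := integral_pairMeasure (κ := κ) h.memLp.1 (fun _ => (1 : ℝ))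
  simp only [smul_eq_mul, mul_one, integral_const, probReal_univ] at h2
  rw [← h2] at h1
  exact (sq_eq_sq₀ (norm_nonneg _) zero_le_one).1 (by rw [outputState, h1, one_pow])

/-- Convergence of phases in `L²` gives, along a subsequence, convergence at almost every time,
hence at all photon times of almost every configuration. The moduli do not depend on the phase, so
dominated convergence applies. -/
theorem continuous_outputState (h : FiniteNumber t₀ t₁ ψ) :
    Continuous (outputState t₀ t₁ κ ψ) := by
  rw [continuous_iff_seqContinuous]
  intro u u₀ hu
  refine tendsto_of_subseq_tendsto fun ns hns => ?_
  obtain ⟨ms, -, hms⟩ := (tendstoInMeasure_of_tendsto_Lp (hu.comp hns)).exists_seq_tendsto_ae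
  refine ⟨ms, ?_⟩
  have hl := memLp_lossyKet (κ := κ) h
  have hm : ∀ w : Lp ℝ 2 ((volume : Measure ℝ).restrict (Icc t₀ t₁)),
      MemLp (outputKet κ ψ w) 2 ((configMeasure t₀ t₁).prod (configMeasure t₀ t₁)) := fun w =>
    memLp_outputKet h (Lp.stronglyMeasurable w).measurable
  refine tendsto_lpSlice (fun i => hm _) (hm _) ?_
  refine tendsto_eLpNorm_two_of_dominated (fun i => (hm _).1) (hm _).1
    (G := fun c => 2 * ‖lossyKet κ ψ c‖) (hl.norm.const_mul 2) ?_ ?_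
  · refine Eventually.of_forall fun i => ae_of_all _ fun c => (norm_sub_le _ _).trans ?_
    rw [norm_outputKet, norm_outputKet, two_mul]
  · filter_upwards [Measure.quasiMeasurePreserving_fst.ae (ae_configMeasure_of_ae hms)] with c hc
    simp only [outputKet_apply]
    have h1 : Tendsto (fun i => flux (u (ns (ms i))) c.1) atTop (𝓝 (flux u₀ c.1)) :=
      tendsto_multiset_sum c.1 hc
    have h2 : Continuous fun r : ℝ => Complex.exp (Complex.I * (r : ℂ)) * lossyKet κ ψ c := by
      fun_prop
    exact (h2.tendsto _).comp h1

theorem lpSlice_outputKet_add (u : Lp ℝ 2 ((volume : Measure ℝ).restrict (Icc t₀ t₁)))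
    {f : ℝ → ℝ} (hf : MemLp f 2 ((volume : Measure ℝ).restrict (Icc t₀ t₁))) (s : ℝ) :
    outputState t₀ t₁ κ ψ (u + s • hf.toLp f) = lpSlice _ fun c =>
      Complex.exp (Complex.I * (s * flux f c.1 : ℝ)) * outputKet κ ψ u c := by
  refine lpSlice_congr ?_
  have h1 : ⇑(u + s • hf.toLp f) =ᵐ[(volume : Measure ℝ).restrict (Icc t₀ t₁)]
      fun t => u t + s * f t := by
    filter_upwards [Lp.coeFn_add u (s • hf.toLp f), Lp.coeFn_smul s (hf.toLp f), hf.coeFn_toLp]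
      with t h2 h3 h4
    rw [h2, Pi.add_apply, h3, Pi.smul_apply, h4, smul_eq_mul]
  refine (outputKet_ae_eq h1).trans (ae_of_all _ fun c => ?_)
  simp only [outputKet_apply]
  rw [flux_add_fun, flux_const_mul, ← mul_assoc, ← Complex.exp_add]
  congr 2
  push_cast
  ring

theorem inner_pairEffect_lpSlice_phase {Y : Type*} [MeasurableSpace Y]
    (E : POVM Y (FieldSpace t₀ t₁)) (s : Set Y) {Ψ : Ket2}
    (hΨ : MemLp Ψ 2 ((configMeasure t₀ t₁).prod (configMeasure t₀ t₁))) {χ : Multiset ℝ → ℝ}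
    (hχ : Measurable χ) :
    (⟪lpSlice _ Ψ, E.pairEffect s (lpSlice _ Ψ)⟫_ℂ).re =
      (⟪lpSlice _ fun c => Complex.exp (Complex.I * χ c.2) * Ψ c,
        E.pairEffect s (lpSlice _ fun c => Complex.exp (Complex.I * χ c.2) * Ψ c)⟫_ℂ).re := by
  have hΦ := memLp_phase (χ := fun c : Multiset ℝ × Multiset ℝ => χ c.2) hΨ
    (hχ.comp measurable_snd).aestronglyMeasurable
  rw [lpSlice_of_memLp hΨ, lpSlice_of_memLp hΦ]
  exact (inner_pairEffect_phase E s hΨ hΦ fun c => rfl).symm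

end Output

/-! ### The quantum Cramér-Rao bound on a window -/

section Window

variable {Ω : Type*} [MeasurableSpace Ω] {P : Measure Ω} [IsProbabilityMeasure P]
  {x : Ω → ℝ → ℝ} {g : ℝ → ℝ} {t₀ t₁ κ : ℝ} {ψ : Multiset ℝ → ℂ}
  {Y : Type*} [MeasurableSpace Y]

theorem outcomeMeasure_outputKet (h : FiniteNumber t₀ t₁ ψ) (E : POVM Y (FieldSpace t₀ t₁))
    {φ : ℝ → ℝ} (hφ : Measurable φ) (hφ2 : MemLp φ 2 ((volume : Measure ℝ).restrict (Icc t₀ t₁)))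
    {s : Set Y} (hs : MeasurableSet s) : outcomeMeasure t₀ t₁ E (outputKet κ ψ φ) s =
      ENNReal.ofReal (⟪outputState t₀ t₁ κ ψ (lpSlice _ φ),
        E.pairEffect s (outputState t₀ t₁ κ ψ (lpSlice _ φ))⟫_ℂ).re := by
  have h1 : outputState t₀ t₁ κ ψ (lpSlice _ φ) = lpSlice _ (outputKet κ ψ φ) :=
    lpSlice_congr (outputKet_ae_eq (lpSlice_coeFn hφ2))
  rw [h1, lpSlice_of_memLp (memLp_outputKet h hφ), outcomeMeasure_apply E _ hs]

theorem lintegral_simpleFunc_sq (ν : Measure Y) (f : SimpleFunc Y ℝ) (c : ℝ) :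
    ∫⁻ y, ENNReal.ofReal ((f y - c) ^ 2) ∂ν =
      ∑ r ∈ f.range, ENNReal.ofReal ((r - c) ^ 2) * ν (f ⁻¹' {r}) := by
  rw [← SimpleFunc.map_lintegral (fun r => ENNReal.ofReal ((r - c) ^ 2)) f,
    ← SimpleFunc.lintegral_eq_lintegral]
  rfl

theorem sum_ofReal_outcome (E : POVM Y (FieldSpace t₀ t₁)) (f : SimpleFunc Y ℝ) (c : ℝ)
    (v : PairSpace t₀ t₁) :
    ∑ r ∈ f.range, ENNReal.ofReal ((r - c) ^ 2) *
        ENNReal.ofReal (⟪v, E.pairEffect (f ⁻¹' {r}) v⟫_ℂ).re =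
      ENNReal.ofReal (∑ r ∈ f.range, (r - c) ^ 2 * (⟪v, E.pairEffect (f ⁻¹' {r}) v⟫_ℂ).re) := by
  have h0 : ∀ r, 0 ≤ (⟪v, E.pairEffect (f ⁻¹' {r}) v⟫_ℂ).re := fun r =>
    (isPositive_liftOp (E.positive _ (f.measurableSet_preimage {r}))).re_inner_nonneg_right _
  rw [ENNReal.ofReal_sum_of_nonneg fun r _ => mul_nonneg (sq_nonneg _) (h0 r)]
  exact Finset.sum_congr rfl fun r _ => (ENNReal.ofReal_mul (sq_nonneg _)).symm

/-- The error density of an estimator that takes finitely many values. -/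
theorem ae_lintegral_simpleFunc (h : FiniteNumber t₀ t₁ ψ) (E : POVM Y (FieldSpace t₀ t₁))
    (hx : Measurable fun p : Ω × ℝ => x p.1 p.2) {C : ℝ≥0∞} (hC' : C < ∞)
    (hC : ∀ s, ∫⁻ ω, ‖x ω s‖ₑ ^ 2 ∂P ≤ C) (hg : Integrable g) (t : ℝ) (f : SimpleFunc Y ℝ) :
    (fun ω => ∫⁻ y, ENNReal.ofReal ((f y - x ω t) ^ 2)
      ∂(outcomeMeasure t₀ t₁ E (outputKet κ ψ (phaseOf g (x ω))))) =ᵐ[P] fun ω =>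
      ENNReal.ofReal (∑ r ∈ f.range, (r - (wavePoint t₀ t₁ g t (x ω)).2) ^ 2 *
        (⟪outputState t₀ t₁ κ ψ (wavePoint t₀ t₁ g t (x ω)).1, E.pairEffect (f ⁻¹' {r})
          (outputState t₀ t₁ κ ψ (wavePoint t₀ t₁ g t (x ω)).1)⟫_ℂ).re) := by
  filter_upwards [ae_memLp_phaseOf t₀ t₁ hx hC' hC hg] with ω hω
  rw [lintegral_simpleFunc_sq, ← sum_ofReal_outcome]
  have hm : Measurable (phaseOf g (x ω)) := (measurable_phaseOf hx hg).comp measurable_prodMk_left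
  simp only [outcomeMeasure_outputKet h E hm hω (f.measurableSet_preimage {_})]
  rfl

local instance (μ : Measure ℝ) : MeasurableSpace (Lp ℝ 2 μ) := borel _

local instance (μ : Measure ℝ) : BorelSpace (Lp ℝ 2 μ) := ⟨rfl⟩

/-- The quantum Cramér-Rao bound for estimators that take finitely many values. -/
theorem sq_le_mul_meanSquareError_simpleFunc (h : FiniteNumber t₀ t₁ ψ)
    (hn : IsProbabilityMeasure (pairMeasure t₀ t₁ κ ψ)) (E : POVM Y (FieldSpace t₀ t₁))
    (hx : Measurable fun p : Ω × ℝ => x p.1 p.2) {C : ℝ≥0∞} (hC' : C < ∞)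
    (hC : ∀ s, ∫⁻ ω, ‖x ω s‖ₑ ^ 2 ∂P ≤ C) (hg : Integrable g) (t : ℝ) {k lam : ℝ → ℝ}
    (hk : BddMeas (conv g k)) (hl : Integrable lam) {β : Ω → ℝ} (hβ : MemLp β 2 P)
    (hF : ∀ (n : ℕ) (t : Fin n → ℝ) (F : (Fin n → ℝ) → ℝ), ContDiff ℝ (⊤ : ℕ∞) F →
      HasCompactSupport F → ∫ ω, fderiv ℝ F (fun i => x ω (t i)) (fun i => k (t i)) ∂P =
        -∫ ω, β ω * F (fun i => x ω (t i)) ∂P) (f : SimpleFunc Y ℝ) :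
    ENNReal.ofReal (k t ^ 2) ≤ ENNReal.ofReal (4 * pairCov t₀ t₁ κ ψ
        (pairFlux (conv g k) fun t => -auxPhase t₀ t₁ lam (conv g k) t)
        (pairFlux (conv g k) fun t => -auxPhase t₀ t₁ lam (conv g k) t) + ∫ ω, β ω ^ 2 ∂P) *
      meanSquareError t₀ t₁ κ ψ P x g E f t := by
  have : Fact ((2 : ℝ≥0∞) ≠ ∞) := ⟨by norm_num⟩
  set φ := conv g k with hφ
  set θ : ℝ → ℝ := fun t => -auxPhase t₀ t₁ lam φ t with hθ
  have hθb : BddMeas θ := (bddMeas_auxPhase t₀ t₁ hl hk).neg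
  set μ := (configMeasure t₀ t₁).prod (configMeasure t₀ t₁) with hμ
  -- Subtracting the mean from the generator changes the states by a global phase only. It reduces
  -- the squared norm of the tangent vector from the second moment to the variance.
  set m := ∫ p, pairFlux φ θ p ∂(pairMeasure t₀ t₁ κ ψ) with hm
  set X : Multiset ℝ × Multiset ℝ → ℝ := fun c => pairFlux φ θ c - m with hX
  have hXm : Measurable X := (measurable_pairFlux hk.1 hθb.1).sub_const m
  have hX2 : MemLp X 2 (pairMeasure t₀ t₁ κ ψ) :=
    (memLp_pairFlux h hk hθb).sub (memLp_const m)
  have hφ2 : MemLp φ 2 ((volume : Measure ℝ).restrict (Icc t₀ t₁)) := by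
    obtain ⟨B, hB⟩ := hk.2
    exact MemLp.of_bound hk.1.aestronglyMeasurable B (ae_of_all _ hB)
  have hZ := aestronglyMeasurable_wavePoint (P := P) t₀ t₁ hx hC' hC hg t
  have hZ2 : MemLp (fun ω => (wavePoint t₀ t₁ g t (x ω)).2) 2 P :=
    memLp_two_of_lintegral_le (hx.comp measurable_prodMk_right).aestronglyMeasurable hC' (hC t)
  have hum : ∀ u : Lp ℝ 2 ((volume : Measure ℝ).restrict (Icc t₀ t₁)),
      MemLp (outputKet κ ψ u) 2 μ := fun u =>
    memLp_outputKet h (Lp.stronglyMeasurable u).measurable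
  have hXl := memLp_mul_lossyKet h hXm.aestronglyMeasurable hX2
  have hXu : ∀ u : Lp ℝ 2 ((volume : Measure ℝ).restrict (Icc t₀ t₁)),
      MemLp (fun c => Complex.I * X c * outputKet κ ψ u c) 2 μ := fun u => by
    refine hXl.of_le ?_ (ae_of_all _ fun c => ?_)
    · refine AEStronglyMeasurable.mul ?_ (hum u).1
      exact ((Complex.measurable_ofReal.comp hXm).const_mul Complex.I).aestronglyMeasurable
    · rw [norm_mul, norm_mul, norm_mul, norm_outputKet, Complex.norm_I, one_mul]
  have hq : ∀ u : Lp ℝ 2 ((volume : Measure ℝ).restrict (Icc t₀ t₁)),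
      ‖lpSlice μ fun c => Complex.I * X c * outputKet κ ψ u c‖ ^ 2 =
        pairCov t₀ t₁ κ ψ (pairFlux φ θ) (pairFlux φ θ) := by
    intro u
    rw [norm_lpSlice_sq (hXu u)]
    have e1 : ∀ c, ‖Complex.I * X c * outputKet κ ψ u c‖ ^ 2 = ‖lossyKet κ ψ c‖ ^ 2 • X c ^ 2 := by
      intro c
      rw [norm_mul, norm_mul, norm_outputKet, Complex.norm_I, one_mul, mul_pow, Complex.norm_real,
        Real.norm_eq_abs, sq_abs, smul_eq_mul, mul_comm]
    simp only [e1]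
    rw [← integral_pairMeasure h.memLp.1]
    have i1 : Integrable (fun p => pairFlux φ θ p ^ 2) (pairMeasure t₀ t₁ κ ψ) :=
      (memLp_pairFlux h hk hθb).integrable_sq
    have i2 := (integrable_pairFlux (κ := κ) h hk hθb).1
    have e2 : ∀ p, X p ^ 2 = pairFlux φ θ p ^ 2 - 2 * m * pairFlux φ θ p + m ^ 2 := fun p => by
      simp only [hX]; ring
    have i3 : Integrable (fun p => pairFlux φ θ p ^ 2 - 2 * m * pairFlux φ θ p)
      (pairMeasure t₀ t₁ κ ψ) := i1.sub (i2.const_mul (2 * m))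
    simp only [e2]
    rw [integral_add i3 (integrable_const _), integral_sub i1 (i2.const_mul (2 * m)),
      integral_const_mul, pairCov, ← hm]
    simp only [integral_const, probReal_univ, one_smul, pow_two]
    ring
  -- The integrand is purely imaginary at each configuration, because `X` is real.
  have hDV : ∀ u : Lp ℝ 2 ((volume : Measure ℝ).restrict (Icc t₀ t₁)),
      (⟪lpSlice μ fun c => Complex.I * X c * outputKet κ ψ u c,
        outputState t₀ t₁ κ ψ u⟫_ℂ).re = 0 := by
    intro u
    rw [outputState, L2.inner_def]
    have i1 := L2.integrable_inner (𝕜 := ℂ) (lpSlice μ fun c => Complex.I * X c * outputKet κ ψ u c)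
      (lpSlice μ (outputKet κ ψ u))
    refine (integral_re i1).symm.trans ?_
    refine integral_eq_zero_of_ae ?_
    filter_upwards [lpSlice_coeFn (hXu u), lpSlice_coeFn (hum u)] with c h1 h2
    rw [h1, h2, RCLike.inner_apply]
    simp only [map_mul, Complex.conj_I, Complex.conj_ofReal, RCLike.re_eq_complex_re, Pi.zero_apply]
    simp only [Complex.mul_re, Complex.mul_im, Complex.neg_re, Complex.neg_im, Complex.I_re,
      Complex.I_im, Complex.conj_re, Complex.conj_im, Complex.ofReal_re, Complex.ofReal_im]
    ring
  obtain ⟨i1, h1⟩ := sq_le_mul_integral_of_effects (P := P)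
    (Z := fun ω => wavePoint t₀ t₁ g t (x ω)) hZ.aemeasurable hZ2 (hφ2.toLp φ, k t) hβ
    (fun L => scoreIdentity_wavePoint t₀ t₁ hx hC' hC hg t hφ2 (hβ.integrable (by norm_num)) hF L)
    f.range (T := fun r => E.pairEffect (f ⁻¹' {r}))
    (fun r v w => (isPositive_liftOp (E.positive _ (f.measurableSet_preimage {r}))).1 v w)
    (fun r v => (isPositive_liftOp
      (E.positive _ (f.measurableSet_preimage {r}))).re_inner_nonneg_right v)
    (fun v => sum_inner_pairEffect E f v) (V := outputState t₀ t₁ κ ψ) (continuous_outputState h)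
    (norm_outputState h)
    -- This curve differs from the shifted output state by the phase `s (flux θ τ - m)`, which
    -- depends on the photons of `B` alone and hence leaves all outcome probabilities unchanged.
    (W := fun s u => lpSlice μ fun c => Complex.exp (Complex.I * (s * X c : ℝ)) * outputKet κ ψ u c)
    (fun u => by simp only [zero_mul, Complex.ofReal_zero, mul_zero, Complex.exp_zero, one_mul]; rfl)
    (fun r u s => by
      have hA := memLp_phase (χ := fun c => s * flux φ c.1) (hum u)
        (((measurable_flux hk.1).comp measurable_fst).const_mul s).aestronglyMeasurable
      rw [lpSlice_outputKet_add, inner_pairEffect_lpSlice_phase E _ hA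
        (χ := fun σ => s * (flux θ σ - m)) (((measurable_flux hθb.1).sub_const m).const_mul s)]
      have e : ∀ c : Multiset ℝ × Multiset ℝ,
          Complex.exp (Complex.I * (s * (flux θ c.2 - m) : ℝ)) *
            (Complex.exp (Complex.I * (s * flux φ c.1 : ℝ)) * outputKet κ ψ u c) =
          Complex.exp (Complex.I * (s * X c : ℝ)) * outputKet κ ψ u c := by
        intro c
        rw [← mul_assoc, ← Complex.exp_add]
        congr 2
        simp only [hX, pairFlux]
        push_cast
        ring
      simp only [e]
      rfl)
    (D := fun u => lpSlice μ fun c => Complex.I * X c * outputKet κ ψ u c)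
    (fun u => hasDerivAt_lpSlice_phase (hum u) hXm.aestronglyMeasurable (hXu u))
    (fun u s => norm_lpSlice_phase_sub_le (hum u) hXm.aestronglyMeasurable (hXu u) s)
    (fun u s => by
      rw [← norm_outputState (κ := κ) h u, outputState]
      refine norm_lpSlice_congr (memLp_phase (hum u) (hXm.const_mul s).aestronglyMeasurable)
        (hum u) fun c => ?_
      rw [norm_mul, mul_comm Complex.I, Complex.norm_exp_ofReal_mul_I, one_mul])
    hq hDV
  have h0 : ∀ ω, 0 ≤ ∑ r ∈ f.range, (r - (wavePoint t₀ t₁ g t (x ω)).2) ^ 2 *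
        (⟪outputState t₀ t₁ κ ψ (wavePoint t₀ t₁ g t (x ω)).1, E.pairEffect (f ⁻¹' {r})
          (outputState t₀ t₁ κ ψ (wavePoint t₀ t₁ g t (x ω)).1)⟫_ℂ).re := fun ω =>
    Finset.sum_nonneg fun r _ => mul_nonneg (sq_nonneg _) ((isPositive_liftOp
      (E.positive _ (f.measurableSet_preimage {r}))).re_inner_nonneg_right _)
  rw [meanSquareError, lintegral_congr_ae (ae_lintegral_simpleFunc h E hx hC' hC hg t f),
    ← ofReal_integral_eq_lintegral_ofReal i1 (ae_of_all _ h0), ← ENNReal.ofReal_mul']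
  · exact ENNReal.ofReal_le_ofReal h1
  · exact integral_nonneg h0

/-- The outcome distribution as a kernel. -/
theorem exists_kernel_outcomeMeasure (h : FiniteNumber t₀ t₁ ψ) (E : POVM Y (FieldSpace t₀ t₁))
    (hn : IsProbabilityMeasure (pairMeasure t₀ t₁ κ ψ))
    (hx : Measurable fun p : Ω × ℝ => x p.1 p.2) {C : ℝ≥0∞} (hC' : C < ∞)
    (hC : ∀ s, ∫⁻ ω, ‖x ω s‖ₑ ^ 2 ∂P ≤ C) (hg : Integrable g) :
    ∃ K : ProbabilityTheory.Kernel Ω Y, ProbabilityTheory.IsMarkovKernel K ∧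
      ∀ᵐ ω ∂P, outcomeMeasure t₀ t₁ E (outputKet κ ψ (phaseOf g (x ω))) = K ω := by
  have hZ := (aestronglyMeasurable_wavePoint (P := P) t₀ t₁ hx hC' hC hg 0).fst
  have hv := (continuous_outputState (κ := κ) h).comp_stronglyMeasurable hZ.stronglyMeasurable_mk
  have hap : ∀ ω, ∀ s, MeasurableSet s →
      outcomeMeasure t₀ t₁ E (outputState t₀ t₁ κ ψ (hZ.mk _ ω)) s =
      ENNReal.ofReal (⟪outputState t₀ t₁ κ ψ (hZ.mk _ ω),
        E.pairEffect s (outputState t₀ t₁ κ ψ (hZ.mk _ ω))⟫_ℂ).re := by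
    intro ω s hs
    have h1 := outcomeMeasure_apply E (Lp.memLp (outputState t₀ t₁ κ ψ (hZ.mk _ ω))) hs
    rwa [Lp.toLp_coeFn] at h1
  refine ⟨⟨fun ω => outcomeMeasure t₀ t₁ E (outputState t₀ t₁ κ ψ (hZ.mk _ ω)), ?_⟩, ⟨fun ω => ?_⟩,
    ?_⟩
  · refine Measure.measurable_of_measurable_coe _ fun s hs => ?_
    simp only [hap _ s hs]
    have hc : Continuous fun v : PairSpace t₀ t₁ => (⟪v, E.pairEffect s v⟫_ℂ).re := by fun_prop
    exact (hc.comp_stronglyMeasurable hv).measurable.ennreal_ofReal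
  · refine ⟨?_⟩
    change outcomeMeasure t₀ t₁ E (outputState t₀ t₁ κ ψ (hZ.mk _ ω)) univ = 1
    rw [outcomeMeasure_univ E (Lp.memLp _), Lp.toLp_coeFn, norm_outputState h]
    simp
  · filter_upwards [ae_memLp_phaseOf t₀ t₁ hx hC' hC hg, hZ.ae_eq_mk] with ω hω hω'
    refine Measure.ext fun s hs => ?_
    have hm : Measurable (phaseOf g (x ω)) :=
      (measurable_phaseOf hx hg).comp measurable_prodMk_left
    rw [outcomeMeasure_outputKet h E hm hω hs]
    refine Eq.trans ?_ (hap ω s hs).symm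
    rw [← hω']
    rfl

/-- Estimators are approximated by estimators that take finitely many values. -/
theorem exists_tendsto_meanSquareError (h : FiniteNumber t₀ t₁ ψ) (E : POVM Y (FieldSpace t₀ t₁))
    (hn : IsProbabilityMeasure (pairMeasure t₀ t₁ κ ψ))
    (hx : Measurable fun p : Ω × ℝ => x p.1 p.2) {C : ℝ≥0∞} (hC' : C < ∞)
    (hC : ∀ s, ∫⁻ ω, ‖x ω s‖ₑ ^ 2 ∂P ≤ C) (hg : Integrable g) (t : ℝ) {est : Y → ℝ}
    (hest : Measurable est) (hfin : meanSquareError t₀ t₁ κ ψ P x g E est t ≠ ∞) :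
    ∃ f : ℕ → SimpleFunc Y ℝ, Tendsto (fun n => meanSquareError t₀ t₁ κ ψ P x g E (f n) t) atTop
      (𝓝 (meanSquareError t₀ t₁ κ ψ P x g E est t)) := by
  set f : ℕ → SimpleFunc Y ℝ := SimpleFunc.approxOn est hest univ 0 (mem_univ _) with hf
  have hft : ∀ y, Tendsto (fun n => f n y) atTop (𝓝 (est y)) := fun y =>
    SimpleFunc.tendsto_approxOn hest _ (by simp)
  have hfb : ∀ n y, |f n y| ≤ 2 * |est y| := by
    intro n y
    have h1 := SimpleFunc.edist_approxOn_y0_le hest (mem_univ (0 : ℝ)) y n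
    rw [edist_dist, edist_dist, ← ENNReal.ofReal_add dist_nonneg dist_nonneg,
      ENNReal.ofReal_le_ofReal_iff (by positivity), Real.dist_eq, Real.dist_eq, zero_sub, zero_sub,
      abs_neg, abs_neg] at h1
    linarith
  refine ⟨f, ?_⟩
  obtain ⟨K, hK, hKe⟩ := exists_kernel_outcomeMeasure h E hn hx hC' hC hg
  have hxt : Measurable fun ω => x ω t := hx.comp measurable_prodMk_right
  have hm : ∀ {e : Y → ℝ}, Measurable e →
      Measurable fun p : Ω × Y => ENNReal.ofReal ((e p.2 - x p.1 t) ^ 2) := fun he =>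
    (((he.comp measurable_snd).sub (hxt.comp measurable_fst)).pow_const 2).ennreal_ofReal
  have hM : ∀ {e : Y → ℝ}, Measurable e → meanSquareError t₀ t₁ κ ψ P x g E e t =
      ∫⁻ p, ENNReal.ofReal ((e p.2 - x p.1 t) ^ 2) ∂(P.compProd K) := by
    intro e he
    rw [Measure.lintegral_compProd (hm he), meanSquareError]
    refine lintegral_congr_ae ?_
    filter_upwards [hKe] with ω hω
    rw [hω]
  simp only [hM hest, hM (f _).measurable] at hfin ⊢
  -- From `|f n| ≤ 2 |est|` one has `(f n - x)² ≤ 8 est² + 2 x²`, and `est² ≤ 2 (est - x)² + 2 x²`.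
  -- Together these give the constants 16 and 18.
  have hpt : ∀ n (p : Ω × Y), ENNReal.ofReal ((f n p.2 - x p.1 t) ^ 2) ≤
      16 * ENNReal.ofReal ((est p.2 - x p.1 t) ^ 2) + 18 * ENNReal.ofReal (x p.1 t ^ 2) := by
    intro n p
    have e1 : (16 : ℝ≥0∞) = ENNReal.ofReal 16 := by norm_num
    have e2 : (18 : ℝ≥0∞) = ENNReal.ofReal 18 := by norm_num
    rw [e1, e2, ← ENNReal.ofReal_mul (by norm_num), ← ENNReal.ofReal_mul (by norm_num),
      ← ENNReal.ofReal_add (by positivity) (by positivity)]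
    refine ENNReal.ofReal_le_ofReal ?_
    have h1 : f n p.2 ^ 2 ≤ 4 * est p.2 ^ 2 := by
      rw [← sq_abs (f n p.2), ← sq_abs (est p.2)]
      nlinarith [hfb n p.2, abs_nonneg (f n p.2), abs_nonneg (est p.2)]
    nlinarith [sq_nonneg (f n p.2 + x p.1 t), sq_nonneg (est p.2 - 2 * x p.1 t)]
  refine tendsto_lintegral_of_dominated_convergence _ (fun n => hm (f n).measurable)
    (fun n => ae_of_all _ fun p => hpt n p) ?_ (ae_of_all _ fun p =>
      ENNReal.tendsto_ofReal (((hft p.2).sub_const _).pow 2))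
  have hm2 : Measurable fun p : Ω × Y => ENNReal.ofReal (x p.1 t ^ 2) :=
    ((hxt.comp measurable_fst).pow_const 2).ennreal_ofReal
  rw [lintegral_add_right _ (hm2.const_mul 18), lintegral_const_mul _ (hm hest),
    lintegral_const_mul _ hm2, Measure.lintegral_compProd hm2]
  simp only [lintegral_const, measure_univ, mul_one]
  refine (ENNReal.add_lt_top.2 ⟨ENNReal.mul_lt_top (by norm_num) hfin.lt_top,
    ENNReal.mul_lt_top (by norm_num) ?_⟩).ne
  refine lt_of_le_of_lt (le_trans (le_of_eq ?_) (hC t)) hC'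
  refine lintegral_congr fun ω => ?_
  rw [← sq_abs, ENNReal.ofReal_pow (abs_nonneg _), Real.enorm_eq_ofReal_abs]

/-- The quantum Cramér-Rao bound on a window, with the direction `k` and the purification `lam`. -/
theorem sq_le_mul_meanSquareError (h : FiniteNumber t₀ t₁ ψ)
    (hn : IsProbabilityMeasure (pairMeasure t₀ t₁ κ ψ)) (E : POVM Y (FieldSpace t₀ t₁))
    (hx : Measurable fun p : Ω × ℝ => x p.1 p.2) {C : ℝ≥0∞} (hC' : C < ∞)
    (hC : ∀ s, ∫⁻ ω, ‖x ω s‖ₑ ^ 2 ∂P ≤ C) (hg : Integrable g) (t : ℝ) {k lam : ℝ → ℝ}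
    (hk : BddMeas (conv g k)) (hl : Integrable lam) {β : Ω → ℝ} (hβ : MemLp β 2 P)
    (hF : ∀ (n : ℕ) (t : Fin n → ℝ) (F : (Fin n → ℝ) → ℝ), ContDiff ℝ (⊤ : ℕ∞) F →
      HasCompactSupport F → ∫ ω, fderiv ℝ F (fun i => x ω (t i)) (fun i => k (t i)) ∂P =
        -∫ ω, β ω * F (fun i => x ω (t i)) ∂P) {est : Y → ℝ} (hest : Measurable est)
    (hfin : meanSquareError t₀ t₁ κ ψ P x g E est t ≠ ∞) :
    ENNReal.ofReal (k t ^ 2) ≤ ENNReal.ofReal (4 * pairCov t₀ t₁ κ ψ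
        (pairFlux (conv g k) fun t => -auxPhase t₀ t₁ lam (conv g k) t)
        (pairFlux (conv g k) fun t => -auxPhase t₀ t₁ lam (conv g k) t) + ∫ ω, β ω ^ 2 ∂P) *
      meanSquareError t₀ t₁ κ ψ P x g E est t := by
  obtain ⟨f, hf⟩ := exists_tendsto_meanSquareError h E hn hx hC' hC hg t hest hfin
  exact ge_of_tendsto' (ENNReal.Tendsto.const_mul hf (Or.inr ENNReal.ofReal_ne_top)) fun n =>
    sq_le_mul_meanSquareError_simpleFunc h hn E hx hC' hC hg t hk hl hβ hF (f n)

end Window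

/-! ### Approximation of spectra -/

section ShiftSum

/-- A linear combination of translates. -/
def shiftSum (f : ℝ → ℝ) {n : ℕ} (c s : Fin n → ℝ) : ℝ → ℝ := ∑ j, fun t => c j * f (t - s j)

variable {f : ℝ → ℝ} {n : ℕ} (c s : Fin n → ℝ)

theorem IsBump.shiftSum (hf : IsBump f) : IsBump (shiftSum f c s) :=
  Finset.sum_induction _ IsBump (fun _ _ => IsBump.add) isBump_zero fun j _ =>
    (hf.comp_sub (s j)).const_mul (c j)

theorem hasCompactSupport_shiftSum (hf : HasCompactSupport f) :
    HasCompactSupport (shiftSum f c s) := by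
  refine Finset.sum_induction _ HasCompactSupport (fun _ _ => HasCompactSupport.add)
    HasCompactSupport.zero fun j _ => ?_
  have h1 : HasCompactSupport fun t => f (t - s j) := hf.comp_homeomorph (Homeomorph.subRight (s j))
  exact h1.mul_left (f := fun _ => c j)

theorem integrable_shiftSum (hf : Integrable f) : Integrable (shiftSum f c s) := by
  refine Finset.sum_induction _ (fun g : ℝ → ℝ => Integrable g) (fun _ _ h1 h2 => h1.add h2)
    (integrable_zero _ _ _) fun j _ => ?_
  exact (hf.comp_sub_right (s j)).const_mul (c j)

theorem spec_shiftSum (hf : Integrable f) (ω : ℝ) :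
    spec (shiftSum f c s) ω = spec f ω * trigSum c s ω := by
  have h1 : ∀ j, spec (fun t => c j * f (t - s j)) ω =
      spec f ω * (c j * Complex.exp (Complex.I * ω * s j)) := fun j => by
    rw [spec_const_mul, spec_comp_sub]; ring
  have h2 : ∀ T : Finset (Fin n), Integrable (∑ j ∈ T, fun t => c j * f (t - s j)) ∧
      spec (∑ j ∈ T, fun t => c j * f (t - s j)) ω =
        ∑ j ∈ T, spec f ω * (c j * Complex.exp (Complex.I * ω * s j)) := by
    intro T
    induction T using Finset.induction_on with
    | empty => exact ⟨integrable_zero _ _ _, by simp [spec]⟩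
    | insert j T hj ih =>
      have hi : Integrable fun t => c j * f (t - s j) := (hf.comp_sub_right (s j)).const_mul (c j)
      rw [Finset.sum_insert hj, Finset.sum_insert hj, ← h1 j, ← ih.2]
      exact ⟨hi.add ih.1, spec_add hi ih.1 ω⟩
  rw [trigSum, Finset.mul_sum]
  exact (h2 Finset.univ).2

end ShiftSum

theorem map_neg_psdMeasure {ρ : ℝ → ℝ} (hρ : Measurable ρ) (he : ∀ᵐ ω, ρ (-ω) = ρ ω) :
    (psdMeasure ρ).map (fun ω => -ω) = psdMeasure ρ := by
  refine Measure.ext fun s hs => ?_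
  rw [Measure.map_apply measurable_neg hs, psdMeasure,
    withDensity_apply _ (measurable_neg hs), withDensity_apply _ hs,
    ← lintegral_indicator (measurable_neg hs), ← lintegral_indicator hs,
    ← (Measure.measurePreserving_neg (volume : Measure ℝ)).lintegral_comp
      (hρ.ennreal_ofReal.indicator hs)]
  refine lintegral_congr_ae ?_
  filter_upwards [he] with ω hω
  by_cases h : -ω ∈ s
  · rw [indicator_of_mem h, indicator_of_mem (by exact h), hω]
  · rw [indicator_of_notMem h, indicator_of_notMem (by exact h)]

/-- Real trigonometric sums approximate Hermitian functions in weighted mean square. -/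
theorem exists_trigSum_weighted {ρ : ℝ → ℝ} (hρ : Measurable ρ) (h0 : ∀ ω, 0 ≤ ρ ω)
    (hi : Integrable ρ) (he : ∀ᵐ ω, ρ (-ω) = ρ ω) {v : ℝ → ℂ} (hv : Measurable v)
    (hv2 : Integrable fun ω => ρ ω * ‖v ω‖ ^ 2) (hsymm : ∀ᵐ ω, v (-ω) = conj (v ω)) {ε : ℝ}
    (hε : 0 < ε) : ∃ (n : ℕ) (c s : Fin n → ℝ),
      Integrable (fun ω => ρ ω * ‖v ω - trigSum c s ω‖ ^ 2) ∧
      ∫ ω, ρ ω * ‖v ω - trigSum c s ω‖ ^ 2 ≤ ε := by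
  have hfin : IsFiniteMeasure (psdMeasure ρ) := isFiniteMeasure_withDensity_ofReal hi.2
  have hV : MemLp v 2 (psdMeasure ρ) := by
    rw [memLp_two_iff_integrable_sq_norm hv.aestronglyMeasurable,
      integrable_psdMeasure_iff hρ h0]
    simpa only [smul_eq_mul] using hv2
  obtain ⟨n, c, s, h⟩ := exists_trigSum_near (map_neg_psdMeasure hρ he) hV
    ((withDensity_absolutelyContinuous _ _).ae_le hsymm) (Real.sqrt_pos.2 hε)
  have hd : MemLp (fun ω => v ω - trigSum c s ω) 2 (psdMeasure ρ) := hV.sub (memLp_trigSum c s)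
  have hd1 := (memLp_two_iff_integrable_sq_norm hd.1).1 hd
  refine ⟨n, c, s, ?_, ?_⟩
  · simpa only [smul_eq_mul] using (integrable_psdMeasure_iff hρ h0 _).1 hd1
  · have h1 := integral_psdMeasure hρ h0 (fun ω => ‖v ω - trigSum c s ω‖ ^ 2)
    simp only [smul_eq_mul] at h1
    rw [← h1, ← norm_lpSlice_sq hd, ← Real.sq_sqrt hε.le]
    refine pow_le_pow_left₀ (norm_nonneg _) ?_ 2
    rw [lpSlice_of_memLp hd, Lp.norm_toLp]
    exact ENNReal.toReal_le_of_le_ofReal (Real.sqrt_nonneg _) h.le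

/-! ### Compactly supported kernels close to the optimal one. -/

section Kernel

variable {η Imean : ℝ} {S : ℝ → ℝ}

theorem measurable_optimalGain (hS : Measurable S) : Measurable (optimalGain η Imean S) :=
  hS.div ((hS.const_mul _).add_const _)

/-- The truncated exponential function. -/
def expWindow : ℝ → ℝ := (Icc (0 : ℝ) 1).indicator fun t => Real.exp (-t)

theorem integrable_expWindow : Integrable expWindow := by
  rw [expWindow, integrable_indicator_iff measurableSet_Icc]
  exact (by fun_prop : Continuous fun t : ℝ => Real.exp (-t)).continuousOn.integrableOn_Icc

theorem hasCompactSupport_expWindow : HasCompactSupport expWindow :=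
  HasCompactSupport.intro isCompact_Icc fun _ ht => indicator_of_notMem ht _

/-- The transform is `(exp(iω - 1) - 1) / (iω - 1)`, and `exp(iω - 1)` has modulus `1/e ≠ 1`. A
compactly supported kernel without spectral zeros is needed in order to divide the optimal `λ` by
its transform at all frequencies. -/
theorem spec_expWindow_ne_zero (ω : ℝ) : spec expWindow ω ≠ 0 := by
  have hz : (Complex.I * ω - 1 : ℂ) ≠ 0 := fun h => by simpa using congrArg Complex.re h
  have h1 : spec expWindow ω = ∫ t in (0 : ℝ)..1, Complex.exp ((Complex.I * ω - 1) * t) := by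
    rw [intervalIntegral.integral_of_le zero_le_one, ← integral_Icc_eq_integral_Ioc,
      ← integral_indicator measurableSet_Icc, spec]
    refine integral_congr_ae (ae_of_all _ fun t => ?_)
    by_cases ht : t ∈ Icc (0 : ℝ) 1
    · simp only [expWindow, indicator_of_mem ht]
      rw [Complex.ofReal_exp, ← Complex.exp_add]
      congr 1
      push_cast
      ring
    · simp only [expWindow, indicator_of_notMem ht, Complex.ofReal_zero, zero_mul]
  rw [h1, integral_exp_mul_complex hz]
  refine div_ne_zero (fun h => ?_) hz
  have h2 : ‖Complex.exp ((Complex.I * ω - 1) * (1 : ℝ))‖ = ‖(1 : ℂ)‖ := by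
    rw [sub_eq_zero.1 h]
    simp
  rw [Complex.norm_exp, norm_one] at h2
  simp at h2

/-- Compactly supported kernels approach the minimum of the spectral quantum Fisher information in
the mean. -/
theorem exists_kernel_near (hη0 : 0 < η) (hη1 : η ≤ 1) (hI : 0 < Imean) (hSm : Measurable S)
    (hS : ∀ ω, 0 ≤ S ω) (hSe : ∀ᵐ ω, S (-ω) = S ω) {f : ℝ → ℝ} (hf : Integrable f)
    (hfi : Integrable fun ω => spectralQFI η Imean S (fun _ => 0) ω * ‖spec f ω‖ ^ 2) {ε : ℝ}
    (hε : 0 < ε) : ∃ lam, Integrable lam ∧ HasCompactSupport lam ∧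
      Integrable (fun ω => minSpectralQFI η Imean S ω * ‖spec f ω‖ ^ 2) ∧
      ∫ ω, spectralQFI η Imean S lam ω * ‖spec f ω‖ ^ 2 ≤
        (∫ ω, minSpectralQFI η Imean S ω * ‖spec f ω‖ ^ 2) + ε := by
  set D : ℝ → ℝ := fun ω => (1 - η) * ((1 - η) * S ω + η * Imean) with hD
  have hD0 : ∀ ω, 0 ≤ D ω := fun ω =>
    mul_nonneg (by linarith) (gain_denom_pos hη0 hη1 hI (hS ω)).le
  have hDm : Measurable D := ((hSm.const_mul _).add_const _).const_mul _
  have hG := measurable_optimalGain (η := η) (Imean := Imean) hSm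
  have hfc := continuous_spec hf
  have huc := continuous_spec integrable_expWindow
  have hz : ∀ ω, spec (fun _ => (0 : ℝ)) ω = 0 := fun ω => by simp [spec]
  have hQ0 : ∀ ω, 0 ≤ minSpectralQFI η Imean S ω := fun ω =>
    minSpectralQFI_nonneg hη0 hη1 hI (hS ω)
  have hmm : Measurable (minSpectralQFI η Imean S) := by
    have : minSpectralQFI η Imean S = fun ω =>
        4 * (S ω * (η * Imean) / ((1 - η) * S ω + η * Imean)) :=
      funext fun ω => minSpectralQFI_eq hη0 hη1 hI (hS ω)
    rw [this]
    exact ((hSm.mul_const _).div ((hSm.const_mul _).add_const _)).const_mul 4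
  have hmi : Integrable (fun ω => minSpectralQFI η Imean S ω * ‖spec f ω‖ ^ 2) := by
    refine Integrable.mono' hfi (hmm.mul (hfc.measurable.norm.pow_const 2)).aestronglyMeasurable
      (ae_of_all _ fun ω => ?_)
    rw [Real.norm_of_nonneg (mul_nonneg (hQ0 ω) (sq_nonneg _)),
      spectralQFI_eq hη0 hη1 hI (hS ω)]
    refine mul_le_mul_of_nonneg_right (le_add_of_nonneg_right ?_) (sq_nonneg _)
    have := hD0 ω
    simp only [hD] at this
    positivity
  set u : ℝ → ℂ := spec expWindow with hu
  have hu0 : ∀ ω, u ω ≠ 0 := spec_expWindow_ne_zero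
  obtain ⟨A, hA⟩ : ∃ A, ∀ ω, ‖u ω‖ ≤ A := ⟨_, norm_spec_le expWindow⟩
  -- For a kernel with transform `u p`, the excess over the minimum is `4 ρ |v - p|²` with this
  -- weight and `v = (optimal λ) / u`. The task becomes approximation of `v` by trigonometric sums
  -- `p` in `L²(ρ)`.
  set ρ : ℝ → ℝ := fun ω => D ω * ‖spec f ω‖ ^ 2 * ‖u ω‖ ^ 2 with hρ
  set v : ℝ → ℂ := fun ω => ((optimalGain η Imean S ω - 1 : ℝ) : ℂ) / u ω with hv
  have hρm : Measurable ρ :=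
    (hDm.mul (hfc.measurable.norm.pow_const 2)).mul (huc.measurable.norm.pow_const 2)
  have hρi : Integrable ρ := by
    refine Integrable.mono' ((hfi.const_mul (1 / (4 * η ^ 2))).mul_const (A ^ 2))
      hρm.aestronglyMeasurable (ae_of_all _ fun ω => ?_)
    -- The kernel `0` gives `4 (η² S + η (1-η) ⟨I⟩)`, which dominates `4 η² D` as `0 < η ≤ 1`.
    -- Integrability of the weight follows from that of the kernel-free information.
    have h1 : D ω ≤ 1 / (4 * η ^ 2) * spectralQFI η Imean S (fun _ => 0) ω := by
      rw [spectralQFI, hz, one_div_mul_eq_div, le_div_iff₀ (by positivity)]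
      have e : ‖(η : ℂ) - (1 - η : ℂ) * 0‖ ^ 2 = η ^ 2 := by
        rw [mul_zero, sub_zero, Complex.norm_real, Real.norm_eq_abs, sq_abs]
      rw [e, add_zero, norm_one, hD]
      have h2 : (1 - η) ^ 2 * S ω ≤ S ω :=
        mul_le_of_le_one_left (hS ω) (by nlinarith)
      have h3 : η ^ 2 * (η * (1 - η) * Imean) ≤ η * (1 - η) * Imean :=
        mul_le_of_le_one_left (by have : 0 ≤ 1 - η := by linarith
                                  positivity) (by nlinarith)
      nlinarith [mul_le_mul_of_nonneg_left h2 (sq_nonneg η)]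
    rw [Real.norm_of_nonneg (by have := hD0 ω; positivity)]
    have h4 : ‖u ω‖ ^ 2 ≤ A ^ 2 := pow_le_pow_left₀ (norm_nonneg _) (hA ω) 2
    have h5 : 0 ≤ D ω * ‖spec f ω‖ ^ 2 := mul_nonneg (hD0 ω) (sq_nonneg _)
    calc ρ ω ≤ D ω * ‖spec f ω‖ ^ 2 * A ^ 2 := mul_le_mul_of_nonneg_left h4 h5
      _ ≤ _ := by
        refine mul_le_mul_of_nonneg_right ?_ (sq_nonneg _)
        rw [← mul_assoc]
        exact mul_le_mul_of_nonneg_right h1 (sq_nonneg _)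
  have hun : ∀ ω, ‖u (-ω)‖ = ‖u ω‖ := fun ω => by rw [hu, ← conj_spec, RCLike.norm_conj]
  have hfn : ∀ ω, ‖spec f (-ω)‖ = ‖spec f ω‖ := fun ω => by rw [← conj_spec, RCLike.norm_conj]
  -- Up to the factor 4 this is the excess of the kernel `0` over the minimum, so it is bounded by
  -- the integrand in `hfi`.
  have hvi : Integrable fun ω => ρ ω * ‖v ω‖ ^ 2 := by
    refine Integrable.mono' hfi ?_ (ae_of_all _ fun ω => ?_)
    · exact (hρm.mul (((Complex.measurable_ofReal.comp (hG.sub_const 1)).div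
        huc.measurable).norm.pow_const 2)).aestronglyMeasurable
    · have hD' := hD0 ω
      rw [Real.norm_of_nonneg (by positivity), spectralQFI_eq hη0 hη1 hI (hS ω), hz]
      have e : ρ ω * ‖v ω‖ ^ 2 = D ω * ‖1 + 0 - (optimalGain η Imean S ω : ℂ)‖ ^ 2 *
          ‖spec f ω‖ ^ 2 := by
        have hu1 : ‖u ω‖ ≠ 0 := norm_ne_zero_iff.2 (hu0 ω)
        have e1 : ‖1 + 0 - (optimalGain η Imean S ω : ℂ)‖ =
            ‖((optimalGain η Imean S ω - 1 : ℝ) : ℂ)‖ := by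
          rw [norm_sub_rev]; push_cast; ring_nf
        simp only [hρ, hv, norm_div, div_pow, e1]
        field_simp
      rw [e]
      refine mul_le_mul_of_nonneg_right ?_ (sq_nonneg _)
      have h6 := hQ0 ω
      have h7 : 0 ≤ D ω * ‖1 + 0 - (optimalGain η Imean S ω : ℂ)‖ ^ 2 := by positivity
      simp only [hD] at h7 ⊢
      linarith
  obtain ⟨n, c, s, hi, hle⟩ := exists_trigSum_weighted hρm (fun ω => by
      have := hD0 ω
      positivity) hρi (by
      filter_upwards [hSe] with ω hω
      simp only [hρ, hD, hun, hfn, hω]) (v := v)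
    ((Complex.measurable_ofReal.comp (hG.sub_const 1)).div huc.measurable) hvi (by
      filter_upwards [hSe] with ω hω
      simp only [hv, optimalGain, hω, map_div₀, Complex.conj_ofReal]
      rw [hu, conj_spec]) (ε := ε / 4) (by positivity)
  refine ⟨shiftSum expWindow c s, integrable_shiftSum c s integrable_expWindow,
    hasCompactSupport_shiftSum c s hasCompactSupport_expWindow, hmi, ?_⟩
  have e : ∀ ω, spectralQFI η Imean S (shiftSum expWindow c s) ω * ‖spec f ω‖ ^ 2 =
      minSpectralQFI η Imean S ω * ‖spec f ω‖ ^ 2 + 4 * (ρ ω * ‖v ω - trigSum c s ω‖ ^ 2) := by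
    intro ω
    rw [spectralQFI_eq hη0 hη1 hI (hS ω), spec_shiftSum c s integrable_expWindow]
    have e1 : 1 + spec expWindow ω * trigSum c s ω - (optimalGain η Imean S ω : ℂ) =
        -(u ω * (v ω - trigSum c s ω)) := by
      have := hu0 ω
      simp only [hv]
      rw [mul_sub, mul_div_cancel₀ _ this]
      push_cast
      ring
    rw [e1, norm_neg, norm_mul, mul_pow]
    simp only [hρ, hD]
    ring
  simp only [e]
  rw [integral_add hmi (hi.const_mul 4), integral_const_mul]
  linarith

end Kernel

/-! ### The spectral quantum Cramér-Rao bound -/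

/-- The inverse spectrum, truncated to `[-n, n]`. -/
def truncInv (m : ℝ → ℝ) (n : ℕ) : ℝ → ℝ :=
  (Icc (-(n : ℝ)) n).indicator fun ω => 1 / (m ω + 1 / ((n : ℝ) + 1))

section TruncInv

variable {m : ℝ → ℝ}

theorem measurable_truncInv (hm : Measurable m) (n : ℕ) : Measurable (truncInv m n) :=
  (measurable_const.div (hm.add_const _)).indicator measurableSet_Icc

theorem truncInv_nonneg (h0 : ∀ ω, 0 ≤ m ω) (n : ℕ) (ω : ℝ) : 0 ≤ truncInv m n ω :=
  indicator_nonneg (fun ω _ => by have := h0 ω; positivity) ω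

theorem truncInv_le (h0 : ∀ ω, 0 ≤ m ω) (n : ℕ) (ω : ℝ) : truncInv m n ω ≤ n + 1 := by
  rw [truncInv]
  by_cases h : ω ∈ Icc (-(n : ℝ)) n
  · rw [indicator_of_mem h, div_le_iff₀ (by have := h0 ω; positivity)]
    have h1 : ((n : ℝ) + 1) * (1 / ((n : ℝ) + 1)) = 1 := by field_simp
    nlinarith [mul_nonneg (by positivity : (0 : ℝ) ≤ (n : ℝ) + 1) (h0 ω)]
  · rw [indicator_of_notMem h]
    positivity

theorem mul_truncInv_le (h0 : ∀ ω, 0 ≤ m ω) (n : ℕ) (ω : ℝ) : m ω * truncInv m n ω ≤ 1 := by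
  rw [truncInv]
  by_cases h : ω ∈ Icc (-(n : ℝ)) n
  · rw [indicator_of_mem h, mul_one_div, div_le_one (by have := h0 ω; positivity)]
    have : 0 ≤ 1 / ((n : ℝ) + 1) := by positivity
    linarith
  · rw [indicator_of_notMem h, mul_zero]
    exact zero_le_one

theorem integrable_truncInv (hm : Measurable m) (h0 : ∀ ω, 0 ≤ m ω) (n : ℕ) : Integrable (truncInv m n) := by
  refine Integrable.mono' (g := (Icc (-(n : ℝ)) n).indicator fun _ => (n : ℝ) + 1)
    ((integrable_indicator_iff measurableSet_Icc).2 (integrable_const _))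
    (measurable_truncInv hm n).aestronglyMeasurable (ae_of_all _ fun ω => ?_)
  rw [Real.norm_of_nonneg (truncInv_nonneg h0 n ω)]
  by_cases h : ω ∈ Icc (-(n : ℝ)) n
  · rw [indicator_of_mem h]
    exact truncInv_le h0 n ω
  · rw [indicator_of_notMem h, truncInv, indicator_of_notMem h]

/-- The truncations increase to `1 / m`, with value `∞` where `m = 0`, so monotone convergence
covers an infinite bound as well. -/
theorem tendsto_lintegral_truncInv (hm : Measurable m) (h0 : ∀ ω, 0 ≤ m ω) :
    Tendsto (fun n => ∫⁻ ω, ENNReal.ofReal (truncInv m n ω)) atTop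
      (𝓝 (∫⁻ ω, (ENNReal.ofReal (m ω))⁻¹)) := by
  refine lintegral_tendsto_of_tendsto_of_monotone
    (fun n => (measurable_truncInv hm n).ennreal_ofReal.aemeasurable) (ae_of_all _ fun ω => ?_)
    (ae_of_all _ fun ω => ?_)
  · refine fun n k hnk => ENNReal.ofReal_le_ofReal ?_
    have hnk' : (n : ℝ) ≤ k := by exact_mod_cast hnk
    simp only [truncInv]
    by_cases h : ω ∈ Icc (-(n : ℝ)) n
    · have h' : ω ∈ Icc (-(k : ℝ)) k := ⟨by linarith [h.1], h.2.trans hnk'⟩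
      rw [indicator_of_mem h, indicator_of_mem h']
      have := h0 ω
      gcongr
    · rw [indicator_of_notMem h]
      exact truncInv_nonneg h0 k ω
  · have h1 : Tendsto (fun n : ℕ => (ENNReal.ofReal (m ω + 1 / ((n : ℝ) + 1)))⁻¹) atTop
        (𝓝 (ENNReal.ofReal (m ω))⁻¹) := by
      refine Tendsto.inv (ENNReal.tendsto_ofReal ?_)
      simpa using tendsto_one_div_add_atTop_nhds_zero_nat.const_add (m ω)
    refine h1.congr' ?_
    filter_upwards [eventually_ge_atTop ⌈|ω|⌉₊] with n hn
    have h2 : |ω| ≤ n := Nat.ceil_le.1 hn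
    have h3 : ω ∈ Icc (-(n : ℝ)) n := abs_le.1 h2
    rw [truncInv, indicator_of_mem h3, one_div (m ω + _), ENNReal.ofReal_inv_of_pos]
    have := h0 ω
    positivity

/-- Smooth directions approach the spectral bound. -/
theorem exists_bump_bound (hm : Measurable m) (h0 : ∀ ω, 0 ≤ m ω) (he : ∀ᵐ ω, m (-ω) = m ω)
    (hi : ∀ h, IsBump h → Integrable fun ω => m ω * ‖spec h ω‖ ^ 2) {b : ℝ} (hb0 : 0 ≤ b)
    (hb : ENNReal.ofReal b < ENNReal.ofReal (1 / (2 * Real.pi)) *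
      ∫⁻ ω, (ENNReal.ofReal (m ω))⁻¹) (t : ℝ) :
    ∃ h, IsBump h ∧ b * (1 / (2 * Real.pi) * ∫ ω, m ω * ‖spec h ω‖ ^ 2) < h t ^ 2 := by
  have hπ := Real.pi_pos
  obtain ⟨n, hn⟩ : ∃ n : ℕ, ENNReal.ofReal b < ENNReal.ofReal (1 / (2 * Real.pi)) *
      ∫⁻ ω, ENNReal.ofReal (truncInv m n ω) :=
    ((ENNReal.Tendsto.const_mul (tendsto_lintegral_truncInv hm h0)
      (Or.inr ENNReal.ofReal_ne_top)).eventually (lt_mem_nhds hb)).exists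
  set w := truncInv m n with hw
  have hwm : Measurable w := measurable_truncInv hm n
  have hw0 : ∀ ω, 0 ≤ w ω := truncInv_nonneg h0 n
  have hwi : Integrable w := integrable_truncInv hm h0 n
  set I := ∫ ω, w ω with hI
  rw [← ofReal_integral_eq_lintegral_ofReal hwi (ae_of_all _ hw0),
    ← ENNReal.ofReal_mul (by positivity), ENNReal.ofReal_lt_ofReal_iff_of_nonneg hb0] at hn
  have hI0 : 0 < I := by
    by_contra h
    have : 1 / (2 * Real.pi) * I ≤ 0 := mul_nonpos_of_nonneg_of_nonpos (by positivity) (not_lt.1 h)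
    linarith
  obtain ⟨f, hf, hfn⟩ := exists_bump_spec_ge n
  have hfc := continuous_spec hf.integrable
  have hfi := hf.integrable_spec
  -- The first term of the weight controls the quadratic form, the second one the value at `t`,
  -- which is an integral of the transform.
  set ρ : ℝ → ℝ := fun ω => m ω * ‖spec f ω‖ ^ 2 + ‖spec f ω‖ with hρ
  -- By Cauchy-Schwarz the best direction has transform `exp(iωt) / m`. Here `1 / m` is replaced by
  -- `w`, and the division by `f̂` leaves the function to be approximated by trigonometric sums. The
  -- bump is chosen so that `f̂` does not vanish on the support of `w`.
  set v : ℝ → ℂ := fun ω => (w ω : ℂ) * Complex.exp (Complex.I * ω * t) / spec f ω with hv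
  have hvf : ∀ ω, spec f ω * v ω = w ω * Complex.exp (Complex.I * ω * t) := by
    intro ω
    by_cases h : ω ∈ Icc (-(n : ℝ)) n
    · have h1 := hfn ω (abs_le.2 h)
      have h2 : spec f ω ≠ 0 := fun h => by rw [h, norm_zero] at h1; linarith
      simp only [hv]
      rw [mul_div_cancel₀ _ h2]
    · have h1 : w ω = 0 := indicator_of_notMem h _
      simp [hv, h1]
  have hvn : ∀ ω, ‖spec f ω‖ * ‖v ω‖ = w ω := fun ω => by
    rw [← norm_mul, hvf, norm_mul, norm_exp_I_mul_mul, mul_one, Complex.norm_real,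
      Real.norm_of_nonneg (hw0 ω)]
  have hvb : ∀ ω, ‖v ω‖ ≤ 2 * w ω := by
    intro ω
    by_cases h : ω ∈ Icc (-(n : ℝ)) n
    · have h1 := hfn ω (abs_le.2 h)
      rw [← hvn ω]
      nlinarith [norm_nonneg (v ω)]
    · have h1 : w ω = 0 := indicator_of_notMem h _
      simp [hv, h1]
  have hρm : Measurable ρ :=
    (hm.mul (hfc.measurable.norm.pow_const 2)).add hfc.measurable.norm
  have hρ0 : ∀ ω, 0 ≤ ρ ω := fun ω => by have := h0 ω; positivity
  have hvm : Measurable v := by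
    refine ((Complex.measurable_ofReal.comp hwm).mul ?_).div hfc.measurable
    exact (by fun_prop : Continuous fun ω : ℝ => Complex.exp (Complex.I * ω * t)).measurable
  have hfe : ∀ ω, ‖spec f (-ω)‖ = ‖spec f ω‖ := fun ω => by rw [← conj_spec, RCLike.norm_conj]
  have hmw : ∀ ω, m ω * w ω ^ 2 ≤ w ω := fun ω => by
    have := mul_le_mul_of_nonneg_right (mul_truncInv_le h0 n ω) (hw0 ω)
    rw [one_mul] at this
    calc m ω * w ω ^ 2 = m ω * w ω * w ω := by ring
      _ ≤ w ω := this
  have hvi : Integrable fun ω => ρ ω * ‖v ω‖ ^ 2 := by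
    refine Integrable.mono' (hwi.const_mul (1 + 2 * ((n : ℝ) + 1)))
      (hρm.mul (hvm.norm.pow_const 2)).aestronglyMeasurable (ae_of_all _ fun ω => ?_)
    rw [Real.norm_of_nonneg (mul_nonneg (hρ0 ω) (sq_nonneg _))]
    have e : ρ ω * ‖v ω‖ ^ 2 = m ω * (‖spec f ω‖ * ‖v ω‖) ^ 2 +
        ‖spec f ω‖ * ‖v ω‖ * ‖v ω‖ := by simp only [hρ]; ring
    rw [e, hvn]
    have h1 : w ω * ‖v ω‖ ≤ w ω * (2 * ((n : ℝ) + 1)) :=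
      mul_le_mul_of_nonneg_left ((hvb ω).trans (by
        have := truncInv_le h0 n ω
        linarith)) (hw0 ω)
    linarith [hmw ω]
  set L := ∫ ω, ‖spec f ω‖ with hL
  -- At `s = 0` the last inequality is `b I / (2π) < (I / (2π))²`, which is `hn` multiplied by `I /
  -- (2π)`. Continuity leaves room for the approximation errors of size `s`.
  obtain ⟨s, hs, hs1, hs2⟩ : ∃ s : ℝ, 0 < s ∧ 0 < I - s * (L + 1) ∧
      b * (1 / (2 * Real.pi) * ((1 + s) * I + (s ^ 2 + s))) <
        (1 / (2 * Real.pi) * (I - s * (L + 1))) ^ 2 := by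
    have hc1 : ContinuousAt (fun s : ℝ => I - s * (L + 1)) 0 := by fun_prop
    have hc2 : ContinuousAt (fun s : ℝ => (1 / (2 * Real.pi) * (I - s * (L + 1))) ^ 2 -
      b * (1 / (2 * Real.pi) * ((1 + s) * I + (s ^ 2 + s)))) 0 := by fun_prop
    have h1 := (hc1.eventually (lt_mem_nhds (a := 0) (by simpa using hI0))).filter_mono
      (nhdsWithin_le_nhds (s := Ioi 0))
    have h2 := (hc2.eventually (lt_mem_nhds (a := 0) (by
      have : 0 < 1 / (2 * Real.pi) * I := by positivity
      simp only [zero_mul, sub_zero, add_zero, one_mul, ne_eq, OfNat.ofNat_ne_zero,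
        not_false_eq_true, zero_pow]
      nlinarith))).filter_mono (nhdsWithin_le_nhds (s := Ioi 0))
    obtain ⟨s, ⟨h3, h4⟩, hs⟩ := ((h1.and h2).and (eventually_mem_nhdsWithin (a := (0 : ℝ)))).exists
    exact ⟨s, hs, h3, sub_pos.1 h4⟩
  obtain ⟨N, c, τ, hdi, hd⟩ := exists_trigSum_weighted hρm hρ0 ((hi f hf).add hfi.norm) (by
      filter_upwards [he] with ω hω
      simp only [hρ, hfe, hω]) hvm hvi (by
      filter_upwards [he] with ω hω
      have hwe : w (-ω) = w ω := by
        simp only [hw, truncInv]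
        by_cases h : ω ∈ Icc (-(n : ℝ)) n
        · have h' : -ω ∈ Icc (-(n : ℝ)) n := ⟨by linarith [h.2], by linarith [h.1]⟩
          rw [indicator_of_mem h, indicator_of_mem h', hω]
        · have h' : -ω ∉ Icc (-(n : ℝ)) n := fun h' => h ⟨by linarith [h'.2], by linarith [h'.1]⟩
          rw [indicator_of_notMem h, indicator_of_notMem h']
      simp only [hv, hwe, map_div₀, map_mul, Complex.conj_ofReal, conj_spec, ← Complex.exp_conj,
        Complex.conj_I]
      push_cast
      ring_nf) (ε := s ^ 2) (by positivity)
  set p := trigSum c τ with hp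
  have hh : IsBump (shiftSum f c τ) := hf.shiftSum c τ
  have hsp : ∀ ω, spec (shiftSum f c τ) ω = spec f ω * p ω := spec_shiftSum c τ hf.integrable
  refine ⟨shiftSum f c τ, hh, ?_⟩
  have hlow : 1 / (2 * Real.pi) * (I - s * (L + 1)) ≤ shiftSum f c τ t := by
    have h1 := hh.inversion t
    have hIc : ∫ ω, (w ω : ℂ) = (I : ℂ) := integral_ofReal
    have hEm : Measurable fun ω : ℝ => Complex.exp (-(Complex.I * ω * t)) :=
      (by fun_prop : Continuous fun ω : ℝ => Complex.exp (-(Complex.I * ω * t))).measurable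
    have hEn : ∀ ω : ℝ, ‖Complex.exp (-(Complex.I * ω * t))‖ = 1 := fun ω => by
      rw [Complex.norm_exp]
      simp
    have j1 : Integrable fun ω => spec (shiftSum f c τ) ω * Complex.exp (-(Complex.I * ω * t)) :=
      hh.integrable_spec.mul_bdd (c := 1) hEm.aestronglyMeasurable (ae_of_all _ fun ω => (hEn ω).le)
    have hwc : Integrable fun ω => (w ω : ℂ) := hwi.ofReal
    have h2 : ‖((2 * Real.pi * shiftSum f c τ t : ℝ) : ℂ) - (I : ℂ)‖ ≤ s * (L + 1) := by
      rw [← h1, ← hIc, ← integral_sub j1 hwc]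
      have j2 : Integrable fun ω => s * ‖spec f ω‖ + s⁻¹ * (ρ ω * ‖v ω - p ω‖ ^ 2) :=
        (hfi.norm.const_mul s).add (hdi.const_mul s⁻¹)
      refine (norm_integral_le_of_norm_le j2 (ae_of_all _ fun ω => ?_)).trans ?_
      · have e : spec (shiftSum f c τ) ω * Complex.exp (-(Complex.I * ω * t)) - w ω =
            -(spec f ω * (v ω - p ω) * Complex.exp (-(Complex.I * ω * t))) := by
          have e1 : (w ω : ℂ) = spec f ω * v ω * Complex.exp (-(Complex.I * ω * t)) := by
            rw [hvf, mul_assoc, ← Complex.exp_add, add_neg_cancel, Complex.exp_zero, mul_one]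
          rw [hsp, e1]
          ring
        rw [e, norm_neg, norm_mul, norm_mul, hEn, mul_one]
        have h3 : ‖spec f ω‖ * ‖v ω - p ω‖ ^ 2 ≤ ρ ω * ‖v ω - p ω‖ ^ 2 := by
          refine mul_le_mul_of_nonneg_right ?_ (sq_nonneg _)
          simp only [hρ]
          have := h0 ω
          linarith [show 0 ≤ m ω * ‖spec f ω‖ ^ 2 by positivity]
        -- This trades a first-power error for a quadratic one. With the squared error at most `s ^
        -- 2`, both terms contribute order `s` after integration against `‖f̂‖`.
        have h4 : ‖v ω - p ω‖ ≤ s + s⁻¹ * ‖v ω - p ω‖ ^ 2 := by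
          set d := ‖v ω - p ω‖
          have : s + s⁻¹ * d ^ 2 - d = s⁻¹ * ((s - d / 2) ^ 2 + 3 / 4 * d ^ 2) := by
            field_simp
            ring
          have : 0 ≤ s⁻¹ * ((s - d / 2) ^ 2 + 3 / 4 * d ^ 2) := by positivity
          linarith
        calc ‖spec f ω‖ * ‖v ω - p ω‖ ≤ ‖spec f ω‖ * (s + s⁻¹ * ‖v ω - p ω‖ ^ 2) := by gcongr
          _ = s * ‖spec f ω‖ + s⁻¹ * (‖spec f ω‖ * ‖v ω - p ω‖ ^ 2) := by ring
          _ ≤ _ := by gcongr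
      · rw [integral_add (hfi.norm.const_mul s) (hdi.const_mul s⁻¹), integral_const_mul,
          integral_const_mul, mul_add, mul_one]
        refine add_le_add le_rfl ?_
        calc s⁻¹ * _ ≤ s⁻¹ * s ^ 2 := by gcongr
          _ = s := by field_simp
    rw [← Complex.ofReal_sub, Complex.norm_real, Real.norm_eq_abs] at h2
    have h3 := (abs_le.1 h2).1
    rw [one_div_mul_eq_div, div_le_iff₀ (by positivity)]
    linarith
  have hup : ∫ ω, m ω * ‖spec (shiftSum f c τ) ω‖ ^ 2 ≤ (1 + s) * I + (s ^ 2 + s) := by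
    have j1 : Integrable fun ω => (1 + s) * w ω + (1 + s⁻¹) * (ρ ω * ‖v ω - p ω‖ ^ 2) :=
      (hwi.const_mul _).add (hdi.const_mul _)
    refine (integral_mono (hi _ hh) j1 fun ω => ?_).trans ?_
    · have hm0 := h0 ω
      have h1 : ‖p ω‖ ≤ ‖v ω‖ + ‖v ω - p ω‖ := by
        have := norm_sub_le (v ω) (v ω - p ω)
        rwa [sub_sub_cancel] at this
      -- The weighted form of `(a + d)² ≤ (1 + s) a² + (1 + 1/s) d²`, so that the main term keeps a
      -- constant close to one.
      have h2 : ‖p ω‖ ^ 2 ≤ (1 + s) * ‖v ω‖ ^ 2 + (1 + s⁻¹) * ‖v ω - p ω‖ ^ 2 := by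
        refine (pow_le_pow_left₀ (norm_nonneg _) h1 2).trans ?_
        set d := ‖v ω - p ω‖
        set a := ‖v ω‖
        have e : (1 + s) * a ^ 2 + (1 + s⁻¹) * d ^ 2 - (a + d) ^ 2 = s⁻¹ * (s * a - d) ^ 2 := by
          field_simp
          ring
        have : 0 ≤ s⁻¹ * (s * a - d) ^ 2 := by positivity
        linarith
      have h3 : m ω * ‖spec f ω‖ ^ 2 * ‖v ω - p ω‖ ^ 2 ≤ ρ ω * ‖v ω - p ω‖ ^ 2 := by
        refine mul_le_mul_of_nonneg_right ?_ (sq_nonneg _)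
        simp only [hρ]
        linarith [norm_nonneg (spec f ω)]
      simp only
      rw [hsp, norm_mul, mul_pow]
      calc m ω * (‖spec f ω‖ ^ 2 * ‖p ω‖ ^ 2)
          ≤ m ω * (‖spec f ω‖ ^ 2 * ((1 + s) * ‖v ω‖ ^ 2 + (1 + s⁻¹) * ‖v ω - p ω‖ ^ 2)) := by
            gcongr
        _ = (1 + s) * (m ω * (‖spec f ω‖ * ‖v ω‖) ^ 2) +
            (1 + s⁻¹) * (m ω * ‖spec f ω‖ ^ 2 * ‖v ω - p ω‖ ^ 2) := by ring
        _ ≤ _ := by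
          rw [hvn]
          gcongr
          exact hmw ω
    · rw [integral_add (hwi.const_mul _) (hdi.const_mul _), integral_const_mul, integral_const_mul]
      refine add_le_add le_rfl ?_
      calc (1 + s⁻¹) * _ ≤ (1 + s⁻¹) * s ^ 2 := by gcongr
        _ = s ^ 2 + s := by field_simp
  calc b * (1 / (2 * Real.pi) * ∫ ω, m ω * ‖spec (shiftSum f c τ) ω‖ ^ 2)
      ≤ b * (1 / (2 * Real.pi) * ((1 + s) * I + (s ^ 2 + s))) := by gcongr
    _ < (1 / (2 * Real.pi) * (I - s * (L + 1))) ^ 2 := hs2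
    _ ≤ _ := pow_le_pow_left₀ (by positivity) hlow 2

end TruncInv

/-! ### Even spectra and the proof of the bound -/

theorem ofReal_mul_mul_conj (r : ℝ) (z : ℂ) : (r : ℂ) * z * conj z = ((r * ‖z‖ ^ 2 : ℝ) : ℂ) := by
  rw [mul_assoc, Complex.mul_conj, Complex.normSq_eq_norm_sq]
  push_cast
  ring

theorem integrable_mul_norm_sq {M : ℝ → ℝ} {z : ℝ → ℂ}
    (h : Integrable fun ω => (M ω : ℂ) * z ω * conj (z ω)) :
    Integrable fun ω => M ω * ‖z ω‖ ^ 2 := by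
  simp only [ofReal_mul_mul_conj] at h
  exact h.re

theorem im_eq_zero_of_ofReal_eq {r : ℝ} {z : ℂ} (h : (r : ℂ) = (1 / (2 * Real.pi) : ℂ) * z) :
    z.im = 0 := by
  have h1 : (2 * Real.pi : ℂ) ≠ 0 := by exact_mod_cast (by positivity : 2 * Real.pi ≠ 0)
  have h2 : z = ((2 * Real.pi * r : ℝ) : ℂ) := by
    push_cast
    rw [h, ← mul_assoc, mul_one_div_cancel h1, one_mul]
  rw [h2, Complex.ofReal_im]

/-- The flux covariance of real test functions is real. Any two bumps are supported in a common
window, so `ae_even_of_integral_real` applies. -/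
theorem IsStationarySource.psd_even {ψ : ℝ → ℝ → Multiset ℝ → ℂ} {Imean : ℝ} {S : ℝ → ℝ}
    (hs : IsStationarySource ψ Imean S) : ∀ᵐ ω, S (-ω) = S ω := by
  have key : ∀ h k, IsBump h → IsBump k →
      Integrable (fun ω => (S ω : ℂ) * spec h ω * conj (spec k ω)) ∧
      (∫ ω, (S ω : ℂ) * spec h ω * conj (spec k ω)).im = 0 := by
    intro h k hh hk
    obtain ⟨R, hR⟩ := exists_support_bound hh.2
    obtain ⟨R', hR'⟩ := exists_support_bound hk.2
    set T : ℝ := max (max (R : ℝ) R') 1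
    have hT : -T < T := by
      have : 1 ≤ T := le_max_right _ _
      linarith
    have hi : ∀ {f : ℝ → ℝ} {r : ℝ}, (∀ t, r < |t| → f t = 0) → r ≤ T →
        (Icc (-T) T).indicator f = f := by
      intro f r hr hrT
      refine indicator_eq_self.2 fun t ht => abs_le.1 ?_
      by_contra h
      exact ht (hr t (hrT.trans_lt (not_le.1 h)))
    obtain ⟨c1, c2⟩ := hs.covariance (-T) T hT h k hh.isTestWaveform.measurable
      hh.isTestWaveform.bounded hk.isTestWaveform.measurable hk.isTestWaveform.bounded
    rw [hi hR ((le_max_left _ _).trans (le_max_left _ _)),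
      hi hR' ((le_max_right _ _).trans (le_max_left _ _))] at c1 c2
    exact ⟨c1, im_eq_zero_of_ofReal_eq c2⟩
  exact ae_even_of_integral_real (fun h hh => (key h h hh hh).1) fun h k hh hk => (key h k hh hk).2

theorem measurable_minSpectralQFI {η Imean : ℝ} {S : ℝ → ℝ} (hS : Measurable S) :
    Measurable (minSpectralQFI η Imean S) := by
  refine Measurable.ite (hS (measurableSet_singleton 0)) measurable_const ?_
  exact (((measurable_const.div hS).add_const _).inv).const_mul 4

/-- A direction `h` and a compactly supported kernel are fixed first, using only the spectra, such
that the limiting inequality holds strictly. The window information converges for this pair, so all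
large windows satisfy the inequality, whatever the measurement and the estimator. -/
theorem eventually_le_meanSquareError {ψ : ℝ → ℝ → Multiset ℝ → ℂ} {Imean κ : ℝ} {S : ℝ → ℝ}
    (hs : IsStationarySource ψ Imean S) (hη0 : 0 < Real.cos κ ^ 2) (hI : 0 < Imean)
    {Ω : Type*} [MeasurableSpace Ω] (P : Measure Ω) [IsProbabilityMeasure P] {x : Ω → ℝ → ℝ}
    {JC g : ℝ → ℝ} (hx : HasPriorInformation P x JC) (hg : Integrable g) (t : ℝ) {b : ℝ≥0∞}
    (hb : b < spectralBound g (minSpectralQFI (Real.cos κ ^ 2) Imean S) JC) :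
    ∀ᶠ w : ℝ × ℝ in atBot ×ˢ atTop, ∀ (Y : Type*) [MeasurableSpace Y]
      (E : POVM Y (FieldSpace w.1 w.2)) (est : Y → ℝ), Measurable est →
      b ≤ meanSquareError w.1 w.2 κ (ψ w.1 w.2) P x g E est t := by
  have hπ := Real.pi_pos
  set η := Real.cos κ ^ 2 with hη
  have hη1 : η ≤ 1 := Real.cos_sq_le_one κ
  have hSm := hs.measurable_psd
  have hS0 := hs.psd_nonneg
  have hSe := hs.psd_even
  obtain ⟨β, hβ, hββ⟩ := hx.score
  obtain ⟨C, hC⟩ := hx.second_moment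
  have hC2 : ∀ s, ∫⁻ ω, ‖x ω s‖ₑ ^ 2 ∂P ≤ C := fun s => by
    refine le_trans (le_of_eq (lintegral_congr fun ω => ?_)) (hC s)
    rw [← sq_abs, ENNReal.ofReal_pow (abs_nonneg _), Real.enorm_eq_ofReal_abs]
  rcases eq_or_ne b 0 with rfl | hb0
  · exact Eventually.of_forall fun _ _ _ _ _ _ => zero_le
  obtain ⟨b, rfl⟩ : ∃ r : ℝ≥0, b = r := ⟨b.toNNReal, (ENNReal.coe_toNNReal hb.ne_top).symm⟩
  have hbpos : (0 : ℝ) < b := by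
    have : b ≠ 0 := by exact_mod_cast hb0
    positivity
  have hbr : ((b : ℝ≥0) : ℝ≥0∞) = ENNReal.ofReal (b : ℝ) := (ENNReal.ofReal_coe_nnreal).symm
  set m : ℝ → ℝ := fun ω => ‖spec g ω‖ ^ 2 * minSpectralQFI η Imean S ω + JC ω with hm
  have hmm : Measurable m :=
    (((continuous_spec hg).measurable.norm.pow_const 2).mul
      (measurable_minSpectralQFI hSm)).add hx.measurable_info
  have hQ0 : ∀ ω, 0 ≤ minSpectralQFI η Imean S ω := fun ω =>
    minSpectralQFI_nonneg hη0 hη1 hI (hS0 ω)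
  have hm0 : ∀ ω, 0 ≤ m ω := fun ω =>
    add_nonneg (mul_nonneg (sq_nonneg _) (hQ0 ω)) (hx.info_nonneg ω)
  have hJe : ∀ᵐ ω, JC (-ω) = JC ω :=
    ae_even_of_integral_real (fun h hh => (hββ h h hh.1 hh.2 hh.1 hh.2).1) fun h k hh hk =>
      im_eq_zero_of_ofReal_eq (hββ h k hh.1 hh.2 hk.1 hk.2).2
  have hme : ∀ᵐ ω, m (-ω) = m ω := by
    filter_upwards [hJe, hSe] with ω h1 h2
    simp only [hm, minSpectralQFI, h1, h2]
    rw [← conj_spec, RCLike.norm_conj]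
  have hsp : ∀ h, IsBump h → ∀ ω, ‖spec (conv g h) ω‖ ^ 2 = ‖spec g ω‖ ^ 2 * ‖spec h ω‖ ^ 2 :=
    fun h hh ω => by rw [spec_conv hg hh.integrable, norm_mul, mul_pow]
  -- The kernel `0` has compact support, so `tendsto_pairCov` yields the integrability that
  -- `exists_kernel_near` needs.
  have hnear : ∀ h, IsBump h → ∀ ε > 0, ∃ lam, Integrable lam ∧ HasCompactSupport lam ∧
      Integrable (fun ω => minSpectralQFI η Imean S ω * ‖spec (conv g h) ω‖ ^ 2) ∧
      ∫ ω, spectralQFI η Imean S lam ω * ‖spec (conv g h) ω‖ ^ 2 ≤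
        (∫ ω, minSpectralQFI η Imean S ω * ‖spec (conv g h) ω‖ ^ 2) + ε := by
    intro h hh ε hε
    obtain ⟨a, ha⟩ := hh.isTestWaveform.exists_amalgam_conv hg
    have hl : Integrable fun _ : ℝ => (0 : ℝ) := integrable_zero _ _ _
    obtain ⟨a', ha'⟩ := ha.windowPair hl HasCompactSupport.zero
    exact exists_kernel_near hη0 hη1 hI hSm hS0 hSe (integrable_conv hg hh.integrable)
      (integrable_mul_norm_sq (hs.tendsto_pairCov κ hl ha' ha').1) hε
  have hJi : ∀ h, IsBump h → Integrable fun ω => JC ω * ‖spec h ω‖ ^ 2 := fun h hh =>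
    integrable_mul_norm_sq (hββ h h hh.1 hh.2 hh.1 hh.2).1
  have hmi : ∀ h, IsBump h →
      Integrable (fun ω => minSpectralQFI η Imean S ω * ‖spec (conv g h) ω‖ ^ 2) ∧
      Integrable (fun ω => m ω * ‖spec h ω‖ ^ 2) ∧ ∫ ω, m ω * ‖spec h ω‖ ^ 2 =
        (∫ ω, minSpectralQFI η Imean S ω * ‖spec (conv g h) ω‖ ^ 2) +
          ∫ ω, JC ω * ‖spec h ω‖ ^ 2 := by
    intro h hh
    obtain ⟨-, -, -, h1, -⟩ := hnear h hh 1 one_pos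
    have e : ∀ ω, m ω * ‖spec h ω‖ ^ 2 =
        minSpectralQFI η Imean S ω * ‖spec (conv g h) ω‖ ^ 2 + JC ω * ‖spec h ω‖ ^ 2 := fun ω => by
      rw [hsp h hh]; simp only [hm]; ring
    simp only [e]
    exact ⟨h1, h1.add (hJi h hh), integral_add h1 (hJi h hh)⟩
  obtain ⟨h, hh, hht⟩ := exists_bump_bound hmm hm0 hme (fun h hh => (hmi h hh).2.1) hbpos.le
    (by rw [← hbr]; exact hb) t
  rw [(hmi h hh).2.2] at hht
  set Q₁ := ∫ ω, minSpectralQFI η Imean S ω * ‖spec (conv g h) ω‖ ^ 2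
  set Q₂ := ∫ ω, JC ω * ‖spec h ω‖ ^ 2 with hQ₂
  have hht0 : 0 < h t ^ 2 := by
    refine lt_of_le_of_lt (mul_nonneg hbpos.le (mul_nonneg (by positivity) (add_nonneg ?_ ?_))) hht
    · exact integral_nonneg fun ω => mul_nonneg (hQ0 ω) (sq_nonneg _)
    · exact integral_nonneg fun ω => mul_nonneg (hx.info_nonneg ω) (sq_nonneg _)
  -- Half of the strict gap left by the choice of `h` is spent on the suboptimality of the kernel.
  obtain ⟨ε, hε, hεt⟩ : ∃ ε > 0, 1 / (2 * Real.pi) * (Q₁ + ε) <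
      h t ^ 2 / b - 1 / (2 * Real.pi) * Q₂ := by
    have h1 : 1 / (2 * Real.pi) * (Q₁ + Q₂) < h t ^ 2 / b := by
      rw [lt_div_iff₀ hbpos, mul_comm]
      exact hht
    refine ⟨Real.pi * (h t ^ 2 / b - 1 / (2 * Real.pi) * (Q₁ + Q₂)),
      mul_pos hπ (sub_pos.2 h1), ?_⟩
    have e : 1 / (2 * Real.pi) * (Real.pi * (h t ^ 2 / b - 1 / (2 * Real.pi) * (Q₁ + Q₂))) =
        (h t ^ 2 / b - 1 / (2 * Real.pi) * (Q₁ + Q₂)) / 2 := by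
      field_simp
    rw [mul_add, e]
    linarith
  obtain ⟨lam, hl, hlc, -, hlQ⟩ := hnear h hh ε hε
  obtain ⟨a, ha⟩ := hh.isTestWaveform.exists_amalgam_conv hg
  obtain ⟨a', ha'⟩ := ha.windowPair hl hlc
  have hlim := (Complex.continuous_re.tendsto _).comp (hs.tendsto_pairCov κ hl ha' ha').2
  simp only [ofReal_mul_mul_conj] at hlim
  rw [integral_complex_ofReal] at hlim
  have hval : ((1 / (2 * Real.pi) : ℂ) *
      ((∫ ω, spectralQFI η Imean S lam ω * ‖spec (conv g h) ω‖ ^ 2 : ℝ) : ℂ)).re <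
      h t ^ 2 / b - 1 / (2 * Real.pi) * Q₂ := by
    refine lt_of_le_of_lt (le_of_eq_of_le ?_ (mul_le_mul_of_nonneg_left hlQ
      (by positivity : 0 ≤ 1 / (2 * Real.pi)))) hεt
    rw [← Complex.ofReal_re (1 / (2 * Real.pi) * _)]
    push_cast
    rfl
  have hscore : ∫ ω, β h ω ^ 2 ∂P = 1 / (2 * Real.pi) * Q₂ := by
    have h1 := (hββ h h hh.1 hh.2 hh.1 hh.2).2
    simp only [ofReal_mul_mul_conj] at h1
    rw [integral_complex_ofReal] at h1
    simp only [pow_two (β h _)]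
    exact_mod_cast h1
  filter_upwards [hlim.eventually (gt_mem_nhds hval),
    (eventually_lt_atBot (0 : ℝ)).prod_mk (eventually_gt_atTop (0 : ℝ))] with w hw1 hw2
  intro Y _ E est hest
  have hw := hw2.1.trans hw2.2
  -- An error below `b` is finite, as the window bound for general estimators requires.
  by_contra hlt
  rw [not_le] at hlt
  have hkey := sq_le_mul_meanSquareError (hs.finiteNumber hw) (hs.isProbabilityMeasure hw κ) E
    hx.measurable ENNReal.coe_lt_top hC2 hg t ha.bddMeas hl (hβ h hh.1 hh.2).2.1
    (hβ h hh.1 hh.2).2.2 hest hlt.ne_top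
  simp only [Function.comp_apply, Complex.ofReal_re] at hw1
  rw [hscore] at hkey
  set A := 4 * pairCov w.1 w.2 κ (ψ w.1 w.2)
    (pairFlux (conv g h) fun t => -auxPhase w.1 w.2 lam (conv g h) t)
    (pairFlux (conv g h) fun t => -auxPhase w.1 w.2 lam (conv g h) t)
  have hA : (A + 1 / (2 * Real.pi) * Q₂) * b < h t ^ 2 := by
    rw [← lt_div_iff₀ hbpos]
    linarith
  have hcon := hkey.trans (mul_le_mul_right hlt.le _)
  rw [hbr, ← ENNReal.ofReal_mul' hbpos.le] at hcon
  exact absurd hcon (not_le.2 ((ENNReal.ofReal_lt_ofReal_iff hht0).2 hA))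

end LossyWaveform

end

/-! ### Assembly of the four claims. -/

theorem mainTheorem6 (κ η Imean : ℝ) (hη : η = Real.cos κ ^ 2) (hη0 : 0 < η) (hI : 0 < Imean)
    (ψ : ℝ → ℝ → Multiset ℝ → ℂ) (S : ℝ → ℝ)
    (hsource : LossyWaveform.IsStationarySource ψ Imean S) :
    -- the spectral quantum Fisher information
    (∀ lam : ℝ → ℝ, Integrable lam →
      LossyWaveform.HasSpectralQFI κ ψ lam (LossyWaveform.spectralQFI η Imean S lam)) ∧
    -- its minimum over the real kernels
    (∀ ω : ℝ, IsLeast {J : ℝ | ∃ lam : ℝ → ℝ, Integrable lam ∧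
        J = LossyWaveform.spectralQFI η Imean S lam ω}
      (LossyWaveform.minSpectralQFI η Imean S ω)) ∧
    -- the shot-noise limit
    (η < 1 → ∀ ω : ℝ, LossyWaveform.minSpectralQFI η Imean S ω ≤ 4 * η * Imean / (1 - η)) ∧
    -- the spectral quantum Cramér-Rao bound, uniformly in the measurement and the estimator
    (∀ (Ω : Type*) [MeasurableSpace Ω] (P : Measure Ω) [IsProbabilityMeasure P]
      (x : Ω → ℝ → ℝ) (JC g : ℝ → ℝ), LossyWaveform.HasPriorInformation P x JC → Integrable g →
      ∀ (t : ℝ) (b : ENNReal),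
        b < LossyWaveform.spectralBound g (LossyWaveform.minSpectralQFI η Imean S) JC →
        ∀ᶠ w : ℝ × ℝ in atBot ×ˢ atTop,
          ∀ (Y : Type*) [MeasurableSpace Y]
            (E : LossyWaveform.POVM Y (LossyWaveform.FieldSpace w.1 w.2)) (est : Y → ℝ),
            Measurable est →
            b ≤ LossyWaveform.meanSquareError w.1 w.2 κ (ψ w.1 w.2) P x g E est t) := by
  subst hη
  have hη1 : Real.cos κ ^ 2 ≤ 1 := Real.cos_sq_le_one κ
  refine ⟨fun lam hl => hsource.hasSpectralQFI κ hl, fun ω =>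
    LossyWaveform.isLeast_minSpectralQFI hη0 hη1 hI (hsource.psd_nonneg ω), fun h ω =>
    LossyWaveform.minSpectralQFI_le hη0 h hI (hsource.psd_nonneg ω), ?_⟩
  intro Ω _ P _ x JC g hx hg t b hb
  exact LossyWaveform.eventually_le_meanSquareError hsource hη0 hI P hx hg t hb
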